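/- **Setting.** Write $S^1=\mathbb R/2\pi\mathbb Z$, $\hat f_k=\frac1{2\pi}\int_0^{2\pi}e^{-ik\theta}f(\theta)\,d\theta$ and $\|f\|_{H^s}^2=\sum_{k\in\mathbb Z}(1+k^2)^s|\hat f_k|^2$. For $s>3/2$ let $D^s(S^1)$ be the set of orientation preserving $C^1$-diffeomorphisms $\gamma$ of $S^1$ whose lifts $\tilde\gamma:\mathbb R\to\mathbb R$ satisfy $\tilde\gamma-\mathrm{id}\in H^s(S^1)$, with the quotient of the topology given by $\|\tilde\gamma-\tilde\nu\|_{H^s}$ on lifts. $\mathrm{Diff}(S^1)$ is the group of orientation preserving smooth diffeomorphisms and $\mathrm{M\ddot ob}\cong PSL(2,\mathbb R)$ its subgroup of Möbius transformations. Let $H_1$ be the complex Hilbert space obtained by completing $C^\infty(S^1,\mathbb R)$ modulo constants in the norm $\|f\|=(\sum_{k\ge1}k|\hat f_k|^2)^{1/2}$, with the complex structure $J$ that multiplies $\hat f_k$ by $i$ and $\hat f_{-k}$ by $-i$ for $k\ge1$; equivalently $H_1=\ell^2(\mathbb N_{\geq 1},\mathbb C)$ with $[f]=(\sqrt k\,\hat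 f_k)_{k\ge1}$. For any real function $f$ with $\|f\|<\infty$ let $[f]\in H_1$ be its class. Let $\Gamma_+(H_1)=\bigoplus_n \mathrm{Sym}\,H_1^{\otimes n}$ be the symmetric Fock space, $e(h)=\bigoplus_n h^{\otimes n}/\sqrt{n!}$ the exponential vectors, and $W(h)$, $h\in H_1$, the Weyl operators, i.e. the unitaries with $W(h)e(g)=\exp(-\tfrac14\|h\|^2-\tfrac1{\sqrt2}\langle h,g\rangle)\,e(g+\tfrac1{\sqrt2}h)$, the scalar product being linear in its second argument; they satisfy $W(f)W(g)=e^{-\frac i2\mathrm{Im}\langle f,g\rangle}W(f+g)$. For a nonempty, non-dense, connected open $I\subset S^1$ put $\mathcal A_{U(1)}(I)=\{W([f]):f\in C^\infty(S^1,\mathbb R),\ \mathrm{supp} f\subset I\}''$. Let $\mathcal U(\Gamma_+(H_1))/\mathbb T$ be the projective unitary group with the quotient of the strong operator topology. The vacuum projective representation of $\mathrm{Diff}(S^1)$ is the homomorphism $U_0:\mathrm{Diff}(S^1)\to\mathcal U(\Gamma_+(H_1))/\mathbb T$ with $\mathrm{Ad}\,U_0(\gamma)(W([f]))=W([f\circ\gamma^{-1}])$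 for $f\in C^\infty(S^1,\mathbb R)$ and with $U_0(\gamma)=\Gamma_+(V)$ up to a phase, where $V[f]=[f\circ\gamma^{-1}]$ is unitary on $H_1$, for $\gamma\in\mathrm{M\ddot ob}$. **Theorem.** Let $s>2$. Then $D^s(S^1)$ is a group under composition which contains $\mathrm{Diff}(S^1)$, and for each $\gamma\in D^s(S^1)$ there is a unitary $U(\gamma)$ on $\Gamma_+(H_1)$, unique up to a phase, such that for every $f\in C^\infty(S^1,\mathbb R)$ one has $\|f\circ\gamma^{-1}\|<\infty$ and $$\mathrm{Ad}\,U(\gamma)(W([f]))=W([f\circ\gamma^{-1}]).$$ Moreover: 1. $\gamma\mapsto \mathrm{Ad}\,U(\gamma)\in\mathrm{Aut}(B(\Gamma_+(H_1)))$ is a group homomorphism which is pointwise strongly continuous: $\gamma\mapsto \mathrm{Ad}\,U(\gamma)(A)\,\xi$ is continuous on $D^s(S^1)$ for all $A\in B(\Gamma_+(H_1))$ and $\xi\in\Gamma_+(H_1)$. 2. $\gamma\mapsto[U(\gamma)]$ is a continuous homomorphism from $D^s(S^1)$ into $\mathcal U(\Gamma_+(H_1))/\mathbb T$, and its restriction to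 $\mathrm{Diff}(S^1)$ is the (existing and unique) vacuum projective representation. 3. The $U(1)$-current net is (by item 2, continuously) $D^s(S^1)$-covariant: for all $\gamma\in D^s(S^1)$ and all $I$ as above, $\mathrm{Ad}\,U(\gamma)(\mathcal A_{U(1)}(I))=\mathcal A_{U(1)}(\gamma I)$, and $\mathrm{Ad}\,U(\gamma)(x)=x$ for $x\in\mathcal A_{U(1)}(I)$ whenever the closure of $\{z:\gamma(z)\ne z\}$ is contained in the interior of $S^1\setminus I$. -/

import Mathlib

open scoped ComplexConjugate ContDiff
namespace U1Current

noncomputable section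

theorem inner_linearCombination {X E : Type} [NormedAddCommGroup E] [InnerProductSpace ℂ E]
    (u v : X → E) (h : ∀ x y, (inner ℂ (u x) (u y) : ℂ) = inner ℂ (v x) (v y)) (a b : X →₀ ℂ) :
    (inner ℂ (Finsupp.linearCombination ℂ u a) (Finsupp.linearCombination ℂ u b) : ℂ) =
      inner ℂ (Finsupp.linearCombination ℂ v a) (Finsupp.linearCombination ℂ v b) := by
  simp only [Finsupp.linearCombination_apply, Finsupp.sum, sum_inner, inner_sum, inner_smul_left,
    inner_smul_right, h]

section Fock
variable {ι : Type}

theorem summable_prod_pi (a : ι → ℂ) (ha : Summable fun i => ‖a i‖) (n : ℕ) :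
    (Summable fun x : Fin n → ι => ‖∏ j, a (x j)‖) ∧
      ∑' x : Fin n → ι, ∏ j, a (x j) = (∑' i, a i) ^ n := by
  induction n with
  | zero => exact ⟨(hasSum_unique _).summable, by simp [tsum_fintype]⟩
  | succ n ih =>
    obtain ⟨h1, h2⟩ := ih
    let e : ι × (Fin n → ι) ≃ (Fin (n + 1) → ι) := Fin.consEquiv (fun _ => ι)
    have he : ∀ p : ι × (Fin n → ι), ∏ j, a (e p j) = a p.1 * ∏ j, a (p.2 j) := by
      intro p
      simp [e, Fin.consEquiv, Fin.prod_univ_succ]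
    constructor
    · rw [← e.summable_iff]
      refine (Summable.mul_norm ha h1).congr fun p => ?_
      simp only [Function.comp_apply, he]
    · rw [← e.tsum_eq]
      simp only [he]
      rw [pow_succ', ← h2, tsum_mul_tsum_of_summable_norm ha h1]

/-- The Hilbert space tensor power `K^{⊗ n}` of `K = ℓ²(ι)`, realised as `ℓ²(ιⁿ)`. -/
abbrev TensorPow (ι : Type) (n : ℕ) : Type := lp (fun _ : Fin n → ι => ℂ) 2

/-- The symmetric subspace `Sym K^{⊗ n}` of `K^{⊗ n}`, for `K = ℓ²(ι)`. -/
def symSubmodule (ι : Type) (n : ℕ) : Submodule ℂ (TensorPow ι n) where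
  carrier := {ψ | ∀ (σ : Equiv.Perm (Fin n)) (x : Fin n → ι), ψ (x ∘ σ) = ψ x}
  add_mem' := by
    intro a b ha hb σ x
    simp only [lp.coeFn_add, Pi.add_apply, ha σ x, hb σ x]
  zero_mem' := by intro σ x; simp
  smul_mem' := by
    intro c a ha σ x
    simp only [lp.coeFn_smul, Pi.smul_apply, ha σ x]

theorem isClosed_symSubmodule (n : ℕ) : IsClosed (symSubmodule ι n : Set (TensorPow ι n)) := by
  have h : (symSubmodule ι n : Set (TensorPow ι n)) =
      ⋂ (σ : Equiv.Perm (Fin n)) (x : Fin n → ι), {ψ : TensorPow ι n | ψ (x ∘ σ) = ψ x} := by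
    ext ψ
    simp only [Set.mem_iInter, Set.mem_ofPred_eq]
    rfl
  rw [h]
  have hc : ∀ x : Fin n → ι, Continuous fun ψ : TensorPow ι n => ψ x := fun x =>
    (lp.evalCLM (𝕜 := ℂ) (fun _ : Fin n → ι => ℂ) 2 x).continuous
  exact isClosed_iInter fun σ => isClosed_iInter fun x => isClosed_eq (hc _) (hc _)

/-- The Hilbert space `Sym K^{⊗ n}`. -/
def SymPow (ι : Type) (n : ℕ) : Type := symSubmodule ι n

instance instNormedAddCommGroupSymPow (n : ℕ) : NormedAddCommGroup (SymPow ι n) :=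
  inferInstanceAs (NormedAddCommGroup (symSubmodule ι n))

instance instInnerProductSpaceSymPow (n : ℕ) : InnerProductSpace ℂ (SymPow ι n) :=
  inferInstanceAs (InnerProductSpace ℂ (symSubmodule ι n))

instance instCompleteSpaceSymPow (n : ℕ) : CompleteSpace (SymPow ι n) :=
  (isClosed_symSubmodule n).completeSpace_coe

/-- The symmetric Fock space `Γ₊(K) = ⨁ₙ Sym K^{⊗ n}` (Hilbert space direct sum) of `K = ℓ²(ι)`. -/
def Fock (ι : Type) : Type := lp (fun n : ℕ => SymPow ι n) 2

instance instNormedAddCommGroupFock : NormedAddCommGroup (Fock ι) :=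
  inferInstanceAs (NormedAddCommGroup (lp (fun n : ℕ => SymPow ι n) 2))

instance instInnerProductSpaceFock : InnerProductSpace ℂ (Fock ι) :=
  inferInstanceAs (InnerProductSpace ℂ (lp (fun n : ℕ => SymPow ι n) 2))

instance instCompleteSpaceFock : CompleteSpace (Fock ι) :=
  inferInstanceAs (CompleteSpace (lp (fun n : ℕ => SymPow ι n) 2))

theorem memlp_two_iff {κ : Type} {E : κ → Type} [∀ i, NormedAddCommGroup (E i)] (f : ∀ i, E i) :
    Memℓp f 2 ↔ Summable fun i => ‖f i‖ ^ 2 := by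
  rw [memℓp_gen_iff (by norm_num)]
  norm_num

theorem memlp_tensor (f : lp (fun _ : ι => ℂ) 2) (n : ℕ) :
    Memℓp (fun x : Fin n → ι => ∏ j, f (x j)) 2 := by
  rw [memlp_two_iff]
  have h := (memlp_two_iff _).1 (lp.memℓp f)
  have h' := (summable_prod_pi (fun i => ((‖f i‖ ^ 2 : ℝ) : ℂ)) (by simpa using h) n).1
  refine h'.congr fun x => ?_
  simp [Finset.prod_pow]

/-- The vector `f^{⊗ n}` in the symmetric tensor power. -/
def tensorPow (f : lp (fun _ : ι => ℂ) 2) (n : ℕ) : SymPow ι n :=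
  ⟨⟨fun x => ∏ j, f (x j), memlp_tensor f n⟩, fun σ x =>
    Equiv.prod_comp σ fun j => f (x j)⟩

theorem inner_tensorPow (f g : lp (fun _ : ι => ℂ) 2) (n : ℕ) :
    (inner ℂ (tensorPow f n) (tensorPow g n) : ℂ) = (inner ℂ f g : ℂ) ^ n := by
  have h0 : (inner ℂ (tensorPow f n) (tensorPow g n) : ℂ) =
      ∑' x : Fin n → ι, (inner ℂ ((tensorPow f n).1 x) ((tensorPow g n).1 x) : ℂ) :=
    lp.inner_eq_tsum (𝕜 := ℂ) (tensorPow f n).1 (tensorPow g n).1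
  have hv : ∀ (f : lp (fun _ : ι => ℂ) 2) (x : Fin n → ι), (tensorPow f n).1 x = ∏ j, f (x j) :=
    fun _ _ => rfl
  have h1 : ∀ x : Fin n → ι, (inner ℂ ((tensorPow f n).1 x) ((tensorPow g n).1 x) : ℂ) =
      ∏ j, (inner ℂ (f (x j)) (g (x j)) : ℂ) := by
    intro x
    rw [hv, hv]
    simp only [RCLike.inner_apply, map_prod, Finset.prod_mul_distrib]
  have hs : Summable fun i => (inner ℂ (f i) (g i) : ℂ) :=
    lp.summable_inner (G := fun _ : ι => ℂ) f g
  have h2 := (summable_prod_pi (fun i => (inner ℂ (f i) (g i) : ℂ)) hs.norm n).2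
  have h3 : (inner ℂ f g : ℂ) = ∑' i, (inner ℂ (f i) (g i) : ℂ) := lp.inner_eq_tsum f g
  rw [h0, h3, ← h2]
  exact tsum_congr h1

theorem memlp_coherent (f : lp (fun _ : ι => ℂ) 2) :
    Memℓp (fun n : ℕ => (((Real.sqrt n.factorial)⁻¹ : ℝ) : ℂ) • tensorPow f n) 2 := by
  rw [memlp_two_iff]
  refine (Real.summable_pow_div_factorial (‖f‖ ^ 2)).congr fun n => ?_
  have h : ‖tensorPow f n‖ ^ 2 = (‖f‖ ^ 2) ^ n := by
    have h1 := inner_tensorPow f f n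
    have h2 := inner_self_eq_norm_sq_to_K (𝕜 := ℂ) (tensorPow f n)
    rw [h1, inner_self_eq_norm_sq_to_K] at h2
    symm
    exact_mod_cast h2
  rw [norm_smul, mul_pow, h]
  simp only [Complex.norm_real, norm_inv, inv_pow, Real.norm_eq_abs, sq_abs,
    Real.sq_sqrt (Nat.cast_nonneg _)]
  rw [div_eq_inv_mul]

/-- The exponential (coherent) vector `⨁ₙ f^{⊗ n} / √(n!)`. -/
def coherent (f : lp (fun _ : ι => ℂ) 2) : Fock ι :=
  ⟨fun n : ℕ => (((Real.sqrt n.factorial)⁻¹ : ℝ) : ℂ) • tensorPow f n, memlp_coherent f⟩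

theorem inner_coherent (f g : lp (fun _ : ι => ℂ) 2) :
    inner ℂ (coherent f) (coherent g) = Complex.exp (inner ℂ f g) := by
  refine (lp.inner_eq_tsum (𝕜 := ℂ) (G := fun n : ℕ => SymPow ι n) (coherent f)
    (coherent g)).trans ?_
  rw [Complex.exp_eq_exp_ℂ, NormedSpace.exp_eq_tsum_div]
  refine tsum_congr fun n => ?_
  have h1 : inner ℂ ((((Real.sqrt n.factorial)⁻¹ : ℝ) : ℂ) • tensorPow f n)
      ((((Real.sqrt n.factorial)⁻¹ : ℝ) : ℂ) • tensorPow g n) =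
      (((Real.sqrt n.factorial)⁻¹ : ℝ) : ℂ) * ((((Real.sqrt n.factorial)⁻¹ : ℝ) : ℂ) *
        inner ℂ f g ^ n) := by
    rw [inner_smul_left, inner_smul_right, inner_tensorPow, Complex.conj_ofReal]
  refine h1.trans ?_
  rw [← mul_assoc, ← Complex.ofReal_mul, ← mul_inv, Real.mul_self_sqrt (Nat.cast_nonneg _)]
  push_cast
  rw [div_eq_inv_mul]

theorem symPow_eq_zero (n : ℕ) (ψ : SymPow ι n)
    (h : ∀ f : lp (fun _ : ι => ℂ) 2, inner ℂ (tensorPow f n) ψ = 0) : ψ = 0 := by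
  classical
  apply Subtype.ext
  ext x
  change ψ.1 x = 0
  set S : Finset ι := Finset.univ.image x with hS
  let P : MvPolynomial ι ℂ := ∑ y ∈ Fintype.piFinset (fun _ : Fin n => S),
    MvPolynomial.monomial (∑ j, Finsupp.single (y j) 1) (ψ.1 y)
  have hP : P = 0 := by
    apply MvPolynomial.funext
    intro t
    rw [map_zero]
    have hmem : Memℓp (fun i : ι => if i ∈ S then conj (t i) else 0) 2 := by
      rw [memlp_two_iff]
      refine summable_of_ne_finset_zero (s := S) fun i hi => ?_
      simp [hi]
    have h0 := (lp.inner_eq_tsum (𝕜 := ℂ)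
      (tensorPow (⟨_, hmem⟩ : lp (fun _ : ι => ℂ) 2) n).1 ψ.1).symm.trans (h ⟨_, hmem⟩)
    rw [tsum_eq_sum (s := Fintype.piFinset (fun _ : Fin n => S))] at h0
    · rw [← h0, map_sum]
      refine Finset.sum_congr rfl fun y hy => ?_
      have hy' : ∀ j, y j ∈ S := Fintype.mem_piFinset.1 hy
      rw [MvPolynomial.eval_monomial]
      have : ((∑ j, Finsupp.single (y j) 1 : ι →₀ ℕ).prod fun i e => t i ^ e) = ∏ j, t (y j) := by
        rw [← Finsupp.prod_finsetSum_index (by simp) (by intros; rw [pow_add])]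
        simp
      rw [this]
      simp [tensorPow, hy']
    · intro y hy
      have : ∃ j, y j ∉ S := by simpa [Fintype.mem_piFinset] using hy
      obtain ⟨j, hj⟩ := this
      have h1 : (tensorPow (⟨_, hmem⟩ : lp (fun _ : ι => ℂ) 2) n).1 y = 0 := by
        change ∏ j, (if y j ∈ S then conj (t (y j)) else 0) = 0
        exact Finset.prod_eq_zero (Finset.mem_univ j) (by simp [hj])
      rw [h1, inner_zero_left]
  have hc : MvPolynomial.coeff (∑ j, Finsupp.single (x j) 1) P = 0 := by rw [hP]; simp
  rw [MvPolynomial.coeff_sum] at hc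
  simp only [MvPolynomial.coeff_monomial] at hc
  have key : ∀ y : Fin n → ι,
      (∑ j, Finsupp.single (y j) 1 : ι →₀ ℕ) = ∑ j, Finsupp.single (x j) 1 → ψ.1 y = ψ.1 x := by
    intro y hy
    have hcard : ∀ c : ι, Fintype.card {j // y j = c} = Fintype.card {j // x j = c} := by
      intro c
      have h3 := congrArg (fun q : ι →₀ ℕ => q c) hy
      simp only [Finsupp.finsetSum_apply, Finsupp.single_apply, Finset.sum_boole, Nat.cast_id] at h3
      rw [Fintype.card_subtype, Fintype.card_subtype, h3]
    let σ : Equiv.Perm (Fin n) := Equiv.ofFiberEquiv fun c => Fintype.equivOfCardEq (hcard c)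
    have hσ : y = x ∘ σ := by
      funext j
      exact (Equiv.ofFiberEquiv_map (fun c => Fintype.equivOfCardEq (hcard c)) j).symm
    rw [hσ]
    exact ψ.2 σ x
  rw [Finset.sum_congr rfl (g := fun y => if (∑ j, Finsupp.single (y j) 1 : ι →₀ ℕ) =
    ∑ j, Finsupp.single (x j) 1 then ψ.1 x else 0)] at hc
  · rw [← Finset.sum_filter, Finset.sum_const, nsmul_eq_mul, mul_eq_zero] at hc
    rcases hc with hc | hc
    · exfalso
      rw [Nat.cast_eq_zero, Finset.card_eq_zero] at hc
      have : x ∈ (∅ : Finset (Fin n → ι)) := by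
        rw [← hc]
        simp [Fintype.mem_piFinset, hS]
      simp at this
    · exact hc
  · intro y _
    split_ifs with h5
    · exact key y h5
    · rfl

theorem tensorPow_smul (t : ℂ) (f : lp (fun _ : ι => ℂ) 2) (n : ℕ) :
    tensorPow (t • f) n = t ^ n • tensorPow f n := by
  apply Subtype.ext
  ext x
  change ∏ j, t * f (x j) = t ^ n * ∏ j, f (x j)
  simp [Finset.prod_mul_distrib]

theorem fock_eq_zero (ψ : Fock ι)
    (h : ∀ f : lp (fun _ : ι => ℂ) 2, inner ℂ (coherent f) ψ = 0) : ψ = 0 := by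
  refine lp.ext (E := fun n : ℕ => SymPow ι n) (funext fun n => ?_)
  apply symPow_eq_zero n
  intro f
  let c : ℕ → ℂ := fun n => inner ℂ ((coherent f).1 n) (ψ.1 n)
  have hs : ∀ t : ℂ, HasSum (fun m => t ^ m * c m) 0 := by
    intro t
    have h1 : HasSum (fun m => (inner ℂ ((coherent (conj t • f)).1 m) (ψ.1 m) : ℂ))
        (inner ℂ (coherent (conj t • f)) ψ) :=
      lp.hasSum_inner (𝕜 := ℂ) (G := fun n : ℕ => SymPow ι n) (coherent (conj t • f)) ψ
    rw [h] at h1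
    have h2 : ∀ m, inner ℂ ((coherent (conj t • f)).1 m) (ψ.1 m) = t ^ m * c m := by
      intro m
      have h3 : (coherent (conj t • f)).1 m = conj t ^ m • (coherent f).1 m := by
        change (((Real.sqrt m.factorial)⁻¹ : ℝ) : ℂ) • tensorPow (conj t • f) m =
          conj t ^ m • (((Real.sqrt m.factorial)⁻¹ : ℝ) : ℂ) • tensorPow f m
        rw [tensorPow_smul, smul_comm]
      rw [h3]
      refine (inner_smul_left _ _ _).trans ?_
      rw [map_pow, Complex.conj_conj]
    simpa only [h2] using h1
  have hp : HasFPowerSeriesAt (fun _ : ℂ => (0 : ℂ)) (FormalMultilinearSeries.ofScalars ℂ c) 0 := by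
    rw [hasFPowerSeriesAt_iff]
    exact Filter.Eventually.of_forall fun t => by simpa using hs t
  have h4 := congrArg (fun q : FormalMultilinearSeries ℂ ℂ ℂ => q.coeff n) hp.eq_zero
  have hcn : c n = 0 := by
    have h6 : (FormalMultilinearSeries.ofScalars ℂ c).coeff n = 0 := h4
    rwa [FormalMultilinearSeries.coeff_ofScalars] at h6
  have h5 : c n = (((Real.sqrt n.factorial)⁻¹ : ℝ) : ℂ) * inner ℂ (tensorPow f n) (ψ.1 n) := by
    change inner ℂ ((((Real.sqrt n.factorial)⁻¹ : ℝ) : ℂ) • tensorPow f n) (ψ.1 n) = _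
    refine (inner_smul_left _ _ _).trans ?_
    rw [Complex.conj_ofReal]
  rw [h5, mul_eq_zero] at hcn
  refine hcn.resolve_left ?_
  refine Complex.ofReal_ne_zero.2 ?_
  positivity

/-- Linear combinations of exponential vectors. -/
def cohComb (ι : Type) : (lp (fun _ : ι => ℂ) 2 →₀ ℂ) →ₗ[ℂ] Fock ι :=
  Finsupp.linearCombination ℂ coherent

theorem denseRange_cohComb : DenseRange (cohComb ι) := by
  have h : (LinearMap.range (cohComb ι)).topologicalClosure = ⊤ := by
    rw [Submodule.topologicalClosure_eq_top_iff, Submodule.eq_bot_iff]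
    intro ψ hψ
    refine fock_eq_zero ψ fun f => ?_
    refine (Submodule.mem_orthogonal _ _).1 hψ _ ⟨Finsupp.single f 1, ?_⟩
    simp [cohComb]
  have h' := Submodule.dense_iff_topologicalClosure_eq_top.2 h
  exact h'

/-- The scalar `exp(-‖h‖²/4 - ⟨h, g⟩/√2)`. -/
def weylFactor (h g : lp (fun _ : ι => ℂ) 2) : ℂ :=
  Complex.exp (-((‖h‖ ^ 2 / 4 : ℝ) : ℂ) - (((Real.sqrt 2)⁻¹ : ℝ) : ℂ) * inner ℂ h g)

/-- The action of the Weyl operator `W(h)` on linear combinations of exponential vectors. -/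
def weylComb (h : lp (fun _ : ι => ℂ) 2) : (lp (fun _ : ι => ℂ) 2 →₀ ℂ) →ₗ[ℂ] Fock ι :=
  Finsupp.linearCombination ℂ fun g =>
    weylFactor h g • coherent (g + (((Real.sqrt 2)⁻¹ : ℝ) : ℂ) • h)

/-- The Weyl operator `W(h)` on the symmetric Fock space: the bounded operator which maps the
exponential vector of `g` to `exp(-‖h‖²/4 - ⟨h, g⟩/√2)` times that of `g + h/√2`
(see `weyl_coherent`). -/
def weyl (h : lp (fun _ : ι => ℂ) 2) : Fock ι →L[ℂ] Fock ι :=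
  (weylComb h).extendOfNorm (cohComb ι)

theorem inner_weylComb (h : lp (fun _ : ι => ℂ) 2) (a b : lp (fun _ : ι => ℂ) 2 →₀ ℂ) :
    (inner ℂ (weylComb h a) (weylComb h b) : ℂ) = inner ℂ (cohComb ι a) (cohComb ι b) := by
  have key : ∀ f g : lp (fun _ : ι => ℂ) 2,
      (inner ℂ (weylFactor h f • coherent (f + (((Real.sqrt 2)⁻¹ : ℝ) : ℂ) • h))
        (weylFactor h g • coherent (g + (((Real.sqrt 2)⁻¹ : ℝ) : ℂ) • h)) : ℂ) =
      inner ℂ (coherent f) (coherent g) := by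
    intro f g
    have hr : (((Real.sqrt 2)⁻¹ : ℝ) : ℂ) * (((Real.sqrt 2)⁻¹ : ℝ) : ℂ) = 1 / 2 := by
      rw [← Complex.ofReal_mul, ← mul_inv, Real.mul_self_sqrt (by norm_num)]
      norm_num
    rw [inner_smul_left, inner_smul_right, inner_coherent, inner_coherent, weylFactor, weylFactor,
      ← Complex.exp_conj, ← Complex.exp_add, ← Complex.exp_add]
    congr 1
    have hh : (inner ℂ h h : ℂ) = ((‖h‖ ^ 2 : ℝ) : ℂ) := by
      rw [inner_self_eq_norm_sq_to_K]; push_cast; rfl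
    simp only [map_sub, map_neg, map_mul, Complex.conj_ofReal, inner_conj_symm, inner_add_left,
      inner_add_right, inner_smul_left, inner_smul_right, hh]
    push_cast at hr ⊢
    linear_combination ((‖h‖ : ℂ) ^ 2) * hr
  exact inner_linearCombination _ _ key a b

theorem norm_weylComb (h : lp (fun _ : ι => ℂ) 2) (a : lp (fun _ : ι => ℂ) 2 →₀ ℂ) :
    ‖weylComb h a‖ = ‖cohComb ι a‖ := by
  have h1 := inner_weylComb h a a
  rw [inner_self_eq_norm_sq_to_K, inner_self_eq_norm_sq_to_K] at h1
  have h2 : ‖weylComb h a‖ ^ 2 = ‖cohComb ι a‖ ^ 2 := by exact_mod_cast h1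
  exact (sq_eq_sq₀ (norm_nonneg _) (norm_nonneg _)).1 h2

theorem weyl_coherent (h g : lp (fun _ : ι => ℂ) 2) :
    weyl h (coherent g) =
      weylFactor h g • coherent (g + (((Real.sqrt 2)⁻¹ : ℝ) : ℂ) • h) := by
  have h1 := LinearMap.extendOfNorm_eq (f := weylComb h) (e := cohComb ι) denseRange_cohComb
    ⟨1, fun a => by rw [norm_weylComb, one_mul]⟩ (Finsupp.single g 1)
  have h2 : cohComb ι (Finsupp.single g 1) = coherent g := by simp [cohComb]
  have h3 : weylComb h (Finsupp.single g 1) =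
      weylFactor h g • coherent (g + (((Real.sqrt 2)⁻¹ : ℝ) : ℂ) • h) := by simp [weylComb]
  rw [h2, h3] at h1
  exact h1

theorem norm_weyl (h : lp (fun _ : ι => ℂ) 2) (ψ : Fock ι) : ‖weyl h ψ‖ = ‖ψ‖ := by
  refine denseRange_cohComb.induction_on (p := fun ψ => ‖weyl h ψ‖ = ‖ψ‖) ψ
    (isClosed_eq (by fun_prop) (by fun_prop)) fun a => ?_
  have h1 := LinearMap.extendOfNorm_eq (f := weylComb h) (e := cohComb ι) denseRange_cohComb
    ⟨1, fun a => by rw [norm_weylComb, one_mul]⟩ a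
  rw [weyl, h1, norm_weylComb]

theorem ext_coherent {S T : Fock ι →L[ℂ] Fock ι} (h : ∀ g, S (coherent g) = T (coherent g)) :
    S = T := by
  have h1 : (S : Fock ι → Fock ι) = T := denseRange_cohComb.equalizer S.continuous T.continuous (by
    funext a
    simp [cohComb, Finsupp.linearCombination_apply, Finsupp.sum, h])
  exact DFunLike.coe_injective h1

/-- The Weyl relations `W(f) W(g) = exp(-i Im ⟨f, g⟩ / 2) W(f + g)`. -/
theorem weyl_mul (f g : lp (fun _ : ι => ℂ) 2) :
    weyl f * weyl g =
      Complex.exp (-Complex.I * (((inner ℂ f g : ℂ).im : ℝ) : ℂ) / 2) • weyl (f + g) := by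
  refine ext_coherent fun k => ?_
  have hr : (((Real.sqrt 2)⁻¹ : ℝ) : ℂ) * (((Real.sqrt 2)⁻¹ : ℝ) : ℂ) = 1 / 2 := by
    rw [← Complex.ofReal_mul, ← mul_inv, Real.mul_self_sqrt (by norm_num)]
    norm_num
  rw [mul_apply_eq_comp, smul_apply, weyl_coherent, map_smul,
    weyl_coherent, weyl_coherent, smul_smul, smul_smul, smul_add, add_assoc,
    add_comm ((((Real.sqrt 2)⁻¹ : ℝ) : ℂ) • g)]
  congr 1
  rw [weylFactor, weylFactor, weylFactor, ← Complex.exp_add, ← Complex.exp_add]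
  congr 1
  have hn : ∀ x : lp (fun _ : ι => ℂ) 2, ((‖x‖ ^ 2 : ℝ) : ℂ) = inner ℂ x x := by
    intro x
    rw [inner_self_eq_norm_sq_to_K]; push_cast; rfl
  have hi : (inner ℂ f g : ℂ) - inner ℂ g f = 2 * Complex.I * (((inner ℂ f g : ℂ).im : ℝ) : ℂ) := by
    rw [← inner_conj_symm g f, Complex.sub_conj]
    push_cast; ring
  have hd : ∀ x : lp (fun _ : ι => ℂ) 2, ((‖x‖ ^ 2 / 4 : ℝ) : ℂ) = inner ℂ x x / 4 := by
    intro x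
    rw [← hn]; push_cast; rfl
  simp only [hd, inner_add_left, inner_add_right, inner_smul_right]
  push_cast at hr ⊢
  linear_combination (-(inner ℂ f g : ℂ)) * hr - hi / 4

theorem weyl_zero : weyl (0 : lp (fun _ : ι => ℂ) 2) = 1 := by
  refine ext_coherent fun k => ?_
  rw [weyl_coherent]
  simp [weylFactor]

end Fock

/-! ### The projective unitary group -/

section Projective
variable (E : Type) [NormedAddCommGroup E] [InnerProductSpace ℂ E] [CompleteSpace E]

/-- The unitaries which are scalar multiples of the identity. -/
def phases : Subgroup (unitary (E →L[ℂ] E)) where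
  carrier := {u | ∃ z : ℂ, (u : E →L[ℂ] E) = z • 1}
  mul_mem' := by
    rintro a b ⟨z, hz⟩ ⟨w, hw⟩
    exact ⟨z * w, by simp [hz, hw, smul_smul, mul_comm]⟩
  one_mem' := ⟨1, by simp⟩
  inv_mem' := by
    rintro a ⟨z, hz⟩
    refine ⟨conj z, ?_⟩
    change star (a : E →L[ℂ] E) = _
    rw [hz, star_smul, star_one]
    rfl

instance instNormalPhases : (phases E).Normal where
  conj_mem := by
    rintro a ⟨z, hz⟩ g
    refine ⟨z, ?_⟩
    have h : ((g * a * g⁻¹ : unitary (E →L[ℂ] E)) : E →L[ℂ] E) =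
        (g : E →L[ℂ] E) * a * star (g : E →L[ℂ] E) := rfl
    rw [h, hz, mul_smul_comm, mul_one, smul_mul_assoc, Unitary.mul_star_self_of_mem g.2]

/-- The projective unitary group `U(E)/𝕋`. -/
def PU : Type := unitary (E →L[ℂ] E) ⧸ phases E

instance instGroupPU : Group (PU E) :=
  inferInstanceAs (Group (unitary (E →L[ℂ] E) ⧸ phases E))

variable {E}

/-- The class of a unitary operator in the projective unitary group. -/
def PU.mk : unitary (E →L[ℂ] E) →* PU E := QuotientGroup.mk' (phases E)

/-- The quotient of the strong operator topology on the unitary group. -/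
instance instTopologicalSpacePU : TopologicalSpace (PU E) :=
  TopologicalSpace.coinduced PU.mk
    (TopologicalSpace.induced
      (fun (u : unitary (E →L[ℂ] E)) (ξ : E) => (u : E →L[ℂ] E) ξ) inferInstance)

/-- The action `[u] ↦ Ad u`, `Ad u (A) = u A u*`, of the projective unitary group by
`*`-automorphisms of `B(E)`. -/
def PU.Ad : PU E →* ((E →L[ℂ] E) ≃⋆ₐ[ℂ] (E →L[ℂ] E)) :=
  QuotientGroup.lift (phases E) (Unitary.conjStarAlgAut ℂ (E →L[ℂ] E)) (by
    rintro u ⟨z, hz⟩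
    ext1 A
    rw [Unitary.conjStarAlgAut_apply]
    have h : (u : E →L[ℂ] E) * star (u : E →L[ℂ] E) = 1 := Unitary.mul_star_self_of_mem u.2
    have hc : (u : E →L[ℂ] E) * A = A * u := by
      rw [hz, smul_mul_assoc, mul_smul_comm, one_mul, mul_one]
    change (u : E →L[ℂ] E) * A * star (u : E →L[ℂ] E) = A
    rw [hc, mul_assoc, h, mul_one])

theorem PU.Ad_mk (u : unitary (E →L[ℂ] E)) (A : E →L[ℂ] E) :
    PU.Ad (PU.mk u) A = u * A * star (u : E →L[ℂ] E) := rfl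

end Projective

/-! ### Functions on the circle and the one-particle space -/

/-- The circle, with the angle `θ ∈ ℝ/2πℤ` as coordinate. -/
abbrev S1 : Type := AddCircle (2 * Real.pi)

/-- The Fourier coefficient `(2π)⁻¹ ∫₀^{2π} e^{-ikθ} g(θ) dθ`. -/
def coeff (g : ℝ → ℝ) (k : ℤ) : ℂ :=
  fourierCoeffOn Real.two_pi_pos (fun θ => (g θ : ℂ)) k

/-- Membership in `C^∞(S¹, ℝ)`. -/
def IsSmooth (f : S1 → ℝ) : Prop := ContDiff ℝ ∞ fun θ : ℝ => f θ

/-- The one-particle space `H₁`. The completion of `C^∞(S¹, ℝ)` modulo constants for the norm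
`‖f‖² = ∑_{k ≥ 1} k |f̂_k|²`, with the complex structure which multiplies `f̂_k`, `k ≥ 1`, by `i`
(and `f̂_{-k}` by `-i`), is identified with `ℓ²(ℕ₊, ℂ)` through `f ↦ (√k f̂_k)_{k ≥ 1}`. -/
abbrev H1 : Type := lp (fun _ : ℕ+ => ℂ) 2

/-- The sequence `(√k f̂_k)_{k ≥ 1}`. -/
def classSeq (f : S1 → ℝ) (k : ℕ+) : ℂ :=
  (Real.sqrt (k : ℕ) : ℂ) * coeff (fun θ => f θ) (k : ℕ)

/-- Finiteness of the seminorm `(∑_{k ≥ 1} k |f̂_k|²)^{1/2}`. -/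
def HasClass (f : S1 → ℝ) : Prop := Memℓp (classSeq f) 2

open Classical in
/-- The class `[f] ∈ H₁` of a function of finite seminorm (`0` by convention for others). -/
def cls (f : S1 → ℝ) : H1 := if h : HasClass f then ⟨classSeq f, h⟩ else 0

/-- The symmetric Fock space `Γ₊(H₁)`. -/
abbrev F1 : Type := Fock ℕ+

/-! ### Diffeomorphisms of the circle -/

/-- `φ : ℝ → ℝ` is a lift of the homeomorphism `γ` of the circle, is of class `C^n`, commutes with
the translation by `2π`, and has positive derivative. -/
structure IsLift (n : ℕ∞) (γ : S1 ≃ₜ S1) (φ : ℝ → ℝ) : Prop where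
  contDiff : ContDiff ℝ n φ
  deriv_pos : ∀ θ, 0 < deriv φ θ
  map_add : ∀ θ, φ (θ + 2 * Real.pi) = φ θ + 2 * Real.pi
  coe_eq : ∀ θ : ℝ, γ (θ : S1) = (φ θ : S1)

/-- The weighted Fourier coefficients `(1 + k²)^{s/2} (φ - id)^_k`, whose `ℓ²`-norm is the
`H^s`-norm of `φ - id`. -/
def sobolevSeq (s : ℝ) (φ : ℝ → ℝ) (k : ℤ) : ℂ :=
  (((1 + (k : ℝ) ^ 2) ^ (s / 2) : ℝ) : ℂ) * coeff (fun θ => φ θ - θ) k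

/-- The universal covering group of `D^s(S¹)`: a diffeomorphism of `S¹` of class `C¹` with a chosen
lift `φ` such that `φ - id ∈ H^s`. -/
structure SobolevLift (s : ℝ) where
  toHomeo : S1 ≃ₜ S1
  lift : ℝ → ℝ
  isLift : IsLift 1 toHomeo lift
  memlp : Memℓp (sobolevSeq s lift) 2

/-- The topology given by the `H^s`-distance of the lifts. -/
instance instTopologicalSpaceSobolevLift (s : ℝ) : TopologicalSpace (SobolevLift s) :=
  TopologicalSpace.induced
    (fun g => (⟨sobolevSeq s g.lift, g.memlp⟩ : lp (fun _ : ℤ => ℂ) 2)) inferInstance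

/-- `γ` is an orientation preserving `C¹`-diffeomorphism with `γ̃ - id ∈ H^s` for a lift `γ̃`. -/
def IsSobolevDiffeo (s : ℝ) (γ : S1 ≃ₜ S1) : Prop := ∃ g : SobolevLift s, g.toHomeo = γ

/-- The set `D^s(S¹)` of Sobolev class diffeomorphisms. -/
def SobolevDiffeo (s : ℝ) : Type := {γ : S1 ≃ₜ S1 // IsSobolevDiffeo s γ}

/-- The covering map onto `D^s(S¹)`. -/
def SobolevLift.proj {s : ℝ} (g : SobolevLift s) : SobolevDiffeo s := ⟨g.toHomeo, g, rfl⟩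

/-- The topology of `D^s(S¹)`: the quotient of the `H^s`-topology on lifts. -/
instance instTopologicalSpaceSobolevDiffeo (s : ℝ) : TopologicalSpace (SobolevDiffeo s) :=
  TopologicalSpace.coinduced SobolevLift.proj inferInstance

/-- `γ` is an orientation preserving smooth diffeomorphism of the circle. -/
def IsSmoothDiffeo (γ : S1 ≃ₜ S1) : Prop := ∃ φ : ℝ → ℝ, IsLift ⊤ γ φ

/-- The group `Diff(S¹)` of orientation preserving smooth diffeomorphisms. -/
def SmoothDiffeo : Type := {γ : S1 ≃ₜ S1 // IsSmoothDiffeo γ}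

/-- `γ` acts on the unit circle of `ℂ` as an element of `PSU(1,1) ≅ PSL(2,ℝ)`. -/
def IsMobius (γ : S1 ≃ₜ S1) : Prop :=
  ∃ a b : ℂ, ‖a‖ ^ 2 - ‖b‖ ^ 2 = 1 ∧ ∀ x : S1,
    (AddCircle.toCircle (γ x) : ℂ) =
      (a * (AddCircle.toCircle x : ℂ) + b) / (conj b * (AddCircle.toCircle x : ℂ) + conj a)

/-! ### Implementation on the Fock space and the net -/

/-- `p ∈ U(Γ₊(H₁))/𝕋` implements `γ`: `Ad p (W([f])) = W([f ∘ γ⁻¹])` for all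
`f ∈ C^∞(S¹, ℝ)`, the functions `f ∘ γ⁻¹` being of finite seminorm. -/
def Implements (p : PU F1) (γ : S1 ≃ₜ S1) : Prop :=
  ∀ f : S1 → ℝ, IsSmooth f →
    HasClass f ∧ HasClass (f ∘ γ.symm) ∧ PU.Ad p (weyl (cls f)) = weyl (cls (f ∘ γ.symm))

/-- `p` is the class of the second quantization `Γ₊(V)` of a (complex linear) unitary operator `V`
on `H₁` with `V [f] = [f ∘ γ⁻¹]`. The unitary `Γ₊(V)` maps the exponential vector of `h` to that
of `V h`. -/
def IsSecondQuantized (p : PU F1) (γ : S1 ≃ₜ S1) : Prop :=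
  ∃ V : H1 ≃ₗᵢ[ℂ] H1, (∀ f : S1 → ℝ, IsSmooth f → V (cls f) = cls (f ∘ γ.symm)) ∧
    ∃ u : unitary (F1 →L[ℂ] F1), PU.mk u = p ∧
      ∀ h : H1, (u : F1 →L[ℂ] F1) (coherent h) = coherent (V h)

/-- The vacuum projective representation of `Diff(S¹)` on `Γ₊(H₁)`: it is multiplicative, extends
the second quantized representation of the Möbius group, and implements the action of `Diff(S¹)`
on the current algebra. -/
structure IsVacuumRep (U₀ : SmoothDiffeo → PU F1) : Prop where
  mul : ∀ γ ν κ : SmoothDiffeo, κ.1 = γ.1 * ν.1 → U₀ κ = U₀ γ * U₀ ν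
  mobius : ∀ γ : SmoothDiffeo, IsMobius γ.1 → IsSecondQuantized (U₀ γ) γ.1
  implements : ∀ γ : SmoothDiffeo, Implements (U₀ γ) γ.1

/-- Nonempty, non-dense, connected open subsets of the circle. -/
def IsInterval (I : Set S1) : Prop := IsOpen I ∧ IsConnected I ∧ ¬ Dense I

/-- The von Neumann algebra `A_{U(1)}(I) = {W([f]) : f ∈ C^∞(S¹, ℝ), supp f ⊂ I}''`. -/
def net (I : Set S1) : Set (F1 →L[ℂ] F1) :=
  Set.centralizer (Set.centralizer
    {T | ∃ f : S1 → ℝ, IsSmooth f ∧ tsupport f ⊆ I ∧ T = weyl (cls f)})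

/-- The support of a homeomorphism of the circle. -/
def supp (γ : S1 ≃ₜ S1) : Set S1 := closure {x | γ x ≠ x}

end

end U1Current

open U1Current

namespace U1Current

noncomputable section

/-! Composition with `γ⁻¹` preserves the symplectic form `Im ⟨[f], [g]⟩ = -(4π)⁻¹ ∫ f dg` and is
bounded for the `H^{1/2}`-norm modulo constants, so a diffeomorphism acts on `H₁` by a bounded
invertible real linear symplectic map `S`. The Weyl operators of smooth functions act irreducibly,
hence a unitary implementing `S` is unique up to a phase (`Implements.unique`). Given existence,
uniqueness alone yields multiplicativity and the comparison with any vacuum representation of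
`Diff(S¹)`. What remains is existence, continuity, the group property of `D^s(S¹)`, and the net.

Existence rests on a quantitative form of Shale's criterion (`exists_implementer`). Write `S = A +
B` with `A` linear and `B` antilinear, and `S⁻¹ = A' + B'`. Then `A' = A*`, `‖Af‖² = ‖f‖² + ‖Bf‖²`,
and `Z = BA⁻¹` is symmetric with Hilbert-Schmidt norm at most `β`, that of `B'`. If `β < 1` there is
a Gaussian vector `Ψ` with `⟨e(f), Ψ⟩ = exp(⟨f, Zf⟩/2)`, and the normalised vectors `exp(‖g‖²/2)
D(Sg)Ψ` have the same scalar products as the `e(g)`. They define the implementer, which moves the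
vacuum by at most `2β/(1-β)`.

The decisive estimate is `hilbertSchmidt_le`: for lifts `φ₀`, `φ₁` the squared Hilbert-Schmidt norm
of the antilinear part attached to `φ₁ ∘ φ₀⁻¹` is at most a constant times `‖φ₁ - φ₀‖²` in `H²`. Its
matrix entry at `(j, k)` is an oscillatory integral of frequency `n = j + k` along the interpolated
lift `(1-τ)φ₀ + τφ₁` at `τ = k/n`. A Sobolev inequality in `τ` replaces the sum over these sample
points by an integral over `τ`; for fixed `τ`, after a change of variables, the sum over `n` is
controlled by `H¹`-norms that are linear in `φ₁ - φ₀`. Cutting the segment from `id` to `φ` into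
short steps and multiplying the implementers handles every `H²`-lift (`Lift.exists_implementer`).

The same smallness gives continuity. If `φᵢ → φ₀` in `H²`, implementers of `φᵢ ∘ φ₀⁻¹` can be chosen
to almost fix the vacuum, while the one-particle maps tend to the identity on `C²` functions; hence
these implementers tend strongly to `1` (`Lift.exists_tendsto_implementer`), and multiplying by a
fixed representative of `U(γ₀)` gives local strongly convergent choices of representatives.

The group property is Sobolev calculus: `H^r` is an algebra for `r > 1/2`, and composition and
reciprocals are controlled for `1 < r ≤ 2` by interpolation and beyond by differentiating. Squared
norms take values in `[0, ∞]`, so finiteness means membership. For the net, `f ∘ γ⁻¹` is only known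
to be `C¹`, so it is approximated in `H¹` by smooth functions supported in the same open set. -/

/-- A function which is both holomorphic and antiholomorphic is constant. -/
theorem const_of_holomorphic_of_antiholomorphic {k₁ k₂ : ℂ → ℂ} (h₁ : Differentiable ℂ k₁)
    (h₂ : Differentiable ℂ k₂) (h : ∀ z, k₁ z = conj (k₂ z)) (z w : ℂ) : k₁ z = k₁ w := by
  refine is_const_of_deriv_eq_zero h₁ (fun x => ?_) z w
  have e1 : ∀ v : ℂ, HasDerivAt (fun t : ℝ => k₁ (x + t * v)) (deriv k₁ x * v) 0 := by
    intro v
    have h3 : HasDerivAt (fun t : ℝ => x + (t : ℂ) * v) v 0 := by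
      simpa using ((hasDerivAt_id (0 : ℝ)).ofReal_comp.mul_const v).const_add x
    have h4 : HasDerivAt k₁ (deriv k₁ x) (x + ((0 : ℝ) : ℂ) * v) := by
      simpa using (h₁ x).hasDerivAt
    exact h4.comp (0 : ℝ) h3
  have e2 : ∀ v : ℂ, HasDerivAt (fun t : ℝ => k₁ (x + t * v)) (conj (deriv k₂ x * v)) 0 := by
    intro v
    have h3 : HasDerivAt (fun t : ℝ => x + (t : ℂ) * v) v 0 := by
      simpa using ((hasDerivAt_id (0 : ℝ)).ofReal_comp.mul_const v).const_add x
    have h4 : HasDerivAt k₂ (deriv k₂ x) (x + ((0 : ℝ) : ℂ) * v) := by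
      simpa using (h₂ x).hasDerivAt
    have h5 := (h4.comp (0 : ℝ) h3).star
    refine h5.congr_of_eventuallyEq (Filter.Eventually.of_forall fun t => ?_)
    exact h _
  -- The direction `1` gives `k₁' = conj k₂'`, the direction `i` gives `i k₁' = -i conj k₂'`;
  -- together `2i k₁' = 0`.
  have a1 := (e1 1).unique (e2 1)
  have aI := (e1 Complex.I).unique (e2 Complex.I)
  simp only [mul_one, map_mul, Complex.conj_I] at a1 aI
  rw [← a1] at aI
  have : 2 * Complex.I * deriv k₁ x = 0 := by linear_combination aI
  simpa using this

/-! ### Weyl operators: adjoints, strong continuity, irreducibility -/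

section Weyl
variable {ι : Type}

local notation "ℓ²" => lp (fun _ : ι => ℂ) 2

theorem weyl_mul_neg (h : ℓ²) : weyl h * weyl (-h) = 1 := by
  rw [weyl_mul, add_neg_cancel, weyl_zero, inner_neg_right, inner_self_eq_norm_sq_to_K]
  have : (-((‖h‖ : ℂ) ^ 2)).im = 0 := by
    rw [← Complex.ofReal_pow, ← Complex.ofReal_neg, Complex.ofReal_im]
  simp [this]

theorem star_weyl (h : ℓ²) : star (weyl h) = weyl (-h) := by
  have h1 : star (weyl h) * weyl h = 1 := by
    refine ContinuousLinearMap.ext fun x => ext_inner_right ℂ fun y => ?_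
    have h2 := (LinearMap.norm_map_iff_inner_map_map (weyl h)).1 (norm_weyl h) x y
    rw [ContinuousLinearMap.star_eq_adjoint]
    change inner ℂ (ContinuousLinearMap.adjoint (weyl h) (weyl h x)) y = inner ℂ x y
    rw [ContinuousLinearMap.adjoint_inner_left]
    exact h2
  calc star (weyl h) = star (weyl h) * (weyl h * weyl (-h)) := by rw [weyl_mul_neg, mul_one]
    _ = weyl (-h) := by rw [← mul_assoc, h1, one_mul]

theorem inner_weyl_weyl (h : ℓ²) (x y : Fock ι) :
    (inner ℂ (weyl h x) (weyl h y) : ℂ) = inner ℂ x y :=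
  (LinearMap.norm_map_iff_inner_map_map (weyl h)).1 (norm_weyl h) x y

/-- The Weyl operator in the normalisation of displacement operators. -/
def displ (k : ℓ²) : Fock ι →L[ℂ] Fock ι := weyl (((Real.sqrt 2 : ℝ) : ℂ) • k)

theorem sqrt_two_inv_mul_sqrt_two : (((Real.sqrt 2)⁻¹ : ℝ) : ℂ) * ((Real.sqrt 2 : ℝ) : ℂ) = 1 := by
  rw [← Complex.ofReal_mul, inv_mul_cancel₀ (by positivity), Complex.ofReal_one]

theorem sqrt_two_mul_sqrt_two : ((Real.sqrt 2 : ℝ) : ℂ) * ((Real.sqrt 2 : ℝ) : ℂ) = 2 := by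
  rw [← Complex.ofReal_mul, Real.mul_self_sqrt (by norm_num)]
  norm_num

theorem displ_coherent (k g : ℓ²) :
    displ k (coherent g) =
      Complex.exp (-((‖k‖ ^ 2 / 2 : ℝ) : ℂ) - inner ℂ k g) • coherent (g + k) := by
  rw [displ, weyl_coherent, smul_smul, sqrt_two_inv_mul_sqrt_two, one_smul, weylFactor,
    inner_smul_left, Complex.conj_ofReal, ← mul_assoc, sqrt_two_inv_mul_sqrt_two, one_mul, norm_smul,
    mul_pow]
  congr 5
  rw [Complex.norm_real, Real.norm_eq_abs, sq_abs, Real.sq_sqrt (by norm_num)]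
  ring

theorem displ_mul (f g : ℓ²) :
    displ f * displ g =
      Complex.exp (-Complex.I * (((inner ℂ f g : ℂ).im : ℝ) : ℂ)) • displ (f + g) := by
  rw [displ, displ, weyl_mul, displ, smul_add]
  congr 2
  rw [inner_smul_left, inner_smul_right, Complex.conj_ofReal, ← mul_assoc, sqrt_two_mul_sqrt_two]
  simp
  ring

theorem star_displ (k : ℓ²) : star (displ k) = displ (-k) := by
  rw [displ, star_weyl, displ, smul_neg]

theorem inner_displ_displ (h : ℓ²) (x y : Fock ι) :
    (inner ℂ (displ h x) (displ h y) : ℂ) = inner ℂ x y := inner_weyl_weyl _ x y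

theorem weyl_eq_displ (h : ℓ²) : weyl h = displ ((((Real.sqrt 2)⁻¹ : ℝ) : ℂ) • h) := by
  rw [displ, smul_smul, mul_comm, sqrt_two_inv_mul_sqrt_two, one_smul]

/-- This is why an implementer is determined by its value on the vacuum `Ω = e(0)`: intertwining
forces `u e(g) = exp(‖g‖²/2) D(Sg) uΩ`. -/
theorem coherent_eq_displ (g : ℓ²) :
    coherent g = Complex.exp ((‖g‖ ^ 2 / 2 : ℝ) : ℂ) • displ g (coherent (0 : ℓ²)) := by
  rw [displ_coherent, smul_smul, ← Complex.exp_add, zero_add]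
  simp

theorem continuous_coherent : Continuous (coherent : ℓ² → Fock ι) := by
  rw [continuous_iff_continuousAt]
  intro f
  rw [ContinuousAt, tendsto_iff_norm_sub_tendsto_zero]
  have h1 : ∀ g : ℓ², ‖coherent g - coherent f‖ = Real.sqrt (Complex.re
      (Complex.exp (inner ℂ g g) - Complex.exp (inner ℂ g f) - Complex.exp (inner ℂ f g) +
        Complex.exp (inner ℂ f f))) := by
    intro g
    rw [norm_eq_sqrt_re_inner (𝕜 := ℂ), inner_sub_sub_self]
    simp only [inner_coherent]
    rfl
  simp only [h1]
  have h2 : Filter.Tendsto (fun g : ℓ² => Real.sqrt (Complex.re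
      (Complex.exp (inner ℂ g g) - Complex.exp (inner ℂ g f) - Complex.exp (inner ℂ f g) +
        Complex.exp (inner ℂ f f)))) (nhds f) (nhds (Real.sqrt (Complex.re
      (Complex.exp (inner ℂ f f) - Complex.exp (inner ℂ f f) - Complex.exp (inner ℂ f f) +
        Complex.exp (inner ℂ f f))))) := by
    refine Continuous.tendsto (f := fun g : ℓ² => Real.sqrt (Complex.re
      (Complex.exp (inner ℂ g g) - Complex.exp (inner ℂ g f) - Complex.exp (inner ℂ f g) +
        Complex.exp (inner ℂ f f)))) ?_ f
    refine Real.continuous_sqrt.comp (Complex.continuous_re.comp ?_)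
    fun_prop
  simpa using h2

theorem dense_induction_coherent {p : Fock ι → Prop} (hc : IsClosed {ψ | p ψ})
    (h : ∀ a, p (cohComb ι a)) (ψ : Fock ι) : p ψ :=
  denseRange_cohComb.induction_on ψ hc h

/-- Strong continuity of a family of uniformly bounded operators can be tested on the exponential
vectors. -/
theorem tendsto_apply_of_coherent {α : Type*} {l : Filter α} {T : α → Fock ι →L[ℂ] Fock ι}
    {T₀ : Fock ι →L[ℂ] Fock ι} (D : Set ℓ²) (hD : Dense D)
    (hT : ∀ᶠ a in l, ∀ x, ‖T a x‖ ≤ ‖x‖) (hT₀ : ∀ x, ‖T₀ x‖ ≤ ‖x‖)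
    (h : ∀ g ∈ D, Filter.Tendsto (fun a => T a (coherent g)) l (nhds (T₀ (coherent g))))
    (ξ : Fock ι) : Filter.Tendsto (fun a => T a ξ) l (nhds (T₀ ξ)) := by
  -- An `ε/3` argument: since all operators are contractions, the vectors on which convergence holds
  -- form a closed set. It is used twice, to pass from `g ∈ D` to all exponential vectors and from
  -- their linear combinations to the whole space.
  have step : ∀ x : Fock ι, (∀ ε > 0, ∃ y : Fock ι, ‖x - y‖ < ε ∧
      Filter.Tendsto (fun a => T a y) l (nhds (T₀ y))) →
      Filter.Tendsto (fun a => T a x) l (nhds (T₀ x)) := by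
    intro x hx
    rw [Metric.tendsto_nhds]
    intro ε hε
    obtain ⟨y, hy, hty⟩ := hx (ε / 3) (by positivity)
    rw [Metric.tendsto_nhds] at hty
    filter_upwards [hty (ε / 3) (by positivity), hT] with a ha hTa
    have e1 : ‖T a x - T a y‖ < ε / 3 := by
      rw [← map_sub]; exact (hTa _).trans_lt hy
    have e2 : ‖T₀ x - T₀ y‖ < ε / 3 := by
      rw [← map_sub]; exact (hT₀ _).trans_lt hy
    rw [← dist_eq_norm] at e1 e2
    rw [dist_comm] at e2
    have := dist_triangle4 (T a x) (T a y) (T₀ y) (T₀ x)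
    linarith
  have hcoh : ∀ g : ℓ², Filter.Tendsto (fun a => T a (coherent g)) l (nhds (T₀ (coherent g))) := by
    intro g
    refine step _ fun ε hε => ?_
    have h1 : {k : ℓ² | ‖coherent g - coherent k‖ < ε} ∈ nhds g := by
      have hc : Continuous fun k : ℓ² => ‖coherent g - coherent k‖ :=
        (continuous_const.sub continuous_coherent).norm
      exact (isOpen_lt hc continuous_const).mem_nhds (by simpa using hε)
    obtain ⟨k, hkD, hk⟩ := hD.inter_nhds_nonempty h1
    exact ⟨coherent k, hk, h k hkD⟩
  refine step ξ fun ε hε => ?_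
  obtain ⟨a, ha⟩ := denseRange_cohComb.exists_dist_lt ξ hε
  refine ⟨cohComb ι a, by rwa [← dist_eq_norm], ?_⟩
  simp only [cohComb, Finsupp.linearCombination_apply, Finsupp.sum, map_sum, map_smul]
  exact tendsto_finsetSum _ fun i _ => (hcoh i).const_smul _

theorem continuous_weyl_apply (ξ : Fock ι) : Continuous fun h : ℓ² => weyl h ξ := by
  rw [continuous_iff_continuousAt]
  intro h
  refine tendsto_apply_of_coherent (T := fun k => weyl k) Set.univ dense_univ
    (Filter.Eventually.of_forall fun k x => (norm_weyl k x).le) (fun x => (norm_weyl h x).le) ?_ ξ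
  intro g _
  simp only [weyl_coherent, weylFactor]
  refine Continuous.tendsto (f := fun k : ℓ² => Complex.exp (-((‖k‖ ^ 2 / 4 : ℝ) : ℂ) -
    (((Real.sqrt 2)⁻¹ : ℝ) : ℂ) * inner ℂ k g) • coherent (g + (((Real.sqrt 2)⁻¹ : ℝ) : ℂ) • k)) ?_ h
  have hc : Continuous fun k : ℓ² => g + (((Real.sqrt 2)⁻¹ : ℝ) : ℂ) • k := by fun_prop
  have hc' : Continuous fun k : ℓ² => coherent (g + (((Real.sqrt 2)⁻¹ : ℝ) : ℂ) • k) :=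
    continuous_coherent.comp hc
  have he : Continuous fun k : ℓ² => Complex.exp (-((‖k‖ ^ 2 / 4 : ℝ) : ℂ) -
      (((Real.sqrt 2)⁻¹ : ℝ) : ℂ) * inner ℂ k g) := by fun_prop
  exact he.smul hc'

/-- A continuous family of vectors is weakly holomorphic if its scalar products with the exponential
vectors are holomorphic. -/
theorem differentiable_inner_of_coherent {v : ℂ → Fock ι} (hv : Continuous v)
    (h : ∀ f : ℓ², Differentiable ℂ fun z : ℂ => (inner ℂ (coherent f) (v z) : ℂ)) (ξ : Fock ι) :
    Differentiable ℂ fun z : ℂ => (inner ℂ ξ (v z) : ℂ) := by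
  rw [← differentiableOn_univ]
  -- Approximate `ξ` by combinations of exponential vectors; as `v` is bounded on compact sets, the
  -- scalar products converge locally uniformly, and such limits of holomorphic functions are
  -- holomorphic.
  have hex : ∀ n : ℕ, ∃ a, dist ξ (cohComb ι a) < 1 / (n + 1) := fun n =>
    denseRange_cohComb.exists_dist_lt ξ (by positivity)
  choose a ha using hex
  have hF : TendstoLocallyUniformlyOn
      (fun (n : ℕ) (z : ℂ) => (inner ℂ (cohComb ι (a n)) (v z) : ℂ))
      (fun z : ℂ => (inner ℂ ξ (v z) : ℂ)) Filter.atTop Set.univ := by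
    rw [tendstoLocallyUniformlyOn_iff_forall_isCompact isOpen_univ]
    intro K _ hK
    obtain ⟨C, hC⟩ := (hK.image hv.norm).bddAbove
    rw [Metric.tendstoUniformlyOn_iff]
    intro ε hε
    have hlim : Filter.Tendsto (fun n : ℕ => 1 / ((n : ℝ) + 1) * max C 0) Filter.atTop (nhds 0) := by
      simpa using tendsto_one_div_add_atTop_nhds_zero_nat.mul_const (max C 0)
    filter_upwards [hlim.eventually_lt_const hε] with n hn z hz
    rw [dist_eq_norm, ← inner_sub_left]
    refine (norm_inner_le_norm _ _).trans_lt (lt_of_le_of_lt ?_ hn)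
    have h1 : ‖ξ - cohComb ι (a n)‖ ≤ 1 / ((n : ℝ) + 1) := by
      rw [← dist_eq_norm]; exact (ha n).le
    have h2 : ‖v z‖ ≤ max C 0 :=
      (hC (Set.mem_image_of_mem _ hz)).trans (le_max_left _ _)
    exact mul_le_mul h1 h2 (norm_nonneg _) (by positivity)
  refine hF.differentiableOn (Filter.Eventually.of_forall fun n => ?_) isOpen_univ
  simp only [cohComb, Finsupp.linearCombination_apply, Finsupp.sum, sum_inner, inner_smul_left]
  rw [differentiableOn_univ]
  exact Differentiable.fun_sum fun f _ => (h f).const_mul _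

/-- `z ↦ ⟨ξ, e(z h)⟩` is an entire function. -/
theorem differentiable_inner_coherent (ξ : Fock ι) (h : ℓ²) :
    Differentiable ℂ fun z : ℂ => (inner ℂ ξ (coherent (z • h)) : ℂ) := by
  have hc : Continuous fun z : ℂ => z • h := by fun_prop
  refine differentiable_inner_of_coherent (continuous_coherent.comp hc) (fun f => ?_) ξ
  simp only [Function.comp_apply, inner_coherent, inner_smul_right]
  fun_prop

/-- Irreducibility of the Weyl operators. -/
theorem eq_smul_one_of_commute_displ (T : Fock ι →L[ℂ] Fock ι)
    (hT : ∀ k : ℓ², T * displ k = displ k * T) : ∃ c : ℂ, T = c • 1 := by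
  -- The kernel `F f g` determines `T`. Commutation with `D(k)` makes it covariant under the
  -- simultaneous translation of `f` and `g` by `k`, so it reduces to a function of `g - f`.
  set F : ℓ² → ℓ² → ℂ := fun f g => inner ℂ (coherent f) (T (coherent g)) with hF
  have key : ∀ f g k : ℓ², F f g = Complex.exp (-((‖k‖ ^ 2 : ℝ) : ℂ) - inner ℂ f k - inner ℂ k g) *
      F (f + k) (g + k) := by
    intro f g k
    have h1 : F f g = inner ℂ (displ k (coherent f)) (T (displ k (coherent g))) := by
      have : T (displ k (coherent g)) = displ k (T (coherent g)) :=
        DFunLike.congr_fun (hT k) (coherent g)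
      rw [this, inner_displ_displ]
    rw [h1, displ_coherent, displ_coherent, map_smul, inner_smul_left, inner_smul_right, ← mul_assoc,
      ← Complex.exp_conj, ← Complex.exp_add]
    congr 2
    simp only [map_sub, map_neg, Complex.conj_ofReal, inner_conj_symm]
    push_cast
    ring
  have hn : ∀ x : ℓ², ((‖x‖ ^ 2 : ℝ) : ℂ) = inner ℂ x x := by
    intro x
    rw [inner_self_eq_norm_sq_to_K]; push_cast; rfl
  have k0 : ∀ f g : ℓ², F f g = Complex.exp (inner ℂ f g) * F 0 (g - f) * Complex.exp 0 := by
    intro f g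
    have := key f g (-f)
    rw [add_neg_cancel, ← sub_eq_add_neg, norm_neg, hn] at this
    rw [this, Complex.exp_zero, mul_one, inner_neg_left, inner_neg_right]
    rw [show -inner ℂ f f - -inner ℂ f f - -inner ℂ f g = (inner ℂ f g : ℂ) by ring]
  -- Translating by `-h` moves the variable to the other slot. On each complex line `F 0 h` is thus
  -- both holomorphic and antiholomorphic, hence constant, and `F f g = F 0 0 · exp ⟨f, g⟩`.
  have k1 : ∀ h : ℓ², F 0 h = F (-h) 0 := by
    intro h
    have := key 0 h (-h)
    rw [zero_add, add_neg_cancel, norm_neg, hn] at this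
    rw [this, inner_neg_left]
    simp
  have hconst : ∀ h : ℓ², F 0 h = F 0 0 := by
    intro h
    have hz := const_of_holomorphic_of_antiholomorphic
      (k₁ := fun z : ℂ => F 0 (z • h)) (k₂ := fun z : ℂ => inner ℂ (T (coherent 0)) (coherent (z • -h)))
      (by
        have := differentiable_inner_coherent (star T (coherent 0)) h
        simpa only [ContinuousLinearMap.star_eq_adjoint,
          ContinuousLinearMap.adjoint_inner_left] using this)
      (differentiable_inner_coherent _ _)
      (by
        intro z
        rw [k1, inner_conj_symm, smul_neg]) 1 0
    simpa using hz
  refine ⟨F 0 0, ext_coherent fun g => ?_⟩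
  rw [← sub_eq_zero]
  refine fock_eq_zero _ fun f => ?_
  rw [inner_sub_right]
  change F f g - inner ℂ (coherent f) (F 0 0 • coherent g) = 0
  rw [k0, hconst, inner_smul_right, inner_coherent]
  simp [mul_comm]

theorem eq_smul_one_of_commute_weyl (D : Set ℓ²) (hD : Dense D) (T : Fock ι →L[ℂ] Fock ι)
    (hT : ∀ k ∈ D, T * weyl k = weyl k * T) : ∃ c : ℂ, T = c • 1 := by
  refine eq_smul_one_of_commute_displ T fun k => ?_
  have h1 : ∀ k : ℓ², T * weyl k = weyl k * T := by
    intro k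
    refine ContinuousLinearMap.ext fun x => ?_
    refine hD.induction (P := fun k => T (weyl k x) = weyl k (T x))
      (fun k hk => DFunLike.congr_fun (hT k hk) x) ?_ k
    exact isClosed_eq (T.continuous.comp (continuous_weyl_apply x)) (continuous_weyl_apply (T x))
  exact h1 _

end Weyl

/-! ### Gaussian vectors with a small Hilbert-Schmidt kernel -/

section Gaussian
variable {ι : Type}

local notation "ℓ²" => lp (fun _ : ι => ℂ) 2

/-- Grouping the indices of an even tensor power into pairs. -/
def pairEquiv (ι : Type) (n : ℕ) : (Fin (n * 2) → ι) ≃ (Fin n → ι × ι) :=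
  ((Equiv.arrowCongr finProdFinEquiv.symm (Equiv.refl ι)).trans (Equiv.curry _ _ _)).trans
    (Equiv.piCongrRight fun _ => finTwoArrowEquiv ι)

theorem pairEquiv_apply (n : ℕ) (x : Fin (n * 2) → ι) (i : Fin n) :
    pairEquiv ι n x i = (x (finProdFinEquiv (i, 0)), x (finProdFinEquiv (i, 1))) := rfl

theorem prod_pairs (n : ℕ) (g : ι → ℂ) (x : Fin (n * 2) → ι) :
    ∏ l, g (x l) = ∏ i, g (pairEquiv ι n x i).1 * g (pairEquiv ι n x i).2 := by
  rw [← Equiv.prod_comp finProdFinEquiv, Fintype.prod_prod_type]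
  simp [pairEquiv_apply, Fin.prod_univ_two]

variable (z : ι × ι → ℂ) (hz : Summable fun p => ‖z p‖ ^ 2)

include hz in
theorem memlp_gaussTensor (n : ℕ) :
    Memℓp (fun x : Fin (n * 2) → ι => ∏ i, z (pairEquiv ι n x i)) 2 := by
  rw [memlp_two_iff]
  have h := (summable_prod_pi (fun p => ((‖z p‖ ^ 2 : ℝ) : ℂ)) (by simpa using hz) n).1
  rw [← (pairEquiv ι n).summable_iff] at h
  refine h.congr fun x => ?_
  simp [Finset.prod_pow]

/-- The tensor power of a Hilbert-Schmidt kernel. -/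
def gaussTensor (n : ℕ) : TensorPow ι (n * 2) :=
  ⟨fun x => ∏ i, z (pairEquiv ι n x i), memlp_gaussTensor z hz n⟩

theorem norm_gaussTensor_sq (n : ℕ) :
    ‖gaussTensor z hz n‖ ^ 2 = (∑' p, ‖z p‖ ^ 2) ^ n := by
  have h1 := lp.norm_rpow_eq_tsum (p := 2) (by norm_num) (gaussTensor z hz n)
  have h2 : ‖gaussTensor z hz n‖ ^ 2 = ∑' x, ‖gaussTensor z hz n x‖ ^ 2 := by
    simpa using h1
  have h3 := (summable_prod_pi (fun p => ((‖z p‖ ^ 2 : ℝ) : ℂ)) (by simpa using hz) n).2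
  rw [← (pairEquiv ι n).tsum_eq] at h3
  rw [h2]
  have h4 : ((∑' x, ‖gaussTensor z hz n x‖ ^ 2 : ℝ) : ℂ) =
      (((∑' p, ‖z p‖ ^ 2) ^ n : ℝ) : ℂ) := by
    push_cast
    simp only [Complex.ofReal_pow] at h3
    rw [← h3]
    refine tsum_congr fun x => ?_
    simp [gaussTensor, Finset.prod_pow]
  exact_mod_cast h4

/-- The quadratic form of the kernel `z`, conjugate linear in each variable. -/
def quadForm (f : ℓ²) : ℂ := ∑' p : ι × ι, conj (f p.1) * conj (f p.2) * z p

include hz in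
theorem summable_quadForm (f : ℓ²) :
    Summable fun p : ι × ι => ‖conj (f p.1) * conj (f p.2) * z p‖ := by
  have h : Summable fun i => ‖f i‖ ^ 2 := (memlp_two_iff _).1 (lp.memℓp f)
  have h2 : Summable fun p : ι × ι => ‖f p.1‖ ^ 2 * ‖f p.2‖ ^ 2 :=
    Summable.mul_of_nonneg h h (fun i => sq_nonneg ‖f i‖) (fun i => sq_nonneg ‖f i‖)
  have h3 : Summable fun p : ι × ι => ‖f p.1‖ ^ 2 * ‖f p.2‖ ^ 2 + ‖z p‖ ^ 2 := h2.add hz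
  refine Summable.of_nonneg_of_le (fun _ => norm_nonneg _) (fun p => ?_) h3
  rw [norm_mul, norm_mul, RCLike.norm_conj, RCLike.norm_conj, ← mul_pow]
  generalize ‖f p.1‖ * ‖f p.2‖ = a
  generalize ‖z p‖ = b
  nlinarith [sq_nonneg (a - b), sq_nonneg (a + b)]

theorem inner_tensorPow_gaussTensor (f : ℓ²) (n : ℕ) :
    (inner ℂ (tensorPow f (n * 2)).1 (gaussTensor z hz n) : ℂ) = quadForm z f ^ n := by
  have h0 : (inner ℂ (tensorPow f (n * 2)).1 (gaussTensor z hz n) : ℂ) =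
      ∑' x : Fin (n * 2) → ι, (inner ℂ ((tensorPow f (n * 2)).1 x) (gaussTensor z hz n x) : ℂ) :=
    lp.inner_eq_tsum (𝕜 := ℂ) _ _
  have h2 := (summable_prod_pi _ (summable_quadForm z hz f) n).2
  rw [← (pairEquiv ι n).tsum_eq] at h2
  rw [h0, quadForm, ← h2]
  refine tsum_congr fun x => ?_
  have h3 : (tensorPow f (n * 2)).1 x = ∏ l, f (x l) := rfl
  have h4 : gaussTensor z hz n x = ∏ i, z (pairEquiv ι n x i) := rfl
  rw [RCLike.inner_apply, h3, h4, map_prod, prod_pairs n (fun a => conj (f a)), mul_comm,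
    ← Finset.prod_mul_distrib]

/-- The symmetrised tensor power of a Hilbert-Schmidt kernel. -/
def gaussSym (n : ℕ) : SymPow ι (n * 2) :=
  haveI : CompleteSpace (symSubmodule ι (n * 2)) := (isClosed_symSubmodule _).completeSpace_coe
  (symSubmodule ι (n * 2)).orthogonalProjectionOnto (gaussTensor z hz n)

theorem inner_tensorPow_gaussSym (f : ℓ²) (n : ℕ) :
    (inner ℂ (tensorPow f (n * 2)) (gaussSym z hz n) : ℂ) = quadForm z f ^ n := by
  have : CompleteSpace (symSubmodule ι (n * 2)) := (isClosed_symSubmodule _).completeSpace_coe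
  rw [← inner_tensorPow_gaussTensor z hz]
  exact (symSubmodule ι (n * 2)).inner_orthogonalProjectionOnto_eq_of_mem_left
    (tensorPow f (n * 2)) (gaussTensor z hz n)

theorem norm_gaussSym_le (n : ℕ) : ‖gaussSym z hz n‖ ≤ Real.sqrt (∑' p, ‖z p‖ ^ 2) ^ n := by
  have : CompleteSpace (symSubmodule ι (n * 2)) := (isClosed_symSubmodule _).completeSpace_coe
  have h1 : ‖gaussSym z hz n‖ ≤ ‖gaussTensor z hz n‖ :=
    (symSubmodule ι (n * 2)).norm_orthogonalProjectionOnto_apply_le _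
  refine h1.trans (le_of_eq ?_)
  rw [← sq_eq_sq₀ (norm_nonneg _) (by positivity), norm_gaussTensor_sq, ← pow_mul, mul_comm n 2,
    pow_mul, Real.sq_sqrt (tsum_nonneg fun _ => by positivity)]

/-- The homogeneous components of a Gaussian vector. -/
def gaussTerm (n : ℕ) : Fock ι :=
  (lp.single (E := fun m : ℕ => SymPow ι m) 2 (n * 2)
    (((Real.sqrt (n * 2).factorial / (2 ^ n * n.factorial) : ℝ) : ℂ) • gaussSym z hz n))

/-- From `(2n)! = C(2n, n) (n!)²` and `C(2n, n) ≤ 4ⁿ`. The homogeneous components of a Gaussian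
vector are then dominated by a geometric series in the Hilbert-Schmidt norm of the kernel. -/
theorem sqrt_factorial_le (n : ℕ) :
    Real.sqrt (n * 2).factorial / (2 ^ n * n.factorial) ≤ 1 := by
  rw [div_le_one (by positivity), Real.sqrt_le_left (by positivity)]
  have h1 := Nat.centralBinom_le_four_pow n
  have h2 : (n * 2).factorial = n.centralBinom * n.factorial * n.factorial := by
    have := Nat.choose_mul_factorial_mul_factorial (n := 2 * n) (k := n) (by omega)
    rw [mul_comm n 2, ← this, Nat.centralBinom]
    congr 2
    omega
  rw [h2]
  have h3 : ((n.centralBinom : ℕ) : ℝ) ≤ 4 ^ n := by exact_mod_cast h1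
  push_cast
  have h4 : ((2 : ℝ) ^ n * n.factorial) ^ 2 = 4 ^ n * n.factorial * n.factorial := by
    rw [mul_pow, ← pow_mul, mul_comm n 2, pow_mul]
    norm_num
    ring
  rw [h4]
  gcongr

theorem norm_gaussTerm_le (n : ℕ) : ‖gaussTerm z hz n‖ ≤ Real.sqrt (∑' p, ‖z p‖ ^ 2) ^ n := by
  have h0 : ‖gaussTerm z hz n‖ =
      ‖((Real.sqrt (n * 2).factorial / (2 ^ n * n.factorial) : ℝ) : ℂ) • gaussSym z hz n‖ :=
    lp.norm_single (E := fun m : ℕ => SymPow ι m) (by norm_num) _ _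
  rw [h0, norm_smul, Complex.norm_real, Real.norm_of_nonneg (by positivity)]
  calc _ ≤ 1 * Real.sqrt (∑' p, ‖z p‖ ^ 2) ^ n :=
        mul_le_mul (sqrt_factorial_le n) (norm_gaussSym_le z hz n) (norm_nonneg _) zero_le_one
    _ = _ := one_mul _

/-- The component of `e(f)` of degree `2n` carries the factor `1/√(2n)!`; the factor `√(2n)!/(2ⁿ
n!)` in `gaussTerm` is chosen so that the `n`-th term of the exponential series of `q(f)/2` appears,
with `q` the quadratic form. -/
theorem inner_coherent_gaussTerm (f : ℓ²) (n : ℕ) :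
    (inner ℂ (coherent f) (gaussTerm z hz n) : ℂ) = (quadForm z f / 2) ^ n / n.factorial := by
  have h0 : (inner ℂ (coherent f) (gaussTerm z hz n) : ℂ) =
      inner ℂ ((((Real.sqrt (n * 2).factorial)⁻¹ : ℝ) : ℂ) • tensorPow f (n * 2))
        (((Real.sqrt (n * 2).factorial / (2 ^ n * n.factorial) : ℝ) : ℂ) • gaussSym z hz n) :=
    lp.inner_single_right (𝕜 := ℂ) (G := fun m : ℕ => SymPow ι m) (n * 2) _ (coherent f)
  rw [h0, inner_smul_left, inner_smul_right, inner_tensorPow_gaussSym, Complex.conj_ofReal,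
    ← mul_assoc, ← Complex.ofReal_mul]
  have h1 : (Real.sqrt (n * 2).factorial)⁻¹ * (Real.sqrt (n * 2).factorial / (2 ^ n * n.factorial))
      = (2 ^ n * (n.factorial : ℝ))⁻¹ := by
    have : Real.sqrt (n * 2).factorial ≠ 0 := by positivity
    field_simp
  rw [h1, div_pow]
  push_cast
  field_simp

theorem norm_coherent_zero : ‖coherent (0 : ℓ²)‖ = 1 := by
  rw [norm_eq_sqrt_re_inner (𝕜 := ℂ), inner_coherent]
  simp

/-- The Gaussian vector with kernel `z`. -/
def gauss : Fock ι := ∑' n, gaussTerm z hz n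

variable (hz1 : Real.sqrt (∑' p, ‖z p‖ ^ 2) < 1)

include hz1 in
theorem summable_norm_gaussTerm : Summable fun n => ‖gaussTerm z hz n‖ :=
  Summable.of_nonneg_of_le (fun _ => norm_nonneg _) (norm_gaussTerm_le z hz)
    (summable_geometric_of_lt_one (Real.sqrt_nonneg _) hz1)

include hz1 in
theorem inner_coherent_gauss (f : ℓ²) :
    (inner ℂ (coherent f) (gauss z hz) : ℂ) = Complex.exp (quadForm z f / 2) := by
  have h1 := ((summable_norm_gaussTerm z hz hz1).of_norm.hasSum.mapL (innerSL ℂ (coherent f)))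
  have h2 : HasSum (fun n => (inner ℂ (coherent f) (gaussTerm z hz n) : ℂ))
      (inner ℂ (coherent f) (gauss z hz)) := h1
  simp only [inner_coherent_gaussTerm] at h2
  rw [Complex.exp_eq_exp_ℂ]
  exact h2.unique (NormedSpace.expSeries_div_hasSum_exp _)

theorem gaussTerm_zero : gaussTerm z hz 0 = coherent 0 := by
  rw [← sub_eq_zero]
  refine fock_eq_zero _ fun f => ?_
  rw [inner_sub_right, inner_coherent_gaussTerm, inner_coherent]
  simp

-- The term of degree zero is the vacuum, and the remaining terms form the tail of a geometric
-- series. This controls how far an implementer moves the vacuum.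
include hz1 in
theorem norm_gauss_sub_le : ‖gauss z hz - coherent 0‖ ≤
    Real.sqrt (∑' p, ‖z p‖ ^ 2) / (1 - Real.sqrt (∑' p, ‖z p‖ ^ 2)) := by
  set β := Real.sqrt (∑' p, ‖z p‖ ^ 2)
  have hs := summable_norm_gaussTerm z hz hz1
  have h1 : gauss z hz - coherent 0 = ∑' n, gaussTerm z hz (n + 1) := by
    rw [gauss, hs.of_norm.tsum_eq_zero_add, gaussTerm_zero, add_sub_cancel_left]
  rw [h1]
  have hb : ∀ n, ‖gaussTerm z hz (n + 1)‖ ≤ β * β ^ n := by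
    intro n
    rw [← pow_succ']
    exact norm_gaussTerm_le z hz (n + 1)
  have hg : HasSum (fun n => β * β ^ n) (β * (1 - β)⁻¹) :=
    (hasSum_geometric_of_lt_one (Real.sqrt_nonneg _) hz1).mul_left β
  rw [div_eq_mul_inv]
  exact tsum_of_norm_bounded hg hb

-- The scalar product with the unit vector `e(0)` equals `1`; apply Cauchy-Schwarz.
include hz1 in
theorem one_le_norm_gauss : 1 ≤ ‖gauss z hz‖ := by
  have h1 := inner_coherent_gauss z hz hz1 0
  have h2 : quadForm z (0 : ℓ²) = 0 := by simp [quadForm]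
  rw [h2, zero_div, Complex.exp_zero] at h1
  have h3 := norm_inner_le_norm (𝕜 := ℂ) (coherent (0 : ℓ²)) (gauss z hz)
  rw [h1, norm_one] at h3
  have h4 := norm_coherent_zero (ι := ι)
  rwa [h4, one_mul] at h3

end Gaussian

/-! ### Symplectic maps: linear part, antilinear part and their ratio -/

section Symplectic
variable {H : Type} [NormedAddCommGroup H] [InnerProductSpace ℂ H]

/-- The complex linear part of a real linear map. -/
def linPart (S : H →L[ℝ] H) : H →L[ℂ] H where
  toFun x := (1 / 2 : ℂ) • (S x - Complex.I • S (Complex.I • x))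
  map_add' x y := by
    simp only [smul_add, map_add]
    module
  map_smul' c x := by
    have e1 : ∀ y : H, S (c • y) = c.re • S y + c.im • S (Complex.I • y) := by
      intro y
      conv_lhs => rw [← Complex.re_add_im c, add_smul, mul_smul, Complex.coe_smul, Complex.coe_smul,
        map_add, map_smul, map_smul]
    rw [smul_comm Complex.I c x, e1, e1, smul_smul Complex.I Complex.I x, Complex.I_mul_I, neg_one_smul,
      map_neg]
    simp only [← Complex.coe_smul, RingHom.id_apply]
    have hI := Complex.I_mul_I
    conv_rhs => rw [← Complex.re_add_im c]
    match_scalars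
    · ring
    · linear_combination ((c.im : ℂ) / 2) * hI
  cont := by fun_prop

/-- The antilinear part of a real linear map. -/
def antiPart (S : H →L[ℝ] H) : H →L⋆[ℂ] H where
  toFun x := (1 / 2 : ℂ) • (S x + Complex.I • S (Complex.I • x))
  map_add' x y := by
    simp only [smul_add, map_add]
    module
  map_smul' c x := by
    have e1 : ∀ y : H, S (c • y) = c.re • S y + c.im • S (Complex.I • y) := by
      intro y
      conv_lhs => rw [← Complex.re_add_im c, add_smul, mul_smul, Complex.coe_smul, Complex.coe_smul,
        map_add, map_smul, map_smul]
    rw [smul_comm Complex.I c x, e1, e1, smul_smul Complex.I Complex.I x, Complex.I_mul_I, neg_one_smul,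
      map_neg]
    simp only [← Complex.coe_smul]
    have hI := Complex.I_mul_I
    have hc : (starRingEnd ℂ) c = c.re - c.im * Complex.I := by
      apply Complex.ext <;> simp
    rw [hc]
    match_scalars
    · ring
    · linear_combination ((c.im : ℂ) / 2) * hI
  cont := by fun_prop

theorem linPart_apply (S : H →L[ℝ] H) (x : H) :
    linPart S x = (1 / 2 : ℂ) • (S x - Complex.I • S (Complex.I • x)) := rfl

theorem antiPart_apply (S : H →L[ℝ] H) (x : H) :
    antiPart S x = (1 / 2 : ℂ) • (S x + Complex.I • S (Complex.I • x)) := rfl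

theorem linPart_add_antiPart (S : H →L[ℝ] H) (x : H) : linPart S x + antiPart S x = S x := by
  rw [linPart_apply, antiPart_apply]
  module

variable (H) in
/-- An invertible bounded real linear map which preserves the symplectic form `Im ⟨·, ·⟩`, together
with its inverse. -/
structure SympEquiv where
  S : H →L[ℝ] H
  S' : H →L[ℝ] H
  right_inv : ∀ x, S (S' x) = x
  left_inv : ∀ x, S' (S x) = x
  symp : ∀ x y, (inner ℂ (S x) (S y) : ℂ).im = (inner ℂ x y : ℂ).im

namespace SympEquiv
variable (σ : SympEquiv H)

/-- The inverse symplectic map. -/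
def symm : SympEquiv H where
  S := σ.S'
  S' := σ.S
  right_inv := σ.left_inv
  left_inv := σ.right_inv
  symp x y := by rw [← σ.symp, σ.right_inv, σ.right_inv]

theorem symp' (x y : H) : (inner ℂ (σ.S x) y : ℂ).im = (inner ℂ x (σ.S' y) : ℂ).im := by
  rw [← σ.symp x, σ.right_inv]

theorem re_eq (x y : H) : (inner ℂ x y : ℂ).re = (inner ℂ x (Complex.I • y) : ℂ).im := by
  rw [inner_smul_right]; simp

theorem symp_re (x y : H) :
    (inner ℂ (σ.S x) y : ℂ).re = (inner ℂ x (σ.S' (Complex.I • y)) : ℂ).im := by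
  rw [re_eq, symp']

theorem inner_I_left_im (x y : H) :
    (inner ℂ (Complex.I • x) y : ℂ).im = -(inner ℂ x y : ℂ).re := by
  rw [inner_smul_left]; simp

/-- `Im ⟨Sf, g⟩ = Im ⟨f, S⁻¹g⟩`, tested on `f`, `if`, `g`, `ig`, recovers the complete complex
scalar products. The adjoint of the linear part of `S` is therefore the linear part of `S⁻¹`,
whereas for the antilinear parts transposition brings a sign (`inner_antiPart`). -/
theorem inner_linPart (f g : H) :
    (inner ℂ (linPart σ.S f) g : ℂ) = inner ℂ f (linPart σ.S' g) := by
  have h1 := σ.symp' f g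
  have h2 := σ.symp_re f g
  have h3 := σ.symp' (Complex.I • f) g
  have h4 := σ.symp_re (Complex.I • f) g
  rw [inner_I_left_im] at h3 h4
  rw [linPart_apply, linPart_apply, inner_smul_left, inner_smul_right, inner_sub_left,
    inner_sub_right, inner_smul_left, inner_smul_right]
  apply Complex.ext <;> simp <;> linarith

theorem inner_antiPart (f g : H) :
    (inner ℂ f (antiPart σ.S' g) : ℂ) = -inner ℂ g (antiPart σ.S f) := by
  have h1 := σ.symp' f g
  have h2 := σ.symp_re f g
  have h3 := σ.symp' (Complex.I • f) g
  have h4 := σ.symp_re (Complex.I • f) g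
  rw [inner_I_left_im] at h3 h4
  rw [← inner_conj_symm g, antiPart_apply, antiPart_apply, inner_smul_left, inner_smul_right, inner_add_left,
    inner_add_right, inner_smul_left, inner_smul_right]
  apply Complex.ext <;> simp only [Complex.mul_re, Complex.mul_im, Complex.add_re, Complex.add_im,
    Complex.neg_re, Complex.neg_im, Complex.conj_re, Complex.conj_im, Complex.I_re, Complex.I_im,
    map_mul, map_add, map_div₀, map_one, map_ofNat, Complex.one_re, Complex.one_im, Complex.div_ofNat_re,
    Complex.div_ofNat_im, h1, h2, h3, h4] <;> ring

theorem comp_aux (f : H) :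
    linPart σ.S' (linPart σ.S f) + antiPart σ.S' (antiPart σ.S f) = f ∧
    linPart σ.S' (antiPart σ.S f) + antiPart σ.S' (linPart σ.S f) = 0 := by
  have h1 : ∀ f, linPart σ.S' (linPart σ.S f) + antiPart σ.S' (antiPart σ.S f) +
      (linPart σ.S' (antiPart σ.S f) + antiPart σ.S' (linPart σ.S f)) = f := by
    intro f
    have := σ.left_inv f
    rw [← linPart_add_antiPart σ.S', ← linPart_add_antiPart σ.S f, map_add, map_add] at this
    rw [← this]
    simp only [map_add]
    conv_rhs => rw [← this]
    simp only [map_add]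
    abel
  -- Replacing `f` by `if` multiplies the complex linear terms of `S⁻¹S = 1` by `i` and the
  -- antilinear ones by `-i`, which separates the identity into its two types.
  have h2 := h1 (Complex.I • f)
  simp only [map_smul, map_smulₛₗ, Complex.conj_I, map_neg] at h2
  have h5 := h1 f
  generalize linPart σ.S' (linPart σ.S f) = p at *
  generalize antiPart σ.S' (antiPart σ.S f) = q at *
  generalize linPart σ.S' (antiPart σ.S f) = r at *
  generalize antiPart σ.S' (linPart σ.S f) = t at *
  have h6 : p + q - (r + t) = f := by
    have h7 := congrArg (fun v => (-Complex.I) • v) h2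
    simp only [smul_add, smul_smul, neg_smul, smul_neg, neg_neg, neg_mul, Complex.I_mul_I,
      one_smul] at h7
    rw [← h7]
    abel
  constructor
  · linear_combination (norm := module) (1 / 2 : ℂ) • h5 + (1 / 2 : ℂ) • h6
  · linear_combination (norm := module) (1 / 2 : ℂ) • h5 - (1 / 2 : ℂ) • h6

theorem inner_linPart_self (f : H) :
    (inner ℂ (linPart σ.S f) (linPart σ.S f) : ℂ) =
      inner ℂ f f + inner ℂ (antiPart σ.S f) (antiPart σ.S f) := by
  rw [inner_linPart, eq_sub_of_add_eq (σ.comp_aux f).1, inner_sub_right, inner_antiPart]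
  ring

theorem norm_le_norm_linPart (f : H) : ‖f‖ ≤ ‖linPart σ.S f‖ := by
  have h := σ.inner_linPart_self f
  simp only [inner_self_eq_norm_sq_to_K] at h
  have h2 : ‖linPart σ.S f‖ ^ 2 = ‖f‖ ^ 2 + ‖antiPart σ.S f‖ ^ 2 := by exact_mod_cast h
  rw [← sq_le_sq₀ (norm_nonneg _) (norm_nonneg _), h2]
  nlinarith [sq_nonneg ‖antiPart σ.S f‖]

/-- The linear part does not decrease norms, so it is injective with closed range. Its adjoint, the
linear part of the inverse, does not decrease norms either, so the range is dense. -/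
theorem exists_inverse_linPart [CompleteSpace H] : ∃ R : H →L[ℂ] H,
    (∀ x, linPart σ.S (R x) = x) ∧ (∀ x, R (linPart σ.S x) = x) ∧ ∀ x, ‖R x‖ ≤ ‖x‖ := by
  have hanti : AntilipschitzWith 1 (linPart σ.S) :=
    (linPart σ.S).antilipschitz_of_bound fun x => by simpa using σ.norm_le_norm_linPart x
  have hinj := hanti.injective
  have hsurj : Function.Surjective (linPart σ.S) := by
    have hcl : IsClosed (Set.range (linPart σ.S)) :=
      hanti.isClosed_range (linPart σ.S).uniformContinuous
    have hd : (LinearMap.range (linPart σ.S).toLinearMap).topologicalClosure = ⊤ := by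
      rw [Submodule.topologicalClosure_eq_top_iff, Submodule.eq_bot_iff]
      intro y hy
      have h0 : ∀ x, (inner ℂ x (linPart σ.S' y) : ℂ) = 0 := by
        intro x
        rw [← inner_linPart]
        exact (Submodule.mem_orthogonal _ _).1 hy _ ⟨x, rfl⟩
      have h1 : linPart σ.S' y = 0 := inner_self_eq_zero.1 (h0 _)
      have h2 := σ.symm.norm_le_norm_linPart y
      change ‖y‖ ≤ ‖linPart σ.S' y‖ at h2
      rw [h1, norm_zero] at h2
      exact norm_le_zero_iff.1 h2
    have hd' : Dense (Set.range (linPart σ.S)) := Submodule.dense_iff_topologicalClosure_eq_top.2 hd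
    rw [← Set.range_eq_univ, ← hcl.closure_eq, hd'.closure_eq]
  let e := ContinuousLinearEquiv.ofBijective (linPart σ.S)
    (LinearMap.ker_eq_bot.2 hinj) (LinearMap.range_eq_top.2 hsurj)
  have he : ∀ x, linPart σ.S (e.symm x) = x := fun x => e.apply_symm_apply x
  refine ⟨e.symm, he, fun x => e.symm_apply_apply x, fun x => ?_⟩
  have := σ.norm_le_norm_linPart (e.symm x)
  rwa [he] at this

/-- The antilinear operator `Z = B A⁻¹` formed with the linear and antilinear parts of a symplectic
map. -/
theorem exists_ratio [CompleteSpace H] : ∃ Z : H →L⋆[ℂ] H,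
    (∀ x, Z (linPart σ.S x) = antiPart σ.S x) ∧ (∀ x y, (inner ℂ x (Z y) : ℂ) = inner ℂ y (Z x)) ∧
      ∀ x, ‖Z x‖ ≤ ‖antiPart σ.S' x‖ := by
  obtain ⟨R, hR1, hR2, hR3⟩ := σ.symm.exists_inverse_linPart
  obtain ⟨Q, hQ1, hQ2, hQ3⟩ := σ.exists_inverse_linPart
  change ∀ x, linPart σ.S' (R x) = x at hR1
  change ∀ x, R (linPart σ.S' x) = x at hR2
  -- With `A'`, `B'` the parts of the inverse, `A'B + B'A = 0` gives `BA⁻¹ = -A'⁻¹B'`. The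
  -- right-hand side is taken as the definition because `A'⁻¹` is a contraction, whence `‖Zx‖ ≤
  -- ‖B'x‖`.
  let Z : H →L⋆[ℂ] H := (-R).comp (antiPart σ.S')
  have hZ : ∀ x, Z x = -R (antiPart σ.S' x) := fun x => rfl
  have hZA : ∀ x, Z (linPart σ.S x) = antiPart σ.S x := by
    intro x
    rw [hZ, ← map_neg, ← eq_neg_of_add_eq_zero_left (σ.comp_aux x).2, hR2]
  refine ⟨Z, hZA, fun x y => ?_, fun x => ?_⟩
  · rw [← hQ1 x, ← hQ1 y, hZA, hZA, inner_linPart, inner_linPart,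
      eq_neg_of_add_eq_zero_left (σ.comp_aux (Q y)).2, inner_neg_right, inner_antiPart, neg_neg,
      ← inner_linPart]
  · rw [hZ, norm_neg]
    exact hR3 _

end SympEquiv

end Symplectic

/-! ### Implementation of symplectic maps on Fock space -/

section Implementer
variable {ι : Type}

/-- The Hilbert space `ℓ²(ι)`. -/
abbrev Ell (ι : Type) : Type := lp (fun _ : ι => ℂ) 2

/-- The unit vectors of `ℓ²(ι)`. -/
def unitVec (i : ι) : Ell ι := by
  classical exact lp.single (E := fun _ : ι => ℂ) 2 i 1

theorem hasSum_unitVec (f : Ell ι) : HasSum (fun i => f i • unitVec i) f := by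
  classical
  have h := lp.hasSum_single (E := fun _ : ι => ℂ) (p := 2) (by norm_num) f
  refine h.congr_fun fun i => ?_
  rw [unitVec, ← lp.single_smul, smul_eq_mul, mul_one]

theorem hasSum_norm_sq (f : Ell ι) : HasSum (fun i => ‖f i‖ ^ 2) (‖f‖ ^ 2) := by
  have h := lp.hasSum_norm (E := fun _ : ι => ℂ) (p := 2) (by norm_num) f
  simpa using h

theorem summable_norm_sq_of_columns (k : ι × ι → ℂ) (T : ι → ℝ)
    (h1 : ∀ b, HasSum (fun a => ‖k (a, b)‖ ^ 2) (T b)) (hs : Summable T) :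
    Summable (fun p => ‖k p‖ ^ 2) ∧ ∑' p, ‖k p‖ ^ 2 = ∑' b, T b := by
  have h2 : Summable fun q : ι × ι => ‖k (q.2, q.1)‖ ^ 2 := by
    rw [summable_prod_of_nonneg fun q => sq_nonneg ‖k (q.2, q.1)‖]
    refine ⟨fun b => (h1 b).summable, ?_⟩
    simpa only [(h1 _).tsum_eq] using hs
  refine ⟨(Equiv.prodComm ι ι).summable_iff.1 h2, ?_⟩
  rw [← (Equiv.prodComm ι ι).tsum_eq]
  have h3 := h2.tsum_prod' fun b => (h1 b).summable
  simp only [(h1 _).tsum_eq] at h3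
  exact h3

section Kernel
variable (Z : Ell ι →L⋆[ℂ] Ell ι)

/-- The matrix of an antilinear operator. -/
def kernelOf (p : ι × ι) : ℂ := Z (unitVec p.2) p.1

theorem summable_kernelOf (hs : Summable fun b => ‖Z (unitVec b)‖ ^ 2) :
    Summable (fun p => ‖kernelOf Z p‖ ^ 2) ∧
      ∑' p, ‖kernelOf Z p‖ ^ 2 = ∑' b, ‖Z (unitVec b)‖ ^ 2 := by
  exact summable_norm_sq_of_columns (kernelOf Z) _ (fun b => hasSum_norm_sq (Z (unitVec b))) hs

theorem quadForm_kernelOf (hs : Summable fun b => ‖Z (unitVec b)‖ ^ 2) (f : Ell ι) :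
    quadForm (kernelOf Z) f = inner ℂ f (Z f) := by
  have h0 := (summable_quadForm (kernelOf Z) (summable_kernelOf Z hs).1 f).of_norm
  have h1 : ∀ b, HasSum (fun a => conj (f a) * conj (f b) * kernelOf Z (a, b))
      (conj (f b) * inner ℂ f (Z (unitVec b))) := by
    intro b
    have h2 : HasSum (fun a => (inner ℂ (f a) (Z (unitVec b) a) : ℂ)) (inner ℂ f (Z (unitVec b))) :=
      lp.hasSum_inner (𝕜 := ℂ) (G := fun _ : ι => ℂ) f (Z (unitVec b))
    refine (h2.mul_left (conj (f b))).congr_fun fun a => ?_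
    rw [RCLike.inner_apply, kernelOf]
    ring
  have h3 : HasSum (fun b => conj (f b) * inner ℂ f (Z (unitVec b))) (inner ℂ f (Z f)) := by
    have h4 := ((hasSum_unitVec f).mapL Z).mapL (innerSL ℂ f)
    refine h4.congr_fun fun b => ?_
    simp
  rw [quadForm, ← (Equiv.prodComm ι ι).tsum_eq]
  have h5 := (Equiv.prodComm ι ι).summable_iff.2 h0
  have h6 := h5.tsum_prod' fun b => (h1 b).summable
  refine h6.trans ?_
  rw [← h3.tsum_eq]
  exact tsum_congr fun b => (h1 b).tsum_eq

end Kernel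

/-- Equality of Gram matrices makes `e(g) ↦ v g` isometric on finite linear combinations, which are
dense. -/
theorem exists_isometry_of_inner (v : Ell ι → Fock ι)
    (h : ∀ f g, (inner ℂ (v f) (v g) : ℂ) = Complex.exp (inner ℂ f g)) :
    ∃ u : Fock ι →L[ℂ] Fock ι, (∀ g, u (coherent g) = v g) ∧ ∀ x, ‖u x‖ = ‖x‖ := by
  set L : (Ell ι →₀ ℂ) →ₗ[ℂ] Fock ι := Finsupp.linearCombination ℂ v with hL
  have hn : ∀ a, ‖L a‖ = ‖cohComb ι a‖ := by
    intro a
    have h1 := inner_linearCombination v coherent (fun x y => by rw [h, inner_coherent]) a a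
    rw [norm_eq_sqrt_re_inner (𝕜 := ℂ), norm_eq_sqrt_re_inner (𝕜 := ℂ)]
    exact congrArg (fun w => Real.sqrt (RCLike.re w)) h1
  have he := LinearMap.extendOfNorm_eq (f := L) (e := cohComb ι) denseRange_cohComb
    ⟨1, fun a => by rw [hn, one_mul]⟩
  refine ⟨L.extendOfNorm (cohComb ι), fun g => ?_, fun x => ?_⟩
  · have := he (Finsupp.single g 1)
    have h2 : cohComb ι (Finsupp.single g 1) = coherent g := by simp [cohComb]
    rw [h2] at this
    rw [this]
    simp [hL]
  · refine dense_induction_coherent (p := fun ψ => ‖L.extendOfNorm (cohComb ι) ψ‖ = ‖ψ‖)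
      (isClosed_eq (by fun_prop) (by fun_prop)) (fun a => ?_) x
    rw [he, hn]

/-- `u u*` commutes with every `D(S k)`, that is, with all displacement operators as `S` is onto, so
it is a scalar by irreducibility. Since `u* u = 1`, this scalar fixes the nonzero vector `u e(0)`
and equals `1`. -/
theorem mem_unitary_of_isometry (u : Fock ι →L[ℂ] Fock ι) (hu : ∀ x, ‖u x‖ = ‖x‖)
    (S S' : Ell ι → Ell ι) (hS : ∀ k, S (S' k) = k) (hneg : ∀ k, S (-k) = -S k)
    (h : ∀ k, u * displ k = displ (S k) * u) : u ∈ unitary (Fock ι →L[ℂ] Fock ι) := by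
  have h1 : star u * u = 1 := by
    refine ContinuousLinearMap.ext fun x => ext_inner_right ℂ fun y => ?_
    have h2 := (LinearMap.norm_map_iff_inner_map_map u).1 hu x y
    rw [ContinuousLinearMap.star_eq_adjoint]
    change inner ℂ (ContinuousLinearMap.adjoint u (u x)) y = inner ℂ x y
    rw [ContinuousLinearMap.adjoint_inner_left]
    exact h2
  have h3 : ∀ k, displ k * star u = star u * displ (S k) := by
    intro k
    have h4 := congrArg star (h (-k))
    simpa only [star_mul, star_displ, neg_neg, hneg] using h4
  obtain ⟨c, hc⟩ := eq_smul_one_of_commute_displ (u * star u) (fun k => by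
    rw [← hS k]
    rw [mul_assoc, ← h3, ← mul_assoc, h, mul_assoc])
  have h5 : c • u = u := by
    calc c • u = (u * star u) * u := by rw [hc, smul_mul_assoc, one_mul]
      _ = u := by rw [mul_assoc, h1, mul_one]
  have h6 : c = 1 := by
    have h7 : (c - 1) • u (coherent 0) = 0 := by
      rw [sub_smul, one_smul, ← smul_apply, h5, sub_self]
    rcases smul_eq_zero.1 h7 with h8 | h8
    · exact sub_eq_zero.1 h8
    · have h9 := hu (coherent 0)
      rw [h8, norm_zero, norm_coherent_zero] at h9
      exact absurd h9 zero_ne_one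
  rw [Unitary.mem_iff]
  refine ⟨h1, ?_⟩
  rw [hc, h6, one_smul]

variable (σ : SympEquiv (Ell ι))

/-- The images of the exponential vectors under the implementer of a symplectic map, up to a
scalar. -/
def transVec (Ψ : Fock ι) (g : Ell ι) : Fock ι :=
  Complex.exp ((‖g‖ ^ 2 / 2 : ℝ) : ℂ) • displ (σ.S g) Ψ

theorem ofReal_norm_sq (x : Ell ι) : ((‖x‖ ^ 2 : ℝ) : ℂ) = inner ℂ x x := by
  rw [inner_self_eq_norm_sq_to_K]; push_cast; rfl

/-- The same transformation law as `displ_coherent`, with `D(S k)` in place of `D(k)`. The phase of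
`D(Sk) D(Sg)` involves only the symplectic form, which `S` preserves; the cross term of `‖g + k‖²`
supplies the real part of `⟨k, g⟩`. -/
theorem displ_transVec (Ψ : Fock ι) (k g : Ell ι) : displ (σ.S k) (transVec σ Ψ g) =
    Complex.exp (-((‖k‖ ^ 2 / 2 : ℝ) : ℂ) - inner ℂ k g) • transVec σ Ψ (g + k) := by
  have h1 : displ (σ.S k) (displ (σ.S g) Ψ) =
      Complex.exp (-Complex.I * (((inner ℂ k g : ℂ).im : ℝ) : ℂ)) • displ (σ.S (g + k)) Ψ := by
    have := DFunLike.congr_fun (displ_mul (σ.S k) (σ.S g)) Ψ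
    rw [σ.symp, ← map_add, add_comm k g] at this
    exact this
  rw [transVec, transVec, map_smul, h1, smul_smul, smul_smul, ← Complex.exp_add, ← Complex.exp_add]
  congr 2
  have h2 := norm_add_sq (𝕜 := ℂ) g k
  rw [h2]
  have h3 : (inner ℂ k g : ℂ) = ((inner ℂ g k : ℂ).re : ℂ) - ((inner ℂ g k : ℂ).im : ℂ) * Complex.I := by
    rw [← inner_conj_symm k g]
    apply Complex.ext <;> simp [-inner_conj_symm]
  have h4 : ((inner ℂ k g : ℂ).im : ℂ) = -((inner ℂ g k : ℂ).im : ℂ) := by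
    rw [← inner_conj_symm k g, Complex.conj_im, Complex.ofReal_neg]
  rw [h3] at *
  have h5 : RCLike.re (inner ℂ g k : ℂ) = (inner ℂ g k : ℂ).re := rfl
  rw [h5]
  push_cast
  simp
  ring

theorem continuous_transVec (Ψ : Fock ι) : Continuous (transVec σ Ψ) := by
  have h1 : Continuous fun g => displ (σ.S g) Ψ := by
    have : Continuous fun g => ((Real.sqrt 2 : ℝ) : ℂ) • σ.S g := by fun_prop
    exact (continuous_weyl_apply Ψ).comp this
  have h2 : Continuous fun g : Ell ι => Complex.exp ((‖g‖ ^ 2 / 2 : ℝ) : ℂ) := by fun_prop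
  exact h2.smul h1

/-- The translation argument used for irreducibility, applied to the kernel of scalar products of
these vectors. Covariance exchanges the two slots, so holomorphy at `f = 0` forces the reduced
kernel to be constant. -/
theorem inner_transVec (Ψ : Fock ι)
    (hΨ : ∀ h : Ell ι, Differentiable ℂ fun z : ℂ => (inner ℂ Ψ (transVec σ Ψ (z • h)) : ℂ)) (f g : Ell ι) :
    (inner ℂ (transVec σ Ψ f) (transVec σ Ψ g) : ℂ) =
      ((‖Ψ‖ ^ 2 : ℝ) : ℂ) * Complex.exp (inner ℂ f g) := by
  set F : Ell ι → Ell ι → ℂ := fun f g => inner ℂ (transVec σ Ψ f) (transVec σ Ψ g) with hF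
  have key : ∀ f g k : Ell ι, F f g = Complex.exp (-((‖k‖ ^ 2 : ℝ) : ℂ) - inner ℂ f k - inner ℂ k g) *
      F (f + k) (g + k) := by
    intro f g k
    have h1 : F f g = inner ℂ (displ (σ.S k) (transVec σ Ψ f)) (displ (σ.S k) (transVec σ Ψ g)) := by
      rw [inner_displ_displ]
    rw [h1, displ_transVec, displ_transVec, inner_smul_left, inner_smul_right, ← mul_assoc,
      ← Complex.exp_conj, ← Complex.exp_add]
    congr 2
    simp only [map_sub, map_neg, Complex.conj_ofReal, inner_conj_symm]
    push_cast
    ring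
  have k0 : F f g = Complex.exp (inner ℂ f g) * F 0 (g - f) := by
    have := key f g (-f)
    rw [add_neg_cancel, ← sub_eq_add_neg, norm_neg, ofReal_norm_sq] at this
    rw [this, inner_neg_left, inner_neg_right]
    rw [show -inner ℂ f f - -inner ℂ f f - -inner ℂ f g = (inner ℂ f g : ℂ) by ring]
  have k1 : ∀ h : Ell ι, F 0 h = F (-h) 0 := by
    intro h
    have := key 0 h (-h)
    rw [zero_add, add_neg_cancel, norm_neg, ofReal_norm_sq] at this
    rw [this, inner_neg_left]
    simp
  have h00 : transVec σ Ψ 0 = Ψ := by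
    have : displ (0 : Ell ι) = 1 := by rw [displ, smul_zero, weyl_zero]
    simp [transVec, this]
  have hconst : ∀ h : Ell ι, F 0 h = F 0 0 := by
    intro h
    have hz := const_of_holomorphic_of_antiholomorphic
      (k₁ := fun z : ℂ => F 0 (z • h)) (k₂ := fun z : ℂ => inner ℂ Ψ (transVec σ Ψ (z • -h)))
      (by simpa only [hF, h00] using hΨ h) (hΨ _)
      (by
        intro z
        rw [k1, inner_conj_symm, smul_neg, hF]
        simp only [h00]) 1 0
    simpa using hz
  change F f g = _
  rw [k0, hconst, hF]
  simp only [h00]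
  rw [inner_self_eq_norm_sq_to_K]
  push_cast
  rw [mul_comm]
  rfl

theorem inner_coherent_displ (Ψ : Fock ι) (f k : Ell ι) :
    (inner ℂ (coherent f) (displ k Ψ) : ℂ) =
      Complex.exp (-((‖k‖ ^ 2 / 2 : ℝ) : ℂ) + inner ℂ f k) * inner ℂ (coherent (f - k)) Ψ := by
  have h1 : (inner ℂ (coherent f) (displ k Ψ) : ℂ) = inner ℂ (displ (-k) (coherent f)) Ψ := by
    have h2 := star_displ k
    rw [← h2, ContinuousLinearMap.star_eq_adjoint, ContinuousLinearMap.adjoint_inner_left]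
  rw [h1, displ_coherent, inner_smul_left, ← Complex.exp_conj, ← sub_eq_add_neg]
  congr 2
  simp only [map_sub, map_neg, Complex.conj_ofReal, norm_neg, inner_neg_left, inner_conj_symm]
  ring

/-- Shale's criterion, for symplectic maps whose antilinear part is small. -/
theorem exists_implementer (hs : Summable fun b => ‖antiPart σ.S' (unitVec b)‖ ^ 2)
    (h1 : Real.sqrt (∑' b, ‖antiPart σ.S' (unitVec b)‖ ^ 2) < 1) :
    ∃ u : unitary (Fock ι →L[ℂ] Fock ι),
      (∀ h, (u : Fock ι →L[ℂ] Fock ι) * weyl h = weyl (σ.S h) * u) ∧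
      ‖(u : Fock ι →L[ℂ] Fock ι) (coherent 0) - coherent 0‖ ≤
        2 * (Real.sqrt (∑' b, ‖antiPart σ.S' (unitVec b)‖ ^ 2) /
          (1 - Real.sqrt (∑' b, ‖antiPart σ.S' (unitVec b)‖ ^ 2))) := by
  set β := Real.sqrt (∑' b, ‖antiPart σ.S' (unitVec b)‖ ^ 2) with hβ
  obtain ⟨Z, hZA, hZsymm, hZn⟩ := σ.exists_ratio
  have hle : ∀ b : ι, ‖Z (unitVec b)‖ ^ 2 ≤ ‖antiPart σ.S' (unitVec b)‖ ^ 2 := fun b =>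
    pow_le_pow_left₀ (norm_nonneg _) (hZn _) 2
  have hZs : Summable fun b => ‖Z (unitVec b)‖ ^ 2 :=
    Summable.of_nonneg_of_le (fun _ => by positivity) hle hs
  obtain ⟨hk, hkt⟩ := summable_kernelOf Z hZs
  have hb : Real.sqrt (∑' p, ‖kernelOf Z p‖ ^ 2) ≤ β := by
    rw [hkt]
    exact Real.sqrt_le_sqrt (hZs.tsum_le_tsum hle hs)
  have hb1 := hb.trans_lt h1
  set Ψ := gauss (kernelOf Z) hk with hΨ
  have hΨc : ∀ f, (inner ℂ (coherent f) Ψ : ℂ) = Complex.exp (inner ℂ f (Z f) / 2) := by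
    intro f
    rw [hΨ, inner_coherent_gauss _ _ hb1, quadForm_kernelOf Z hZs]
  -- Completing the Gaussian with `ZA = B` and the symmetry of `Z`. Here `A - ZB` is complex linear,
  -- being built from a linear map and a product of two antilinear ones, and `⟨Bg, ·⟩` depends
  -- linearly on `g`; hence the exponent is a polynomial in `z` for `g = z h`.
  have hE : ∀ f g : Ell ι, (inner ℂ (coherent f) (transVec σ Ψ g) : ℂ) =
      Complex.exp (inner ℂ f (Z f) / 2 + inner ℂ f (linPart σ.S g - Z (antiPart σ.S g)) -
        inner ℂ (antiPart σ.S g) (linPart σ.S g - Z (antiPart σ.S g)) / 2) := by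
    intro f g
    rw [transVec, inner_smul_right, inner_coherent_displ, hΨc, ← mul_assoc, ← Complex.exp_add,
      ← Complex.exp_add]
    congr 1
    have e1 : σ.S g = linPart σ.S g + antiPart σ.S g := (linPart_add_antiPart _ _).symm
    have e2 := hZA g
    have e3 := σ.inner_linPart_self g
    have d1 : ((‖g‖ ^ 2 / 2 : ℝ) : ℂ) = inner ℂ g g / 2 := by
      rw [← ofReal_norm_sq]; push_cast; ring
    have d2 : ((‖σ.S g‖ ^ 2 / 2 : ℝ) : ℂ) = inner ℂ (σ.S g) (σ.S g) / 2 := by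
      rw [← ofReal_norm_sq]; push_cast; ring
    rw [d1, d2, e1]
    generalize linPart σ.S g = a at *
    generalize antiPart σ.S g = b at *
    have s1 := hZsymm f a
    have s2 := hZsymm f b
    have s3 := hZsymm a b
    rw [e2] at s1 s3
    simp only [inner_add_left, inner_add_right, inner_sub_left, inner_sub_right, map_add, map_sub, e2]
    linear_combination (-1 / 2 : ℂ) * e3 + (1 / 2) * s1 + (1 / 2) * s2 + (1 / 2) * s3
  have hhol : ∀ h : Ell ι, Differentiable ℂ fun z : ℂ => (inner ℂ Ψ (transVec σ Ψ (z • h)) : ℂ) := by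
    intro h
    have hc : Continuous fun z : ℂ => z • h := by fun_prop
    refine differentiable_inner_of_coherent ((continuous_transVec σ Ψ).comp hc) (fun f => ?_) Ψ
    simp only [Function.comp_apply, hE, map_smul, map_smulₛₗ, ← smul_sub, inner_smul_left,
      inner_smul_right, RingHomCompTriple.comp_apply, RingHom.id_apply]
    fun_prop
  have hin := inner_transVec σ Ψ hhol
  have hΨ1 : 1 ≤ ‖Ψ‖ := one_le_norm_gauss _ _ hb1
  have hΨ0 : (‖Ψ‖ : ℂ) ≠ 0 := by
    rw [Complex.ofReal_ne_zero]; positivity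
  obtain ⟨u, hu, hun⟩ := exists_isometry_of_inner (fun g => ((‖Ψ‖⁻¹ : ℝ) : ℂ) • transVec σ Ψ g) (by
    intro f g
    rw [inner_smul_left, inner_smul_right, hin, Complex.conj_ofReal]
    push_cast
    field_simp)
  have hcomm : ∀ k, u * displ k = displ (σ.S k) * u := by
    intro k
    refine ext_coherent fun g => ?_
    rw [mul_apply_eq_comp, mul_apply_eq_comp, displ_coherent, map_smul, hu, hu, map_smul,
      displ_transVec, smul_comm]
  have hmem := mem_unitary_of_isometry u hun σ.S σ.S' σ.right_inv (map_neg σ.S) hcomm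
  refine ⟨⟨u, hmem⟩, fun h => ?_, ?_⟩
  · have := hcomm ((((Real.sqrt 2)⁻¹ : ℝ) : ℂ) • h)
    have e : σ.S ((((Real.sqrt 2)⁻¹ : ℝ) : ℂ) • h) = (((Real.sqrt 2)⁻¹ : ℝ) : ℂ) • σ.S h := by
      rw [Complex.coe_smul, map_smul, Complex.coe_smul]
      rfl
    rw [e, ← weyl_eq_displ, ← weyl_eq_displ] at this
    exact this
  · change ‖u (coherent 0) - coherent 0‖ ≤ _
    have h00 : transVec σ Ψ 0 = Ψ := by
      have : displ (0 : Ell ι) = 1 := by rw [displ, smul_zero, weyl_zero]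
      simp [transVec, this]
    rw [hu, h00]
    have hd : ‖Ψ - coherent 0‖ ≤ β / (1 - β) := by
      refine (norm_gauss_sub_le _ _ hb1).trans ?_
      have : 0 < 1 - β := by linarith
      gcongr
    -- As `‖Ψ‖ ≥ 1`, normalising moves `Ψ` by `‖Ψ‖ - 1 ≤ ‖Ψ - e(0)‖`; this is the origin of the
    -- factor `2` in the bound.
    have e1 : ‖((‖Ψ‖⁻¹ : ℝ) : ℂ) • Ψ - Ψ‖ = ‖Ψ‖ - 1 := by
      have : ((‖Ψ‖⁻¹ : ℝ) : ℂ) • Ψ - Ψ = ((‖Ψ‖⁻¹ - 1 : ℝ) : ℂ) • Ψ := by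
        push_cast; rw [sub_smul, one_smul]
      rw [this, norm_smul, Complex.norm_real, Real.norm_eq_abs, abs_of_nonpos, neg_sub, sub_mul,
        inv_mul_cancel₀ (by positivity), one_mul]
      rw [sub_nonpos]
      exact inv_le_one_of_one_le₀ hΨ1
    have e2 : ‖Ψ‖ - 1 ≤ ‖Ψ - coherent 0‖ := by
      rw [← norm_coherent_zero (ι := ι)]
      exact norm_sub_norm_le _ _
    have e3 := norm_sub_le_norm_sub_add_norm_sub (((‖Ψ‖⁻¹ : ℝ) : ℂ) • Ψ) Ψ (coherent 0)
    linarith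

end Implementer

/-! ### Fourier coefficients of continuous periodic functions -/

open Filter Topology
open scoped ENNReal


/-- The Fourier coefficients of a complex function on `[0, 2π]`. -/
def cf (f : ℝ → ℂ) (k : ℤ) : ℂ := fourierCoeffOn Real.two_pi_pos f k

/-- The function `θ ↦ e^{ikθ}`. -/
def ex (k : ℤ) (θ : ℝ) : ℂ := Complex.exp (k * θ * Complex.I)

theorem coeff_eq_cf (g : ℝ → ℝ) (k : ℤ) : coeff g k = cf (fun θ => (g θ : ℂ)) k := rfl

theorem cf_eq (f : ℝ → ℂ) (k : ℤ) :
    cf f k = (2 * Real.pi : ℂ)⁻¹ * ∫ θ in (0 : ℝ)..2 * Real.pi, ex (-k) θ * f θ := by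
  rw [cf, fourierCoeffOn_eq_integral, sub_zero, Complex.real_smul]
  push_cast
  rw [one_div]
  congr 2
  funext θ
  rw [fourier_coe_apply, smul_eq_mul, ex]
  congr 2
  have : (Real.pi : ℂ) ≠ 0 := Complex.ofReal_ne_zero.2 Real.pi_ne_zero
  push_cast
  field_simp

theorem ex_zero (θ : ℝ) : ex 0 θ = 1 := by simp [ex]

theorem ex_add (k l : ℤ) (θ : ℝ) : ex (k + l) θ = ex k θ * ex l θ := by
  rw [ex, ex, ex, ← Complex.exp_add]
  push_cast
  ring_nf

theorem norm_ex (k : ℤ) (θ : ℝ) : ‖ex k θ‖ = 1 := by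
  have : (k : ℂ) * θ * Complex.I = ((k * θ : ℝ) : ℂ) * Complex.I := by push_cast; ring
  rw [ex, this, Complex.norm_exp_ofReal_mul_I]

theorem conj_ex (k : ℤ) (θ : ℝ) : conj (ex k θ) = ex (-k) θ := by
  rw [ex, ex, ← Complex.exp_conj]
  simp

theorem ex_add_real (k : ℤ) (θ η : ℝ) : ex k (θ + η) = ex k θ * ex k η := by
  rw [ex, ex, ex, ← Complex.exp_add]
  push_cast
  ring_nf

theorem ex_two_pi (k : ℤ) : ex k (2 * Real.pi) = 1 := by
  rw [ex]
  have := Complex.exp_int_mul_two_pi_mul_I k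
  rw [← this]
  push_cast
  ring_nf

theorem ex_per (k : ℤ) (θ : ℝ) : ex k (θ + 2 * Real.pi) = ex k θ := by
  rw [ex_add_real, ex_two_pi, mul_one]

theorem contDiff_ex (k : ℤ) : ContDiff ℝ ∞ (ex k) := by
  unfold ex
  have : ContDiff ℝ ∞ fun θ : ℝ => (θ : ℂ) := Complex.ofRealCLM.contDiff
  fun_prop

theorem continuous_ex (k : ℤ) : Continuous (ex k) := (contDiff_ex k).continuous

theorem hasDerivAt_ex (k : ℤ) (θ : ℝ) : HasDerivAt (ex k) (k * Complex.I * ex k θ) θ := by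
  have h1 : HasDerivAt (fun θ : ℝ => (k : ℂ) * θ * Complex.I) (k * Complex.I) θ := by
    simpa using ((hasDerivAt_id θ).ofReal_comp.const_mul (k : ℂ)).mul_const Complex.I
  have := h1.cexp
  rwa [mul_comm (Complex.exp _)] at this

theorem cf_ex (k n : ℤ) : cf (ex k) n = if k = n then 1 else 0 := by
  rw [cf_eq]
  have hpi : (Real.pi : ℂ) ≠ 0 := Complex.ofReal_ne_zero.2 Real.pi_ne_zero
  simp only [← ex_add]
  split_ifs with h
  · subst h
    simp only [neg_add_cancel, ex_zero, intervalIntegral.integral_const, sub_zero, Complex.real_smul,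
      mul_one]
    push_cast
    field_simp
  · have h0 : ((-n + k : ℤ) : ℂ) * Complex.I ≠ 0 := by
      refine mul_ne_zero ?_ Complex.I_ne_zero
      exact_mod_cast (by omega : -n + k ≠ 0)
    have h1 : ∀ θ : ℝ, HasDerivAt (fun θ => (((-n + k : ℤ) : ℂ) * Complex.I)⁻¹ * ex (-n + k) θ)
        (ex (-n + k) θ) θ := by
      intro θ
      refine ((hasDerivAt_ex (-n + k) θ).const_mul _).congr_deriv ?_
      rw [← mul_assoc, inv_mul_cancel₀ h0, one_mul]
    rw [intervalIntegral.integral_eq_sub_of_hasDerivAt (fun θ _ => h1 θ)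
      ((continuous_ex _).intervalIntegrable _ _), ex_two_pi]
    simp [ex]

theorem cf_add {f g : ℝ → ℂ} (hf : Continuous f) (hg : Continuous g) (k : ℤ) :
    cf (fun θ => f θ + g θ) k = cf f k + cf g k := by
  simp only [cf_eq]
  rw [← mul_add, ← intervalIntegral.integral_add]
  · simp only [mul_add]
  · exact ((continuous_ex _).mul hf).intervalIntegrable _ _
  · exact ((continuous_ex _).mul hg).intervalIntegrable _ _

theorem cf_const_mul (c : ℂ) (f : ℝ → ℂ) (k : ℤ) : cf (fun θ => c * f θ) k = c * cf f k := by
  simp only [cf_eq]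
  rw [mul_left_comm c, ← intervalIntegral.integral_const_mul c]
  congr 2
  funext θ
  ring

theorem cf_sub {f g : ℝ → ℂ} (hf : Continuous f) (hg : Continuous g) (k : ℤ) :
    cf (fun θ => f θ - g θ) k = cf f k - cf g k := by
  have hg' : Continuous fun θ => (-1 : ℂ) * g θ := by fun_prop
  have h := cf_add hf hg' k
  rw [cf_const_mul] at h
  simpa [sub_eq_add_neg] using h

theorem cf_sum {ι : Type*} (s : Finset ι) (f : ι → ℝ → ℂ) (hf : ∀ i, Continuous (f i)) (k : ℤ) :
    cf (fun θ => ∑ i ∈ s, f i θ) k = ∑ i ∈ s, cf (f i) k := by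
  classical
  induction s using Finset.induction_on with
  | empty => simp [cf_eq]
  | insert a s ha ih =>
    simp only [Finset.sum_insert ha]
    rw [cf_add (hf a) (continuous_finsetSum _ fun i _ => hf i), ih]

theorem norm_cf_le {f : ℝ → ℂ} {C : ℝ} (h : ∀ θ, ‖f θ‖ ≤ C) (k : ℤ) : ‖cf f k‖ ≤ C := by
  rw [cf_eq, norm_mul]
  have h1 : ‖∫ θ in (0 : ℝ)..2 * Real.pi, ex (-k) θ * f θ‖ ≤ C * |2 * Real.pi - 0| :=
    intervalIntegral.norm_integral_le_of_norm_le_const fun θ _ => by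
      rw [norm_mul, norm_ex, one_mul]; exact h θ
  have h2 : ‖(2 * Real.pi : ℂ)⁻¹‖ = (2 * Real.pi)⁻¹ := by
    rw [norm_inv, norm_mul, Complex.norm_real, Real.norm_of_nonneg Real.pi_pos.le]
    simp
  rw [sub_zero, abs_of_pos Real.two_pi_pos] at h1
  rw [h2, inv_mul_le_iff₀ Real.two_pi_pos, mul_comm _ C]
  exact h1

theorem tendsto_cf {α : Type*} {l : Filter α} {F : α → ℝ → ℂ} {f : ℝ → ℂ} (hF : ∀ a, Continuous (F a))
    (hf : Continuous f) (h : TendstoUniformly F f l) (k : ℤ) :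
    Tendsto (fun a => cf (F a) k) l (𝓝 (cf f k)) := by
  rw [Metric.tendsto_nhds]
  intro ε hε
  rw [Metric.tendstoUniformly_iff] at h
  filter_upwards [h (ε / 2) (by positivity)] with a ha
  rw [dist_eq_norm, ← cf_sub (hF a) hf]
  refine (norm_cf_le (C := ε / 2) (fun θ => ?_) k).trans_lt (by linarith)
  have := ha θ
  rw [dist_comm, dist_eq_norm] at this
  exact this.le

theorem parseval {f : ℝ → ℂ} (hf : Continuous f) :
    HasSum (fun k => ‖cf f k‖ ^ 2) ((2 * Real.pi)⁻¹ * ∫ θ in (0 : ℝ)..2 * Real.pi, ‖f θ‖ ^ 2) := by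
  have h : MeasureTheory.MemLp f 2
      (MeasureTheory.volume.restrict (Set.Ioc (0 : ℝ) (2 * Real.pi))) := by
    obtain ⟨C, hC⟩ := (isCompact_Icc (a := (0 : ℝ)) (b := 2 * Real.pi)).exists_bound_of_continuousOn
      hf.continuousOn
    refine MeasureTheory.MemLp.of_bound hf.aestronglyMeasurable C ?_
    filter_upwards [MeasureTheory.ae_restrict_mem measurableSet_Ioc] with x hx
    exact hC x (Set.Ioc_subset_Icc_self hx)
  have := hasSum_sq_fourierCoeffOn Real.two_pi_pos h
  rwa [sub_zero, smul_eq_mul] at this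

/-- Continuous functions on `ℝ` which are periodic with period `2π`. -/
structure PerCont (f : ℝ → ℂ) : Prop where
  cont : Continuous f
  per : ∀ θ, f (θ + 2 * Real.pi) = f θ

theorem perCont_ex (k : ℤ) : PerCont (ex k) := ⟨continuous_ex k, ex_per k⟩

theorem PerCont.add {f g : ℝ → ℂ} (hf : PerCont f) (hg : PerCont g) :
    PerCont fun θ => f θ + g θ :=
  ⟨hf.cont.add hg.cont, fun θ => by rw [hf.per, hg.per]⟩

theorem PerCont.sub {f g : ℝ → ℂ} (hf : PerCont f) (hg : PerCont g) :
    PerCont fun θ => f θ - g θ :=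
  ⟨hf.cont.sub hg.cont, fun θ => by rw [hf.per, hg.per]⟩

theorem PerCont.mul {f g : ℝ → ℂ} (hf : PerCont f) (hg : PerCont g) :
    PerCont fun θ => f θ * g θ :=
  ⟨hf.cont.mul hg.cont, fun θ => by rw [hf.per, hg.per]⟩

theorem perCont_const (c : ℂ) : PerCont fun _ => c := ⟨continuous_const, fun _ => rfl⟩

theorem PerCont.eq_of_Icc {f g : ℝ → ℂ} (hf : PerCont f) (hg : PerCont g)
    (h : ∀ θ ∈ Set.Icc 0 (2 * Real.pi), f θ = g θ) : f = g := by
  funext θ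
  have hf' : Function.Periodic f (2 * Real.pi) := hf.per
  have hg' : Function.Periodic g (2 * Real.pi) := hg.per
  obtain ⟨y, hy, hy2⟩ := (hf.sub hg).per |> fun (h : Function.Periodic (fun θ => f θ - g θ)
    (2 * Real.pi)) => h.exists_mem_Ico₀ Real.two_pi_pos θ
  have := h y ⟨hy.1, hy.2.le⟩
  rw [this, sub_self] at hy2
  exact sub_eq_zero.1 hy2

theorem PerCont.bounded {f : ℝ → ℂ} (hf : PerCont f) : ∃ C, 0 ≤ C ∧ ∀ θ, ‖f θ‖ ≤ C := by
  obtain ⟨C, hC⟩ := (isCompact_Icc (a := (0 : ℝ)) (b := 2 * Real.pi)).exists_bound_of_continuousOn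
    hf.cont.continuousOn
  refine ⟨max C 0, le_max_right _ _, fun θ => ?_⟩
  have hf' : Function.Periodic f (2 * Real.pi) := hf.per
  obtain ⟨y, hy, hy2⟩ := hf'.exists_mem_Ico₀ Real.two_pi_pos θ
  rw [hy2]
  exact (hC y ⟨hy.1, hy.2.le⟩).trans (le_max_left _ _)

theorem eq_of_cf_eq {f g : ℝ → ℂ} (hf : PerCont f) (hg : PerCont g) (h : ∀ k, cf f k = cf g k) :
    f = g := by
  refine hf.eq_of_Icc hg fun θ hθ => ?_
  by_contra hne
  have h1 := parseval (hf.sub hg).cont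
  simp only [cf_sub hf.cont hg.cont, h, sub_self, norm_zero] at h1
  have h0 : HasSum (fun _ : ℤ => (0 : ℝ) ^ 2) 0 := by
    rw [zero_pow two_ne_zero]
    exact hasSum_zero
  have h2 := h1.unique h0
  have h3 : 0 < ∫ θ in (0 : ℝ)..2 * Real.pi, ‖f θ - g θ‖ ^ 2 := by
    refine intervalIntegral.integral_pos Real.two_pi_pos
      ((hf.sub hg).cont.norm.pow 2).continuousOn (fun _ _ => by positivity) ⟨θ, hθ, ?_⟩
    have : f θ - g θ ≠ 0 := sub_ne_zero.2 hne
    positivity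
  have h4 : 0 < (2 * Real.pi)⁻¹ * ∫ θ in (0 : ℝ)..2 * Real.pi, ‖f θ - g θ‖ ^ 2 := by positivity
  linarith

section Series
variable {a : ℤ → ℂ}

theorem summable_series (ha : Summable fun k => ‖a k‖) (θ : ℝ) : Summable fun k => a k * ex k θ := by
  refine Summable.of_norm ?_
  simpa only [norm_mul, norm_ex, mul_one] using ha

theorem tendstoUniformly_series (ha : Summable fun k => ‖a k‖) :
    TendstoUniformly (fun (s : Finset ℤ) θ => ∑ k ∈ s, a k * ex k θ)
      (fun θ => ∑' k, a k * ex k θ) atTop := by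
  refine tendstoUniformly_tsum ha fun k θ => ?_
  rw [norm_mul, norm_ex, mul_one]

theorem perCont_series (ha : Summable fun k => ‖a k‖) : PerCont fun θ => ∑' k, a k * ex k θ := by
  refine ⟨continuous_tsum (fun k => continuous_const.mul (continuous_ex k)) ha fun k θ => ?_,
    fun θ => by simp only [ex_per]⟩
  rw [norm_mul, norm_ex, mul_one]

theorem cf_finset_sum (s : Finset ℤ) (a : ℤ → ℂ) (n : ℤ) :
    cf (fun θ => ∑ k ∈ s, a k * ex k θ) n = if n ∈ s then a n else 0 := by
  rw [cf_sum s (fun k θ => a k * ex k θ) (fun k => continuous_const.mul (continuous_ex k))]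
  simp only [cf_const_mul, cf_ex, mul_ite, mul_one, mul_zero]
  simp

theorem cf_series (ha : Summable fun k => ‖a k‖) (n : ℤ) :
    cf (fun θ => ∑' k, a k * ex k θ) n = a n := by
  have h1 := tendsto_cf (fun s => by
    exact continuous_finsetSum s fun k _ => continuous_const.mul (continuous_ex k))
    (perCont_series ha).cont (tendstoUniformly_series ha) n
  refine tendsto_nhds_unique h1 ?_
  refine tendsto_const_nhds.congr' ?_
  filter_upwards [eventually_ge_atTop {n}] with s hs
  rw [cf_finset_sum, if_pos (Finset.singleton_subset_iff.1 hs)]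

end Series

/-- Fourier inversion for functions with summable Fourier coefficients. -/
theorem series_cf {f : ℝ → ℂ} (hf : PerCont f) (h : Summable fun k => ‖cf f k‖) :
    (fun θ => ∑' k, cf f k * ex k θ) = f :=
  eq_of_cf_eq (perCont_series h) hf fun k => cf_series h k

theorem tendstoUniformly_partialSums {f : ℝ → ℂ} (hf : PerCont f) (h : Summable fun k => ‖cf f k‖) :
    TendstoUniformly (fun (s : Finset ℤ) θ => ∑ k ∈ s, cf f k * ex k θ) f atTop := by
  have := tendstoUniformly_series h
  rwa [series_cf hf h] at this

theorem cf_deriv {f : ℝ → ℂ} (hf : ContDiff ℝ 1 f) (hp : ∀ θ, f (θ + 2 * Real.pi) = f θ) (k : ℤ) :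
    cf (deriv f) k = k * Complex.I * cf f k := by
  have hd : ∀ θ, HasDerivAt f (deriv f θ) θ := fun θ => (hf.differentiable one_ne_zero θ).hasDerivAt
  have hc : Continuous (deriv f) := hf.continuous_deriv_one
  have h1 := intervalIntegral.integral_mul_deriv_eq_deriv_mul (a := 0) (b := 2 * Real.pi)
    (u := ex (-k)) (v := f) (u' := fun θ => (-k : ℤ) * Complex.I * ex (-k) θ) (v' := deriv f)
    (fun θ _ => hasDerivAt_ex (-k) θ) (fun θ _ => hd θ)
    ((continuous_const.mul (continuous_ex _)).intervalIntegrable _ _) (hc.intervalIntegrable _ _)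
  have h2 : f (2 * Real.pi) = f 0 := by simpa using hp 0
  have h3 : ex (-k) 0 = 1 := by simp [ex]
  rw [ex_two_pi, h2, h3, sub_self, zero_sub] at h1
  rw [cf_eq, cf_eq, h1]
  simp only [mul_assoc]
  rw [intervalIntegral.integral_const_mul, intervalIntegral.integral_const_mul]
  push_cast
  ring

/-! ### Sobolev norms and the algebra property -/

/-- The Sobolev weight `(1 + k²)^r`. -/
def wt (r : ℝ) (k : ℤ) : ℝ≥0∞ := ENNReal.ofReal ((1 + (k : ℝ) ^ 2) ^ r)

theorem wt_add (r t : ℝ) (k : ℤ) : wt (r + t) k = wt r k * wt t k := by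
  rw [wt, wt, wt, ← ENNReal.ofReal_mul (by positivity), Real.rpow_add (by positivity)]

theorem wt_zero (k : ℤ) : wt 0 k = 1 := by simp [wt]

theorem wt_one (k : ℤ) : wt 1 k = 1 + ENNReal.ofReal ((k : ℝ) ^ 2) := by
  rw [wt, Real.rpow_one, ENNReal.ofReal_add zero_le_one (by positivity), ENNReal.ofReal_one]

theorem wt_mono {r t : ℝ} (h : r ≤ t) (k : ℤ) : wt r k ≤ wt t k := by
  refine ENNReal.ofReal_le_ofReal (Real.rpow_le_rpow_of_exponent_le ?_ h)
  nlinarith [sq_nonneg (k : ℝ)]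

theorem wt_ne_top (r : ℝ) (k : ℤ) : wt r k ≠ ⊤ := ENNReal.ofReal_ne_top

theorem wt_ne_zero (r : ℝ) (k : ℤ) : wt r k ≠ 0 := by
  rw [wt, ne_eq, ENNReal.ofReal_eq_zero, not_le]
  positivity

/-- The square of the `H^r`-norm. -/
def sob (r : ℝ) (f : ℝ → ℂ) : ℝ≥0∞ := ∑' k, wt r k * ‖cf f k‖ₑ ^ 2

theorem sob_mono {r t : ℝ} (h : r ≤ t) (f : ℝ → ℂ) : sob r f ≤ sob t f :=
  ENNReal.tsum_le_tsum fun k => by gcongr; exact wt_mono h k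

/-- An exact identity, as `(1 + k²)^{r+1} = (1 + k²)^r + (1 + k²)^r k²`. All inductions over integer
regularity steps run through it. -/
theorem sob_add_one (r : ℝ) {f : ℝ → ℂ} (hf : ContDiff ℝ 1 f) (hp : ∀ θ, f (θ + 2 * Real.pi) = f θ) :
    sob (r + 1) f = sob r f + sob r (deriv f) := by
  rw [sob, sob, sob, ← ENNReal.tsum_add]
  refine tsum_congr fun k => ?_
  rw [cf_deriv hf hp, wt_add, wt_one, enorm_mul, mul_pow]
  have : ‖(k : ℂ) * Complex.I‖ₑ ^ 2 = ENNReal.ofReal ((k : ℝ) ^ 2) := by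
    rw [← ofReal_norm, ← ENNReal.ofReal_pow (norm_nonneg _)]
    simp
  rw [this]
  ring

theorem sob_zero_eq {f : ℝ → ℂ} (hf : Continuous f) :
    sob 0 f = ENNReal.ofReal ((2 * Real.pi)⁻¹ * ∫ θ in (0 : ℝ)..2 * Real.pi, ‖f θ‖ ^ 2) := by
  have h := parseval hf
  rw [← h.tsum_eq, ENNReal.ofReal_tsum_of_nonneg (fun _ => by positivity) h.summable, sob]
  refine tsum_congr fun k => ?_
  rw [wt_zero, one_mul, ENNReal.ofReal_pow (norm_nonneg _), ofReal_norm]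

theorem sob_zero_le_of_bound {f : ℝ → ℂ} (hf : Continuous f) {C : ℝ}
    (h : ∀ θ, ‖f θ‖ ≤ C) : sob 0 f ≤ ENNReal.ofReal (C ^ 2) := by
  rw [sob_zero_eq hf]
  refine ENNReal.ofReal_le_ofReal ?_
  rw [inv_mul_le_iff₀ Real.two_pi_pos]
  have h1 : ∫ θ in (0 : ℝ)..2 * Real.pi, ‖f θ‖ ^ 2 ≤ ∫ _ in (0 : ℝ)..2 * Real.pi, C ^ 2 :=
    intervalIntegral.integral_mono_on Real.two_pi_pos.le
      ((hf.norm.pow 2).intervalIntegrable _ _) (continuous_const.intervalIntegrable _ _)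
      fun θ _ => pow_le_pow_left₀ (norm_nonneg _) (h θ) 2
  simpa using h1

theorem sob_zero_mul_le {f g : ℝ → ℂ} (hf : Continuous f) (hg : Continuous g) {C : ℝ}
    (h : ∀ θ, ‖g θ‖ ≤ C) :
    sob 0 (fun θ => f θ * g θ) ≤ ENNReal.ofReal (C ^ 2) * sob 0 f := by
  have hfg : Continuous fun θ => f θ * g θ := hf.mul hg
  rw [sob_zero_eq hfg, sob_zero_eq hf, ← ENNReal.ofReal_mul (by positivity)]
  refine ENNReal.ofReal_le_ofReal ?_
  have hpi : 0 ≤ (2 * Real.pi)⁻¹ := by positivity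
  rw [mul_left_comm (C ^ 2), ← intervalIntegral.integral_const_mul (C ^ 2)]
  refine mul_le_mul_of_nonneg_left ?_ hpi
  refine intervalIntegral.integral_mono_on Real.two_pi_pos.le
      ((hfg.norm.pow 2).intervalIntegrable _ _)
      ((continuous_const.mul (hf.norm.pow 2)).intervalIntegrable _ _) fun θ _ => ?_
  rw [norm_mul, mul_pow, mul_comm]
  exact mul_le_mul_of_nonneg_right (pow_le_pow_left₀ (norm_nonneg _) (h θ) 2) (by positivity)

theorem sob_const_mul (r : ℝ) (c : ℂ) (f : ℝ → ℂ) :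
    sob r (fun θ => c * f θ) = ‖c‖ₑ ^ 2 * sob r f := by
  rw [sob, sob, ← ENNReal.tsum_mul_left]
  refine tsum_congr fun k => ?_
  rw [cf_const_mul, enorm_mul, mul_pow]
  ring

theorem enorm_add_sq_le (x y : ℂ) : ‖x + y‖ₑ ^ 2 ≤ 2 * (‖x‖ₑ ^ 2 + ‖y‖ₑ ^ 2) := by
  calc ‖x + y‖ₑ ^ 2 = ENNReal.ofReal (‖x + y‖ ^ 2) := by
        rw [ENNReal.ofReal_pow (norm_nonneg _), ofReal_norm]
    _ ≤ ENNReal.ofReal (2 * (‖x‖ ^ 2 + ‖y‖ ^ 2)) := by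
        refine ENNReal.ofReal_le_ofReal ?_
        have := norm_add_le x y
        nlinarith [sq_nonneg (‖x‖ - ‖y‖), norm_nonneg (x + y), norm_nonneg x, norm_nonneg y]
    _ = _ := by
        rw [ENNReal.ofReal_mul zero_le_two, ENNReal.ofReal_add (by positivity) (by positivity),
          ENNReal.ofReal_pow (norm_nonneg _), ENNReal.ofReal_pow (norm_nonneg _),
          ofReal_norm, ofReal_norm]
        norm_num

theorem sob_add_le (r : ℝ) {f g : ℝ → ℂ} (hf : Continuous f) (hg : Continuous g) :
    sob r (fun θ => f θ + g θ) ≤ 2 * (sob r f + sob r g) := by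
  rw [sob, sob, sob, ← ENNReal.tsum_add, ← ENNReal.tsum_mul_left]
  refine ENNReal.tsum_le_tsum fun k => ?_
  rw [cf_add hf hg]
  calc wt r k * ‖cf f k + cf g k‖ₑ ^ 2 ≤ wt r k * (2 * (‖cf f k‖ₑ ^ 2 + ‖cf g k‖ₑ ^ 2)) := by
        gcongr
        exact enorm_add_sq_le _ _
    _ = _ := by ring

/-- Lower semicontinuity of the Sobolev norm. -/
theorem sob_le_of_tendsto {α : Type*} {l : Filter α} [l.NeBot] {F : α → ℝ → ℂ} {f : ℝ → ℂ} {r : ℝ}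
    {M : ℝ≥0∞} (h : ∀ k, Tendsto (fun a => cf (F a) k) l (𝓝 (cf f k)))
    (hM : ∀ᶠ a in l, sob r (F a) ≤ M) : sob r f ≤ M := by
  rw [sob, ENNReal.tsum_eq_iSup_sum]
  refine iSup_le fun s => ?_
  have h1 : Tendsto (fun a => ∑ k ∈ s, wt r k * ‖cf (F a) k‖ₑ ^ 2) l
      (𝓝 (∑ k ∈ s, wt r k * ‖cf f k‖ₑ ^ 2)) := by
    refine tendsto_finsetSum s fun k _ => ?_
    refine ENNReal.Tendsto.const_mul ?_ (Or.inr (wt_ne_top r k))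
    exact (ENNReal.continuous_pow 2).continuousAt.tendsto.comp
      ((continuous_enorm.tendsto _).comp (h k))
  refine le_of_tendsto h1 ?_
  filter_upwards [hM] with a ha
  exact (ENNReal.sum_le_tsum s).trans ha

/-- The Cauchy-Schwarz inequality for series in `[0, ∞]`. -/
theorem tsum_mul_sq_le {ι : Type*} (a b : ι → ℝ≥0∞) :
    (∑' i, a i * b i) ^ 2 ≤ (∑' i, a i ^ 2) * ∑' i, b i ^ 2 := by
  let _ : MeasurableSpace ι := ⊤
  have h := ENNReal.lintegral_mul_le_Lp_mul_Lq (MeasureTheory.Measure.count : MeasureTheory.Measure ι)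
    (p := 2) (q := 2) (by constructor <;> norm_num) (f := a) (g := b)
    (measurable_from_top.aemeasurable) (measurable_from_top.aemeasurable)
  simp only [MeasureTheory.lintegral_count, Pi.mul_apply] at h
  have h2 := pow_le_pow_left₀ (zero_le) h 2
  refine h2.trans (le_of_eq ?_)
  rw [mul_pow]
  simp only [← ENNReal.rpow_natCast, ← ENNReal.rpow_mul]
  norm_num

/-- Young's inequality `‖a * b‖₂ ≤ ‖a‖₂ ‖b‖₁` for sequences. -/
theorem tsum_conv_sq_le (a b : ℤ → ℝ≥0∞) :
    ∑' k, (∑' j, a j * b (k - j)) ^ 2 ≤ (∑' j, a j ^ 2) * (∑' j, b j) ^ 2 := by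
  have hb : ∀ k : ℤ, ∑' j, b (k - j) = ∑' j, b j := fun k =>
    (Equiv.subLeft k).tsum_eq b
  have hb' : ∀ j : ℤ, ∑' k, b (k - j) = ∑' k, b k := fun j => (Equiv.subRight j).tsum_eq b
  have h1 : ∀ k, (∑' j, a j * b (k - j)) ^ 2 ≤ (∑' j, a j ^ 2 * b (k - j)) * ∑' j, b j := by
    intro k
    have h2 := tsum_mul_sq_le (fun j => a j * b (k - j) ^ (1 / 2 : ℝ)) (fun j => b (k - j) ^ (1 / 2 : ℝ))
    have h3 : ∀ x : ℝ≥0∞, x ^ (1 / 2 : ℝ) * x ^ (1 / 2 : ℝ) = x := by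
      intro x
      rw [← ENNReal.rpow_add_of_nonneg _ _ (by norm_num) (by norm_num)]
      norm_num
    simp only [mul_assoc, h3, mul_pow, pow_two (_ ^ (1 / 2 : ℝ)), hb] at h2
    exact h2
  calc ∑' k, (∑' j, a j * b (k - j)) ^ 2 ≤ ∑' k, (∑' j, a j ^ 2 * b (k - j)) * ∑' j, b j :=
        ENNReal.tsum_le_tsum h1
    _ = (∑' j, a j ^ 2) * (∑' j, b j) ^ 2 := by
        rw [ENNReal.tsum_mul_right, ENNReal.tsum_comm]
        simp only [ENNReal.tsum_mul_left, hb', ENNReal.tsum_mul_right]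
        ring

/-- The sum `∑ (1 + k²)^{-r}`. -/
def wtSum (r : ℝ) : ℝ≥0∞ := ∑' k, wt (-r) k

theorem wtSum_ne_top {r : ℝ} (hr : 1 / 2 < r) : wtSum r ≠ ⊤ := by
  have h1 : Summable fun k : ℤ => |(k : ℝ)| ^ (-(2 * r)) := Real.summable_abs_int_rpow (by linarith)
  have h2 : Summable fun k : ℤ => if k = 0 then (1 : ℝ) else 0 :=
    summable_of_ne_finset_zero (s := {0}) fun k hk => by simpa using hk
  have h3 : Summable fun k : ℤ => (1 + (k : ℝ) ^ 2) ^ (-r) := by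
    refine Summable.of_nonneg_of_le (fun k => by positivity) (fun k => ?_) (h1.add h2)
    by_cases hk : k = 0
    · subst hk
      have : (0 : ℝ) ≤ |((0 : ℤ) : ℝ)| ^ (-(2 * r)) := by positivity
      simp
      positivity
    · have hk' : (0 : ℝ) < |(k : ℝ)| := by
        rw [abs_pos]; exact_mod_cast hk
      rw [if_neg hk, add_zero, ← sq_abs, show -(2 * r) = 2 * (-r) by ring, Real.rpow_mul hk'.le]
      refine Real.rpow_le_rpow_of_nonpos (by positivity) ?_ (by linarith)
      norm_num
  rw [wtSum]
  simp only [wt]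
  exact h3.tsum_ofReal_ne_top

theorem wt_half_sq (r : ℝ) (k : ℤ) : wt (r / 2) k ^ 2 = wt r k := by
  rw [sq, ← wt_add, add_halves]

theorem wt_neg_mul (r : ℝ) (k : ℤ) : wt (-r) k * wt r k = 1 := by
  rw [← wt_add, neg_add_cancel, wt_zero]

/-- Cauchy-Schwarz after inserting `(1 + k²)^{-r/2} (1 + k²)^{r/2}`; as `wtSum r` is finite for `r >
1/2`, this is the Sobolev embedding into absolutely convergent Fourier series. -/
theorem tsum_enorm_sq_le (r : ℝ) (a : ℤ → ℝ≥0∞) :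
    (∑' k, a k) ^ 2 ≤ wtSum r * ∑' k, wt r k * a k ^ 2 := by
  have h := tsum_mul_sq_le (fun k => wt (-r / 2) k) (fun k => wt (r / 2) k * a k)
  have h1 : ∀ k, wt (-r / 2) k * (wt (r / 2) k * a k) = a k := fun k => by
    rw [← mul_assoc, neg_div, wt_neg_mul, one_mul]
  simp only [h1, mul_pow, wt_half_sq] at h
  exact h

theorem tsum_enorm_cf_sq_le (r : ℝ) (f : ℝ → ℂ) :
    (∑' k, ‖cf f k‖ₑ) ^ 2 ≤ wtSum r * sob r f := tsum_enorm_sq_le r _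

theorem tsum_enorm_cf_ne_top {r : ℝ} (hr : 1 / 2 < r) {f : ℝ → ℂ} (h : sob r f ≠ ⊤) :
    ∑' k, ‖cf f k‖ₑ ≠ ⊤ := by
  intro h0
  have h1 := tsum_enorm_cf_sq_le r f
  rw [h0, ENNReal.top_pow two_ne_zero, top_le_iff] at h1
  exact ENNReal.mul_ne_top (wtSum_ne_top hr) h h1

theorem summable_norm_cf {r : ℝ} (hr : 1 / 2 < r) {f : ℝ → ℂ} (h : sob r f ≠ ⊤) :
    Summable fun k => ‖cf f k‖ := by
  have h1 := tsum_enorm_cf_ne_top hr h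
  have h2 := ENNReal.summable_toReal h1
  simpa using h2

theorem enorm_le_tsum {f : ℝ → ℂ} (hf : PerCont f) (h : Summable fun k => ‖cf f k‖) (θ : ℝ) :
    ‖f θ‖ₑ ≤ ∑' k, ‖cf f k‖ₑ := by
  have h1 := congrFun (series_cf hf h) θ
  rw [← h1]
  refine (enorm_tsum_le_tsum_enorm).trans (ENNReal.tsum_le_tsum fun k => ?_)
  rw [enorm_mul, ← ofReal_norm (ex k θ), norm_ex]
  simp

theorem enorm_sq_le_sob {r : ℝ} (hr : 1 / 2 < r) {f : ℝ → ℂ} (hf : PerCont f) (θ : ℝ) :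
    ‖f θ‖ₑ ^ 2 ≤ wtSum r * sob r f := by
  by_cases h : sob r f = ⊤
  -- Since `0 * ⊤ = 0`, the right-hand side is infinite only because `wtSum r` is nonzero, as its
  -- term `k = 0` shows.
  · rw [h, ENNReal.mul_top]
    · exact le_top
    · refine (lt_of_lt_of_le ?_ (ENNReal.le_tsum 0)).ne'
      exact pos_iff_ne_zero.2 (wt_ne_zero _ _)
  · exact (pow_le_pow_left₀ zero_le (enorm_le_tsum hf (summable_norm_cf hr h) θ) 2).trans
      (tsum_enorm_cf_sq_le r f)

theorem cf_ex_mul (j : ℤ) (g : ℝ → ℂ) (n : ℤ) : cf (fun θ => ex j θ * g θ) n = cf g (n - j) := by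
  rw [cf_eq, cf_eq]
  congr 2
  funext θ
  rw [← mul_assoc, ← ex_add]
  congr 2
  ring

/-- Multiply the uniformly convergent Fourier partial sums of `f` by the bounded function `g` and
pass to the limit. The inequality, without the convolution formula itself, suffices and needs no
summability for `g`. -/
theorem enorm_cf_mul_le {f g : ℝ → ℂ} (hf : PerCont f) (hg : PerCont g)
    (h : Summable fun k => ‖cf f k‖) (n : ℤ) :
    ‖cf (fun θ => f θ * g θ) n‖ₑ ≤ ∑' j, ‖cf f j‖ₑ * ‖cf g (n - j)‖ₑ := by
  obtain ⟨C, hC0, hC⟩ := hg.bounded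
  have hu : TendstoUniformly (fun (s : Finset ℤ) θ => (∑ k ∈ s, cf f k * ex k θ) * g θ)
      (fun θ => f θ * g θ) atTop := by
    have h1 := tendstoUniformly_partialSums hf h
    rw [Metric.tendstoUniformly_iff] at h1 ⊢
    intro ε hε
    filter_upwards [h1 (ε / (C + 1)) (by positivity)] with s hs θ
    have h2 := hs θ
    rw [dist_eq_norm] at h2 ⊢
    rw [← sub_mul, norm_mul]
    rw [lt_div_iff₀ (by positivity)] at h2
    refine lt_of_le_of_lt ?_ h2
    gcongr
    exact (hC θ).trans (by linarith)
  have h2 := tendsto_cf (fun s => by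
    have : Continuous fun θ => ∑ k ∈ s, cf f k * ex k θ :=
      continuous_finsetSum s fun k _ => continuous_const.mul (continuous_ex k)
    exact this.mul hg.cont) (hf.mul hg).cont hu n
  have h3 : ∀ s : Finset ℤ, cf (fun θ => (∑ k ∈ s, cf f k * ex k θ) * g θ) n =
      ∑ k ∈ s, cf f k * cf g (n - k) := by
    intro s
    simp only [Finset.sum_mul, mul_assoc]
    rw [cf_sum s (fun k θ => cf f k * (ex k θ * g θ))
      (fun k => continuous_const.mul ((continuous_ex k).mul hg.cont))]
    simp only [cf_const_mul, cf_ex_mul]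
  refine le_of_tendsto ((continuous_enorm.tendsto _).comp h2) (Eventually.of_forall fun s => ?_)
  simp only [Function.comp_apply, h3]
  refine (enorm_sum_le _ _).trans ?_
  simp only [enorm_mul]
  exact ENNReal.sum_le_tsum s

/-- From `k² ≤ 2j² + 2(k - j)²`: the weight at `k` is borne by one of the two frequencies `j`, `k -
j`, so in a product the derivatives fall on one factor at a time. -/
theorem wt_half_le {r : ℝ} (hr : 0 ≤ r) (k j : ℤ) :
    wt (r / 2) k ≤ ENNReal.ofReal (4 ^ (r / 2)) * (wt (r / 2) j + wt (r / 2) (k - j)) := by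
  have h1 : (1 + (k : ℝ) ^ 2) ≤ 4 * max (1 + (j : ℝ) ^ 2) (1 + ((k - j : ℤ) : ℝ) ^ 2) := by
    have e1 := le_max_left (1 + (j : ℝ) ^ 2) (1 + ((k - j : ℤ) : ℝ) ^ 2)
    have e2 := le_max_right (1 + (j : ℝ) ^ 2) (1 + ((k - j : ℤ) : ℝ) ^ 2)
    have e3 : (k : ℝ) ^ 2 ≤ 2 * (j : ℝ) ^ 2 + 2 * ((k - j : ℤ) : ℝ) ^ 2 := by
      push_cast
      nlinarith [sq_nonneg ((j : ℝ) - (k - j))]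
    linarith
  have h2 : (1 + (k : ℝ) ^ 2) ^ (r / 2) ≤ 4 ^ (r / 2) *
      ((1 + (j : ℝ) ^ 2) ^ (r / 2) + (1 + ((k - j : ℤ) : ℝ) ^ 2) ^ (r / 2)) := by
    refine (Real.rpow_le_rpow (by positivity) h1 (by positivity)).trans ?_
    rw [Real.mul_rpow (by norm_num) (by positivity)]
    refine mul_le_mul_of_nonneg_left ?_ (by positivity)
    rcases max_cases (1 + (j : ℝ) ^ 2) (1 + ((k - j : ℤ) : ℝ) ^ 2) with ⟨h, _⟩ | ⟨h, _⟩
    · rw [h]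
      have : 0 ≤ (1 + ((k - j : ℤ) : ℝ) ^ 2) ^ (r / 2) := by positivity
      linarith
    · rw [h]
      have : 0 ≤ (1 + (j : ℝ) ^ 2) ^ (r / 2) := by positivity
      linarith
  rw [wt, wt, wt, ← ENNReal.ofReal_add (by positivity) (by positivity),
    ← ENNReal.ofReal_mul (by positivity)]
  exact ENNReal.ofReal_le_ofReal h2

theorem ennreal_add_sq_le (x y : ℝ≥0∞) : (x + y) ^ 2 ≤ 2 * (x ^ 2 + y ^ 2) := by
  have := ENNReal.rpow_add_le_mul_rpow_add_rpow x y (p := 2) (by norm_num)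
  norm_num at this
  exact this

/-- The constant in the algebra property of `H^r`. -/
def algConst (r : ℝ) : ℝ≥0∞ := ENNReal.ofReal (4 ^ (r / 2)) ^ 2 * (4 * wtSum r)

theorem algConst_ne_top {r : ℝ} (hr : 1 / 2 < r) : algConst r ≠ ⊤ :=
  ENNReal.mul_ne_top (ENNReal.pow_ne_top ENNReal.ofReal_ne_top)
    (ENNReal.mul_ne_top (by norm_num) (wtSum_ne_top hr))

/-- For `r > 1/2` the space `H^r` is an algebra. -/
theorem sob_mul_le {r : ℝ} (hr : 1 / 2 < r) {f g : ℝ → ℂ} (hf : PerCont f) (hg : PerCont g)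
    (h : sob r f ≠ ⊤) : sob r (fun θ => f θ * g θ) ≤ algConst r * (sob r f * sob r g) := by
  set K := ENNReal.ofReal (4 ^ (r / 2)) with hK
  set a : ℤ → ℝ≥0∞ := fun j => ‖cf f j‖ₑ with ha
  set b : ℤ → ℝ≥0∞ := fun j => ‖cf g j‖ₑ with hb
  -- In `X` the weight sits on `f`, in `Y` on `g`. Young's inequality bounds each by a weighted
  -- `ℓ²`-norm times an `ℓ¹`-norm, and the latter is again an `H^r`-norm because `r > 1/2`.
  set X : ℤ → ℝ≥0∞ := fun k => ∑' j, (wt (r / 2) j * a j) * b (k - j) with hX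
  set Y : ℤ → ℝ≥0∞ := fun k => ∑' j, (wt (r / 2) j * b j) * a (k - j) with hY
  have h1 : ∀ k, wt (r / 2) k * ‖cf (fun θ => f θ * g θ) k‖ₑ ≤ K * (X k + Y k) := by
    intro k
    have hY' : Y k = ∑' j, a j * (wt (r / 2) (k - j) * b (k - j)) := by
      rw [hY]
      simp only
      rw [← (Equiv.subLeft k).tsum_eq]
      refine tsum_congr fun j => ?_
      simp only [Equiv.subLeft_apply, sub_sub_cancel]
      ring
    calc wt (r / 2) k * ‖cf (fun θ => f θ * g θ) k‖ₑ
        ≤ wt (r / 2) k * ∑' j, a j * b (k - j) := by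
          gcongr
          exact enorm_cf_mul_le hf hg (summable_norm_cf hr h) k
      _ = ∑' j, wt (r / 2) k * (a j * b (k - j)) := by rw [ENNReal.tsum_mul_left]
      _ ≤ ∑' j, K * ((wt (r / 2) j * a j) * b (k - j) + a j * (wt (r / 2) (k - j) * b (k - j))) := by
          refine ENNReal.tsum_le_tsum fun j => ?_
          calc wt (r / 2) k * (a j * b (k - j))
              ≤ (K * (wt (r / 2) j + wt (r / 2) (k - j))) * (a j * b (k - j)) := by
                gcongr
                exact wt_half_le (by linarith) k j
            _ = _ := by ring
      _ = K * (X k + Y k) := by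
          rw [ENNReal.tsum_mul_left, ENNReal.tsum_add, hY']
  have hS : ∀ φ : ℝ → ℂ, ∑' j, (wt (r / 2) j * ‖cf φ j‖ₑ) ^ 2 = sob r φ := by
    intro φ
    simp only [mul_pow, wt_half_sq]
    rfl
  have hXs : ∑' k, X k ^ 2 ≤ sob r f * (wtSum r * sob r g) := by
    refine (tsum_conv_sq_le _ _).trans ?_
    rw [hS f]
    gcongr
    exact tsum_enorm_cf_sq_le r g
  have hYs : ∑' k, Y k ^ 2 ≤ sob r g * (wtSum r * sob r f) := by
    refine (tsum_conv_sq_le _ _).trans ?_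
    rw [hS g]
    gcongr
    exact tsum_enorm_cf_sq_le r f
  calc sob r (fun θ => f θ * g θ) = ∑' k, (wt (r / 2) k * ‖cf (fun θ => f θ * g θ) k‖ₑ) ^ 2 :=
        (hS _).symm
    _ ≤ ∑' k, K ^ 2 * (2 * (X k ^ 2 + Y k ^ 2)) := by
        refine ENNReal.tsum_le_tsum fun k => ?_
        refine (pow_le_pow_left₀ zero_le (h1 k) 2).trans ?_
        rw [mul_pow]
        gcongr
        exact ennreal_add_sq_le _ _
    _ = K ^ 2 * (2 * (∑' k, X k ^ 2 + ∑' k, Y k ^ 2)) := by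
        rw [ENNReal.tsum_mul_left, ENNReal.tsum_mul_left, ENNReal.tsum_add]
    _ ≤ K ^ 2 * (2 * (sob r f * (wtSum r * sob r g) + sob r g * (wtSum r * sob r f))) := by
        gcongr
    _ = algConst r * (sob r f * sob r g) := by
        rw [algConst]
        ring

/-! ### Interpolation of weighted `ℓ²` bounds -/

section Interpolation

/-- The kernel `t^{-1-θ} tλ / (1 + tλ)`, whose integral over `t > 0` is a multiple of `λ^θ`. -/
def interpKer (θ l t : ℝ) : ℝ := t ^ (-1 - θ) * (t * l / (1 + t * l))

/-- The substitution `t ↦ l t`: the kernel depends on `t l` up to the power `t^{-1-θ}`, whose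
rescaling produces `l^θ`. -/
theorem lintegral_interpKer (θ : ℝ) {l : ℝ} (hl : 0 < l) :
    ∫⁻ t in Set.Ioi (0 : ℝ), ENNReal.ofReal (interpKer θ l t) =
      ENNReal.ofReal (l ^ θ) * ∫⁻ t in Set.Ioi (0 : ℝ), ENNReal.ofReal (interpKer θ 1 t) := by
  have himg : (fun x : ℝ => l * x) '' Set.Ioi 0 = Set.Ioi 0 := by
    rw [Set.image_mul_left_Ioi hl, mul_zero]
  have h1 := MeasureTheory.lintegral_image_eq_lintegral_abs_deriv_mul (s := Set.Ioi (0 : ℝ))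
    (f := fun x => l * x) (f' := fun _ => l) measurableSet_Ioi
    (fun x _ => by simpa using ((hasDerivAt_id x).const_mul l).hasDerivWithinAt)
    (fun x _ y _ h => mul_left_cancel₀ hl.ne' h) (fun t => ENNReal.ofReal (interpKer θ 1 t))
  rw [himg] at h1
  rw [h1, ← MeasureTheory.lintegral_const_mul' _ _ ENNReal.ofReal_ne_top]
  refine MeasureTheory.setLIntegral_congr_fun measurableSet_Ioi fun t ht => ?_
  have ht' : 0 < t := ht
  rw [← ENNReal.ofReal_mul (by positivity), ← ENNReal.ofReal_mul (by positivity), abs_of_pos hl]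
  congr 1
  rw [interpKer, interpKer, mul_one, Real.mul_rpow hl.le ht'.le]
  have e1 : l ^ θ * (l * l ^ (-1 - θ)) = 1 := by
    have : l * l ^ (-1 - θ) = l ^ (-θ) := by
      rw [show -θ = 1 + (-1 - θ) by ring, Real.rpow_add hl, Real.rpow_one]
    rw [this, ← Real.rpow_add hl]
    simp
  rw [mul_comm l t]
  linear_combination (-t ^ (-1 - θ) * (t * l / (1 + t * l))) * e1

/-- The integrand is at most `t^{-θ}` near `0`, integrable because `θ < 1`, and at most `t^{-1-θ}`
near infinity, integrable because `θ > 0`. -/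
theorem lintegral_interpKer_one_ne_top {θ : ℝ} (h0 : 0 < θ) (h1 : θ < 1) :
    ∫⁻ t in Set.Ioi (0 : ℝ), ENNReal.ofReal (interpKer θ 1 t) ≠ ⊤ := by
  rw [← Set.Ioc_union_Ioi_eq_Ioi zero_le_one]
  refine ((MeasureTheory.lintegral_union_le _ _ _).trans_lt (ENNReal.add_lt_top.2 ⟨?_, ?_⟩)).ne
  · have hi : MeasureTheory.IntegrableOn (fun t : ℝ => t ^ (-θ)) (Set.Ioc 0 1) :=
      (intervalIntegrable_iff_integrableOn_Ioc_of_le zero_le_one).1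
        (intervalIntegral.intervalIntegrable_rpow' (by linarith))
    refine lt_of_le_of_lt ?_ hi.lintegral_lt_top
    refine MeasureTheory.setLIntegral_mono' measurableSet_Ioc fun t ht => ?_
    have ht0 : 0 < t := ht.1
    refine ENNReal.ofReal_le_ofReal ?_
    rw [interpKer, show -θ = (-1 - θ) + 1 by ring, Real.rpow_add ht0, Real.rpow_one, mul_one]
    gcongr
    exact div_le_self ht0.le (by linarith)
  · have hi : MeasureTheory.IntegrableOn (fun t : ℝ => t ^ (-1 - θ)) (Set.Ioi 1) :=
      integrableOn_Ioi_rpow_of_lt (by linarith) zero_lt_one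
    refine lt_of_le_of_lt ?_ hi.lintegral_lt_top
    refine MeasureTheory.setLIntegral_mono' measurableSet_Ioi fun t ht => ?_
    have ht0 : 0 < t := zero_lt_one.trans ht
    refine ENNReal.ofReal_le_ofReal ?_
    rw [interpKer, mul_one]
    refine mul_le_of_le_one_right (by positivity) ?_
    rw [div_le_one (by positivity)]
    linarith

theorem measurable_interpKer (θ l : ℝ) : Measurable fun t => ENNReal.ofReal (interpKer θ l t) := by
  unfold interpKer
  fun_prop

theorem lintegral_interpKer_one_ne_zero (θ : ℝ) :
    ∫⁻ t in Set.Ioi (0 : ℝ), ENNReal.ofReal (interpKer θ 1 t) ≠ 0 := by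
  rw [← pos_iff_ne_zero, MeasureTheory.setLIntegral_pos_iff (measurable_interpKer θ 1)]
  have : Set.Ioi (0 : ℝ) ⊆
      Function.support (fun t => ENNReal.ofReal (interpKer θ 1 t)) ∩ Set.Ioi 0 := by
    intro t ht
    have ht0 : 0 < t := ht
    refine ⟨?_, ht⟩
    rw [Function.mem_support, ne_eq, ENNReal.ofReal_eq_zero, not_le, interpKer]
    positivity
  refine lt_of_lt_of_le ?_ (MeasureTheory.measure_mono this)
  simp

/-- Interpolation between weighted `ℓ²` spaces. -/
theorem interpolation (v : ℤ → ℤ → ℂ) (L : ℤ → ℝ) (hL : ∀ k, 0 < L k) (M : ℝ≥0∞)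
    (h0 : ∀ a : ℤ →₀ ℂ, ∑' n, ‖a.sum fun k c => c * v k n‖ₑ ^ 2 ≤ M * ∑' k, ‖a k‖ₑ ^ 2)
    (h1 : ∀ a : ℤ →₀ ℂ, ∑' n, ENNReal.ofReal (L n) * ‖a.sum fun k c => c * v k n‖ₑ ^ 2 ≤
      M * ∑' k, ENNReal.ofReal (L k) * ‖a k‖ₑ ^ 2) {θ : ℝ} (hθ0 : 0 < θ) (hθ1 : θ < 1)
    (a : ℤ →₀ ℂ) :
    ∑' n, ENNReal.ofReal (L n ^ θ) * ‖a.sum fun k c => c * v k n‖ₑ ^ 2 ≤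
      M * ∑' k, ENNReal.ofReal (L k ^ θ) * ‖a k‖ₑ ^ 2 := by
  set T : (ℤ →₀ ℂ) → ℤ → ℂ := fun a n => a.sum fun k c => c * v k n with hT
  have hTadd : ∀ a b n, T (a + b) n = T a n + T b n := by
    intro a b n
    exact Finsupp.sum_add_index' (fun _ => by simp) (fun _ _ _ => by ring)
  have key : ∀ t : ℝ, 0 < t →
      ∑' n, ENNReal.ofReal (t * L n / (1 + t * L n)) * ‖T a n‖ₑ ^ 2 ≤
        M * ∑' k, ENNReal.ofReal (t * L k / (1 + t * L k)) * ‖a k‖ₑ ^ 2 := by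
    intro t ht
    have hp : ∀ k, 0 < 1 + t * L k := fun k => by have := hL k; positivity
    -- The split `a = a0 + a1` minimising `‖a0‖² + t ∑ L |a1|²`; the minimum is `∑ tL/(1 + tL)
    -- |a|²`. For the images `x + y` the same quantity is a lower bound for every split, since the
    -- difference is a multiple of `(‖x‖ - tL ‖y‖)²`.
    let a0 : ℤ →₀ ℂ := Finsupp.onFinset a.support
      (fun k => ((t * L k / (1 + t * L k) : ℝ) : ℂ) * a k) (fun k hk => by
        rw [Finsupp.mem_support_iff]; rintro h; simp [h] at hk)
    let a1 : ℤ →₀ ℂ := Finsupp.onFinset a.support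
      (fun k => ((1 / (1 + t * L k) : ℝ) : ℂ) * a k) (fun k hk => by
        rw [Finsupp.mem_support_iff]; rintro h; simp [h] at hk)
    have ha : a = a0 + a1 := by
      ext k
      simp only [a0, a1, Finsupp.add_apply, Finsupp.onFinset_apply]
      rw [← add_mul, ← Complex.ofReal_add, ← add_div, add_comm (t * L k), div_self (hp k).ne']
      simp
    have e1 : ∀ n, ENNReal.ofReal (t * L n / (1 + t * L n)) * ‖T a n‖ₑ ^ 2 ≤
        ‖T a0 n‖ₑ ^ 2 + ENNReal.ofReal t * (ENNReal.ofReal (L n) * ‖T a1 n‖ₑ ^ 2) := by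
      intro n
      rw [ha, hTadd]
      generalize T a0 n = x
      generalize T a1 n = y
      have hLn := hL n
      have hpn := hp n
      have hc : ∀ w : ℂ, ‖w‖ₑ ^ 2 = ENNReal.ofReal (‖w‖ ^ 2) := fun w => by
        rw [ENNReal.ofReal_pow (norm_nonneg _), ofReal_norm]
      rw [hc, hc, hc, ← ENNReal.ofReal_mul (by positivity), ← ENNReal.ofReal_mul (by positivity),
        ← ENNReal.ofReal_mul (by positivity), ← ENNReal.ofReal_add (by positivity) (by positivity)]
      refine ENNReal.ofReal_le_ofReal ?_
      have h2 : ‖x + y‖ ^ 2 ≤ (‖x‖ + ‖y‖) ^ 2 := pow_le_pow_left₀ (norm_nonneg _) (norm_add_le x y) 2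
      rw [div_mul_eq_mul_div, div_le_iff₀ hpn]
      have h3 : t * L n * ‖x + y‖ ^ 2 ≤ t * L n * (‖x‖ + ‖y‖) ^ 2 := by gcongr
      nlinarith [sq_nonneg (‖x‖ - t * L n * ‖y‖)]
    have e2 : ∀ k, ‖a0 k‖ₑ ^ 2 + ENNReal.ofReal t * (ENNReal.ofReal (L k) * ‖a1 k‖ₑ ^ 2) =
        ENNReal.ofReal (t * L k / (1 + t * L k)) * ‖a k‖ₑ ^ 2 := by
      intro k
      have hLn := hL k
      have hpn := hp k
      have hc : ∀ w : ℂ, ‖w‖ₑ ^ 2 = ENNReal.ofReal (‖w‖ ^ 2) := fun w => by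
        rw [ENNReal.ofReal_pow (norm_nonneg _), ofReal_norm]
      rw [hc, hc, hc, ← ENNReal.ofReal_mul (by positivity), ← ENNReal.ofReal_mul (by positivity),
        ← ENNReal.ofReal_mul (by positivity), ← ENNReal.ofReal_add (by positivity) (by positivity)]
      congr 1
      simp only [a0, a1, Finsupp.onFinset_apply, norm_mul, Complex.norm_real, mul_pow,
        Real.norm_eq_abs, sq_abs]
      field_simp
      ring
    calc ∑' n, ENNReal.ofReal (t * L n / (1 + t * L n)) * ‖T a n‖ₑ ^ 2
        ≤ ∑' n, (‖T a0 n‖ₑ ^ 2 + ENNReal.ofReal t * (ENNReal.ofReal (L n) * ‖T a1 n‖ₑ ^ 2)) :=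
          ENNReal.tsum_le_tsum e1
      _ = ∑' n, ‖T a0 n‖ₑ ^ 2 + ENNReal.ofReal t * ∑' n, ENNReal.ofReal (L n) * ‖T a1 n‖ₑ ^ 2 := by
          rw [ENNReal.tsum_add, ENNReal.tsum_mul_left]
      _ ≤ M * ∑' k, ‖a0 k‖ₑ ^ 2 +
          ENNReal.ofReal t * (M * ∑' k, ENNReal.ofReal (L k) * ‖a1 k‖ₑ ^ 2) := by
          gcongr
          · exact h0 a0
          · exact h1 a1
      _ = M * ∑' k, (‖a0 k‖ₑ ^ 2 + ENNReal.ofReal t * (ENNReal.ofReal (L k) * ‖a1 k‖ₑ ^ 2)) := by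
          rw [ENNReal.tsum_add, ENNReal.tsum_mul_left]
          ring
      _ = _ := by simp only [e2]
  set c := ∫⁻ t in Set.Ioi (0 : ℝ), ENNReal.ofReal (interpKer θ 1 t) with hc
  have hsplit : ∀ t : ℝ, 0 < t → ∀ k, ENNReal.ofReal (interpKer θ (L k) t) =
      ENNReal.ofReal (t ^ (-1 - θ)) * ENNReal.ofReal (t * L k / (1 + t * L k)) := by
    intro t ht k
    rw [interpKer, ENNReal.ofReal_mul (by positivity)]
  -- Integrating the bound for fixed `t` against `t^{-1-θ} dt` turns `tL/(1 + tL)` into `c L^θ`,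
  -- with the same finite nonzero `c` on both sides. This is why no constant is lost.
  have hint : ∀ x : ℤ → ℂ, ∫⁻ t in Set.Ioi (0 : ℝ),
      ∑' k, ENNReal.ofReal (interpKer θ (L k) t) * ‖x k‖ₑ ^ 2 =
      c * ∑' k, ENNReal.ofReal (L k ^ θ) * ‖x k‖ₑ ^ 2 := by
    intro x
    rw [MeasureTheory.lintegral_tsum
      fun k => ((measurable_interpKer θ (L k)).mul_const _).aemeasurable, ← ENNReal.tsum_mul_left]
    refine tsum_congr fun k => ?_
    rw [MeasureTheory.lintegral_mul_const _ (measurable_interpKer θ (L k)),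
      lintegral_interpKer θ (hL k)]
    ring
  have hfin : c * ∑' n, ENNReal.ofReal (L n ^ θ) * ‖T a n‖ₑ ^ 2 ≤
      c * (M * ∑' k, ENNReal.ofReal (L k ^ θ) * ‖a k‖ₑ ^ 2) := by
    rw [← hint, mul_left_comm, ← hint, ← MeasureTheory.lintegral_const_mul]
    · refine MeasureTheory.setLIntegral_mono' measurableSet_Ioi fun t ht => ?_
      simp only [hsplit t ht, mul_assoc, ENNReal.tsum_mul_left]
      rw [mul_left_comm M]
      gcongr
      exact key t ht
    · exact Measurable.tsum fun k => (measurable_interpKer θ (L k)).mul_const _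
  exact (ENNReal.mul_le_mul_iff_right (lintegral_interpKer_one_ne_zero θ)
    (lintegral_interpKer_one_ne_top hθ0 hθ1)).1 hfin

end Interpolation

/-! ### Lifts of circle diffeomorphisms and changes of variables -/

/-- Lifts of orientation preserving `C¹`-diffeomorphisms of the circle. -/
structure Lift (ψ : ℝ → ℝ) : Prop where
  contDiff : ContDiff ℝ 1 ψ
  deriv_pos : ∀ θ, 0 < deriv ψ θ
  map_add : ∀ θ, ψ (θ + 2 * Real.pi) = ψ θ + 2 * Real.pi

namespace Lift
variable {ψ χ : ℝ → ℝ}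

theorem hasDerivAt (h : Lift ψ) (θ : ℝ) : HasDerivAt ψ (deriv ψ θ) θ :=
  (h.contDiff.differentiable one_ne_zero θ).hasDerivAt

theorem continuous_deriv (h : Lift ψ) : Continuous (deriv ψ) := h.contDiff.continuous_deriv_one

theorem deriv_add (h : Lift ψ) (θ : ℝ) : deriv ψ (θ + 2 * Real.pi) = deriv ψ θ := by
  have h1 : deriv (fun θ => ψ (θ + 2 * Real.pi)) θ = deriv ψ (θ + 2 * Real.pi) :=
    deriv_comp_add_const ψ _ _
  rw [← h1]
  simp only [h.map_add]
  exact deriv_add_const _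

theorem perCont_deriv (h : Lift ψ) : PerCont fun θ => ((deriv ψ θ : ℝ) : ℂ) :=
  ⟨Complex.continuous_ofReal.comp h.continuous_deriv, fun θ => by rw [h.deriv_add]⟩

theorem perCont_sub_id (h : Lift ψ) : PerCont fun θ => ((ψ θ - θ : ℝ) : ℂ) :=
  ⟨Complex.continuous_ofReal.comp (h.contDiff.continuous.sub continuous_id), fun θ => by
    rw [h.map_add]; ring_nf⟩

theorem exists_deriv_le (h : Lift ψ) : ∃ M, 0 < M ∧ ∀ θ, deriv ψ θ ≤ M := by
  obtain ⟨C, hC0, hC⟩ := h.perCont_deriv.bounded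
  refine ⟨C + 1, by positivity, fun θ => ?_⟩
  have h1 := hC θ
  rw [Complex.norm_real] at h1
  exact (le_abs_self _).trans (h1.trans (by linarith))

theorem exists_le_deriv (h : Lift ψ) : ∃ m, 0 < m ∧ ∀ θ, m ≤ deriv ψ θ := by
  have hp : PerCont fun θ => (((deriv ψ θ : ℝ) : ℂ)⁻¹) :=
    ⟨h.perCont_deriv.cont.inv₀ fun θ => Complex.ofReal_ne_zero.2 (h.deriv_pos θ).ne',
      fun θ => by rw [h.deriv_add]⟩
  obtain ⟨C, hC0, hC⟩ := hp.bounded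
  refine ⟨(C + 1)⁻¹, by positivity, fun θ => ?_⟩
  have h1 := hC θ
  rw [norm_inv, Complex.norm_real, Real.norm_of_nonneg (h.deriv_pos θ).le] at h1
  exact inv_le_of_inv_le₀ (h.deriv_pos θ) (h1.trans (by linarith))

theorem strictMono (h : Lift ψ) : StrictMono ψ := strictMono_of_deriv_pos h.deriv_pos

theorem exists_abs_sub_le (h : Lift ψ) : ∃ C, 0 ≤ C ∧ ∀ θ, |ψ θ - θ| ≤ C := by
  obtain ⟨C, hC0, hC⟩ := h.perCont_sub_id.bounded
  refine ⟨C, hC0, fun θ => ?_⟩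
  have h1 := hC θ
  rwa [Complex.norm_real] at h1

theorem surjective (h : Lift ψ) : Function.Surjective ψ := by
  obtain ⟨C, hC0, hC⟩ := h.exists_abs_sub_le
  refine h.contDiff.continuous.surjective ?_ ?_
  · refine tendsto_atTop_mono (fun θ => ?_) (tendsto_atTop_add_const_right atTop (-C) tendsto_id)
    have := (abs_le.1 (hC θ)).1
    simp only [id]
    linarith
  · refine tendsto_atBot_mono (fun θ => ?_) (tendsto_atBot_add_const_right atBot C tendsto_id)
    have := (abs_le.1 (hC θ)).2
    simp only [id]
    linarith

/-- The inverse of a lift. -/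
theorem exists_inv (h : Lift ψ) : ∃ φ : ℝ → ℝ, Lift φ ∧ (∀ θ, φ (ψ θ) = θ) ∧ (∀ θ, ψ (φ θ) = θ) ∧
    ∀ θ, deriv φ θ = (deriv ψ (φ θ))⁻¹ := by
  let e := h.strictMono.orderIsoOfSurjective ψ h.surjective
  have e1 : ∀ θ, e.symm (ψ θ) = θ := fun θ => e.symm_apply_apply θ
  have e2 : ∀ θ, ψ (e.symm θ) = θ := fun θ => e.apply_symm_apply θ
  have hd : ∀ θ, HasDerivAt e.symm (deriv ψ (e.symm θ))⁻¹ θ := fun θ =>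
    HasDerivAt.of_local_left_inverse e.symm.continuous.continuousAt (h.hasDerivAt _)
      (h.deriv_pos _).ne' (Eventually.of_forall e2)
  have hd' : ∀ θ, deriv e.symm θ = (deriv ψ (e.symm θ))⁻¹ := fun θ => (hd θ).deriv
  refine ⟨e.symm, ⟨?_, ?_, ?_⟩, e1, e2, hd'⟩
  · rw [contDiff_one_iff_deriv]
    refine ⟨fun θ => (hd θ).differentiableAt, ?_⟩
    rw [funext hd']
    exact (h.continuous_deriv.comp e.symm.continuous).inv₀ fun θ => (h.deriv_pos _).ne'
  · intro θ
    rw [hd']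
    exact inv_pos.2 (h.deriv_pos _)
  · intro θ
    apply h.strictMono.injective
    rw [h.map_add, e2, e2]

theorem comp (h : Lift ψ) (h' : Lift χ) : Lift fun θ => ψ (χ θ) := by
  have hd : ∀ θ, HasDerivAt (fun θ => ψ (χ θ)) (deriv ψ (χ θ) * deriv χ θ) θ := fun θ =>
    (h.hasDerivAt _).comp θ (h'.hasDerivAt θ)
  refine ⟨h.contDiff.comp h'.contDiff, fun θ => ?_, fun θ => ?_⟩
  · rw [(hd θ).deriv]
    exact mul_pos (h.deriv_pos _) (h'.deriv_pos _)
  · rw [h'.map_add, h.map_add]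

theorem deriv_comp (h : Lift ψ) (h' : Lift χ) (θ : ℝ) :
    deriv (fun θ => ψ (χ θ)) θ = deriv ψ (χ θ) * deriv χ θ :=
  ((h.hasDerivAt _).comp θ (h'.hasDerivAt θ)).deriv

theorem perCont_comp (h : Lift ψ) {f : ℝ → ℂ} (hf : PerCont f) : PerCont fun θ => f (ψ θ) :=
  ⟨hf.cont.comp h.contDiff.continuous, fun θ => by rw [h.map_add, hf.per]⟩

theorem integral_comp (h : Lift ψ) {G : ℝ → ℂ} (hG : PerCont G) :
    ∫ θ in (0 : ℝ)..2 * Real.pi, ((deriv ψ θ : ℝ) : ℂ) * G (ψ θ) = ∫ θ in (0 : ℝ)..2 * Real.pi, G θ := by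
  have h1 := intervalIntegral.integral_deriv_smul_comp (a := 0) (b := 2 * Real.pi) (g := G)
    (fun θ _ => h.hasDerivAt θ) h.continuous_deriv.continuousOn hG.cont
  simp only [Complex.real_smul, Function.comp_apply] at h1
  rw [h1]
  have h2 : ψ (2 * Real.pi) = ψ 0 + 2 * Real.pi := by simpa using h.map_add 0
  have hp : Function.Periodic G (2 * Real.pi) := hG.per
  rw [h2, hp.intervalIntegral_add_eq (ψ 0) 0, zero_add]

/-- The substitution `θ ↦ ψ θ` removes the composition from `f`: coefficients of `f ∘ ψ⁻¹` become
oscillatory integrals with phase `ψ` and density `ψ'`. -/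
theorem cf_comp (h : Lift ψ) {f : ℝ → ℂ} (hf : PerCont f) {φ : ℝ → ℝ}
    (hφψ : ∀ θ, φ (ψ θ) = θ) (hφ : Lift φ) (n : ℤ) : cf (fun θ => f (φ θ)) n =
      (2 * Real.pi : ℂ)⁻¹ * ∫ θ in (0 : ℝ)..2 * Real.pi, ((deriv ψ θ : ℝ) : ℂ) * (ex (-n) (ψ θ) * f θ) := by
  rw [cf_eq, ← h.integral_comp ((perCont_ex (-n)).mul (hφ.perCont_comp hf))]
  simp only [hφψ]

/-- `∫ |f ∘ ψ|² ≤ m⁻¹ ∫ ψ' |f ∘ ψ|² = m⁻¹ ∫ |f|²`. -/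
theorem sob_zero_comp (h : Lift ψ) {m : ℝ} (hm : 0 < m) (hψ : ∀ θ, m ≤ deriv ψ θ) {f : ℝ → ℂ}
    (hf : PerCont f) : sob 0 (fun θ => f (ψ θ)) ≤ ENNReal.ofReal m⁻¹ * sob 0 f := by
  have hG : PerCont fun θ => ((‖f θ‖ ^ 2 : ℝ) : ℂ) :=
    ⟨Complex.continuous_ofReal.comp (hf.cont.norm.pow 2), fun θ => by rw [hf.per]⟩
  have h1 := h.integral_comp hG
  simp only [← Complex.ofReal_mul] at h1
  rw [intervalIntegral.integral_ofReal, intervalIntegral.integral_ofReal, Complex.ofReal_inj] at h1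
  rw [sob_zero_eq hf.cont, sob_zero_eq (h.perCont_comp hf).cont,
    ← ENNReal.ofReal_mul (by positivity), ← h1]
  refine ENNReal.ofReal_le_ofReal ?_
  rw [mul_left_comm, ← intervalIntegral.integral_const_mul m⁻¹]
  refine mul_le_mul_of_nonneg_left ?_ (by positivity)
  refine intervalIntegral.integral_mono_on Real.two_pi_pos.le
    (((h.perCont_comp hf).cont.norm.pow 2).intervalIntegrable _ _)
    (Continuous.intervalIntegrable ?_ _ _) fun θ _ => ?_
  · exact continuous_const.mul (h.continuous_deriv.mul ((h.perCont_comp hf).cont.norm.pow 2))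
  · rw [← mul_assoc]
    refine le_mul_of_one_le_left (by positivity) ?_
    rw [← inv_mul_cancel₀ hm.ne']
    exact mul_le_mul_of_nonneg_left (hψ θ) (by positivity)

end Lift

theorem PerCont.deriv {f : ℝ → ℂ} (hf : PerCont f) (h : ContDiff ℝ 1 f) : PerCont (deriv f) := by
  refine ⟨h.continuous_deriv_one, fun θ => ?_⟩
  have h1 : _root_.deriv (fun θ => f (θ + 2 * Real.pi)) θ = _root_.deriv f (θ + 2 * Real.pi) :=
    deriv_comp_add_const f _ _
  rw [← h1]
  simp only [hf.per]

theorem PerCont.sob_add_one {f : ℝ → ℂ} (hf : PerCont f) (h : ContDiff ℝ 1 f) (r : ℝ) :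
    sob (r + 1) f = sob r f + sob r (_root_.deriv f) := U1Current.sob_add_one r h hf.per

theorem PerCont.sob_one {f : ℝ → ℂ} (hf : PerCont f) (h : ContDiff ℝ 1 f) :
    sob 1 f = sob 0 f + sob 0 (_root_.deriv f) := by
  have := hf.sob_add_one h 0
  rwa [zero_add] at this

theorem PerCont.sob_two {f : ℝ → ℂ} (hf : PerCont f) (h : ContDiff ℝ 1 f) :
    sob 2 f = sob 1 f + sob 1 (_root_.deriv f) := by
  have := hf.sob_add_one h 1
  norm_num at this
  exact this

/-! ### Trigonometric polynomials and passage to the limit -/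

/-- Finite linear combinations `∑ aₖ Eₖ` of functions. -/
def comb (E : ℤ → ℝ → ℂ) (a : ℤ →₀ ℂ) (θ : ℝ) : ℂ := a.sum fun k c => c * E k θ

theorem cf_comb {E : ℤ → ℝ → ℂ} (hE : ∀ k, Continuous (E k)) (a : ℤ →₀ ℂ) (n : ℤ) :
    cf (comb E a) n = a.sum fun k c => c * cf (E k) n := by
  have h : comb E a = fun θ => ∑ k ∈ a.support, a k * E k θ := rfl
  rw [h, cf_sum _ (fun k θ => a k * E k θ) fun k => continuous_const.mul (hE k)]
  simp only [cf_const_mul]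
  rfl

theorem cf_comb_ex (a : ℤ →₀ ℂ) (n : ℤ) : cf (comb ex a) n = a n := by
  rw [cf_comb continuous_ex]
  simp only [cf_ex, mul_ite, mul_one, mul_zero]
  simp [Finsupp.sum, eq_comm]

theorem contDiff_comb_ex (a : ℤ →₀ ℂ) : ContDiff ℝ ∞ (comb ex a) := by
  have h : comb ex a = fun θ => ∑ k ∈ a.support, a k * ex k θ := rfl
  rw [h]
  exact ContDiff.sum fun k _ => contDiff_const.mul (contDiff_ex k)

theorem perCont_comb_ex (a : ℤ →₀ ℂ) : PerCont (comb ex a) :=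
  ⟨(contDiff_comb_ex a).continuous, fun θ => by simp only [comb, ex_per]⟩

/-- Interpolation between `L²` and `H^t` for the linear map `e^{ikθ} ↦ E k`, on trigonometric
polynomials only; general functions follow by lower semicontinuity of the Sobolev norm. At `η = 1`
the upper endpoint is used directly. -/
theorem sob_comb_interpolation {E : ℤ → ℝ → ℂ} (hE : ∀ k, Continuous (E k)) (t : ℝ) (M : ℝ≥0∞)
    (h0 : ∀ a, sob 0 (comb E a) ≤ M * sob 0 (comb ex a))
    (h1 : ∀ a, sob t (comb E a) ≤ M * sob t (comb ex a)) {η : ℝ} (hη0 : 0 < η) (hη1 : η ≤ 1)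
    (a : ℤ →₀ ℂ) : sob (t * η) (comb E a) ≤ M * sob (t * η) (comb ex a) := by
  rcases hη1.lt_or_eq with hη | rfl
  · have key := interpolation (fun k n => cf (E k) n) (fun k => (1 + (k : ℝ) ^ 2) ^ t)
      (fun k => by positivity) M (fun a => ?_) (fun a => ?_) hη0 hη a
    · have hp : ∀ k : ℤ, ((1 + (k : ℝ) ^ 2) ^ t) ^ η = (1 + (k : ℝ) ^ 2) ^ (t * η) := fun k =>
        (Real.rpow_mul (by positivity) _ _).symm
      simp only [hp, ← cf_comb hE] at key
      simpa only [sob, wt, cf_comb_ex] using key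
    · simpa only [sob, wt_zero, one_mul, cf_comb_ex, cf_comb hE] using h0 a
    · simpa only [sob, wt, cf_comb_ex, cf_comb hE] using h1 a
  · rw [mul_one]
    exact h1 a

/-- The Fourier partial sums. -/
def partialSum (f : ℝ → ℂ) (s : Finset ℤ) : ℤ →₀ ℂ :=
  Finsupp.onFinset s (fun k => if k ∈ s then cf f k else 0) fun k hk => by
    by_contra h
    simp [h] at hk

theorem comb_partialSum (E : ℤ → ℝ → ℂ) (f : ℝ → ℂ) (s : Finset ℤ) (θ : ℝ) :
    comb E (partialSum f s) θ = ∑ k ∈ s, cf f k * E k θ := by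
  rw [comb, partialSum, Finsupp.onFinset_sum _ (fun _ => by simp)]
  exact Finset.sum_congr rfl fun k hk => by rw [if_pos hk]

theorem sob_partialSum_le (r : ℝ) (f : ℝ → ℂ) (s : Finset ℤ) :
    sob r (comb ex (partialSum f s)) ≤ sob r f := by
  refine ENNReal.tsum_le_tsum fun k => ?_
  rw [cf_comb_ex]
  gcongr
  simp only [partialSum, Finsupp.onFinset_apply]
  split_ifs <;> simp

theorem tendstoUniformly_partialSum {f : ℝ → ℂ} (hf : PerCont f) (h : Summable fun k => ‖cf f k‖) :
    TendstoUniformly (fun s => comb ex (partialSum f s)) f atTop := by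
  have h1 : (fun s => comb ex (partialSum f s)) = fun (s : Finset ℤ) θ => ∑ k ∈ s, cf f k * ex k θ :=
    funext fun s => funext fun θ => comb_partialSum ex f s θ
  rw [h1]
  exact tendstoUniformly_partialSums hf h

/-- A Sobolev bound for trigonometric polynomials extends to continuous functions. -/
theorem sob_le_of_partialSum {r t : ℝ} {f : ℝ → ℂ} (hf : PerCont f)
    (T : (ℝ → ℂ) → ℝ → ℂ) (hT : ∀ f, Continuous f → Continuous (T f)) (C : ℝ)
    (hTC : ∀ f g : ℝ → ℂ, ∀ ε, (∀ θ, ‖f θ - g θ‖ ≤ ε) → ∀ θ, ‖T f θ - T g θ‖ ≤ C * ε) {M : ℝ≥0∞}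
    (hM : ∀ a, sob r (T (comb ex a)) ≤ M * sob t (comb ex a)) (hs : Summable fun k => ‖cf f k‖) :
    sob r (T f) ≤ M * sob t f := by
  have h1 : TendstoUniformly (fun s => T (comb ex (partialSum f s))) (T f) atTop := by
    have h2 := tendstoUniformly_partialSum hf hs
    rw [Metric.tendstoUniformly_iff] at h2 ⊢
    intro ε hε
    filter_upwards [h2 (ε / (|C| + 1)) (by positivity)] with s hs θ
    have h3 := hTC f (comb ex (partialSum f s)) (ε / (|C| + 1))
      (fun θ => by rw [← dist_eq_norm]; exact (hs θ).le) θ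
    rw [dist_eq_norm]
    refine h3.trans_lt ?_
    rw [mul_div_assoc', div_lt_iff₀ (by positivity)]
    nlinarith [le_abs_self C]
  refine sob_le_of_tendsto (fun k => tendsto_cf (fun s => hT _ (perCont_comb_ex _).cont)
    (hT f hf.cont) h1 k) (Eventually.of_forall fun s => (hM _).trans ?_)
  gcongr
  exact sob_partialSum_le t f s

theorem sob_comb_ne_top (r : ℝ) (a : ℤ →₀ ℂ) : sob r (comb ex a) ≠ ⊤ := by
  rw [sob, tsum_eq_sum (s := a.support)]
  · exact ENNReal.sum_ne_top.2 fun k _ => ENNReal.mul_ne_top (wt_ne_top r k)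
      (ENNReal.pow_ne_top enorm_ne_top)
  · intro k hk
    rw [cf_comb_ex, Finsupp.notMem_support_iff.1 hk]
    simp

theorem exists_deriv_comb (a : ℤ →₀ ℂ) : ∃ b, deriv (comb ex a) = comb ex b := by
  refine ⟨Finsupp.onFinset a.support (fun k => a k * (k * Complex.I)) fun k hk => ?_, ?_⟩
  · rw [Finsupp.mem_support_iff]
    rintro h
    simp [h] at hk
  · funext θ
    rw [comb, Finsupp.onFinset_sum _ (fun _ => by simp)]
    have h : comb ex a = fun θ => ∑ k ∈ a.support, a k * ex k θ := rfl
    rw [h]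
    have h1 : HasDerivAt (fun θ => ∑ k ∈ a.support, a k * ex k θ)
        (∑ k ∈ a.support, a k * (k * Complex.I * ex k θ)) θ :=
      HasDerivAt.fun_sum fun k _ => (hasDerivAt_ex k θ).const_mul _
    rw [h1.deriv]
    exact Finset.sum_congr rfl fun k _ => by ring

/-- The termwise derivative has coefficients in the weighted space of order `r - 1 > 1/2`, so it
converges absolutely and uniformly. -/
theorem contDiff_one_of_sob {r : ℝ} (hr : 3 / 2 < r) {f : ℝ → ℂ} (hf : PerCont f)
    (h : sob r f ≠ ⊤) : ContDiff ℝ 1 f := by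
  have h1 : ∑' k : ℤ, ‖(k : ℂ) * Complex.I * cf f k‖ₑ ≠ ⊤ := by
    intro h0
    have h2 := tsum_enorm_sq_le (r - 1) fun k : ℤ => ‖(k : ℂ) * Complex.I * cf f k‖ₑ
    rw [h0, ENNReal.top_pow two_ne_zero, top_le_iff] at h2
    refine ENNReal.mul_ne_top (wtSum_ne_top (by linarith)) (ne_top_of_le_ne_top h ?_) h2
    refine ENNReal.tsum_le_tsum fun k => ?_
    have : ‖(k : ℂ) * Complex.I‖ₑ ^ 2 = ENNReal.ofReal ((k : ℝ) ^ 2) := by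
      rw [← ofReal_norm, ← ENNReal.ofReal_pow (norm_nonneg _)]
      simp
    rw [enorm_mul, mul_pow, this, ← mul_assoc]
    gcongr
    calc wt (r - 1) k * ENNReal.ofReal ((k : ℝ) ^ 2) ≤ wt (r - 1) k * wt 1 k := by
          gcongr
          rw [wt_one]
          exact le_add_self
      _ = wt r k := by rw [← wt_add, sub_add_cancel]
  have hs : Summable fun k : ℤ => ‖(k : ℂ) * Complex.I * cf f k‖ := by
    simpa using ENNReal.summable_toReal h1
  have hs0 := summable_norm_cf (by linarith) h
  have hd : ∀ θ, HasDerivAt f (∑' k : ℤ, (k * Complex.I * cf f k) * ex k θ) θ := by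
    intro θ
    have h2 := hasDerivAt_tsum hs (g := fun k θ => cf f k * ex k θ)
      (g' := fun k θ => (k * Complex.I * cf f k) * ex k θ) (y₀ := 0)
      (fun k y => ((hasDerivAt_ex k y).const_mul (cf f k)).congr_deriv (by ring))
      (fun k y => by rw [norm_mul, norm_ex, mul_one]) (summable_series hs0 0) θ
    rwa [series_cf hf hs0] at h2
  rw [contDiff_one_iff_deriv]
  refine ⟨fun θ => (hd θ).differentiableAt, ?_⟩
  rw [show deriv f = _ from funext fun θ => (hd θ).deriv]
  exact (perCont_series hs).cont

theorem sob_const_ne_top (r : ℝ) (c : ℂ) : sob r (fun _ => c) ≠ ⊤ := by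
  have h : (fun _ => c) = comb ex (Finsupp.single 0 c) := by
    funext θ
    rw [comb, Finsupp.sum_single_index (by simp), ex_zero, mul_one]
  rw [h]
  exact sob_comb_ne_top r _

theorem sob_add_ne_top {r : ℝ} {f g : ℝ → ℂ} (hf : Continuous f) (hg : Continuous g)
    (h1 : sob r f ≠ ⊤) (h2 : sob r g ≠ ⊤) : sob r (fun θ => f θ + g θ) ≠ ⊤ :=
  ne_top_of_le_ne_top (ENNReal.mul_ne_top (by norm_num) (ENNReal.add_ne_top.2 ⟨h1, h2⟩))
    (sob_add_le r hf hg)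

theorem sob_neg (r : ℝ) (f : ℝ → ℂ) : sob r (fun θ => -f θ) = sob r f := by
  have := sob_const_mul r (-1) f
  simpa using this

theorem sob_sub_ne_top {r : ℝ} {f g : ℝ → ℂ} (hf : Continuous f) (hg : Continuous g)
    (h1 : sob r f ≠ ⊤) (h2 : sob r g ≠ ⊤) : sob r (fun θ => f θ - g θ) ≠ ⊤ := by
  simp only [sub_eq_add_neg]
  exact sob_add_ne_top hf hg.neg h1 (by rwa [sob_neg])

theorem sob_mul_ne_top {r : ℝ} (hr : 1 / 2 < r) {f g : ℝ → ℂ} (hf : PerCont f) (hg : PerCont g)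
    (h1 : sob r f ≠ ⊤) (h2 : sob r g ≠ ⊤) : sob r (fun θ => f θ * g θ) ≠ ⊤ :=
  ne_top_of_le_ne_top (ENNReal.mul_ne_top (algConst_ne_top hr) (ENNReal.mul_ne_top h1 h2))
    (sob_mul_le hr hf hg h1)

namespace Lift
variable {ψ : ℝ → ℝ}

theorem hasDerivAt_comp (h : Lift ψ) {f : ℝ → ℂ} (hf : ContDiff ℝ 1 f) (θ : ℝ) :
    HasDerivAt (fun θ => f (ψ θ)) (deriv f (ψ θ) * ((deriv ψ θ : ℝ) : ℂ)) θ := by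
  have h1 := HasDerivAt.scomp θ (hf.differentiable one_ne_zero (ψ θ)).hasDerivAt (h.hasDerivAt θ)
  rw [Complex.real_smul, mul_comm] at h1
  exact h1

theorem deriv_fun_comp (h : Lift ψ) {f : ℝ → ℂ} (hf : ContDiff ℝ 1 f) :
    deriv (fun θ => f (ψ θ)) = fun θ => deriv f (ψ θ) * ((deriv ψ θ : ℝ) : ℂ) :=
  funext fun θ => (h.hasDerivAt_comp hf θ).deriv

theorem contDiff_comp (h : Lift ψ) {f : ℝ → ℂ} (hf : ContDiff ℝ 1 f) :
    ContDiff ℝ 1 fun θ => f (ψ θ) := hf.comp h.contDiff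

theorem hasDerivAt_sub_id (h : Lift ψ) (θ : ℝ) :
    HasDerivAt (fun θ => ((ψ θ - θ : ℝ) : ℂ)) (((deriv ψ θ : ℝ) : ℂ) - 1) θ := by
  have := ((h.hasDerivAt θ).sub (hasDerivAt_id θ)).ofReal_comp
  simpa using this

theorem contDiff_sub_id (h : Lift ψ) : ContDiff ℝ 1 fun θ => ((ψ θ - θ : ℝ) : ℂ) :=
  Complex.ofRealCLM.contDiff.comp (h.contDiff.sub contDiff_id)

theorem sob_sub_id (h : Lift ψ) (r : ℝ) : sob (r + 1) (fun θ => ((ψ θ - θ : ℝ) : ℂ)) =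
    sob r (fun θ => ((ψ θ - θ : ℝ) : ℂ)) + sob r fun θ => ((deriv ψ θ : ℝ) : ℂ) - 1 := by
  rw [h.perCont_sub_id.sob_add_one h.contDiff_sub_id, funext fun θ => (h.hasDerivAt_sub_id θ).deriv]

theorem sob_deriv_ne_top (h : Lift ψ) {r : ℝ}
    (hr : sob (r + 1) (fun θ => ((ψ θ - θ : ℝ) : ℂ)) ≠ ⊤) :
    sob r (fun θ => ((deriv ψ θ : ℝ) : ℂ)) ≠ ⊤ := by
  rw [h.sob_sub_id, ENNReal.add_ne_top] at hr
  have := sob_add_ne_top (h.perCont_deriv.cont.sub continuous_const) continuous_const hr.2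
    (sob_const_ne_top r 1)
  simpa using this

end Lift

/-! ### Composition with a diffeomorphism on Sobolev spaces -/

/-- The constant in the bound for the composition with a lift on `H¹`. -/
def compConst (m M : ℝ) : ℝ≥0∞ := ENNReal.ofReal m⁻¹ * (1 + ENNReal.ofReal (M ^ 2))

theorem compConst_ne_top (m M : ℝ) : compConst m M ≠ ⊤ :=
  ENNReal.mul_ne_top ENNReal.ofReal_ne_top
    (ENNReal.add_ne_top.2 ⟨ENNReal.one_ne_top, ENNReal.ofReal_ne_top⟩)

namespace Lift
variable {ψ : ℝ → ℝ} {m M : ℝ}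

theorem sob_one_comp_of_contDiff (h : Lift ψ) (hm : 0 < m) (hψ : ∀ θ, m ≤ deriv ψ θ)
    (hM : ∀ θ, deriv ψ θ ≤ M) {f : ℝ → ℂ} (hf : PerCont f) (hf1 : ContDiff ℝ 1 f) :
    sob 1 (fun θ => f (ψ θ)) ≤ compConst m M * sob 1 f := by
  have hf' := hf.deriv hf1
  rw [(h.perCont_comp hf).sob_one (h.contDiff_comp hf1), h.deriv_fun_comp hf1, hf.sob_one hf1]
  have h1 := h.sob_zero_comp hm hψ hf
  have h2 := h.sob_zero_comp hm hψ hf'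
  have h3 := sob_zero_mul_le (h.perCont_comp hf').cont h.perCont_deriv.cont (C := M) fun θ => by
    rw [Complex.norm_real, Real.norm_of_nonneg (h.deriv_pos θ).le]
    exact hM θ
  calc _ ≤ ENNReal.ofReal m⁻¹ * sob 0 f +
        ENNReal.ofReal (M ^ 2) * (ENNReal.ofReal m⁻¹ * sob 0 (deriv f)) := by
        refine add_le_add h1 (h3.trans ?_)
        gcongr
    -- Adding the missing nonnegative cross terms makes the bound factor as a constant times the
    -- full `H¹`-norm.
    _ ≤ ENNReal.ofReal m⁻¹ * sob 0 f +
        ENNReal.ofReal (M ^ 2) * (ENNReal.ofReal m⁻¹ * sob 0 (deriv f)) +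
        (ENNReal.ofReal (M ^ 2) * ENNReal.ofReal m⁻¹ * sob 0 f +
          ENNReal.ofReal m⁻¹ * sob 0 (deriv f)) := le_self_add
    _ = _ := by
        rw [compConst]
        ring

theorem sob_comp_of_comb (h : Lift ψ) {r t : ℝ} {K : ℝ≥0∞}
    (hK : ∀ a, sob r (fun θ => comb ex a (ψ θ)) ≤ K * sob t (comb ex a)) {f : ℝ → ℂ}
    (hf : PerCont f) (hs : Summable fun k => ‖cf f k‖) : sob r (fun θ => f (ψ θ)) ≤ K * sob t f :=
  sob_le_of_partialSum hf (fun f θ => f (ψ θ)) (fun _ hf => hf.comp h.contDiff.continuous) 1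
    (fun _ _ ε hfg θ => by rw [one_mul]; exact hfg (ψ θ)) hK hs

theorem sob_one_comp (h : Lift ψ) (hm : 0 < m) (hψ : ∀ θ, m ≤ deriv ψ θ)
    (hM : ∀ θ, deriv ψ θ ≤ M) {f : ℝ → ℂ} (hf : PerCont f) (hft : sob 1 f ≠ ⊤) :
    sob 1 (fun θ => f (ψ θ)) ≤ compConst m M * sob 1 f :=
  h.sob_comp_of_comb (fun a => h.sob_one_comp_of_contDiff hm hψ hM
    (perCont_comb_ex a) ((contDiff_comb_ex a).of_le (by simp))) hf
    (summable_norm_cf (by norm_num) hft)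

theorem sob_one_comp_ne_top (h : Lift ψ) {f : ℝ → ℂ} (hf : PerCont f) (hft : sob 1 f ≠ ⊤) :
    sob 1 (fun θ => f (ψ θ)) ≠ ⊤ := by
  obtain ⟨m, hm, hm'⟩ := h.exists_le_deriv
  obtain ⟨M, -, hM⟩ := h.exists_deriv_le
  exact ne_top_of_le_ne_top (ENNReal.mul_ne_top (compConst_ne_top m M) hft)
    (h.sob_one_comp hm hm' hM hf hft)

/-- Interpolation between `L²` and `H²`. The bound on `H²` comes from `(f ∘ ψ)' = (f' ∘ ψ) ψ'`:
composition is bounded on `H¹`, and `H¹` is an algebra containing `ψ'`. -/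
theorem sob_comp_ne_top_of_le_two (h : Lift ψ)
    (h1 : sob 1 (fun θ => ((deriv ψ θ : ℝ) : ℂ)) ≠ ⊤) {r : ℝ} (hr : 1 < r) (hr2 : r ≤ 2)
    {f : ℝ → ℂ} (hf : PerCont f) (hft : sob r f ≠ ⊤) : sob r (fun θ => f (ψ θ)) ≠ ⊤ := by
  obtain ⟨m, hm, hm'⟩ := h.exists_le_deriv
  obtain ⟨M, -, hM⟩ := h.exists_deriv_le
  set K := compConst m M * (1 + algConst 1 * sob 1 (fun θ => ((deriv ψ θ : ℝ) : ℂ))) with hK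
  have hKt : K ≠ ⊤ := ENNReal.mul_ne_top (compConst_ne_top m M)
    (ENNReal.add_ne_top.2 ⟨ENNReal.one_ne_top, ENNReal.mul_ne_top (algConst_ne_top (by norm_num)) h1⟩)
  have h0K : ENNReal.ofReal m⁻¹ ≤ K := by
    rw [hK, compConst, mul_assoc]
    refine le_mul_of_one_le_right' ?_
    exact one_le_mul_of_one_le_of_one_le (le_self_add) (le_self_add)
  refine ne_top_of_le_ne_top (ENNReal.mul_ne_top hKt hft)
    (h.sob_comp_of_comb (fun a => ?_) hf (summable_norm_cf (by linarith) hft))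
  have key := sob_comb_interpolation (E := fun k θ => ex k (ψ θ))
    (fun k => (continuous_ex k).comp h.contDiff.continuous) 2 K (fun a => ?_) (fun a => ?_)
    (η := r / 2) (by linarith) (by linarith) a
  · rw [mul_div_cancel₀ r two_ne_zero] at key
    exact key
  · refine (h.sob_zero_comp hm hm' (perCont_comb_ex a)).trans ?_
    gcongr
  · have hc1 : ContDiff ℝ 1 (comb ex a) := (contDiff_comb_ex a).of_le (by simp)
    obtain ⟨b, hb⟩ := exists_deriv_comb a
    have hb1 : ContDiff ℝ 1 (comb ex b) := (contDiff_comb_ex b).of_le (by simp)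
    change sob 2 (fun θ => comb ex a (ψ θ)) ≤ _
    rw [(h.perCont_comp (perCont_comb_ex a)).sob_two (h.contDiff_comp hc1), h.deriv_fun_comp hc1,
      (perCont_comb_ex a).sob_two hc1, hb]
    have e1 := h.sob_one_comp_of_contDiff hm hm' hM (perCont_comb_ex a) hc1
    have e2 := h.sob_one_comp_of_contDiff hm hm' hM (perCont_comb_ex b) hb1
    have e3 := sob_mul_le (r := 1) (by norm_num) (h.perCont_comp (perCont_comb_ex b)) h.perCont_deriv
      (h.sob_one_comp_ne_top (perCont_comb_ex b) (sob_comb_ne_top 1 b))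
    calc _ ≤ compConst m M * sob 1 (comb ex a) + algConst 1 * (compConst m M * sob 1 (comb ex b) *
          sob 1 (fun θ => ((deriv ψ θ : ℝ) : ℂ))) := by
          refine add_le_add e1 (e3.trans ?_)
          gcongr
      _ ≤ compConst m M * sob 1 (comb ex a) + algConst 1 * (compConst m M * sob 1 (comb ex b) *
          sob 1 (fun θ => ((deriv ψ θ : ℝ) : ℂ))) + (compConst m M * sob 1 (comb ex b) +
          algConst 1 * (compConst m M * sob 1 (comb ex a) *
          sob 1 (fun θ => ((deriv ψ θ : ℝ) : ℂ)))) := le_self_add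
      _ = _ := by
          rw [hK]
          ring

/-- Composition with an `H^r`-diffeomorphism preserves `H^r`. -/
theorem sob_comp_ne_top (h : Lift ψ) (h1 : sob 1 (fun θ => ((deriv ψ θ : ℝ) : ℂ)) ≠ ⊤)
    {r : ℝ} (hr : 1 < r) (hr2 : r ≤ 2) (n : ℕ)
    (hψ : sob (r + n) (fun θ => ((ψ θ - θ : ℝ) : ℂ)) ≠ ⊤) {f : ℝ → ℂ} (hf : PerCont f)
    (hft : sob (r + n) f ≠ ⊤) : sob (r + n) (fun θ => f (ψ θ)) ≠ ⊤ := by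
  induction n generalizing f with
  | zero =>
    simp only [Nat.cast_zero, add_zero] at hft ⊢
    exact h.sob_comp_ne_top_of_le_two h1 hr hr2 hf hft
  | succ n ih =>
    have hn : (0 : ℝ) ≤ n := Nat.cast_nonneg n
    have e : r + ((n + 1 : ℕ) : ℝ) = (r + n) + 1 := by push_cast; ring
    rw [e] at hψ hft ⊢
    have hf1 := contDiff_one_of_sob (by linarith) hf hft
    have hψ' := h.sob_deriv_ne_top hψ
    rw [h.sob_sub_id, ENNReal.add_ne_top] at hψ
    rw [hf.sob_add_one hf1, ENNReal.add_ne_top] at hft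
    -- One further derivative: `(f' ∘ ψ) ψ'` is a product of functions of regularity `r + n`, the
    -- first by the induction hypothesis and the second by the assumption on `ψ - id`.
    rw [(h.perCont_comp hf).sob_add_one (h.contDiff_comp hf1), h.deriv_fun_comp hf1,
      ENNReal.add_ne_top]
    exact ⟨ih hψ.1 hf hft.1, sob_mul_ne_top (by linarith) (h.perCont_comp (hf.deriv hf1))
      h.perCont_deriv (ih hψ.1 (hf.deriv hf1) hft.2) hψ'⟩

end Lift

/-! ### Reciprocals in Sobolev spaces -/

section Inverse
variable {g : ℝ → ℂ} {c : ℝ}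

theorem PerCont.inv (hg : PerCont g) (h0 : ∀ θ, g θ ≠ 0) : PerCont fun θ => (g θ)⁻¹ :=
  ⟨hg.cont.inv₀ h0, fun θ => by rw [hg.per]⟩

theorem hasDerivAt_inv_fun (hg1 : ContDiff ℝ 1 g) (h0 : ∀ θ, g θ ≠ 0) (θ : ℝ) :
    HasDerivAt (fun θ => (g θ)⁻¹) (deriv g θ * (-((g θ)⁻¹ * (g θ)⁻¹))) θ := by
  refine ((hg1.differentiable one_ne_zero θ).hasDerivAt.fun_inv (h0 θ)).congr_deriv ?_
  field_simp

theorem sob_one_inv_of_contDiff (hg : PerCont g) (hg1 : ContDiff ℝ 1 g) (hc : 0 < c)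
    (h : ∀ θ, c ≤ ‖g θ‖) :
    sob 1 (fun θ => (g θ)⁻¹) ≤ ENNReal.ofReal (c⁻¹ ^ 2) + ENNReal.ofReal ((c⁻¹ ^ 2) ^ 2) * sob 1 g := by
  have h0 : ∀ θ, g θ ≠ 0 := fun θ => norm_pos_iff.1 (hc.trans_le (h θ))
  have hb : ∀ θ, ‖(g θ)⁻¹‖ ≤ c⁻¹ := fun θ => by
    rw [norm_inv]
    exact inv_anti₀ hc (h θ)
  have hi := hg.inv h0
  rw [hi.sob_one (hg1.inv h0), funext fun θ => (hasDerivAt_inv_fun hg1 h0 θ).deriv]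
  refine add_le_add (sob_zero_le_of_bound hi.cont hb) ?_
  have hc2 : Continuous fun θ => -((g θ)⁻¹ * (g θ)⁻¹) := (hi.cont.mul hi.cont).neg
  refine (sob_zero_mul_le (C := c⁻¹ ^ 2) (hg.deriv hg1).cont hc2 fun θ => ?_).trans ?_
  · rw [norm_neg, norm_mul, sq]
    exact mul_le_mul (hb θ) (hb θ) (norm_nonneg _) (by positivity)
  · gcongr
    rw [hg.sob_one hg1]
    exact le_add_self

/-- Partial sums of `g` converge uniformly, hence are eventually bounded below by `c / 2`, and their
reciprocals converge uniformly to `1/g`. Lower semicontinuity then lets uniform bounds be proved for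
reciprocals of trigonometric polynomials only. -/
theorem sob_inv_le_of_partialSum {r t : ℝ} (ht : 1 / 2 < t) (hg : PerCont g) (hgt : sob t g ≠ ⊤)
    (hc : 0 < c) (h : ∀ θ, c ≤ ‖g θ‖) {K : ℝ≥0∞}
    (hK : ∀ a, (∀ θ, c / 2 ≤ ‖comb ex a θ‖) → sob t (comb ex a) ≤ sob t g →
      sob r (fun θ => (comb ex a θ)⁻¹) ≤ K) : sob r (fun θ => (g θ)⁻¹) ≤ K := by
  have h0 : ∀ θ, g θ ≠ 0 := fun θ => norm_pos_iff.1 (hc.trans_le (h θ))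
  have h2 := tendstoUniformly_partialSum hg (summable_norm_cf ht hgt)
  rw [Metric.tendstoUniformly_iff] at h2
  have hlow : ∀ᶠ s in atTop, ∀ θ, c / 2 ≤ ‖comb ex (partialSum g s) θ‖ := by
    filter_upwards [h2 (c / 2) (by positivity)] with s hs θ
    have h3 := hs θ
    rw [dist_eq_norm] at h3
    have h4 := norm_sub_norm_le (g θ) (comb ex (partialSum g s) θ)
    linarith [h θ]
  refine sob_le_of_tendsto (l := atTop) (F := fun s θ => (comb ex (partialSum g s) θ)⁻¹) (fun k => ?_) ?_
  · rw [Metric.tendsto_nhds]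
    intro ε hε
    filter_upwards [hlow, h2 (ε * c ^ 2 / 4) (by positivity)] with s hs hs2
    have h0s : ∀ θ, comb ex (partialSum g s) θ ≠ 0 := fun θ =>
      norm_pos_iff.1 ((half_pos hc).trans_le (hs θ))
    rw [dist_eq_norm, ← cf_sub ((perCont_comb_ex _).inv h0s).cont (hg.inv h0).cont]
    refine (norm_cf_le (C := ε / 2) (fun θ => ?_) k).trans_lt (by linarith)
    rw [inv_sub_inv (h0s θ) (h0 θ), norm_div, norm_mul, div_le_iff₀ (by
      have := norm_pos_iff.2 (h0s θ)
      have := norm_pos_iff.2 (h0 θ)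
      positivity)]
    have h3 := hs2 θ
    rw [dist_eq_norm] at h3
    have h4 : c / 2 * c ≤ ‖comb ex (partialSum g s) θ‖ * ‖g θ‖ :=
      mul_le_mul (hs θ) (h θ) hc.le (norm_nonneg _)
    nlinarith
  · filter_upwards [hlow] with s hs
    exact hK _ hs (sob_partialSum_le t g s)

theorem sob_one_inv_le (hg : PerCont g) (hgt : sob 1 g ≠ ⊤) (hc : 0 < c) (h : ∀ θ, c ≤ ‖g θ‖) :
    sob 1 (fun θ => (g θ)⁻¹) ≤
      ENNReal.ofReal ((c / 2)⁻¹ ^ 2) + ENNReal.ofReal (((c / 2)⁻¹ ^ 2) ^ 2) * sob 1 g := by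
  refine sob_inv_le_of_partialSum (by norm_num) hg hgt hc h fun a ha ha2 => ?_
  refine (sob_one_inv_of_contDiff (perCont_comb_ex a) ((contDiff_comb_ex a).of_le (by simp))
    (half_pos hc) ha).trans ?_
  gcongr

/-- Multiplication by `H¹`-functions on `H^η`, `0 < η ≤ 1`. -/
theorem sob_comb_mul_le {w : ℝ → ℂ} (hw : PerCont w) {C : ℝ} (hC : ∀ θ, ‖w θ‖ ≤ C) {η : ℝ}
    (hη0 : 0 < η) (hη1 : η ≤ 1) (a : ℤ →₀ ℂ) : sob η (fun θ => comb ex a θ * w θ) ≤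
      (ENNReal.ofReal (C ^ 2) + algConst 1 * sob 1 w) * sob η (comb ex a) := by
  have hcomb : ∀ a : ℤ →₀ ℂ, comb (fun k θ => ex k θ * w θ) a = fun θ => comb ex a θ * w θ := by
    intro a
    funext θ
    simp only [comb, Finsupp.sum, Finset.sum_mul, mul_assoc]
  have key := sob_comb_interpolation (E := fun k θ => ex k θ * w θ)
    (fun k => (continuous_ex k).mul hw.cont) 1 (ENNReal.ofReal (C ^ 2) + algConst 1 * sob 1 w)
    (fun a => ?_) (fun a => ?_) hη0 hη1 a
  · rw [one_mul, hcomb] at key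
    exact key
  · rw [hcomb]
    refine (sob_zero_mul_le (perCont_comb_ex a).cont hw.cont hC).trans ?_
    gcongr
    exact le_self_add
  · rw [hcomb]
    refine (sob_mul_le (by norm_num) (perCont_comb_ex a) hw (sob_comb_ne_top 1 a)).trans ?_
    rw [mul_left_comm, mul_comm]
    gcongr
    exact le_add_self

/-- `(1/g)' = -g'/g²` with `g' ∈ H^{r-1}` and `0 < r - 1 ≤ 1`. This exponent may be below the
algebra range, so multiplication by `1/g² ∈ H¹` is bounded there by interpolation,
`sob_comb_mul_le`. -/
theorem sob_inv_ne_top_of_le_two (hg : PerCont g) {r : ℝ} (hr : 1 < r) (hr2 : r ≤ 2)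
    (hgt : sob r g ≠ ⊤) (hc : 0 < c) (h : ∀ θ, c ≤ ‖g θ‖) : sob r (fun θ => (g θ)⁻¹) ≠ ⊤ := by
  set d := (c / 2)⁻¹ with hd
  set K1 := ENNReal.ofReal (d ^ 2) + ENNReal.ofReal ((d ^ 2) ^ 2) * sob r g with hK1
  have hK1t : K1 ≠ ⊤ := ENNReal.add_ne_top.2 ⟨ENNReal.ofReal_ne_top,
    ENNReal.mul_ne_top ENNReal.ofReal_ne_top hgt⟩
  set K2 := ENNReal.ofReal ((d ^ 2) ^ 2) + algConst 1 * (algConst 1 * (K1 * K1)) with hK2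
  have hat : algConst 1 ≠ ⊤ := algConst_ne_top (by norm_num)
  have hK2t : K2 ≠ ⊤ := ENNReal.add_ne_top.2 ⟨ENNReal.ofReal_ne_top,
    ENNReal.mul_ne_top hat (ENNReal.mul_ne_top hat (ENNReal.mul_ne_top hK1t hK1t))⟩
  refine ne_top_of_le_ne_top (ENNReal.add_ne_top.2 ⟨hK1t, ENNReal.mul_ne_top hK2t hgt⟩)
    (sob_inv_le_of_partialSum (by linarith) hg hgt hc h fun a ha ha2 => ?_)
  have hc2 := half_pos hc
  have h0 : ∀ θ, comb ex a θ ≠ 0 := fun θ => norm_pos_iff.1 (hc2.trans_le (ha θ))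
  have hb : ∀ θ, ‖(comb ex a θ)⁻¹‖ ≤ d := fun θ => by
    rw [norm_inv]
    exact inv_anti₀ hc2 (ha θ)
  have ha1 : ContDiff ℝ 1 (comb ex a) := (contDiff_comb_ex a).of_le (by simp)
  have hi := (perCont_comb_ex a).inv h0
  have e1 : sob 1 (fun θ => (comb ex a θ)⁻¹) ≤ K1 := by
    refine (sob_one_inv_of_contDiff (perCont_comb_ex a) ha1 hc2 ha).trans ?_
    rw [hK1]
    gcongr
    exact (sob_mono hr.le _).trans ha2
  obtain ⟨b, hb'⟩ := exists_deriv_comb a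
  have hr' : r = (r - 1) + 1 := by ring
  rw [hr', (perCont_comb_ex a).sob_add_one ha1, hb'] at ha2
  rw [hr', hi.sob_add_one (ha1.inv h0), funext fun θ => (hasDerivAt_inv_fun ha1 h0 θ).deriv, hb']
  refine add_le_add ((sob_mono (by linarith) _).trans e1) ?_
  have hw : PerCont fun θ => -((comb ex a θ)⁻¹ * (comb ex a θ)⁻¹) :=
    ⟨(hi.cont.mul hi.cont).neg, fun θ => by rw [(perCont_comb_ex a).per]⟩
  refine (sob_comb_mul_le hw (C := d ^ 2) (fun θ => ?_) (by linarith) (by linarith) b).trans ?_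
  · rw [norm_neg, norm_mul, sq]
    exact mul_le_mul (hb θ) (hb θ) (norm_nonneg _) ((norm_nonneg _).trans (hb θ))
  · rw [hK2]
    have e2 : sob 1 (fun θ => (comb ex a θ)⁻¹ * (comb ex a θ)⁻¹) ≤ algConst 1 * (K1 * K1) := by
      refine (sob_mul_le (by norm_num) hi hi (ne_top_of_le_ne_top hK1t e1)).trans ?_
      gcongr
    rw [sob_neg 1 fun θ => (comb ex a θ)⁻¹ * (comb ex a θ)⁻¹]
    rw [← hr'] at ha2 ⊢
    gcongr
    exact le_add_self.trans ha2

theorem sob_inv_ne_top (hg : PerCont g) {r : ℝ} (hr : 1 < r) (hr2 : r ≤ 2) (n : ℕ)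
    (hgt : sob (r + n) g ≠ ⊤) (hc : 0 < c) (h : ∀ θ, c ≤ ‖g θ‖) :
    sob (r + n) (fun θ => (g θ)⁻¹) ≠ ⊤ := by
  induction n with
  | zero =>
    simp only [Nat.cast_zero, add_zero] at hgt ⊢
    exact sob_inv_ne_top_of_le_two hg hr hr2 hgt hc h
  | succ n ih =>
    have hn : (0 : ℝ) ≤ n := Nat.cast_nonneg n
    have e : r + ((n + 1 : ℕ) : ℝ) = (r + n) + 1 := by push_cast; ring
    have h0 : ∀ θ, g θ ≠ 0 := fun θ => norm_pos_iff.1 (hc.trans_le (h θ))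
    have hi := hg.inv h0
    rw [e] at hgt ⊢
    have hg1 := contDiff_one_of_sob (by linarith) hg hgt
    rw [hg.sob_add_one hg1, ENNReal.add_ne_top] at hgt
    rw [hi.sob_add_one (hg1.inv h0), funext fun θ => (hasDerivAt_inv_fun hg1 h0 θ).deriv,
      ENNReal.add_ne_top]
    have hi' := ih hgt.1
    have hn' : 1 / 2 < r + n := by linarith
    have h2 := sob_mul_ne_top hn' hi hi hi' hi'
    refine ⟨hi', sob_mul_ne_top hn' (hg.deriv hg1)
      ⟨(hi.cont.mul hi.cont).neg, fun θ => by rw [hg.per]⟩ hgt.2 ?_⟩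
    rwa [sob_neg _ fun θ => (g θ)⁻¹ * (g θ)⁻¹]

end Inverse

/-! ### The group `D^s(S¹)` -/

namespace Lift
variable {φ ψ : ℝ → ℝ}

theorem inv_eq_of_inverse (h : Lift φ) (hψ : Lift ψ) (hφψ : ∀ θ, φ (ψ θ) = θ) (θ : ℝ) :
    deriv ψ θ = (deriv φ (ψ θ))⁻¹ := by
  have h1 := h.deriv_comp hψ θ
  simp only [hφψ, deriv_id''] at h1
  exact eq_inv_of_mul_eq_one_right h1.symm

/-- A bootstrap on `ψ' = (1/φ') ∘ ψ`: if `ψ - id ∈ H^{r+j}`, composition with `ψ` preserves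
`H^{r+j}`, so `ψ'` lies there and `ψ - id ∈ H^{r+j+1}`. It starts from `ψ - id = -(φ - id) ∘ ψ`. -/
theorem sob_inv_ne_top (h : Lift φ) (hψ : Lift ψ) (hφψ : ∀ θ, φ (ψ θ) = θ) {r : ℝ} (hr : 1 < r)
    (hr2 : r ≤ 2) (n : ℕ) (hφs : sob (r + n + 1) (fun θ => ((φ θ - θ : ℝ) : ℂ)) ≠ ⊤) :
    sob (r + n + 1) (fun θ => ((ψ θ - θ : ℝ) : ℂ)) ≠ ⊤ := by
  obtain ⟨m, hm, hm'⟩ := h.exists_le_deriv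
  have hn : (0 : ℝ) ≤ n := Nat.cast_nonneg n
  have h' := h.sob_deriv_ne_top hφs
  have hb : ∀ θ, m ≤ ‖((deriv φ θ : ℝ) : ℂ)‖ := fun θ => by
    rw [Complex.norm_real, Real.norm_of_nonneg (h.deriv_pos θ).le]
    exact hm' θ
  have hi := U1Current.sob_inv_ne_top h.perCont_deriv hr hr2 n h' hm hb
  have hic := h.perCont_deriv.inv fun θ => Complex.ofReal_ne_zero.2 (h.deriv_pos θ).ne'
  have hd : (fun θ => ((deriv ψ θ : ℝ) : ℂ)) = fun θ => (((deriv φ (ψ θ) : ℝ) : ℂ))⁻¹ := by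
    funext θ
    rw [h.inv_eq_of_inverse hψ hφψ]
    push_cast
    rfl
  -- Composition with any `C¹`-lift preserves `H¹`, so `ψ' ∈ H¹` is available before anything is
  -- known on the Sobolev regularity of `ψ`.
  have h1 : sob 1 (fun θ => ((deriv ψ θ : ℝ) : ℂ)) ≠ ⊤ := by
    rw [hd]
    exact hψ.sob_one_comp_ne_top (f := fun θ => ((deriv φ θ : ℝ) : ℂ)⁻¹) hic
      (ne_top_of_le_ne_top hi (sob_mono (r := 1) (t := r + n) (by linarith) _))
  have key : ∀ j : ℕ, j ≤ n + 1 → sob (r + j) (fun θ => ((ψ θ - θ : ℝ) : ℂ)) ≠ ⊤ := by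
    intro j
    induction j with
    | zero =>
      intro _
      rw [Nat.cast_zero, add_zero]
      have e := hψ.sob_comp_ne_top_of_le_two h1 hr hr2 h.perCont_sub_id
        (ne_top_of_le_ne_top hφs (sob_mono (by linarith) _))
      have heq : (fun θ => ((ψ θ - θ : ℝ) : ℂ)) = fun θ => -((φ (ψ θ) - ψ θ : ℝ) : ℂ) := by
        funext θ
        rw [hφψ]
        push_cast
        ring
      rw [heq, sob_neg r fun θ => ((φ (ψ θ) - ψ θ : ℝ) : ℂ)]
      exact e
    | succ j ih =>
      intro hj
      have ih' := ih (by omega)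
      have hjn : (j : ℝ) ≤ n := by exact_mod_cast (by omega : j ≤ n)
      rw [Nat.cast_succ, ← add_assoc, hψ.sob_sub_id, ENNReal.add_ne_top]
      refine ⟨ih', sob_sub_ne_top hψ.perCont_deriv.cont continuous_const ?_ (sob_const_ne_top _ _)⟩
      rw [hd]
      exact hψ.sob_comp_ne_top h1 hr hr2 j ih' (f := fun θ => ((deriv φ θ : ℝ) : ℂ)⁻¹) hic
        (ne_top_of_le_ne_top hi (sob_mono (r := r + j) (t := r + n) (by linarith) _))
  have := key (n + 1) le_rfl
  rwa [Nat.cast_succ, ← add_assoc] at this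

end Lift

theorem norm_sobolevSeq_sq (s : ℝ) (φ : ℝ → ℝ) (k : ℤ) : ENNReal.ofReal (‖sobolevSeq s φ k‖ ^ 2) =
    wt s k * ‖cf (fun θ => ((φ θ - θ : ℝ) : ℂ)) k‖ₑ ^ 2 := by
  have h : ((1 + (k : ℝ) ^ 2) ^ (s / 2)) ^ 2 = (1 + (k : ℝ) ^ 2) ^ s := by
    rw [← Real.rpow_natCast, ← Real.rpow_mul (by positivity)]
    norm_num
  rw [sobolevSeq, coeff_eq_cf, norm_mul, Complex.norm_real,
    Real.norm_of_nonneg (by positivity), mul_pow, h, ENNReal.ofReal_mul (by positivity), wt,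
    ENNReal.ofReal_pow (norm_nonneg _), ofReal_norm]

theorem memlp_sobolevSeq_iff (s : ℝ) (φ : ℝ → ℝ) :
    Memℓp (sobolevSeq s φ) 2 ↔ sob s (fun θ => ((φ θ - θ : ℝ) : ℂ)) ≠ ⊤ := by
  rw [memlp_two_iff, sob]
  simp only [← norm_sobolevSeq_sq]
  constructor
  · exact fun h => h.tsum_ofReal_ne_top
  · intro h
    have := ENNReal.summable_toReal h
    simpa only [ENNReal.toReal_ofReal (sq_nonneg _)] using this

/-- Interpolation treats `1 < r ≤ 2` and differentiation adds `n`; the last `1` appears because it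
is `φ'` that lies in `H^{r+n}`. The hypothesis `2 < s` is exactly `1 < r` when `n = 0`. -/
theorem exists_eq_add_nat {s : ℝ} (hs : 2 < s) :
    ∃ (r : ℝ) (n : ℕ), 1 < r ∧ r ≤ 2 ∧ s = r + n + 1 := by
  have h1 := Nat.ceil_lt_add_one (show (0 : ℝ) ≤ s - 3 + 1 by linarith)
  rcases le_or_gt s 3 with h | h
  · exact ⟨s - 1, 0, by linarith, by linarith, by simp⟩
  · have h2 := Nat.le_ceil (s - 3)
    have h3 := Nat.ceil_lt_add_one (show (0 : ℝ) ≤ s - 3 by linarith)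
    exact ⟨s - 1 - ⌈s - 3⌉₊, ⌈s - 3⌉₊, by linarith, by linarith, by ring⟩

theorem IsLift.lift {n : ℕ∞} (hn : n ≠ 0) {γ : S1 ≃ₜ S1} {φ : ℝ → ℝ} (h : IsLift n γ φ) : Lift φ :=
  ⟨h.contDiff.of_le (by
    exact_mod_cast Order.one_le_iff_ne_zero.2 hn), h.deriv_pos, h.map_add⟩

theorem Lift.isLift {γ : S1 ≃ₜ S1} {φ : ℝ → ℝ} (h : Lift φ) (hγ : ∀ θ : ℝ, γ (θ : S1) = (φ θ : S1)) :
    IsLift 1 γ φ := ⟨h.contDiff, h.deriv_pos, h.map_add, hγ⟩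

theorem isSobolevDiffeo_iff {s : ℝ} {γ : S1 ≃ₜ S1} : IsSobolevDiffeo s γ ↔
    ∃ φ, Lift φ ∧ (∀ θ : ℝ, γ (θ : S1) = (φ θ : S1)) ∧
      sob s (fun θ => ((φ θ - θ : ℝ) : ℂ)) ≠ ⊤ := by
  constructor
  · rintro ⟨g, rfl⟩
    exact ⟨g.lift, g.isLift.lift one_ne_zero, g.isLift.coe_eq, (memlp_sobolevSeq_iff _ _).1 g.memlp⟩
  · rintro ⟨φ, h1, h2, h3⟩
    exact ⟨⟨γ, φ, h1.isLift h2, (memlp_sobolevSeq_iff _ _).2 h3⟩, rfl⟩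

/-- `φ ∘ ψ - id = (φ - id) ∘ ψ + (ψ - id)`. -/
theorem Lift.sob_comp_sub_id {s : ℝ} (hs : 2 < s) {φ ψ : ℝ → ℝ} (hφ : Lift φ) (hψ : Lift ψ)
    (h1 : sob s (fun θ => ((φ θ - θ : ℝ) : ℂ)) ≠ ⊤) (h2 : sob s (fun θ => ((ψ θ - θ : ℝ) : ℂ)) ≠ ⊤) :
    sob s (fun θ => ((φ (ψ θ) - θ : ℝ) : ℂ)) ≠ ⊤ := by
  obtain ⟨r, n, hr, hr2, rfl⟩ := exists_eq_add_nat hs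
  have hn : (0 : ℝ) ≤ n := Nat.cast_nonneg n
  have h3 : sob 1 (fun θ => ((deriv ψ θ : ℝ) : ℂ)) ≠ ⊤ :=
    hψ.sob_deriv_ne_top (ne_top_of_le_ne_top h2 (sob_mono (by linarith) _))
  have e : (r + n + 1 : ℝ) = r + ((n + 1 : ℕ) : ℝ) := by push_cast; ring
  rw [e] at h1 h2 ⊢
  have h4 := hψ.sob_comp_ne_top h3 hr hr2 (n + 1) h2 hφ.perCont_sub_id h1
  have h5 := sob_add_ne_top (hψ.perCont_comp hφ.perCont_sub_id).cont hψ.perCont_sub_id.cont h4 h2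
  convert h5 using 3
  push_cast
  ring

theorem IsSobolevDiffeo.mul {s : ℝ} (hs : 2 < s) {γ ν : S1 ≃ₜ S1} (hγ : IsSobolevDiffeo s γ)
    (hν : IsSobolevDiffeo s ν) : IsSobolevDiffeo s (γ * ν) := by
  obtain ⟨φ, h1, h2, h3⟩ := isSobolevDiffeo_iff.1 hγ
  obtain ⟨ψ, k1, k2, k3⟩ := isSobolevDiffeo_iff.1 hν
  refine isSobolevDiffeo_iff.2 ⟨fun θ => φ (ψ θ), h1.comp k1, fun θ => ?_, h1.sob_comp_sub_id hs k1 h3 k3⟩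
  change γ (ν θ) = _
  rw [k2, h2]

/-- An `H^s`-lift of a diffeomorphism together with an `H^s`-lift of its inverse. -/
structure LiftPair (s : ℝ) (γ : S1 ≃ₜ S1) (φ ψ : ℝ → ℝ) : Prop where
  lift : Lift φ
  lift_inv : Lift ψ
  right_inv : ∀ θ, φ (ψ θ) = θ
  left_inv : ∀ θ, ψ (φ θ) = θ
  coe_eq : ∀ θ : ℝ, γ (θ : S1) = (φ θ : S1)
  coe_inv_eq : ∀ θ : ℝ, γ.symm (θ : S1) = (ψ θ : S1)
  sob_ne_top : sob s (fun θ => ((φ θ - θ : ℝ) : ℂ)) ≠ ⊤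
  sob_inv_ne_top : sob s (fun θ => ((ψ θ - θ : ℝ) : ℂ)) ≠ ⊤

theorem LiftPair.symm {s : ℝ} {γ : S1 ≃ₜ S1} {φ ψ : ℝ → ℝ} (h : LiftPair s γ φ ψ) :
    LiftPair s γ.symm ψ φ :=
  ⟨h.lift_inv, h.lift, h.left_inv, h.right_inv, h.coe_inv_eq, h.coe_eq, h.sob_inv_ne_top, h.sob_ne_top⟩

theorem Lift.exists_liftPair {s : ℝ} (hs : 2 < s) {γ : S1 ≃ₜ S1} {φ : ℝ → ℝ} (h : Lift φ)
    (hγ : ∀ θ : ℝ, γ (θ : S1) = (φ θ : S1)) (h3 : sob s (fun θ => ((φ θ - θ : ℝ) : ℂ)) ≠ ⊤) :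
    ∃ ψ, LiftPair s γ φ ψ := by
  obtain ⟨ψ, k1, k2, k3, -⟩ := h.exists_inv
  refine ⟨ψ, h, k1, k3, k2, hγ, fun θ => ?_, h3, ?_⟩
  · rw [γ.symm_apply_eq, hγ, k3]
  · obtain ⟨r, n, hr, hr2, rfl⟩ := exists_eq_add_nat hs
    exact h.sob_inv_ne_top k1 k3 hr hr2 n h3

theorem IsSobolevDiffeo.exists_liftPair {s : ℝ} (hs : 2 < s) {γ : S1 ≃ₜ S1}
    (h : IsSobolevDiffeo s γ) : ∃ φ ψ, LiftPair s γ φ ψ := by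
  obtain ⟨φ, h1, h2, h3⟩ := isSobolevDiffeo_iff.1 h
  exact ⟨φ, h1.exists_liftPair hs h2 h3⟩

theorem LiftPair.isSobolevDiffeo {s : ℝ} {γ : S1 ≃ₜ S1} {φ ψ : ℝ → ℝ} (h : LiftPair s γ φ ψ) :
    IsSobolevDiffeo s γ := isSobolevDiffeo_iff.2 ⟨φ, h.lift, h.coe_eq, h.sob_ne_top⟩

theorem IsSobolevDiffeo.inv {s : ℝ} (hs : 2 < s) {γ : S1 ≃ₜ S1} (h : IsSobolevDiffeo s γ) :
    IsSobolevDiffeo s γ⁻¹ := by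
  obtain ⟨φ, ψ, h⟩ := h.exists_liftPair hs
  exact h.symm.isSobolevDiffeo

theorem sob_nat_ne_top_of_smooth (n : ℕ) {f : ℝ → ℂ} (hf : PerCont f) (h : ContDiff ℝ ∞ f) :
    sob n f ≠ ⊤ := by
  induction n generalizing f with
  | zero =>
    obtain ⟨C, -, hC⟩ := hf.bounded
    rw [Nat.cast_zero]
    exact ne_top_of_le_ne_top ENNReal.ofReal_ne_top (sob_zero_le_of_bound hf.cont hC)
  | succ n ih =>
    have h1 : ContDiff ℝ 1 f := h.of_le (by simp)
    rw [Nat.cast_succ, hf.sob_add_one h1, ENNReal.add_ne_top]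
    exact ⟨ih hf h, ih (hf.deriv h1) (contDiff_infty_iff_deriv.1 h).2⟩

theorem sob_ne_top_of_smooth (r : ℝ) {f : ℝ → ℂ} (hf : PerCont f) (h : ContDiff ℝ ∞ f) :
    sob r f ≠ ⊤ := by
  obtain ⟨n, hn⟩ := exists_nat_ge r
  exact ne_top_of_le_ne_top (sob_nat_ne_top_of_smooth n hf h) (sob_mono hn f)

theorem IsSmoothDiffeo.isSobolevDiffeo (s : ℝ) {γ : S1 ≃ₜ S1} (h : IsSmoothDiffeo γ) :
    IsSobolevDiffeo s γ := by
  obtain ⟨φ, h⟩ := h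
  have h1 := h.lift (by simp)
  refine isSobolevDiffeo_iff.2 ⟨φ, h1, h.coe_eq, sob_ne_top_of_smooth s h1.perCont_sub_id ?_⟩
  exact Complex.ofRealCLM.contDiff.comp (h.contDiff.sub contDiff_id)

/-! ### The Hilbert-Schmidt estimate -/

/-- A one-dimensional Sobolev inequality on an interval of length `1 / n`. -/
theorem mul_norm_sq_le_integral {F F' : ℝ → ℂ} (hF : ∀ x, HasDerivAt F (F' x) x)
    (hF' : Continuous F') {n : ℝ} (hn : 0 < n) {a b : ℝ} (hab : b = a + 1 / n) :
    n * ‖F a‖ ^ 2 ≤ ∫ x in a..b, (2 * n ^ 2 * ‖F x‖ ^ 2 + 2 * ‖F' x‖ ^ 2) := by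
  have hle : a ≤ b := by rw [hab]; linarith [show 0 < 1 / n by positivity]
  have hlen : b - a = 1 / n := by rw [hab]; ring
  have hFc : Continuous F := continuous_iff_continuousAt.2 fun x => (hF x).continuousAt
  have hi2 : IntervalIntegrable (fun x => ‖F' x‖ ^ 2) MeasureTheory.volume a b :=
    (hF'.norm.pow 2).intervalIntegrable _ _
  set P := ∫ x in a..b, ‖F' x‖ ^ 2 with hP
  set Q := ∫ x in a..b, ‖F' x‖ with hQ
  have hQ0 : 0 ≤ Q := intervalIntegral.integral_nonneg hle fun _ _ => norm_nonneg _
  -- Cauchy-Schwarz on an interval of length `1/n`, read off from `∫ (‖F'‖ - nQ)² ≥ 0`, where `nQ`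
  -- is the mean of `‖F'‖`.
  have hCS : Q ^ 2 ≤ P / n := by
    have h1 : 0 ≤ ∫ x in a..b, (‖F' x‖ - n * Q) ^ 2 :=
      intervalIntegral.integral_nonneg hle fun _ _ => sq_nonneg _
    have h2 : ∫ x in a..b, (‖F' x‖ - n * Q) ^ 2 = P - 2 * (n * Q) * Q + (n * Q) ^ 2 * (1 / n) := by
      rw [← hlen]
      have e : ∀ x, (‖F' x‖ - n * Q) ^ 2 = (‖F' x‖ ^ 2 - 2 * (n * Q) * ‖F' x‖) + (n * Q) ^ 2 := by
        intro x; ring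
      simp only [e]
      rw [intervalIntegral.integral_add, intervalIntegral.integral_sub hi2,
        intervalIntegral.integral_const_mul, intervalIntegral.integral_const, smul_eq_mul]
      · ring
      · exact (continuous_const.mul hF'.norm).intervalIntegrable _ _
      · exact ((hF'.norm.pow 2).sub (continuous_const.mul hF'.norm)).intervalIntegrable _ _
      · exact continuous_const.intervalIntegrable _ _
    rw [h2] at h1
    rw [le_div_iff₀ hn]
    have e3 : (n * Q) ^ 2 * (1 / n) = n * Q ^ 2 := by field_simp
    rw [e3] at h1
    nlinarith
  have hpt : ∀ x ∈ Set.Icc a b, ‖F a‖ ^ 2 ≤ 2 * ‖F x‖ ^ 2 + 2 * (P / n) := by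
    intro x hx
    have h1 : F x - F a = ∫ y in a..x, F' y :=
      (intervalIntegral.integral_eq_sub_of_hasDerivAt (fun y _ => hF y)
        (hF'.intervalIntegrable _ _)).symm
    have h2 : ‖F x - F a‖ ≤ Q := by
      rw [h1]
      refine (intervalIntegral.norm_integral_le_integral_norm hx.1).trans ?_
      refine intervalIntegral.integral_mono_interval le_rfl hx.1 hx.2
        (Eventually.of_forall fun _ => norm_nonneg _) (hF'.norm.intervalIntegrable _ _)
    have h3 : ‖F a‖ ≤ ‖F x‖ + Q := by
      have := norm_sub_norm_le (F a) (F x)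
      rw [norm_sub_rev] at this
      linarith
    have h4 : ‖F a‖ ^ 2 ≤ (‖F x‖ + Q) ^ 2 := pow_le_pow_left₀ (norm_nonneg _) h3 2
    nlinarith [sq_nonneg (‖F x‖ - Q)]
  have hint : ∫ x in a..b, ‖F a‖ ^ 2 ≤ ∫ x in a..b, (2 * ‖F x‖ ^ 2 + 2 * (P / n)) :=
    intervalIntegral.integral_mono_on hle (continuous_const.intervalIntegrable _ _)
      (((continuous_const.mul (hFc.norm.pow 2)).add continuous_const).intervalIntegrable _ _) hpt
  rw [intervalIntegral.integral_const, intervalIntegral.integral_add,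
    intervalIntegral.integral_const_mul, intervalIntegral.integral_const, hlen, smul_eq_mul,
    smul_eq_mul] at hint
  · rw [intervalIntegral.integral_add, intervalIntegral.integral_const_mul,
      intervalIntegral.integral_const_mul, ← hP]
    · have h5 : n ^ 2 * (1 / n * ‖F a‖ ^ 2) = n * ‖F a‖ ^ 2 := by field_simp
      have h6 : n ^ 2 * (1 / n * (2 * (P / n))) = 2 * P := by field_simp
      have h7 := mul_le_mul_of_nonneg_left hint (sq_nonneg n)
      rw [h5, mul_add, h6] at h7
      linarith
    · exact (continuous_const.mul (hFc.norm.pow 2)).intervalIntegrable _ _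
    · exact (continuous_const.mul (hF'.norm.pow 2)).intervalIntegrable _ _
  · exact (continuous_const.mul (hFc.norm.pow 2)).intervalIntegrable _ _
  · exact continuous_const.intervalIntegrable _ _

/-- Summing over the intervals `[k/n, (k+1)/n]`: point samples at spacing `1/n` are controlled by an
integral over `[0, 1]`, one derivative costing a factor `1/n`. The samples to be bounded are the
matrix entries with `j + k = n`. -/
theorem sum_mul_norm_sq_le_integral {F F' : ℝ → ℂ} (hF : ∀ x, HasDerivAt F (F' x) x)
    (hF' : Continuous F') (n : ℕ) :
    ∑ k ∈ Finset.range n, (n : ℝ) * ‖F (k / n)‖ ^ 2 ≤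
      ∫ x in (0 : ℝ)..1, (2 * (n : ℝ) ^ 2 * ‖F x‖ ^ 2 + 2 * ‖F' x‖ ^ 2) := by
  rcases Nat.eq_zero_or_pos n with rfl | hn
  · simp only [Finset.range_zero, Finset.sum_empty]
    exact intervalIntegral.integral_nonneg zero_le_one fun x _ => by positivity
  have hn' : (0 : ℝ) < n := Nat.cast_pos.2 hn
  have hFc : Continuous F := continuous_iff_continuousAt.2 fun x => (hF x).continuousAt
  have hc : Continuous fun x => 2 * (n : ℝ) ^ 2 * ‖F x‖ ^ 2 + 2 * ‖F' x‖ ^ 2 := by fun_prop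
  have h := intervalIntegral.sum_integral_adjacent_intervals (a := fun k : ℕ => (k : ℝ) / n)
    (n := n) (f := fun x => 2 * (n : ℝ) ^ 2 * ‖F x‖ ^ 2 + 2 * ‖F' x‖ ^ 2)
    (μ := MeasureTheory.volume) fun k _ => hc.intervalIntegrable _ _
  rw [Nat.cast_zero, zero_div, div_self hn'.ne'] at h
  rw [← h]
  refine Finset.sum_le_sum fun k _ => mul_norm_sq_le_integral hF hF' hn' ?_
  push_cast
  ring

section HilbertSchmidt
variable {φ₀ φ₁ : ℝ → ℝ}

/-- The segment between two lifts. -/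
def seg (φ₀ φ₁ : ℝ → ℝ) (τ θ : ℝ) : ℝ := (1 - τ) * φ₀ θ + τ * φ₁ θ

theorem hasDerivAt_seg (h₀ : Lift φ₀) (h₁ : Lift φ₁) (τ θ : ℝ) :
    HasDerivAt (seg φ₀ φ₁ τ) ((1 - τ) * deriv φ₀ θ + τ * deriv φ₁ θ) θ :=
  ((h₀.hasDerivAt θ).const_mul _).add ((h₁.hasDerivAt θ).const_mul _)

theorem lift_seg (h₀ : Lift φ₀) (h₁ : Lift φ₁) {τ : ℝ} (hτ : τ ∈ Set.Icc (0 : ℝ) 1) :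
    Lift (seg φ₀ φ₁ τ) where
  contDiff := (contDiff_const.mul h₀.contDiff).add (contDiff_const.mul h₁.contDiff)
  deriv_pos θ := by
    rw [(hasDerivAt_seg h₀ h₁ τ θ).deriv]
    have e0 := h₀.deriv_pos θ
    have e1 := h₁.deriv_pos θ
    rcases hτ.1.eq_or_lt with h | h
    · rw [← h]; simpa using e0
    · have : 0 ≤ (1 - τ) * deriv φ₀ θ := mul_nonneg (by linarith [hτ.2]) e0.le
      positivity
  map_add θ := by
    rw [seg, seg, h₀.map_add, h₁.map_add]
    ring

theorem le_deriv_seg (h₀ : Lift φ₀) (h₁ : Lift φ₁) {τ : ℝ} (hτ : τ ∈ Set.Icc (0 : ℝ) 1) {m : ℝ}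
    (m₀ : ∀ θ, m ≤ deriv φ₀ θ) (m₁ : ∀ θ, m ≤ deriv φ₁ θ) (θ : ℝ) : m ≤ deriv (seg φ₀ φ₁ τ) θ := by
  rw [(hasDerivAt_seg h₀ h₁ τ θ).deriv]
  nlinarith [m₀ θ, m₁ θ, hτ.1, hτ.2]

theorem deriv_seg_le (h₀ : Lift φ₀) (h₁ : Lift φ₁) {τ : ℝ} (hτ : τ ∈ Set.Icc (0 : ℝ) 1) {M : ℝ}
    (m₀ : ∀ θ, deriv φ₀ θ ≤ M) (m₁ : ∀ θ, deriv φ₁ θ ≤ M) (θ : ℝ) : deriv (seg φ₀ φ₁ τ) θ ≤ M := by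
  rw [(hasDerivAt_seg h₀ h₁ τ θ).deriv]
  nlinarith [m₀ θ, m₁ θ, hτ.1, hτ.2]

/-- `(2π)⁻¹ ∫ e^{-inχ} φ₀'` for the points `χ` of the segment from `φ₀` to `φ₁`. -/
def segInt (φ₀ φ₁ : ℝ → ℝ) (n : ℤ) (τ : ℝ) : ℂ :=
  (2 * Real.pi : ℂ)⁻¹ * ∫ θ in (0 : ℝ)..2 * Real.pi,
    ((deriv φ₀ θ : ℝ) : ℂ) * ex (-n) (seg φ₀ φ₁ τ θ)

/-- The derivative of `segInt`. -/
def segInt' (φ₀ φ₁ : ℝ → ℝ) (n : ℤ) (τ : ℝ) : ℂ :=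
  (2 * Real.pi : ℂ)⁻¹ * ∫ θ in (0 : ℝ)..2 * Real.pi, ((deriv φ₀ θ : ℝ) : ℂ) *
    (((φ₁ θ - φ₀ θ : ℝ) : ℂ) * ((-n : ℤ) * Complex.I * ex (-n) (seg φ₀ φ₁ τ θ)))

theorem continuous_seg (h₀ : Lift φ₀) (h₁ : Lift φ₁) :
    Continuous fun p : ℝ × ℝ => seg φ₀ φ₁ p.1 p.2 := by
  have e0 := h₀.contDiff.continuous
  have e1 := h₁.contDiff.continuous
  unfold seg
  fun_prop

theorem continuous_segInt' (h₀ : Lift φ₀) (h₁ : Lift φ₁) (n : ℤ) :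
    Continuous (segInt' φ₀ φ₁ n) := by
  have e0 := h₀.contDiff.continuous
  have e1 := h₁.contDiff.continuous
  have e2 := h₀.continuous_deriv
  have e3 := continuous_seg h₀ h₁
  have e4 := continuous_ex (-n)
  refine continuous_const.mul
    (intervalIntegral.continuous_parametric_intervalIntegral_of_continuous' ?_ _ _)
  simp only [Function.uncurry_def]
  fun_prop

theorem hasDerivAt_segInt (h₀ : Lift φ₀) (h₁ : Lift φ₁) (n : ℤ) (τ : ℝ) :
    HasDerivAt (segInt φ₀ φ₁ n) (segInt' φ₀ φ₁ n τ) τ := by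
  have e0 := h₀.contDiff.continuous
  have e1 := h₁.contDiff.continuous
  have e2 := h₀.continuous_deriv
  have e3 := continuous_seg h₀ h₁
  have e4 := continuous_ex (-n)
  have hc : ∀ τ, Continuous (seg φ₀ φ₁ τ) := fun τ => by unfold seg; fun_prop
  refine HasDerivAt.const_mul _ ?_
  have hF : ∀ τ, Continuous fun θ => ((deriv φ₀ θ : ℝ) : ℂ) * ex (-n) (seg φ₀ φ₁ τ θ) := by
    intro τ
    have := hc τ
    fun_prop
  have hF' : ∀ τ, Continuous fun θ => ((deriv φ₀ θ : ℝ) : ℂ) *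
      (((φ₁ θ - φ₀ θ : ℝ) : ℂ) * ((-n : ℤ) * Complex.I * ex (-n) (seg φ₀ φ₁ τ θ))) := by
    intro τ
    have := hc τ
    fun_prop
  refine (intervalIntegral.hasDerivAt_integral_of_dominated_loc_of_deriv_le
    (F := fun τ θ => ((deriv φ₀ θ : ℝ) : ℂ) * ex (-n) (seg φ₀ φ₁ τ θ))
    (F' := fun τ θ => ((deriv φ₀ θ : ℝ) : ℂ) *
      (((φ₁ θ - φ₀ θ : ℝ) : ℂ) * ((-n : ℤ) * Complex.I * ex (-n) (seg φ₀ φ₁ τ θ))))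
    (bound := fun θ => ‖((deriv φ₀ θ : ℝ) : ℂ)‖ * (‖((φ₁ θ - φ₀ θ : ℝ) : ℂ)‖ * ‖((-n : ℤ) : ℂ)‖))
    (s := Set.univ) Filter.univ_mem
    (Eventually.of_forall fun τ => (hF τ).aestronglyMeasurable)
    ((hF τ).intervalIntegrable _ _) (hF' τ).aestronglyMeasurable
    (Eventually.of_forall fun θ _ τ _ => ?_) (Continuous.intervalIntegrable (by fun_prop) _ _)
    (Eventually.of_forall fun θ _ τ _ => ?_)).2
  · rw [norm_mul, norm_mul, norm_mul, norm_mul, norm_ex, Complex.norm_I, mul_one, mul_one]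
  · refine HasDerivAt.const_mul _ ?_
    have h1 : HasDerivAt (fun τ => seg φ₀ φ₁ τ θ) (φ₁ θ - φ₀ θ) τ := by
      have := (((hasDerivAt_id τ).const_sub 1).mul_const (φ₀ θ)).add
        ((hasDerivAt_id τ).mul_const (φ₁ θ))
      refine this.congr_deriv ?_
      ring
    have h2 := HasDerivAt.scomp τ (hasDerivAt_ex (-n) (seg φ₀ φ₁ τ θ)) h1
    rw [Complex.real_smul] at h2
    exact h2

/-- The matrix elements of the composition operators on `e^{-ikθ}`. -/
theorem cf_ex_comp (h₀ : Lift φ₀) (h₁ : Lift φ₁) {ψ₀ : ℝ → ℝ} (hψ : Lift ψ₀)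
    (hψφ : ∀ θ, ψ₀ (φ₀ θ) = θ) (j k : ℕ) (hjk : j + k ≠ 0) :
    cf (fun θ => ex (-k) (φ₁ (ψ₀ θ))) j = segInt φ₀ φ₁ (j + k : ℕ) ((k : ℝ) / (j + k : ℕ)) := by
  rw [h₀.cf_comp (h₁.perCont_comp (perCont_ex (-k))) hψφ hψ, segInt]
  congr 2
  funext θ
  congr 1
  have hn : ((j + k : ℕ) : ℝ) ≠ 0 := Nat.cast_ne_zero.2 hjk
  rw [ex, ex, ex, ← Complex.exp_add]
  congr 1
  have e : ((j + k : ℕ) : ℝ) * seg φ₀ φ₁ ((k : ℝ) / (j + k : ℕ)) θ = j * φ₀ θ + k * φ₁ θ := by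
    rw [seg]
    field_simp
    push_cast
    ring
  have e' : ((j + k : ℕ) : ℂ) * (seg φ₀ φ₁ ((k : ℝ) / (j + k : ℕ)) θ : ℂ) =
      j * (φ₀ θ : ℂ) + k * (φ₁ θ : ℂ) := by exact_mod_cast e
  push_cast at e' ⊢
  linear_combination Complex.I * e'

end HilbertSchmidt

section HilbertSchmidt
variable {φ₀ φ₁ : ℝ → ℝ}

theorem perCont_sub (h₀ : Lift φ₀) (h₁ : Lift φ₁) : PerCont fun θ => ((φ₁ θ - φ₀ θ : ℝ) : ℂ) := by
  refine ⟨Complex.continuous_ofReal.comp (h₁.contDiff.continuous.sub h₀.contDiff.continuous),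
    fun θ => ?_⟩
  rw [h₁.map_add, h₀.map_add]
  ring_nf

theorem sob_two_sub (h₀ : Lift φ₀) (h₁ : Lift φ₁) : sob 2 (fun θ => ((φ₁ θ - φ₀ θ : ℝ) : ℂ)) =
    sob 1 (fun θ => ((φ₁ θ - φ₀ θ : ℝ) : ℂ)) +
      sob 1 fun θ => ((deriv φ₁ θ : ℝ) : ℂ) - ((deriv φ₀ θ : ℝ) : ℂ) := by
  have hd : ∀ θ, HasDerivAt (fun θ => ((φ₁ θ - φ₀ θ : ℝ) : ℂ))
      (((deriv φ₁ θ : ℝ) : ℂ) - ((deriv φ₀ θ : ℝ) : ℂ)) θ := fun θ => by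
    have := ((h₁.hasDerivAt θ).sub (h₀.hasDerivAt θ)).ofReal_comp
    rw [Complex.ofReal_sub] at this
    exact this
  rw [(perCont_sub h₀ h₁).sob_two (Complex.ofRealCLM.contDiff.comp (h₁.contDiff.sub h₀.contDiff)),
    show deriv _ = _ from funext fun θ => (hd θ).deriv]

theorem cf_const (c : ℂ) {n : ℤ} (hn : n ≠ 0) : cf (fun _ => c) n = 0 := by
  have h := cf_const_mul c (ex 0) n
  rw [cf_ex, if_neg hn.symm, mul_zero] at h
  simpa only [ex_zero, mul_one] using h

/-- After the substitution by `χ = seg φ₀ φ₁ τ` the density is `φ₀'/χ' = 1 - τ(φ₁' - φ₀')/χ'`. The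
constant has no coefficient at `n ≠ 0`, which makes the result linear in `φ₁' - φ₀'`, up to the
factor `1/χ'`. -/
theorem segInt_eq (h₀ : Lift φ₀) (h₁ : Lift φ₁) {τ : ℝ} (hτ : τ ∈ Set.Icc (0 : ℝ) 1) {κ : ℝ → ℝ}
    (hκ : Lift κ) (hl : ∀ θ, κ (seg φ₀ φ₁ τ θ) = θ) {n : ℤ} (hn : n ≠ 0) :
    segInt φ₀ φ₁ n τ = cf (fun θ => (-τ : ℂ) * ((((deriv (seg φ₀ φ₁ τ) (κ θ) : ℝ) : ℂ))⁻¹ *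
      (((deriv φ₁ (κ θ) : ℝ) : ℂ) - ((deriv φ₀ (κ θ) : ℝ) : ℂ)))) n := by
  have hχ := lift_seg h₀ h₁ hτ
  have hχ0 : ∀ θ, ((deriv (seg φ₀ φ₁ τ) θ : ℝ) : ℂ) ≠ 0 := fun θ =>
    Complex.ofReal_ne_zero.2 (hχ.deriv_pos θ).ne'
  have hG : PerCont fun θ => (-τ : ℂ) * ((((deriv (seg φ₀ φ₁ τ) θ : ℝ) : ℂ))⁻¹ *
      (((deriv φ₁ θ : ℝ) : ℂ) - ((deriv φ₀ θ : ℝ) : ℂ))) :=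
    (perCont_const _).mul ((hχ.perCont_deriv.inv hχ0).mul (h₁.perCont_deriv.sub h₀.perCont_deriv))
  have h1 := cf_add (hκ.perCont_comp hG).cont (continuous_const (y := (1 : ℂ))) n
  rw [cf_const 1 hn, add_zero] at h1
  rw [← h1, hχ.cf_comp (hG.add (perCont_const 1)) hl hκ, segInt]
  congr 2
  funext θ
  have e := (hasDerivAt_seg h₀ h₁ τ θ).deriv
  have e' : ((deriv (seg φ₀ φ₁ τ) θ : ℝ) : ℂ) =
      (1 - τ) * ((deriv φ₀ θ : ℝ) : ℂ) + τ * ((deriv φ₁ θ : ℝ) : ℂ) := by rw [e]; push_cast; rfl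
  have h0 := hχ0 θ
  have e2 : ((deriv (seg φ₀ φ₁ τ) θ : ℝ) : ℂ) * ((((deriv (seg φ₀ φ₁ τ) θ : ℝ) : ℂ))⁻¹) = 1 :=
    mul_inv_cancel₀ h0
  linear_combination (-ex (-n) (seg φ₀ φ₁ τ θ)) * e' + (τ * ex (-n) (seg φ₀ φ₁ τ θ) *
    (((deriv φ₁ θ : ℝ) : ℂ) - ((deriv φ₀ θ : ℝ) : ℂ))) * e2

/-- The `τ`-derivative brings down `-in(φ₁ - φ₀)`, so the remaining coefficient is again of a
function with an `H¹`-norm controlled by `φ₁ - φ₀`, and the factor `n` is absorbed by that norm. -/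
theorem segInt'_eq (h₀ : Lift φ₀) (h₁ : Lift φ₁) {τ : ℝ} (hτ : τ ∈ Set.Icc (0 : ℝ) 1) {κ : ℝ → ℝ}
    (hκ : Lift κ) (hl : ∀ θ, κ (seg φ₀ φ₁ τ θ) = θ) (n : ℤ) :
    segInt' φ₀ φ₁ n τ = -(n * Complex.I) * cf (fun θ => (((deriv (seg φ₀ φ₁ τ) (κ θ) : ℝ) : ℂ))⁻¹ *
      ((deriv φ₀ (κ θ) : ℝ) : ℂ) * ((φ₁ (κ θ) - φ₀ (κ θ) : ℝ) : ℂ)) n := by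
  have hχ := lift_seg h₀ h₁ hτ
  have hχ0 : ∀ θ, ((deriv (seg φ₀ φ₁ τ) θ : ℝ) : ℂ) ≠ 0 := fun θ =>
    Complex.ofReal_ne_zero.2 (hχ.deriv_pos θ).ne'
  have hG : PerCont fun θ => (((deriv (seg φ₀ φ₁ τ) θ : ℝ) : ℂ))⁻¹ *
      ((deriv φ₀ θ : ℝ) : ℂ) * ((φ₁ θ - φ₀ θ : ℝ) : ℂ) :=
    ((hχ.perCont_deriv.inv hχ0).mul h₀.perCont_deriv).mul (perCont_sub h₀ h₁)
  rw [hχ.cf_comp hG hl hκ, segInt', mul_left_comm,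
    ← intervalIntegral.integral_const_mul (-(n * Complex.I))]
  congr 2
  funext θ
  have e2 : ((deriv (seg φ₀ φ₁ τ) θ : ℝ) : ℂ) * ((((deriv (seg φ₀ φ₁ τ) θ : ℝ) : ℂ))⁻¹) = 1 :=
    mul_inv_cancel₀ (hχ0 θ)
  push_cast
  linear_combination (n * Complex.I * ex (-n) (seg φ₀ φ₁ τ θ) * ((deriv φ₀ θ : ℝ) : ℂ) *
    ((φ₁ θ : ℂ) - φ₀ θ)) * e2

/-- The bound for the `H¹`-norm of the reciprocal of the derivative of a lift. -/
def invConst (m : ℝ) (K : ℝ≥0∞) : ℝ≥0∞ :=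
  ENNReal.ofReal ((m / 2)⁻¹ ^ 2) + ENNReal.ofReal (((m / 2)⁻¹ ^ 2) ^ 2) * (4 * K)

/-- The constant in the Hilbert-Schmidt estimate. -/
def hsConst (m M : ℝ) (K : ℝ≥0∞) : ℝ≥0∞ :=
  2 * (compConst M⁻¹ m⁻¹ * (algConst 1 * (invConst m K * (1 + algConst 1 * K))))

theorem invConst_ne_top {m : ℝ} {K : ℝ≥0∞} (hK : K ≠ ⊤) : invConst m K ≠ ⊤ :=
  ENNReal.add_ne_top.2 ⟨ENNReal.ofReal_ne_top,
    ENNReal.mul_ne_top ENNReal.ofReal_ne_top (ENNReal.mul_ne_top (by norm_num) hK)⟩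

theorem hsConst_ne_top {m M : ℝ} {K : ℝ≥0∞} (hK : K ≠ ⊤) : hsConst m M K ≠ ⊤ := by
  have h : algConst 1 ≠ ⊤ := algConst_ne_top (by norm_num)
  exact ENNReal.mul_ne_top (by norm_num) (ENNReal.mul_ne_top (compConst_ne_top _ _)
    (ENNReal.mul_ne_top h (ENNReal.mul_ne_top (invConst_ne_top hK)
      (ENNReal.add_ne_top.2 ⟨ENNReal.one_ne_top, ENNReal.mul_ne_top h hK⟩))))

theorem sob_const_mul_le (r : ℝ) {c : ℂ} (hc : ‖c‖ ≤ 1) (f : ℝ → ℂ) :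
    sob r (fun θ => c * f θ) ≤ sob r f := by
  rw [sob_const_mul]
  refine mul_le_of_le_one_left' (pow_le_one₀ zero_le ?_)
  rw [← ofReal_norm]
  simpa using ENNReal.ofReal_le_ofReal hc

/-- The bounds on `φ₀'` and `φ₁'` are uniform along the segment: the lower bound `m` by convexity,
the `H¹`-bound up to the factor `4` that enters `invConst`. -/
theorem sob_one_inv_deriv_seg_le (h₀ : Lift φ₀) (h₁ : Lift φ₁) {τ : ℝ}
    (hτ : τ ∈ Set.Icc (0 : ℝ) 1) {m : ℝ} (hm : 0 < m)
    (m₀ : ∀ θ, m ≤ deriv φ₀ θ) (m₁ : ∀ θ, m ≤ deriv φ₁ θ) {K : ℝ≥0∞} (hK : K ≠ ⊤)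
    (K₀ : sob 1 (fun θ => ((deriv φ₀ θ : ℝ) : ℂ)) ≤ K)
    (K₁ : sob 1 (fun θ => ((deriv φ₁ θ : ℝ) : ℂ)) ≤ K) :
    sob 1 (fun θ => (((deriv (seg φ₀ φ₁ τ) θ : ℝ) : ℂ))⁻¹) ≤ invConst m K := by
  have hχ := lift_seg h₀ h₁ hτ
  have h1 : sob 1 (fun θ => ((deriv (seg φ₀ φ₁ τ) θ : ℝ) : ℂ)) ≤ 4 * K := by
    have e : (fun θ => ((deriv (seg φ₀ φ₁ τ) θ : ℝ) : ℂ)) = fun θ =>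
        ((1 - τ : ℝ) : ℂ) * ((deriv φ₀ θ : ℝ) : ℂ) + (τ : ℂ) * ((deriv φ₁ θ : ℝ) : ℂ) := by
      funext θ
      rw [(hasDerivAt_seg h₀ h₁ τ θ).deriv]
      push_cast
      rfl
    rw [e]
    refine (sob_add_le 1 (continuous_const.mul h₀.perCont_deriv.cont)
      (continuous_const.mul h₁.perCont_deriv.cont)).trans ?_
    have e1 := sob_const_mul_le 1 (c := ((1 - τ : ℝ) : ℂ)) (by
      rw [Complex.norm_real, Real.norm_of_nonneg (by linarith [hτ.2])]
      linarith [hτ.1]) fun θ => ((deriv φ₀ θ : ℝ) : ℂ)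
    have e2 := sob_const_mul_le 1 (c := (τ : ℂ)) (by
      rw [Complex.norm_real, Real.norm_of_nonneg hτ.1]
      exact hτ.2) fun θ => ((deriv φ₁ θ : ℝ) : ℂ)
    calc _ ≤ 2 * (K + K) := by
          gcongr
          · exact e1.trans K₀
          · exact e2.trans K₁
      _ = _ := by ring
  refine (sob_one_inv_le hχ.perCont_deriv
    (ne_top_of_le_ne_top (ENNReal.mul_ne_top (by norm_num) hK) h1) hm fun θ => ?_).trans ?_
  · rw [Complex.norm_real, Real.norm_of_nonneg (hχ.deriv_pos θ).le]
    exact le_deriv_seg h₀ h₁ hτ m₀ m₁ θ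
  · rw [invConst]
    gcongr

/-- At fixed `τ` both sums are parts of `H¹`-norms of functions composed with the inverse of the
interpolated lift. Before composition, each is a product with a factor `φ₁' - φ₀'` or `φ₁ - φ₀`, and
all the others are bounded in `H¹` uniformly in `τ`. -/
theorem tsum_segInt_le (h₀ : Lift φ₀) (h₁ : Lift φ₁) {τ : ℝ}
    (hτ : τ ∈ Set.Icc (0 : ℝ) 1) {m M : ℝ} (hm : 0 < m) (hM : 0 < M)
    (m₀ : ∀ θ, m ≤ deriv φ₀ θ) (m₁ : ∀ θ, m ≤ deriv φ₁ θ)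
    (M₀ : ∀ θ, deriv φ₀ θ ≤ M) (M₁ : ∀ θ, deriv φ₁ θ ≤ M) {K : ℝ≥0∞} (hK : K ≠ ⊤)
    (K₀ : sob 1 (fun θ => ((deriv φ₀ θ : ℝ) : ℂ)) ≤ K)
    (K₁ : sob 1 (fun θ => ((deriv φ₁ θ : ℝ) : ℂ)) ≤ K)
    (hu : sob 2 (fun θ => ((φ₁ θ - φ₀ θ : ℝ) : ℂ)) ≠ ⊤) (N : ℕ) :
    ENNReal.ofReal (∑ n ∈ Finset.range N,
      (2 * (n : ℝ) ^ 2 * ‖segInt φ₀ φ₁ n τ‖ ^ 2 + 2 * ‖segInt' φ₀ φ₁ n τ‖ ^ 2)) ≤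
      hsConst m M K * sob 2 (fun θ => ((φ₁ θ - φ₀ θ : ℝ) : ℂ)) := by
  have hχ := lift_seg h₀ h₁ hτ
  obtain ⟨κ, hκ, hl, hr, hd⟩ := hχ.exists_inv
  have hχ0 : ∀ θ, ((deriv (seg φ₀ φ₁ τ) θ : ℝ) : ℂ) ≠ 0 := fun θ =>
    Complex.ofReal_ne_zero.2 (hχ.deriv_pos θ).ne'
  set S := sob 2 (fun θ => ((φ₁ θ - φ₀ θ : ℝ) : ℂ)) with hS
  set Q := invConst m K with hQ
  have hQt : Q ≠ ⊤ := invConst_ne_top hK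
  have hat : algConst 1 ≠ ⊤ := algConst_ne_top (by norm_num)
  have hi := hχ.perCont_deriv.inv hχ0
  have hQ1 := sob_one_inv_deriv_seg_le h₀ h₁ hτ hm m₀ m₁ hK K₀ K₁
  have hS2 := sob_two_sub h₀ h₁
  have hu0 : sob 1 (fun θ => ((φ₁ θ - φ₀ θ : ℝ) : ℂ)) ≤ S := by
    rw [hS, hS2]; exact le_self_add
  have hu1 : sob 1 (fun θ => ((deriv φ₁ θ : ℝ) : ℂ) - ((deriv φ₀ θ : ℝ) : ℂ)) ≤ S := by
    rw [hS, hS2]; exact le_add_self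
  set G : ℝ → ℂ := fun θ => (-τ : ℂ) * ((((deriv (seg φ₀ φ₁ τ) θ : ℝ) : ℂ))⁻¹ *
      (((deriv φ₁ θ : ℝ) : ℂ) - ((deriv φ₀ θ : ℝ) : ℂ))) with hG
  set H : ℝ → ℂ := fun θ => (((deriv (seg φ₀ φ₁ τ) θ : ℝ) : ℂ))⁻¹ *
      ((deriv φ₀ θ : ℝ) : ℂ) * ((φ₁ θ - φ₀ θ : ℝ) : ℂ) with hH
  have hGc : PerCont G := (perCont_const _).mul (hi.mul (h₁.perCont_deriv.sub h₀.perCont_deriv))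
  have hi0 := hi.mul h₀.perCont_deriv
  have hHc : PerCont H := hi0.mul (perCont_sub h₀ h₁)
  have hGs : sob 1 G ≤ algConst 1 * (Q * S) := by
    refine (sob_const_mul_le 1 (by
      rw [norm_neg, Complex.norm_real, Real.norm_of_nonneg hτ.1]; exact hτ.2) _).trans ?_
    refine (sob_mul_le (by norm_num) hi (h₁.perCont_deriv.sub h₀.perCont_deriv)
      (ne_top_of_le_ne_top hQt hQ1)).trans ?_
    gcongr
  have hHs : sob 1 H ≤ algConst 1 * ((algConst 1 * (Q * K)) * S) := by
    have e1 : sob 1 (fun θ => (((deriv (seg φ₀ φ₁ τ) θ : ℝ) : ℂ))⁻¹ * ((deriv φ₀ θ : ℝ) : ℂ)) ≤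
        algConst 1 * (Q * K) := by
      refine (sob_mul_le (by norm_num) hi h₀.perCont_deriv (ne_top_of_le_ne_top hQt hQ1)).trans ?_
      gcongr
    refine (sob_mul_le (by norm_num) hi0 (perCont_sub h₀ h₁) (ne_top_of_le_ne_top
      (ENNReal.mul_ne_top hat (ENNReal.mul_ne_top hQt hK)) e1)).trans ?_
    gcongr
  have hGt : sob 1 G ≠ ⊤ := ne_top_of_le_ne_top
    (ENNReal.mul_ne_top hat (ENNReal.mul_ne_top hQt hu)) hGs
  have hHt : sob 1 H ≠ ⊤ := ne_top_of_le_ne_top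
    (ENNReal.mul_ne_top hat (ENNReal.mul_ne_top
      (ENNReal.mul_ne_top hat (ENNReal.mul_ne_top hQt hK)) hu)) hHs
  have hκ1 : ∀ θ, M⁻¹ ≤ deriv κ θ := fun θ => by
    rw [hd]
    exact inv_anti₀ (hχ.deriv_pos _) (deriv_seg_le h₀ h₁ hτ M₀ M₁ _)
  have hκ2 : ∀ θ, deriv κ θ ≤ m⁻¹ := fun θ => by
    rw [hd]
    exact inv_anti₀ hm (le_deriv_seg h₀ h₁ hτ m₀ m₁ _)
  have hGk := hκ.sob_one_comp (inv_pos.2 hM) hκ1 hκ2 hGc hGt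
  have hHk := hκ.sob_one_comp (inv_pos.2 hM) hκ1 hκ2 hHc hHt
  have hterm : ∀ n : ℕ, ENNReal.ofReal
      (2 * (n : ℝ) ^ 2 * ‖segInt φ₀ φ₁ n τ‖ ^ 2 + 2 * ‖segInt' φ₀ φ₁ n τ‖ ^ 2) ≤
      2 * (wt 1 (n : ℤ) * ‖cf (fun θ => G (κ θ)) n‖ₑ ^ 2 +
        wt 1 (n : ℤ) * ‖cf (fun θ => H (κ θ)) n‖ₑ ^ 2) := by
    intro n
    -- The formula for `segInt` omits the constant and fails at `n = 0`, but there the left-hand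
    -- side vanishes because of the factors `n`.
    rcases Nat.eq_zero_or_pos n with rfl | hn
    · rw [segInt'_eq h₀ h₁ hτ hκ hl]
      simp
    · rw [segInt_eq h₀ h₁ hτ hκ hl (by exact_mod_cast hn.ne'), segInt'_eq h₀ h₁ hτ hκ hl]
      have hw : ENNReal.ofReal ((n : ℝ) ^ 2) ≤ wt 1 (n : ℤ) := by
        rw [wt_one, Int.cast_natCast]
        exact le_add_self
      have e : ∀ x y : ℂ, ENNReal.ofReal (2 * (n : ℝ) ^ 2 * ‖x‖ ^ 2 +
          2 * ‖-(((n : ℤ) : ℂ) * Complex.I) * y‖ ^ 2) = 2 * (ENNReal.ofReal ((n : ℝ) ^ 2) * ‖x‖ₑ ^ 2 +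
            ENNReal.ofReal ((n : ℝ) ^ 2) * ‖y‖ₑ ^ 2) := by
        intro x y
        have h1 : ‖-(((n : ℤ) : ℂ) * Complex.I) * y‖ ^ 2 = (n : ℝ) ^ 2 * ‖y‖ ^ 2 := by
          simp [mul_pow]
        rw [h1, ← ofReal_norm, ← ofReal_norm, ← ENNReal.ofReal_pow (norm_nonneg _),
          ← ENNReal.ofReal_pow (norm_nonneg _), ← ENNReal.ofReal_mul (by positivity),
          ← ENNReal.ofReal_mul (by positivity), ← ENNReal.ofReal_add (by positivity) (by positivity),
          ← ENNReal.ofReal_ofNat 2, ← ENNReal.ofReal_mul (by positivity)]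
        congr 1
        ring
      rw [e]
      gcongr
  rw [ENNReal.ofReal_sum_of_nonneg fun n _ => by positivity]
  calc _ ≤ ∑ n ∈ Finset.range N, 2 * (wt 1 (n : ℤ) * ‖cf (fun θ => G (κ θ)) n‖ₑ ^ 2 +
        wt 1 (n : ℤ) * ‖cf (fun θ => H (κ θ)) n‖ₑ ^ 2) := Finset.sum_le_sum fun n _ => hterm n
    _ ≤ ∑' n : ℕ, 2 * (wt 1 (n : ℤ) * ‖cf (fun θ => G (κ θ)) n‖ₑ ^ 2 +
        wt 1 (n : ℤ) * ‖cf (fun θ => H (κ θ)) n‖ₑ ^ 2) := ENNReal.sum_le_tsum _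
    _ ≤ ∑' n : ℤ, 2 * (wt 1 n * ‖cf (fun θ => G (κ θ)) n‖ₑ ^ 2 +
        wt 1 n * ‖cf (fun θ => H (κ θ)) n‖ₑ ^ 2) :=
        ENNReal.tsum_comp_le_tsum_of_injective Nat.cast_injective _
    _ = 2 * (sob 1 (fun θ => G (κ θ)) + sob 1 (fun θ => H (κ θ))) := by
        rw [ENNReal.tsum_mul_left, ENNReal.tsum_add]
        rfl
    _ ≤ 2 * (compConst M⁻¹ m⁻¹ * (algConst 1 * (Q * S)) +
          compConst M⁻¹ m⁻¹ * (algConst 1 * ((algConst 1 * (Q * K)) * S))) := by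
        gcongr
        · exact hGk.trans (by gcongr)
        · exact hHk.trans (by gcongr)
    _ = _ := by
        rw [hsConst]
        ring

/-- The Hilbert-Schmidt estimate for the off-diagonal part of the composition operator with
`φ₁ ∘ φ₀⁻¹`. -/
theorem hilbertSchmidt_le (h₀ : Lift φ₀) (h₁ : Lift φ₁) {ψ₀ : ℝ → ℝ} (hψ : Lift ψ₀)
    (hψφ : ∀ θ, ψ₀ (φ₀ θ) = θ) {m M : ℝ} (hm : 0 < m) (hM : 0 < M)
    (m₀ : ∀ θ, m ≤ deriv φ₀ θ) (m₁ : ∀ θ, m ≤ deriv φ₁ θ)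
    (M₀ : ∀ θ, deriv φ₀ θ ≤ M) (M₁ : ∀ θ, deriv φ₁ θ ≤ M) {K : ℝ≥0∞} (hK : K ≠ ⊤)
    (K₀ : sob 1 (fun θ => ((deriv φ₀ θ : ℝ) : ℂ)) ≤ K)
    (K₁ : sob 1 (fun θ => ((deriv φ₁ θ : ℝ) : ℂ)) ≤ K)
    (hu : sob 2 (fun θ => ((φ₁ θ - φ₀ θ : ℝ) : ℂ)) ≠ ⊤) :
    ∑' p : ℕ+ × ℕ+, ENNReal.ofReal ((p.1 : ℝ) / p.2 *
      ‖cf (fun θ => ex (-((p.2 : ℕ) : ℤ)) (φ₁ (ψ₀ θ))) (p.1 : ℕ)‖ ^ 2) ≤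
      hsConst m M K * sob 2 (fun θ => ((φ₁ θ - φ₀ θ : ℝ) : ℂ)) := by
  set R := hsConst m M K * sob 2 (fun θ => ((φ₁ θ - φ₀ θ : ℝ) : ℂ)) with hR
  have hRt : R ≠ ⊤ := ENNReal.mul_ne_top (hsConst_ne_top hK) hu
  let f : (Σ n : ℕ, Fin n) → ℝ≥0∞ := fun q =>
    ENNReal.ofReal ((q.1 : ℝ) * ‖segInt φ₀ φ₁ q.1 ((q.2 : ℕ) / (q.1 : ℝ))‖ ^ 2)
  -- Matrix entries are grouped by total frequency `n = j + k`; the pair is sent to the sample point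
  -- `k/n`, with `0 < k < n` since `j ≥ 1`.
  let ι : ℕ+ × ℕ+ → Σ n : ℕ, Fin n := fun p => ⟨p.1 + p.2, ⟨p.2, by have := p.1.pos; omega⟩⟩
  have hι : Function.Injective ι := by
    rintro ⟨j, k⟩ ⟨j', k'⟩ h
    have h1 : (j : ℕ) + k = j' + k' := congrArg (fun q : Σ n : ℕ, Fin n => q.1) h
    have h2 : (k : ℕ) = k' := congrArg (fun q : Σ n : ℕ, Fin n => (q.2 : ℕ)) h
    have h3 : (j : ℕ) = j' := by omega
    rw [PNat.coe_injective h2, PNat.coe_injective h3]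
  have hle : ∀ p : ℕ+ × ℕ+, ENNReal.ofReal ((p.1 : ℝ) / p.2 *
      ‖cf (fun θ => ex (-((p.2 : ℕ) : ℤ)) (φ₁ (ψ₀ θ))) (p.1 : ℕ)‖ ^ 2) ≤ f (ι p) := by
    rintro ⟨j, k⟩
    have hjk : (j : ℕ) + k ≠ 0 := by have := j.pos; omega
    rw [cf_ex_comp h₀ h₁ hψ hψφ j k hjk]
    refine ENNReal.ofReal_le_ofReal ?_
    simp only [ι]
    gcongr
    -- The weight satisfies `j / k ≤ j + k`, as `k ≥ 1`.
    rw [div_le_iff₀ (by exact_mod_cast k.pos)]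
    have h1 : (1 : ℝ) ≤ (k : ℕ) := by exact_mod_cast k.pos
    have h2 : (0 : ℝ) ≤ (j : ℕ) := by positivity
    push_cast
    nlinarith
  have hsum : ∑' q, f q = ∑' n : ℕ, ENNReal.ofReal
      (∑ k ∈ Finset.range n, (n : ℝ) * ‖segInt φ₀ φ₁ n ((k : ℝ) / n)‖ ^ 2) := by
    rw [ENNReal.tsum_sigma' f]
    refine tsum_congr fun n => ?_
    rw [tsum_fintype, Finset.sum_range, ENNReal.ofReal_sum_of_nonneg fun _ _ => by positivity]
  refine (ENNReal.tsum_le_tsum hle).trans ((ENNReal.tsum_comp_le_tsum_of_injective hι f).trans ?_)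
  rw [hsum]
  -- With finitely many `n`, interchanging the sum over `n` and the integral over `τ` is elementary;
  -- the bound is uniform in `N`.
  refine ENNReal.tsum_le_of_sum_range_le fun N => ?_
  rw [← ENNReal.ofReal_sum_of_nonneg fun n _ => Finset.sum_nonneg fun _ _ => by positivity,
    ← ENNReal.ofReal_toReal hRt]
  refine ENNReal.ofReal_le_ofReal ?_
  have hc : ∀ n : ℕ, Continuous fun τ =>
      2 * (n : ℝ) ^ 2 * ‖segInt φ₀ φ₁ n τ‖ ^ 2 + 2 * ‖segInt' φ₀ φ₁ n τ‖ ^ 2 := by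
    intro n
    have e1 : Continuous (segInt φ₀ φ₁ n) :=
      continuous_iff_continuousAt.2 fun τ => (hasDerivAt_segInt h₀ h₁ n τ).continuousAt
    have e2 := continuous_segInt' h₀ h₁ n
    fun_prop
  calc ∑ n ∈ Finset.range N, ∑ k ∈ Finset.range n, (n : ℝ) * ‖segInt φ₀ φ₁ n ((k : ℝ) / n)‖ ^ 2
      ≤ ∑ n ∈ Finset.range N, ∫ τ in (0 : ℝ)..1,
        (2 * (n : ℝ) ^ 2 * ‖segInt φ₀ φ₁ n τ‖ ^ 2 + 2 * ‖segInt' φ₀ φ₁ n τ‖ ^ 2) :=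
        Finset.sum_le_sum fun n _ => sum_mul_norm_sq_le_integral (hasDerivAt_segInt h₀ h₁ n)
          (continuous_segInt' h₀ h₁ n) n
    _ = ∫ τ in (0 : ℝ)..1, ∑ n ∈ Finset.range N,
        (2 * (n : ℝ) ^ 2 * ‖segInt φ₀ φ₁ n τ‖ ^ 2 + 2 * ‖segInt' φ₀ φ₁ n τ‖ ^ 2) :=
        (intervalIntegral.integral_finsetSum fun n _ => (hc n).intervalIntegrable _ _).symm
    _ ≤ ∫ _ in (0 : ℝ)..1, R.toReal := by
        refine intervalIntegral.integral_mono_on zero_le_one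
          ((continuous_finsetSum _ fun n _ => hc n).intervalIntegrable _ _)
          (continuous_const.intervalIntegrable _ _) fun τ hτ => ?_
        exact (ENNReal.ofReal_le_iff_le_toReal hRt).1
          (tsum_segInt_le h₀ h₁ hτ hm hM m₀ m₁ M₀ M₁ hK K₀ K₁ hu N)
    _ = R.toReal := by simp

end HilbertSchmidt

/-! ### The one-particle space and the action of lifts on it -/

theorem hasSum_pnat {X : Type*} [AddCommMonoid X] [TopologicalSpace X] [ContinuousAdd X] {F : ℤ → X}
    {a : X} (hF : HasSum F a) (h0 : F 0 = 0) (hneg : ∀ n, F (-n) = F n) :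
    HasSum (fun k : ℕ+ => F (k : ℕ) + F (k : ℕ)) a := by
  have h1 := hF.nat_add_neg
  simp only [hneg, h0, add_zero] at h1
  refine (PNat.coe_injective.hasSum_iff (f := fun n : ℕ => F n + F n) fun n hn => ?_).2 h1
  have : n = 0 := by
    by_contra h
    exact hn ⟨⟨n, Nat.pos_of_ne_zero h⟩, rfl⟩
  simp [this, h0]

open Classical in
/-- The sequence `(√k f_k)_{k ≥ 1}` as a vector of `H₁`, for a complex function on `ℝ`. -/
def clv (f : ℝ → ℂ) : H1 :=
  if h : Memℓp (fun k : ℕ+ => (Real.sqrt (k : ℕ) : ℂ) * cf f (k : ℕ)) 2 then ⟨_, h⟩ else 0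

theorem cls_eq_clv (f : S1 → ℝ) : cls f = clv fun θ => ((f θ : ℝ) : ℂ) := rfl

theorem enorm_sqrt_mul_sq (k : ℕ) (z : ℂ) :
    ‖(Real.sqrt k : ℂ) * z‖ₑ ^ 2 = ENNReal.ofReal k * ‖z‖ₑ ^ 2 := by
  rw [enorm_mul, mul_pow, ← ofReal_norm (Real.sqrt k : ℂ), Complex.norm_real,
    Real.norm_of_nonneg (Real.sqrt_nonneg _), ← ENNReal.ofReal_pow (Real.sqrt_nonneg _),
    Real.sq_sqrt (Nat.cast_nonneg _)]

theorem ofReal_nat_le_wt (k : ℕ) : ENNReal.ofReal k ≤ wt (1 / 2) (k : ℤ) := by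
  refine ENNReal.ofReal_le_ofReal ?_
  rw [← Real.sqrt_eq_rpow]
  exact Real.le_sqrt_of_sq_le (by push_cast; linarith)

theorem wt_half_le_nat {k : ℕ} (hk : k ≠ 0) : wt (1 / 2) (k : ℤ) ≤ 2 * ENNReal.ofReal k := by
  rw [wt, ← Real.sqrt_eq_rpow, ← ENNReal.ofReal_ofNat 2, ← ENNReal.ofReal_mul (by positivity)]
  refine ENNReal.ofReal_le_ofReal (Real.sqrt_le_iff.2 ⟨by positivity, ?_⟩)
  have : (1 : ℝ) ≤ k := by exact_mod_cast Nat.pos_of_ne_zero hk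
  push_cast
  nlinarith

theorem tsum_classSeq_le (f : ℝ → ℂ) :
    ∑' k : ℕ+, ‖(Real.sqrt (k : ℕ) : ℂ) * cf f (k : ℕ)‖ₑ ^ 2 ≤ sob (1 / 2) f := by
  simp only [enorm_sqrt_mul_sq]
  refine (ENNReal.tsum_le_tsum (g := fun k : ℕ+ => wt (1 / 2) (k : ℕ) * ‖cf f (k : ℕ)‖ₑ ^ 2)
    fun k => by gcongr; exact ofReal_nat_le_wt k).trans ?_
  have hi : Function.Injective fun k : ℕ+ => ((k : ℕ) : ℤ) :=
    Nat.cast_injective.comp PNat.coe_injective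
  exact ENNReal.tsum_comp_le_tsum_of_injective hi fun k : ℤ => wt (1 / 2) k * ‖cf f k‖ₑ ^ 2

theorem memlp_clv {f : ℝ → ℂ} (h : sob (1 / 2) f ≠ ⊤) :
    Memℓp (fun k : ℕ+ => (Real.sqrt (k : ℕ) : ℂ) * cf f (k : ℕ)) 2 := by
  rw [memlp_two_iff]
  have h1 := ENNReal.summable_toReal (ne_top_of_le_ne_top h (tsum_classSeq_le f))
  simpa only [ENNReal.toReal_pow, toReal_enorm] using h1

theorem clv_apply {f : ℝ → ℂ} (h : sob (1 / 2) f ≠ ⊤) (k : ℕ+) :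
    clv f k = (Real.sqrt (k : ℕ) : ℂ) * cf f (k : ℕ) := by
  rw [clv, dif_pos (memlp_clv h)]

theorem enorm_sq_eq_tsum (h : H1) : ‖h‖ₑ ^ 2 = ∑' k, ‖h k‖ₑ ^ 2 := by
  have h1 := hasSum_norm_sq h
  rw [← ofReal_norm, ← ENNReal.ofReal_pow (norm_nonneg _), ← h1.tsum_eq,
    ENNReal.ofReal_tsum_of_nonneg (fun _ => by positivity) h1.summable]
  refine tsum_congr fun k => ?_
  rw [ENNReal.ofReal_pow (norm_nonneg _), ofReal_norm]

theorem enorm_clv_sq_le {f : ℝ → ℂ} : ‖clv f‖ₑ ^ 2 ≤ sob (1 / 2) f := by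
  by_cases h : sob (1 / 2) f = ⊤
  · rw [h]; exact le_top
  · rw [enorm_sq_eq_tsum]
    simp only [clv_apply h]
    exact tsum_classSeq_le f

theorem clv_add {f g : ℝ → ℂ} (hf : Continuous f) (hg : Continuous g) (h1 : sob (1 / 2) f ≠ ⊤)
    (h2 : sob (1 / 2) g ≠ ⊤) : clv (fun θ => f θ + g θ) = clv f + clv g := by
  ext k
  rw [clv_apply (sob_add_ne_top hf hg h1 h2), lp.coeFn_add, Pi.add_apply, clv_apply h1,
    clv_apply h2, cf_add hf hg, mul_add]

theorem clv_const_mul (c : ℂ) {f : ℝ → ℂ} (h1 : sob (1 / 2) f ≠ ⊤) :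
    clv (fun θ => c * f θ) = c • clv f := by
  ext k
  have h2 : sob (1 / 2) (fun θ => c * f θ) ≠ ⊤ := by
    rw [sob_const_mul]
    exact ENNReal.mul_ne_top (ENNReal.pow_ne_top enorm_ne_top) h1
  rw [clv_apply h2, lp.coeFn_smul, Pi.smul_apply, clv_apply h1, cf_const_mul, smul_eq_mul]
  ring

/-- The real functions of class `C¹` with period `2π`. -/
def perC1 : Submodule ℝ (ℝ → ℝ) where
  carrier := {f | ContDiff ℝ 1 f ∧ ∀ θ, f (θ + 2 * Real.pi) = f θ}
  add_mem' := fun ha hb => ⟨ha.1.add hb.1, fun θ => by simp [ha.2 θ, hb.2 θ]⟩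
  zero_mem' := ⟨contDiff_const, fun _ => rfl⟩
  smul_mem' := fun c _ ha => ⟨ha.1.const_smul c, fun θ => by simp [ha.2 θ]⟩

theorem perC1.perCont (f : perC1) : PerCont fun θ => ((f.1 θ : ℝ) : ℂ) :=
  ⟨Complex.continuous_ofReal.comp f.2.1.continuous, fun θ => by rw [f.2.2]⟩

theorem perC1.contDiff (f : perC1) : ContDiff ℝ 1 fun θ => ((f.1 θ : ℝ) : ℂ) :=
  Complex.ofRealCLM.contDiff.comp f.2.1

theorem perC1.hasDerivAt (f : perC1) (θ : ℝ) :
    HasDerivAt (fun θ => ((f.1 θ : ℝ) : ℂ)) ((deriv f.1 θ : ℝ) : ℂ) θ :=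
  (f.2.1.differentiable one_ne_zero θ).hasDerivAt.ofReal_comp

theorem PerCont.sob_one_ne_top {f : ℝ → ℂ} (hf : PerCont f) (h : ContDiff ℝ 1 f) : sob 1 f ≠ ⊤ := by
  obtain ⟨C, -, hC⟩ := hf.bounded
  obtain ⟨C', -, hC'⟩ := (hf.deriv h).bounded
  rw [hf.sob_one h, ENNReal.add_ne_top]
  exact ⟨ne_top_of_le_ne_top ENNReal.ofReal_ne_top (sob_zero_le_of_bound hf.cont hC),
    ne_top_of_le_ne_top ENNReal.ofReal_ne_top (sob_zero_le_of_bound (hf.deriv h).cont hC')⟩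

theorem perC1.sob_one_ne_top (f : perC1) : sob 1 (fun θ => ((f.1 θ : ℝ) : ℂ)) ≠ ⊤ :=
  (perC1.perCont f).sob_one_ne_top (perC1.contDiff f)

theorem perC1.sob_half_ne_top (f : perC1) : sob (1 / 2) (fun θ => ((f.1 θ : ℝ) : ℂ)) ≠ ⊤ :=
  ne_top_of_le_ne_top (perC1.sob_one_ne_top f) (sob_mono (by norm_num) _)

/-- The class in `H₁` of a periodic `C¹` function. -/
def clR : perC1 →ₗ[ℝ] H1 where
  toFun f := clv fun θ => ((f.1 θ : ℝ) : ℂ)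
  map_add' f g := by
    rw [← clv_add (perC1.perCont f).cont (perC1.perCont g).cont (perC1.sob_half_ne_top f) (perC1.sob_half_ne_top g)]
    congr 1
    funext θ
    exact Complex.ofReal_add _ _
  map_smul' c f := by
    have h : (RingHom.id ℝ c) • clv (fun θ => ((f.1 θ : ℝ) : ℂ)) =
      (c : ℂ) • clv (fun θ => ((f.1 θ : ℝ) : ℂ)) := rfl
    rw [h, ← clv_const_mul (c : ℂ) (perC1.sob_half_ne_top f)]
    congr 1
    funext θ
    exact Complex.ofReal_mul _ _

theorem clR_apply (f : perC1) : clR f = clv fun θ => ((f.1 θ : ℝ) : ℂ) := rfl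

theorem cf_neg_of_real (f : ℝ → ℝ) (k : ℤ) :
    cf (fun θ => ((f θ : ℝ) : ℂ)) (-k) = conj (cf (fun θ => ((f θ : ℝ) : ℂ)) k) := by
  have h := intervalIntegral.intervalIntegral_conj (μ := MeasureTheory.volume) (a := 0)
    (b := 2 * Real.pi) (f := fun θ => ex (-k) θ * ((f θ : ℝ) : ℂ))
  rw [cf_eq, cf_eq, map_mul, ← h]
  congr 1
  · simp [map_ofNat (starRingEnd ℂ) 2]
  · refine intervalIntegral.integral_congr fun θ _ => ?_
    simp only [map_mul, conj_ex, Complex.conj_ofReal]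

/-- The `H^{1/2}`-norm of a real function modulo constants is equivalent to that of `H₁`. -/
theorem sob_half_sub_mean_le (f : perC1) :
    sob (1 / 2) (fun θ => ((f.1 θ : ℝ) : ℂ) - cf (fun θ => ((f.1 θ : ℝ) : ℂ)) 0) ≤
      4 * ‖clR f‖ₑ ^ 2 := by
  set F : ℝ → ℂ := fun θ => ((f.1 θ : ℝ) : ℂ) with hF
  have hc : ∀ k, cf (fun θ => F θ - cf F 0) k = if k = 0 then 0 else cf F k := by
    intro k
    rw [cf_sub (perC1.perCont f).cont continuous_const]
    split_ifs with h
    · have h1 := cf_const_mul (cf F 0) (ex 0) 0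
      rw [cf_ex, if_pos rfl, mul_one] at h1
      simp only [ex_zero, mul_one] at h1
      rw [h, h1, sub_self]
    · rw [cf_const _ h, sub_zero]
  have hw : ∀ k : ℤ, wt (1 / 2) (-k) = wt (1 / 2) k := fun k => by simp [wt]
  have hn : ∀ k : ℤ, ‖cf F (-k)‖ₑ = ‖cf F k‖ₑ := fun k => by
    rw [cf_neg_of_real, ← ofReal_norm, ← ofReal_norm, RCLike.norm_conj]
  have h := hasSum_pnat (F := fun k : ℤ => wt (1 / 2) k * ‖cf (fun θ => F θ - cf F 0) k‖ₑ ^ 2)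
    ENNReal.summable.hasSum (by simp [hc]) fun k => by
      simp only [hc, hw, neg_eq_zero]
      split_ifs <;> simp [hn]
  rw [sob, ← h.tsum_eq, enorm_sq_eq_tsum, ← ENNReal.tsum_mul_left]
  refine ENNReal.tsum_le_tsum fun k => ?_
  rw [clR_apply, clv_apply (perC1.sob_half_ne_top f), enorm_sqrt_mul_sq, hc, if_neg (by simp)]
  calc _ ≤ 2 * ENNReal.ofReal (k : ℕ) * ‖cf F (k : ℕ)‖ₑ ^ 2 +
      2 * ENNReal.ofReal (k : ℕ) * ‖cf F (k : ℕ)‖ₑ ^ 2 := by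
        gcongr <;> exact wt_half_le_nat k.ne_zero
    _ = _ := by ring

/-- The function `2 Re (c e^{ibθ}) / √b`, whose class is `c` times a unit vector. -/
def reEx (c : ℂ) (b : ℕ+) : perC1 :=
  ⟨fun θ => 2 / Real.sqrt (b : ℕ) * (c * ex (b : ℕ) θ).re, by
    refine ⟨contDiff_const.mul (Complex.reCLM.contDiff.comp (contDiff_const.mul
      ((contDiff_ex _).of_le (by simp)))), fun θ => by simp only [ex_per]⟩⟩

theorem reEx_eq (c : ℂ) (b : ℕ+) (θ : ℝ) : (((reEx c b).1 θ : ℝ) : ℂ) =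
    (Real.sqrt (b : ℕ) : ℂ)⁻¹ * c * ex (b : ℕ) θ +
      (Real.sqrt (b : ℕ) : ℂ)⁻¹ * conj c * ex (-((b : ℕ) : ℤ)) θ := by
  rw [reEx]
  simp only
  rw [← conj_ex, Complex.ofReal_mul, Complex.re_eq_add_conj]
  push_cast
  rw [map_mul]
  ring

theorem unitVec_self {ι : Type} (i : ι) : unitVec i i = 1 := by
  classical
  rw [unitVec, lp.single_apply, Pi.single_eq_same]

theorem unitVec_of_ne {ι : Type} {i j : ι} (h : j ≠ i) : unitVec i j = 0 := by
  classical
  rw [unitVec, lp.single_apply, Pi.single_eq_of_ne h]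

theorem clR_reEx (c : ℂ) (b : ℕ+) : clR (reEx c b) = c • unitVec b := by
  ext k
  rw [clR_apply, clv_apply (perC1.sob_half_ne_top (reEx c b)), lp.coeFn_smul, Pi.smul_apply,
    smul_eq_mul]
  simp only [reEx_eq]
  rw [cf_add (f := fun θ => (Real.sqrt (b : ℕ) : ℂ)⁻¹ * c * ex (b : ℕ) θ)
    (g := fun θ => (Real.sqrt (b : ℕ) : ℂ)⁻¹ * conj c * ex (-((b : ℕ) : ℤ)) θ)
    (continuous_const.mul (continuous_ex _)) (continuous_const.mul (continuous_ex _)), cf_const_mul, cf_const_mul, cf_ex, cf_ex]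
  have h2 : -((b : ℕ) : ℤ) ≠ ((k : ℕ) : ℤ) := by
    have h3 := b.pos
    have h4 := k.pos
    omega
  rw [if_neg h2, mul_zero, add_zero]
  by_cases h : k = b
  · subst h
    have h5 : (Real.sqrt (k : ℕ) : ℂ) ≠ 0 := by
      rw [Complex.ofReal_ne_zero, Real.sqrt_ne_zero']
      exact_mod_cast k.pos
    simp only [if_true, unitVec_self]
    field_simp
  · have h5 : ¬ ((b : ℕ) : ℤ) = ((k : ℕ) : ℤ) := fun h6 =>
      h (PNat.coe_injective (by exact_mod_cast h6.symm))
    simp [h5, unitVec_of_ne h]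

/-- Real combinations suffice because `reEx c b` has class `c • unitVec b` for every complex `c`.
The submodule is a parameter so that density can also be obtained for smooth functions. -/
theorem denseRange_clR_of_reEx {X : Submodule ℝ perC1} (hX : ∀ c b, reEx c b ∈ X) :
    Dense (clR '' (X : Set perC1)) := by
  intro h
  have h1 := hasSum_unitVec h
  refine mem_closure_of_tendsto h1 (Eventually.of_forall fun s => ?_)
  refine ⟨∑ b ∈ s, reEx (h b) b, X.sum_mem fun b _ => hX _ _, ?_⟩
  rw [map_sum]
  exact Finset.sum_congr rfl fun b _ => clR_reEx _ _

theorem denseRange_clR : DenseRange clR := by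
  have := denseRange_clR_of_reEx (X := ⊤) fun _ _ => Submodule.mem_top
  rwa [Submodule.top_coe, Set.image_univ] at this

namespace Lift
variable {ψ φ χ : ℝ → ℝ}

/-- Composition with a lift. -/
def compR (h : Lift ψ) : perC1 →ₗ[ℝ] perC1 where
  toFun f := ⟨fun θ => f.1 (ψ θ), f.2.1.comp h.contDiff, fun θ => by simp only [h.map_add, f.2.2]⟩
  map_add' _ _ := rfl
  map_smul' _ _ := rfl

theorem compR_apply (h : Lift ψ) (f : perC1) (θ : ℝ) : (h.compR f).1 θ = f.1 (ψ θ) := rfl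

/-- Midpoint interpolation between the bounds for composition on `L²` and on `H¹`. -/
theorem sob_half_comp_le (h : Lift ψ) {m M : ℝ} (hm : 0 < m) (hψ : ∀ θ, m ≤ deriv ψ θ)
    (hM : ∀ θ, deriv ψ θ ≤ M) {f : ℝ → ℂ} (hf : PerCont f) (hs : Summable fun k => ‖cf f k‖) :
    sob (1 / 2) (fun θ => f (ψ θ)) ≤ compConst m M * sob (1 / 2) f := by
  refine h.sob_comp_of_comb (fun a => ?_) hf hs
  have key := sob_comb_interpolation (E := fun k θ => ex k (ψ θ))
    (fun k => (continuous_ex k).comp h.contDiff.continuous) 1 (compConst m M) (fun a => ?_)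
    (fun a => ?_) (η := 1 / 2) (by norm_num) (by norm_num) a
  · simp only [one_mul] at key
    exact key
  · refine (h.sob_zero_comp hm hψ (perCont_comb_ex a)).trans ?_
    gcongr
    exact le_mul_of_one_le_right' le_self_add
  · change sob 1 (fun θ => comb ex a (ψ θ)) ≤ _
    exact h.sob_one_comp hm hψ hM (perCont_comb_ex a) (sob_comb_ne_top 1 a)

/-- The norm of `H₁` controls the `H^{1/2}`-norm only modulo constants. Subtracting the mean of `f`
before composing is harmless: a constant stays constant under composition and has no positive
Fourier coefficients. -/
theorem norm_clR_compR_le (h : Lift ψ) {m M : ℝ} (hm : 0 < m) (hψ : ∀ θ, m ≤ deriv ψ θ)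
    (hM : ∀ θ, deriv ψ θ ≤ M) (f : perC1) :
    ‖clR (h.compR f)‖ ≤ Real.sqrt (compConst m M * 4).toReal * ‖clR f‖ := by
  set F : ℝ → ℂ := fun θ => ((f.1 θ : ℝ) : ℂ) with hF
  set c := cf F 0 with hc
  have hFc : PerCont fun θ => F θ - c := (perC1.perCont f).sub (perCont_const c)
  have hFs : sob 1 (fun θ => F θ - c) ≠ ⊤ :=
    sob_sub_ne_top (perC1.perCont f).cont continuous_const (perC1.sob_one_ne_top f) (sob_const_ne_top 1 c)
  have h1 : clR (h.compR f) = clv fun θ => F (ψ θ) - c := by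
    have e1 : sob (1 / 2) (fun θ => F (ψ θ) - c) ≠ ⊤ :=
      sob_sub_ne_top (h.perCont_comp (perC1.perCont f)).cont continuous_const (perC1.sob_half_ne_top (h.compR f))
        (sob_const_ne_top _ c)
    ext k
    rw [clR_apply, clv_apply (perC1.sob_half_ne_top (h.compR f)), clv_apply e1,
      cf_sub (h.perCont_comp (perC1.perCont f)).cont continuous_const, cf_const c (by simp), sub_zero]
    rfl
  have h2 : ‖clR (h.compR f)‖ₑ ^ 2 ≤ compConst m M * 4 * ‖clR f‖ₑ ^ 2 := by
    rw [h1, mul_assoc]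
    refine enorm_clv_sq_le.trans ((h.sob_half_comp_le hm hψ hM hFc
      (summable_norm_cf (by norm_num) hFs)).trans ?_)
    gcongr
    exact sob_half_sub_mean_le f
  have h3 : compConst m M * 4 ≠ ⊤ := ENNReal.mul_ne_top (compConst_ne_top m M) (by norm_num)
  have h4 := ENNReal.toReal_mono (ENNReal.mul_ne_top h3 (ENNReal.pow_ne_top enorm_ne_top)) h2
  rw [ENNReal.toReal_mul, ENNReal.toReal_pow, ENNReal.toReal_pow, toReal_enorm, toReal_enorm] at h4
  refine le_of_sq_le_sq ?_ (by positivity)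
  rwa [mul_pow, Real.sq_sqrt ENNReal.toReal_nonneg]

theorem exists_norm_clR_compR_le (h : Lift ψ) : ∃ C, ∀ f, ‖clR (h.compR f)‖ ≤ C * ‖clR f‖ := by
  obtain ⟨m, hm, hm'⟩ := h.exists_le_deriv
  obtain ⟨M, -, hM⟩ := h.exists_deriv_le
  exact ⟨_, h.norm_clR_compR_le hm hm' hM⟩

/-- The operator on `H₁` induced by the composition with a lift. -/
def op (h : Lift ψ) : H1 →L[ℝ] H1 := (clR.comp h.compR).extendOfNorm clR

theorem op_clR (h : Lift ψ) (f : perC1) : h.op (clR f) = clR (h.compR f) :=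
  LinearMap.extendOfNorm_eq denseRange_clR h.exists_norm_clR_compR_le f

theorem ext_clR {S T : H1 →L[ℝ] H1} (h : ∀ f, S (clR f) = T (clR f)) : S = T :=
  DFunLike.coe_injective (denseRange_clR.equalizer S.continuous T.continuous (funext h))

theorem op_comp (h : Lift ψ) (k : Lift χ) (x : H1) : h.op (k.op x) = (k.comp h).op x := by
  have : h.op.comp k.op = (k.comp h).op := ext_clR fun f => by
    rw [ContinuousLinearMap.comp_apply, op_clR, op_clR, op_clR]
    rfl
  exact congrArg (fun T : H1 →L[ℝ] H1 => T x) this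

theorem op_eq_self (h : Lift ψ) (hψ : ∀ θ, ψ θ = θ) (x : H1) : h.op x = x := by
  have : h.op = ContinuousLinearMap.id ℝ H1 := ext_clR fun f => by
    rw [op_clR, ContinuousLinearMap.id_apply]
    congr 1
    apply Subtype.ext
    funext θ
    rw [compR_apply, hψ]
  rw [this, ContinuousLinearMap.id_apply]

end Lift

/-! ### The symplectic form and implementers of close lifts -/

/-- The symplectic form of `H₁` in terms of functions. -/
theorem im_inner_clR (f g : perC1) : (inner ℂ (clR f) (clR g) : ℂ).im =
    -((4 * Real.pi)⁻¹ * ∫ θ in (0 : ℝ)..2 * Real.pi, f.1 θ * deriv g.1 θ) := by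
  set F : ℝ → ℂ := fun θ => ((f.1 θ : ℝ) : ℂ) with hF
  set G : ℝ → ℂ := fun θ => ((g.1 θ : ℝ) : ℂ) with hG
  set G' : ℝ → ℂ := fun θ => ((deriv g.1 θ : ℝ) : ℂ) with hG'
  have hGd : deriv G = G' := funext fun θ => ((perC1.hasDerivAt g) θ).deriv
  have hG'c : Continuous G' := Complex.continuous_ofReal.comp g.2.1.continuous_deriv_one
  have hFc : Continuous F := (perC1.perCont f).cont
  have hcf : ∀ k, cf G' k = k * Complex.I * cf G k := fun k => by
    rw [← hGd, cf_deriv (perC1.contDiff g) (perC1.perCont g).per]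
  -- Parseval for `f ± g'` and polarisation, whence the factor `1/4`; as `f` and `g'` are real, this
  -- yields `∫ f g'`.
  have h1 := ((parseval (hFc.add hG'c)).sub (parseval (hFc.sub hG'c))).mul_left (1 / 4)
  have h2 : ∀ k : ℤ, 1 / 4 * (‖cf (fun θ => F θ + G' θ) k‖ ^ 2 - ‖cf (fun θ => F θ - G' θ) k‖ ^ 2) =
      -(k * (conj (cf F k) * cf G k).im) := by
    intro k
    rw [cf_add hFc hG'c, cf_sub hFc hG'c, hcf, ← Complex.normSq_eq_norm_sq,
      ← Complex.normSq_eq_norm_sq, Complex.normSq_apply, Complex.normSq_apply]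
    simp
    ring
  have h3 : ∫ θ in (0 : ℝ)..2 * Real.pi, ‖F θ + G' θ‖ ^ 2 =
      (∫ θ in (0 : ℝ)..2 * Real.pi, ‖F θ - G' θ‖ ^ 2) +
        4 * ∫ θ in (0 : ℝ)..2 * Real.pi, f.1 θ * deriv g.1 θ := by
    rw [← intervalIntegral.integral_const_mul, ← intervalIntegral.integral_add]
    · refine intervalIntegral.integral_congr fun θ _ => ?_
      simp only [hF, hG', ← Complex.ofReal_add, ← Complex.ofReal_sub, Complex.norm_real,
        Real.norm_eq_abs, sq_abs]
      ring
    · exact ((hFc.sub hG'c).norm.pow 2).intervalIntegrable _ _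
    · exact (continuous_const.mul (f.2.1.continuous.mul g.2.1.continuous_deriv_one)).intervalIntegrable
        _ _
  have h4 : HasSum (fun k : ℤ => -(k * (conj (cf F k) * cf G k).im))
      ((2 * Real.pi)⁻¹ * ∫ θ in (0 : ℝ)..2 * Real.pi, f.1 θ * deriv g.1 θ) := by
    have e : (2 * Real.pi)⁻¹ * ∫ θ in (0 : ℝ)..2 * Real.pi, f.1 θ * deriv g.1 θ = 1 / 4 *
        ((2 * Real.pi)⁻¹ * (∫ θ in (0 : ℝ)..2 * Real.pi, ‖F θ + G' θ‖ ^ 2) -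
          (2 * Real.pi)⁻¹ * ∫ θ in (0 : ℝ)..2 * Real.pi, ‖F θ - G' θ‖ ^ 2) := by
      rw [h3]
      ring
    rw [e]
    simp only [← h2]
    exact h1
  -- For real functions the terms `k` and `-k` agree, so the sum over `ℤ` is twice that over `k ≥
  -- 1`; this turns `(2π)⁻¹` into `(4π)⁻¹`.
  have h5 := hasSum_pnat h4 (by simp) fun k => by
    rw [cf_neg_of_real, cf_neg_of_real]
    simp
    ring
  have h6 := (lp.hasSum_inner (𝕜 := ℂ) (G := fun _ : ℕ+ => ℂ) (clR f) (clR g)).mapL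
    Complex.imCLM
  have h7 : ∀ k : ℕ+, Complex.imCLM (inner ℂ (clR f k) (clR g k)) =
      -(1 / 2) * (-(((k : ℕ) : ℤ) * (conj (cf F (k : ℕ)) * cf G (k : ℕ)).im) +
        -(((k : ℕ) : ℤ) * (conj (cf F (k : ℕ)) * cf G (k : ℕ)).im)) := by
    intro k
    rw [clR_apply, clR_apply, clv_apply (perC1.sob_half_ne_top f), clv_apply (perC1.sob_half_ne_top g)]
    have h8 : Real.sqrt (k : ℕ) * Real.sqrt (k : ℕ) = (k : ℕ) := Real.mul_self_sqrt (Nat.cast_nonneg _)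
    have h9 : (inner ℂ ((Real.sqrt (k : ℕ) : ℂ) * cf F (k : ℕ)) ((Real.sqrt (k : ℕ) : ℂ) * cf G (k : ℕ)) : ℂ) =
        ((k : ℕ) : ℝ) * (conj (cf F (k : ℕ)) * cf G (k : ℕ)) := by
      have h11 : (Real.sqrt (k : ℕ) : ℂ) * (Real.sqrt (k : ℕ) : ℂ) = (((k : ℕ) : ℝ) : ℂ) := by
        rw [← Complex.ofReal_mul, h8]
      rw [RCLike.inner_apply, map_mul, Complex.conj_ofReal]
      linear_combination (cf G (k : ℕ) * conj (cf F (k : ℕ))) * h11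
    rw [h9, Complex.imCLM_apply, Complex.im_ofReal_mul]
    push_cast
    ring
  simp only [h7] at h6
  have h10 := (h5.mul_left (-(1 / 2))).unique h6
  rw [Complex.imCLM_apply] at h10
  rw [← h10, mul_inv, mul_inv]
  ring

namespace Lift
variable {φ ψ χ : ℝ → ℝ}

theorem op_congr (h : Lift ψ) (k : Lift χ) (e : ∀ θ, ψ θ = χ θ) : h.op = k.op := by
  obtain rfl : ψ = χ := funext e
  rfl

/-- On functions, `∫ f dg` is invariant under a change of variables; the general case follows by
density of the classes. -/
theorem im_inner_op (h : Lift ψ) (x y : H1) :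
    (inner ℂ (h.op x) (h.op y) : ℂ).im = (inner ℂ x y : ℂ).im := by
  refine denseRange_clR.induction_on₂ (p := fun x y =>
    (inner ℂ (h.op x) (h.op y) : ℂ).im = (inner ℂ x y : ℂ).im) ?_ (fun f g => ?_) x y
  · exact isClosed_eq (by fun_prop) (by fun_prop)
  · rw [h.op_clR, h.op_clR, im_inner_clR, im_inner_clR]
    have hG : PerCont fun θ => ((f.1 θ * deriv g.1 θ : ℝ) : ℂ) := by
      have h1 := (perC1.perCont f).mul ((perC1.perCont g).deriv (perC1.contDiff g))
      rw [show deriv (fun θ => ((g.1 θ : ℝ) : ℂ)) = _ from funext fun θ => (perC1.hasDerivAt g θ).deriv]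
        at h1
      simpa using h1
    have h2 := h.integral_comp hG
    simp only [← Complex.ofReal_mul] at h2
    rw [intervalIntegral.integral_ofReal, intervalIntegral.integral_ofReal, Complex.ofReal_inj] at h2
    rw [← h2]
    congr 2
    refine intervalIntegral.integral_congr fun θ _ => ?_
    have h3 : HasDerivAt (h.compR g).1 (deriv g.1 (ψ θ) * deriv ψ θ) θ :=
      ((g.2.1.differentiable one_ne_zero (ψ θ)).hasDerivAt).comp θ (h.hasDerivAt θ)
    simp only [h3.deriv, compR_apply]
    ring

/-- The symplectic transformation induced by a diffeomorphism with lift `φ`, with inverse `ψ`. -/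
def sympEquiv (h : Lift φ) (k : Lift ψ) (hl : ∀ θ, ψ (φ θ) = θ) (hr : ∀ θ, φ (ψ θ) = θ) :
    SympEquiv H1 where
  S := k.op
  S' := h.op
  right_inv x := (op_comp k h x).trans (op_eq_self _ hr x)
  left_inv x := (op_comp h k x).trans (op_eq_self _ hl x)
  symp := k.im_inner_op

theorem contDiff_ex_comp (h : Lift ψ) (k : ℤ) : ContDiff ℝ 1 fun θ => ex k (ψ θ) :=
  h.contDiff_comp ((contDiff_ex k).of_le (by simp))

theorem sob_half_ex_comp_ne_top (h : Lift ψ) (k : ℤ) : sob (1 / 2) (fun θ => ex k (ψ θ)) ≠ ⊤ :=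
  ne_top_of_le_ne_top ((h.perCont_comp (perCont_ex k)).sob_one_ne_top (h.contDiff_ex_comp k))
    (sob_mono (by norm_num) _)

theorem op_smul_unitVec (h : Lift ψ) (c : ℂ) (b : ℕ+) : h.op (c • unitVec b) =
    ((Real.sqrt (b : ℕ) : ℂ)⁻¹ * c) • clv (fun θ => ex (b : ℕ) (ψ θ)) +
      ((Real.sqrt (b : ℕ) : ℂ)⁻¹ * conj c) • clv (fun θ => ex (-((b : ℕ) : ℤ)) (ψ θ)) := by
  rw [← clR_reEx, op_clR, clR_apply]
  simp only [compR_apply, reEx_eq]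
  have h1 := h.sob_half_ex_comp_ne_top (b : ℕ)
  have h2 := h.sob_half_ex_comp_ne_top (-((b : ℕ) : ℤ))
  have e : ∀ (c : ℂ) {f : ℝ → ℂ}, sob (1 / 2) f ≠ ⊤ → sob (1 / 2) (fun θ => c * f θ) ≠ ⊤ := by
    intro c f hf
    rw [sob_const_mul]
    exact ENNReal.mul_ne_top (ENNReal.pow_ne_top enorm_ne_top) hf
  rw [clv_add (f := fun θ => (Real.sqrt (b : ℕ) : ℂ)⁻¹ * c * ex (b : ℕ) (ψ θ))
    (g := fun θ => (Real.sqrt (b : ℕ) : ℂ)⁻¹ * conj c * ex (-((b : ℕ) : ℤ)) (ψ θ))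
    (continuous_const.mul (h.contDiff_ex_comp _).continuous)
    (continuous_const.mul (h.contDiff_ex_comp _).continuous) (e _ h1) (e _ h2),
    clv_const_mul _ h1, clv_const_mul _ h2]

/-- The vector `c • unitVec b` is the class of a real function with one term `c e^{ibθ}` and one
term `conj c e^{-ibθ}`; composition keeps both, and the second is the antilinear one. The antilinear
part thus measures how much `e^{-ibψ}` leaks into positive frequencies. -/
theorem antiPart_op_unitVec (h : Lift ψ) (b : ℕ+) : antiPart h.op (unitVec b) =
    (Real.sqrt (b : ℕ) : ℂ)⁻¹ • clv (fun θ => ex (-((b : ℕ) : ℤ)) (ψ θ)) := by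
  have h1 := h.op_smul_unitVec 1 b
  rw [one_smul] at h1
  have h2 : antiPart h.op (unitVec b) = (1 / 2 : ℂ) •
      (h.op (unitVec b) + Complex.I • h.op (Complex.I • unitVec b)) := rfl
  rw [h2, h1, op_smul_unitVec, map_one, Complex.conj_I]
  generalize clv (fun θ => ex (b : ℕ) (ψ θ)) = X
  generalize clv (fun θ => ex (-((b : ℕ) : ℤ)) (ψ θ)) = Y
  match_scalars
  · linear_combination (1 / 2 * (Real.sqrt (b : ℕ) : ℂ)⁻¹) * Complex.I_mul_I
  · linear_combination (-(1 / 2) * (Real.sqrt (b : ℕ) : ℂ)⁻¹) * Complex.I_mul_I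

theorem enorm_antiPart_op_unitVec (h : Lift ψ) (b : ℕ+) : ‖antiPart h.op (unitVec b)‖ₑ ^ 2 =
    ∑' j : ℕ+, ENNReal.ofReal ((j : ℝ) / b *
      ‖cf (fun θ => ex (-((b : ℕ) : ℤ)) (ψ θ)) (j : ℕ)‖ ^ 2) := by
  rw [enorm_sq_eq_tsum]
  refine tsum_congr fun j => ?_
  have hb : (0 : ℝ) < (b : ℕ) := by exact_mod_cast b.pos
  rw [antiPart_op_unitVec, lp.coeFn_smul, Pi.smul_apply, clv_apply (h.sob_half_ex_comp_ne_top _),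
    ← ofReal_norm, ← ENNReal.ofReal_pow (norm_nonneg _)]
  congr 1
  rw [norm_smul, norm_mul, norm_inv, Complex.norm_real, Complex.norm_real,
    Real.norm_of_nonneg (Real.sqrt_nonneg _), Real.norm_of_nonneg (Real.sqrt_nonneg _), mul_pow,
    mul_pow, inv_pow, Real.sq_sqrt hb.le, Real.sq_sqrt (Nat.cast_nonneg _)]
  ring

/-- For `β ≤ ε ≤ 1/2` one has `2β/(1 - β) ≤ 4ε`. The implemented map is composition with `ψ`, and
the criterion concerns the antilinear part of its inverse; hence the condition is on `φ`. -/
theorem exists_implementer_of_tsum_le (h : Lift φ) (k : Lift ψ) (hl : ∀ θ, ψ (φ θ) = θ)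
    (hr : ∀ θ, φ (ψ θ) = θ) {ε : ℝ} (hε0 : 0 ≤ ε) (hε : ε ≤ 1 / 2)
    (hle : ∑' p : ℕ+ × ℕ+, ENNReal.ofReal ((p.1 : ℝ) / p.2 *
      ‖cf (fun θ => ex (-((p.2 : ℕ) : ℤ)) (φ θ)) (p.1 : ℕ)‖ ^ 2) ≤ ENNReal.ofReal (ε ^ 2)) :
    ∃ u : unitary (F1 →L[ℂ] F1), (∀ x, (u : F1 →L[ℂ] F1) * weyl x = weyl (k.op x) * u) ∧
      ‖(u : F1 →L[ℂ] F1) (coherent 0) - coherent 0‖ ≤ 4 * ε := by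
  have h1 : ∑' b : ℕ+, ‖antiPart h.op (unitVec b)‖ₑ ^ 2 ≤ ENNReal.ofReal (ε ^ 2) := by
    refine le_trans (le_of_eq ?_) hle
    rw [ENNReal.tsum_prod', ENNReal.tsum_comm]
    exact tsum_congr fun b => h.enorm_antiPart_op_unitVec b
  have h2 : ∑' b : ℕ+, ‖antiPart h.op (unitVec b)‖ₑ ^ 2 ≠ ⊤ :=
    ne_top_of_le_ne_top ENNReal.ofReal_ne_top h1
  have hs : Summable fun b : ℕ+ => ‖antiPart h.op (unitVec b)‖ ^ 2 := by
    simpa only [ENNReal.toReal_pow, toReal_enorm] using ENNReal.summable_toReal h2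
  have h3 : ∑' b : ℕ+, ‖antiPart h.op (unitVec b)‖ ^ 2 ≤ ε ^ 2 := by
    have h4 := ENNReal.toReal_mono ENNReal.ofReal_ne_top h1
    rw [ENNReal.tsum_toReal_eq (fun _ => ENNReal.pow_ne_top enorm_ne_top),
      ENNReal.toReal_ofReal (sq_nonneg ε)] at h4
    simpa only [ENNReal.toReal_pow, toReal_enorm] using h4
  have h5 : Real.sqrt (∑' b : ℕ+, ‖antiPart h.op (unitVec b)‖ ^ 2) ≤ ε :=
    Real.sqrt_le_iff.2 ⟨hε0, h3⟩
  obtain ⟨u, hu1, hu2⟩ := exists_implementer (h.sympEquiv k hl hr) hs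
    (h5.trans_lt (by linarith))
  refine ⟨u, hu1, hu2.trans ?_⟩
  change 2 * (Real.sqrt (∑' b : ℕ+, ‖antiPart h.op (unitVec b)‖ ^ 2) /
    (1 - Real.sqrt (∑' b : ℕ+, ‖antiPart h.op (unitVec b)‖ ^ 2))) ≤ 4 * ε
  have h6 := Real.sqrt_nonneg (∑' b : ℕ+, ‖antiPart h.op (unitVec b)‖ ^ 2)
  generalize Real.sqrt (∑' b : ℕ+, ‖antiPart h.op (unitVec b)‖ ^ 2) = β at h5 h6 ⊢
  have h7 : β / (1 - β) ≤ 2 * ε := by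
    rw [div_le_iff₀ (by linarith)]
    nlinarith
  linarith

/-- Implementers of `φ₁ ∘ φ₀⁻¹` for close lifts `φ₀`, `φ₁`. -/
theorem exists_implementer_of_close {φ₀ φ₁ ψ₀ ψ₁ : ℝ → ℝ} (h₀ : Lift φ₀) (h₁ : Lift φ₁)
    (k₀ : Lift ψ₀) (k₁ : Lift ψ₁) (l₀ : ∀ θ, ψ₀ (φ₀ θ) = θ) (r₀ : ∀ θ, φ₀ (ψ₀ θ) = θ)
    (l₁ : ∀ θ, ψ₁ (φ₁ θ) = θ) (r₁ : ∀ θ, φ₁ (ψ₁ θ) = θ) {m M : ℝ} (hm : 0 < m) (hM : 0 < M)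
    (m₀ : ∀ θ, m ≤ deriv φ₀ θ) (m₁ : ∀ θ, m ≤ deriv φ₁ θ)
    (M₀ : ∀ θ, deriv φ₀ θ ≤ M) (M₁ : ∀ θ, deriv φ₁ θ ≤ M) {K : ℝ≥0∞} (hK : K ≠ ⊤)
    (K₀ : sob 1 (fun θ => ((deriv φ₀ θ : ℝ) : ℂ)) ≤ K)
    (K₁ : sob 1 (fun θ => ((deriv φ₁ θ : ℝ) : ℂ)) ≤ K)
    (hu : sob 2 (fun θ => ((φ₁ θ - φ₀ θ : ℝ) : ℂ)) ≠ ⊤) {ε : ℝ} (hε0 : 0 ≤ ε) (hε : ε ≤ 1 / 2)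
    (hle : hsConst m M K * sob 2 (fun θ => ((φ₁ θ - φ₀ θ : ℝ) : ℂ)) ≤ ENNReal.ofReal (ε ^ 2)) :
    ∃ u : unitary (F1 →L[ℂ] F1),
      (∀ x, (u : F1 →L[ℂ] F1) * weyl x = weyl ((h₀.comp k₁).op x) * u) ∧
      ‖(u : F1 →L[ℂ] F1) (coherent 0) - coherent 0‖ ≤ 4 * ε :=
  (h₁.comp k₀).exists_implementer_of_tsum_le (h₀.comp k₁) (fun θ => by rw [l₁, r₀])
    (fun θ => by rw [l₀, r₁]) hε0 hε
    ((hilbertSchmidt_le h₀ h₁ k₀ l₀ hm hM m₀ m₁ M₀ M₁ hK K₀ K₁ hu).trans hle)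

end Lift

/-! ### Implementers for all `H²`-lifts -/

theorem lift_id : Lift id where
  contDiff := contDiff_id
  deriv_pos θ := by simp
  map_add θ := rfl

theorem sob_one_deriv_seg_le {φ₀ φ₁ : ℝ → ℝ} (h₀ : Lift φ₀) (h₁ : Lift φ₁) {τ : ℝ}
    (hτ : τ ∈ Set.Icc (0 : ℝ) 1) {K : ℝ≥0∞} (K₀ : sob 1 (fun θ => ((deriv φ₀ θ : ℝ) : ℂ)) ≤ K)
    (K₁ : sob 1 (fun θ => ((deriv φ₁ θ : ℝ) : ℂ)) ≤ K) :
    sob 1 (fun θ => ((deriv (seg φ₀ φ₁ τ) θ : ℝ) : ℂ)) ≤ 4 * K := by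
  have e : (fun θ => ((deriv (seg φ₀ φ₁ τ) θ : ℝ) : ℂ)) = fun θ =>
      ((1 - τ : ℝ) : ℂ) * ((deriv φ₀ θ : ℝ) : ℂ) + (τ : ℂ) * ((deriv φ₁ θ : ℝ) : ℂ) := by
    funext θ
    rw [(hasDerivAt_seg h₀ h₁ τ θ).deriv]
    push_cast
    rfl
  rw [e]
  refine (sob_add_le 1 (continuous_const.mul h₀.perCont_deriv.cont)
    (continuous_const.mul h₁.perCont_deriv.cont)).trans ?_
  have e1 := sob_const_mul_le 1 (c := ((1 - τ : ℝ) : ℂ)) (by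
    rw [Complex.norm_real, Real.norm_of_nonneg (by linarith [hτ.2])]
    linarith [hτ.1]) fun θ => ((deriv φ₀ θ : ℝ) : ℂ)
  have e2 := sob_const_mul_le 1 (c := (τ : ℂ)) (by
    rw [Complex.norm_real, Real.norm_of_nonneg hτ.1]
    exact hτ.2) fun θ => ((deriv φ₁ θ : ℝ) : ℂ)
  calc _ ≤ 2 * (K + K) := by
        gcongr
        · exact e1.trans K₀
        · exact e2.trans K₁
    _ = _ := by ring

/-- Every diffeomorphism with an `H²`-lift is implemented. -/
theorem Lift.exists_implementer {φ ψ : ℝ → ℝ} (h : Lift φ) (k : Lift ψ) (hr : ∀ θ, φ (ψ θ) = θ)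
    (hs : sob 2 (fun θ => ((φ θ - θ : ℝ) : ℂ)) ≠ ⊤) :
    ∃ u : unitary (F1 →L[ℂ] F1), ∀ x, (u : F1 →L[ℂ] F1) * weyl x = weyl (k.op x) * u := by
  obtain ⟨m', hm', hmφ⟩ := h.exists_le_deriv
  obtain ⟨M', hM', hMφ⟩ := h.exists_deriv_le
  set m := min 1 m' with hm
  set M := max 1 M' with hM
  have hm0 : 0 < m := lt_min zero_lt_one hm'
  have hM0 : 0 < M := lt_max_of_lt_left zero_lt_one
  have hid : ∀ θ, deriv (id : ℝ → ℝ) θ = 1 := fun θ => by simp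
  set K := max (sob 1 fun θ => ((deriv (id : ℝ → ℝ) θ : ℝ) : ℂ)) (sob 1 fun θ => ((deriv φ θ : ℝ) : ℂ))
    with hK
  have hKt : 4 * K ≠ ⊤ := by
    refine ENNReal.mul_ne_top (by norm_num) ?_
    rw [hK]
    refine (max_lt (lt_top_iff_ne_top.2 ?_) (lt_top_iff_ne_top.2 ?_)).ne
    · simp only [hid]
      exact sob_const_ne_top 1 _
    · refine h.sob_deriv_ne_top ?_
      norm_num
      simpa using hs
  set S := sob 2 (fun θ => ((φ θ - θ : ℝ) : ℂ)) with hS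
  have hCt : hsConst m M (4 * K) * S ≠ ⊤ := ENNReal.mul_ne_top (hsConst_ne_top hKt) hs
  -- Consecutive points of the segment from `id` to `φ`, cut into `N` pieces, have squared
  -- `H²`-distance `S/N²`. With `4CS < N ≤ N²` the Hilbert-Schmidt bound of each step is at most
  -- `(1/2)²`.
  obtain ⟨N, hN⟩ := exists_nat_gt (4 * (hsConst m M (4 * K) * S).toReal)
  have hN0 : (0 : ℝ) < N := lt_of_le_of_lt (by positivity) hN
  have hN1 : (1 : ℝ) ≤ N := by exact_mod_cast (Nat.cast_pos.1 hN0)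
  have hτ : ∀ i : ℕ, i ≤ N → (i : ℝ) / N ∈ Set.Icc (0 : ℝ) 1 := fun i hi =>
    ⟨by positivity, by rw [div_le_one hN0]; exact_mod_cast hi⟩
  -- The implementer of the next point is the product of one for the short step and the previous
  -- one. At each stage `χ` is the inverse of the interpolated lift, since composition with the
  -- inverse is implemented.
  have key : ∀ i : ℕ, i ≤ N → ∀ {χ : ℝ → ℝ} (kχ : Lift χ), (∀ θ, seg id φ (i / N) (χ θ) = θ) →
      ∃ u : unitary (F1 →L[ℂ] F1), ∀ x, (u : F1 →L[ℂ] F1) * weyl x = weyl (kχ.op x) * u := by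
    intro i
    induction i with
    | zero =>
      intro _ χ kχ hχ
      refine ⟨1, fun x => ?_⟩
      rw [kχ.op_eq_self fun θ => by simpa [seg] using hχ θ]
      simp
    | succ i ih =>
      intro hi χ kχ hχ
      have hi0 := hτ i (by omega)
      have hi1 := hτ (i + 1) hi
      have L0 := lift_seg lift_id h hi0
      have L1 := lift_seg lift_id h hi1
      obtain ⟨ψ₀, k₀, l₀, r₀, -⟩ := L0.exists_inv
      obtain ⟨u₀, hu₀⟩ := ih (by omega) k₀ r₀
      have l₁ : ∀ θ, χ (seg id φ ((i + 1 : ℕ) / N) θ) = θ := fun θ =>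
        L1.strictMono.injective (hχ _)
      have hsub : (fun θ => ((seg id φ ((i + 1 : ℕ) / N) θ - seg id φ (i / N) θ : ℝ) : ℂ)) =
          fun θ => ((1 / N : ℝ) : ℂ) * ((φ θ - θ : ℝ) : ℂ) := by
        funext θ
        rw [← Complex.ofReal_mul]
        congr 1
        simp only [seg, id]
        push_cast
        ring
      have hsub2 : sob 2 (fun θ => ((seg id φ ((i + 1 : ℕ) / N) θ - seg id φ (i / N) θ : ℝ) : ℂ)) =
          ENNReal.ofReal ((1 / N) ^ 2) * S := by
        rw [hsub, sob_const_mul, ← ofReal_norm, Complex.norm_real,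
          Real.norm_of_nonneg (by positivity), ENNReal.ofReal_pow (by positivity)]
      obtain ⟨v, hv, -⟩ := Lift.exists_implementer_of_close L0 L1 k₀ kχ l₀ r₀ l₁ hχ hm0 hM0
        (le_deriv_seg lift_id h hi0 (fun θ => by rw [hid]; exact min_le_left _ _)
          fun θ => (min_le_right _ _).trans (hmφ θ))
        (le_deriv_seg lift_id h hi1 (fun θ => by rw [hid]; exact min_le_left _ _)
          fun θ => (min_le_right _ _).trans (hmφ θ))
        (deriv_seg_le lift_id h hi0 (fun θ => by rw [hid]; exact le_max_left _ _)
          fun θ => (hMφ θ).trans (le_max_right _ _))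
        (deriv_seg_le lift_id h hi1 (fun θ => by rw [hid]; exact le_max_left _ _)
          fun θ => (hMφ θ).trans (le_max_right _ _)) hKt
        (sob_one_deriv_seg_le lift_id h hi0 (le_max_left _ _) (le_max_right _ _))
        (sob_one_deriv_seg_le lift_id h hi1 (le_max_left _ _) (le_max_right _ _))
        (by rw [hsub2]; exact ENNReal.mul_ne_top ENNReal.ofReal_ne_top hs)
        (ε := 1 / 2) (by norm_num) le_rfl (by
          rw [hsub2, mul_left_comm, ← ENNReal.ofReal_toReal hCt, ← ENNReal.ofReal_mul (by positivity)]
          refine ENNReal.ofReal_le_ofReal ?_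
          rw [div_pow, one_pow, div_mul_eq_mul_div, one_mul, div_le_iff₀ (by positivity)]
          nlinarith)
      refine ⟨v * u₀, fun x => ?_⟩
      have e : (L0.comp kχ).op (k₀.op x) = kχ.op x := by
        rw [Lift.op_comp]
        exact congrArg (fun T : H1 →L[ℝ] H1 => T x) (Lift.op_congr _ _ fun θ => by rw [l₀])
      change (v : F1 →L[ℂ] F1) * u₀ * weyl x = weyl (kχ.op x) * (v * u₀)
      rw [mul_assoc, hu₀, ← mul_assoc, hv, e, mul_assoc]
  refine key N le_rfl k fun θ => ?_
  rw [div_self hN0.ne']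
  simpa [seg] using hr θ

/-! ### Implementation of diffeomorphisms: uniqueness and multiplicativity -/

/-- A `C¹` function on the circle as a periodic function on the line. -/
def ofC1 (f : S1 → ℝ) (hf : ContDiff ℝ 1 fun θ : ℝ => f θ) : perC1 :=
  ⟨fun θ => f θ, hf, fun _ => congrArg f (AddCircle.coe_add_period _ _)⟩

theorem clR_ofC1 {f : S1 → ℝ} (hf : ContDiff ℝ 1 fun θ : ℝ => f θ) : clR (ofC1 f hf) = cls f := rfl

theorem hasClass_of_contDiff {f : S1 → ℝ} (hf : ContDiff ℝ 1 fun θ : ℝ => f θ) : HasClass f :=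
  memlp_clv (perC1.sob_half_ne_top (ofC1 f hf))

theorem IsSmooth.contDiff_one {f : S1 → ℝ} (hf : IsSmooth f) : ContDiff ℝ 1 fun θ : ℝ => f θ :=
  ContDiff.of_le hf (by simp)

theorem exists_eq_ofC1 (f : perC1) : ∃ g : S1 → ℝ, ∀ θ : ℝ, g θ = f.1 θ :=
  ⟨Function.Periodic.lift (f := f.1) f.2.2, fun _ => rfl⟩

/-- The classes of smooth functions are dense in the one-particle space. -/
theorem dense_cls_smooth : Dense {x : H1 | ∃ f : S1 → ℝ, IsSmooth f ∧ cls f = x} := by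
  let X : Submodule ℝ perC1 :=
    { carrier := {f | ContDiff ℝ ∞ f.1}
      add_mem' := fun {f g} (ha : ContDiff ℝ ∞ f.1) (hb : ContDiff ℝ ∞ g.1) =>
        show ContDiff ℝ ∞ (f.1 + g.1) from ha.add hb
      zero_mem' := show ContDiff ℝ ∞ fun _ : ℝ => (0 : ℝ) from contDiff_const
      smul_mem' := fun c f (ha : ContDiff ℝ ∞ f.1) =>
        show ContDiff ℝ ∞ (c • f.1) from ha.const_smul c }
  have hX : ∀ c b, reEx c b ∈ X := fun c b => by
    change ContDiff ℝ ∞ fun θ => 2 / Real.sqrt (b : ℕ) * (c * ex (b : ℕ) θ).re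
    exact contDiff_const.mul (Complex.reCLM.contDiff.comp (contDiff_const.mul (contDiff_ex _)))
  refine (denseRange_clR_of_reEx hX).mono ?_
  rintro _ ⟨f, hf, rfl⟩
  obtain ⟨g, hg⟩ := exists_eq_ofC1 f
  have hg' : (fun θ : ℝ => g θ) = f.1 := funext hg
  have hs : IsSmooth g := by
    rw [IsSmooth, hg']
    exact hf
  refine ⟨g, hs, ?_⟩
  rw [clR_apply, cls_eq_clv]
  simp only [hg]

namespace LiftPair
variable {s : ℝ} {γ : S1 ≃ₜ S1} {φ ψ : ℝ → ℝ}

theorem contDiff_comp_symm (h : LiftPair s γ φ ψ) {f : S1 → ℝ}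
    (hf : ContDiff ℝ 1 fun θ : ℝ => f θ) : ContDiff ℝ 1 fun θ : ℝ => (f ∘ γ.symm) θ := by
  have e : (fun θ : ℝ => (f ∘ γ.symm) θ) = fun θ : ℝ => (h.lift_inv.compR (ofC1 f hf)).1 θ := by
    funext θ
    rw [Lift.compR_apply, Function.comp_apply, h.coe_inv_eq]
    rfl
  rw [e]
  exact (h.lift_inv.compR (ofC1 f hf)).2.1

theorem op_cls (h : LiftPair s γ φ ψ) {f : S1 → ℝ} (hf : ContDiff ℝ 1 fun θ : ℝ => f θ) :
    h.lift_inv.op (cls f) = cls (f ∘ γ.symm) := by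
  rw [← clR_ofC1 hf, Lift.op_clR, ← clR_ofC1 (h.contDiff_comp_symm hf)]
  congr 1
  refine Subtype.ext (funext fun θ => ?_)
  rw [Lift.compR_apply]
  change f (ψ θ : ℝ) = f (γ.symm θ)
  rw [h.coe_inv_eq]

end LiftPair

theorem unitary_intertwine_iff {E : Type} [NormedAddCommGroup E] [InnerProductSpace ℂ E]
    [CompleteSpace E] (u : unitary (E →L[ℂ] E)) (A B : E →L[ℂ] E) :
    PU.Ad (PU.mk u) A = B ↔ (u : E →L[ℂ] E) * A = B * u := by
  rw [PU.Ad_mk]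
  constructor
  · rintro rfl
    rw [mul_assoc _ (star _), Unitary.star_mul_self_of_mem u.2, mul_one]
  · intro h
    rw [h, mul_assoc, Unitary.mul_star_self_of_mem u.2, mul_one]

theorem PU.mk_surjective {E : Type} [NormedAddCommGroup E] [InnerProductSpace ℂ E]
    [CompleteSpace E] (p : PU E) : ∃ u, PU.mk u = p := QuotientGroup.mk'_surjective _ p

/-- Classes of smooth functions are dense and `h ↦ W(h)ξ` is continuous, so intertwining on smooth
functions extends to all of `H₁`. -/
theorem LiftPair.implements_iff {s : ℝ} {γ : S1 ≃ₜ S1} {φ ψ : ℝ → ℝ} (h : LiftPair s γ φ ψ)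
    (u : unitary (F1 →L[ℂ] F1)) : Implements (PU.mk u) γ ↔
      ∀ x, (u : F1 →L[ℂ] F1) * weyl x = weyl (h.lift_inv.op x) * u := by
  constructor
  · intro hi x
    refine ContinuousLinearMap.ext fun ξ => ?_
    refine dense_cls_smooth.induction (P := fun x =>
      (u : F1 →L[ℂ] F1) (weyl x ξ) = weyl (h.lift_inv.op x) ((u : F1 →L[ℂ] F1) ξ)) ?_ ?_ x
    · rintro _ ⟨f, hf, rfl⟩
      have h1 := (unitary_intertwine_iff u _ _).1 (hi f hf).2.2
      rw [← h.op_cls hf.contDiff_one] at h1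
      exact congrArg (fun T : F1 →L[ℂ] F1 => T ξ) h1
    · exact isClosed_eq ((u : F1 →L[ℂ] F1).continuous.comp (continuous_weyl_apply ξ))
        ((continuous_weyl_apply _).comp h.lift_inv.op.continuous)
  · intro hu f hf
    refine ⟨hasClass_of_contDiff hf.contDiff_one,
      hasClass_of_contDiff (h.contDiff_comp_symm hf.contDiff_one), ?_⟩
    rw [unitary_intertwine_iff, hu, h.op_cls hf.contDiff_one]

/-- `u* v` commutes with `W(x)` for `x` in the dense set `D`, so it is a scalar by irreducibility.
`T` may be any function on `D`. -/
theorem PU.mk_eq_of_intertwine {u v : unitary (F1 →L[ℂ] F1)} {D : Set H1} (hD : Dense D)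
    {T : H1 → H1} (hu : ∀ x ∈ D, (u : F1 →L[ℂ] F1) * weyl x = weyl (T x) * u)
    (hv : ∀ x ∈ D, (v : F1 →L[ℂ] F1) * weyl x = weyl (T x) * v) : PU.mk u = PU.mk v := by
  obtain ⟨c, hc⟩ := eq_smul_one_of_commute_weyl D hD
    (star (u : F1 →L[ℂ] F1) * (v : F1 →L[ℂ] F1)) fun x hx => by
      have h1 : star (u : F1 →L[ℂ] F1) * weyl (T x) = weyl x * star (u : F1 →L[ℂ] F1) := by
        have h2 := congrArg (fun A => star (u : F1 →L[ℂ] F1) * A * star (u : F1 →L[ℂ] F1)) (hu x hx)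
        simp only [← mul_assoc, Unitary.star_mul_self_of_mem u.2, one_mul] at h2
        rw [mul_assoc _ (u : F1 →L[ℂ] F1), Unitary.mul_star_self_of_mem u.2, mul_one] at h2
        exact h2.symm
      rw [mul_assoc, hv x hx, ← mul_assoc, h1, mul_assoc]
  exact QuotientGroup.eq.2 ⟨c, hc⟩

theorem Implements.unique {γ : S1 ≃ₜ S1} {p q : PU F1} (hp : Implements p γ)
    (hq : Implements q γ) : p = q := by
  obtain ⟨u, rfl⟩ := PU.mk_surjective p
  obtain ⟨v, rfl⟩ := PU.mk_surjective q
  choose! T hT using fun x (hx : x ∈ {x : H1 | ∃ f : S1 → ℝ, IsSmooth f ∧ cls f = x}) => hx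
  refine PU.mk_eq_of_intertwine dense_cls_smooth (T := fun x => cls (T x ∘ γ.symm))
    (fun x hx => ?_) fun x hx => ?_
  · have h := (unitary_intertwine_iff u _ _).1 (hp _ (hT x hx).1).2.2
    rwa [(hT x hx).2] at h
  · have h := (unitary_intertwine_iff v _ _).1 (hq _ (hT x hx).1).2.2
    rwa [(hT x hx).2] at h

theorem LiftPair.exists_implements {s : ℝ} (hs : 2 < s) {γ : S1 ≃ₜ S1} {φ ψ : ℝ → ℝ}
    (h : LiftPair s γ φ ψ) : ∃ p, Implements p γ := by
  obtain ⟨u, hu⟩ := h.lift.exists_implementer h.lift_inv h.right_inv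
    (ne_top_of_le_ne_top h.sob_ne_top (sob_mono hs.le _))
  exact ⟨PU.mk u, (h.implements_iff u).2 hu⟩

/-- The intermediate function `f ∘ ν⁻¹` is only known to be `C¹`, so the first factor is applied
through the extension of its intertwining relation to all of `H₁`. -/
theorem Implements.mul {s : ℝ} {γ ν : S1 ≃ₜ S1} {φ ψ χ ρ : ℝ → ℝ} (h : LiftPair s γ φ ψ)
    (k : LiftPair s ν χ ρ) {p q : PU F1} (hp : Implements p γ) (hq : Implements q ν) :
    Implements (p * q) (γ * ν) := by
  obtain ⟨u, rfl⟩ := PU.mk_surjective p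
  intro f hf
  have h1 := k.contDiff_comp_symm hf.contDiff_one
  refine ⟨(hq f hf).1, hasClass_of_contDiff (h.contDiff_comp_symm h1), ?_⟩
  have h2 : PU.Ad (PU.mk u * q) (weyl (cls f)) = PU.Ad (PU.mk u) (PU.Ad q (weyl (cls f))) := by
    rw [map_mul]
    rfl
  rw [h2, (hq f hf).2.2, unitary_intertwine_iff, (h.implements_iff u).1 hp, h.op_cls h1]
  rfl

/-! ### Möbius transformations and second quantization -/

section ComplexLinear
variable {H : Type} [NormedAddCommGroup H] [InnerProductSpace ℂ H]

/-- A symplectic transformation without antilinear part is a unitary operator. -/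
theorem SympEquiv.exists_linearIsometryEquiv (σ : SympEquiv H) (h : ∀ x, antiPart σ.S' x = 0) :
    ∃ V : H ≃ₗᵢ[ℂ] H, ∀ x, V x = σ.S x := by
  have h1 : ∀ x, antiPart σ.S x = 0 := fun x => ext_inner_left ℂ fun g => by
    have h2 := σ.inner_antiPart x g
    rw [h, inner_zero_right] at h2
    rw [inner_zero_right]
    exact neg_eq_zero.1 h2.symm
  have h3 : ∀ x, linPart σ.S x = σ.S x := fun x => by
    have h4 := linPart_add_antiPart σ.S x
    rwa [h1, add_zero] at h4
  have h5 : ∀ x, ‖linPart σ.S x‖ = ‖x‖ := fun x => by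
    have h6 := σ.inner_linPart_self x
    rw [h1, inner_zero_right, add_zero] at h6
    simp only [inner_self_eq_norm_sq_to_K] at h6
    have h7 : ‖linPart σ.S x‖ ^ 2 = ‖x‖ ^ 2 := by exact_mod_cast h6
    exact (sq_eq_sq₀ (norm_nonneg _) (norm_nonneg _)).1 h7
  refine ⟨LinearIsometryEquiv.ofSurjective ⟨(linPart σ.S).toLinearMap, h5⟩ fun y =>
    ⟨σ.S' y, ?_⟩, h3⟩
  exact (h3 _).trans (σ.right_inv y)

end ComplexLinear

theorem ex_eq_toCircle (k : ℤ) (θ : ℝ) : ex k θ = (AddCircle.toCircle (θ : S1) : ℂ) ^ k := by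
  rw [AddCircle.toCircle_apply_mk, div_self (by positivity), one_mul, Circle.coe_exp, ex,
    ← Complex.exp_int_mul, mul_assoc]

theorem ex_eq_circleMap (k : ℕ) (θ : ℝ) : ex k θ = circleMap 0 1 θ ^ k := by
  rw [circleMap, ex, Complex.ofReal_one, one_mul, zero_add, ← Complex.exp_nat_mul, mul_assoc]
  push_cast
  rfl

theorem mobius_denom_ne_zero {a b z : ℂ} (h : ‖a‖ ^ 2 - ‖b‖ ^ 2 = 1) (hz : ‖z‖ ≤ 1) :
    conj b * z + conj a ≠ 0 := by
  intro h0
  have h1 : ‖conj b * z‖ = ‖conj a‖ := by rw [eq_neg_of_add_eq_zero_left h0, norm_neg]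
  rw [norm_mul, RCLike.norm_conj, RCLike.norm_conj] at h1
  nlinarith [mul_le_mul_of_nonneg_left hz (norm_nonneg b), norm_nonneg a, norm_nonneg b]

/-- The Fourier coefficients of `μ(z)⁻ᵇ` of positive index vanish for a Möbius transformation `μ`. -/
theorem cf_ex_comp_of_mobius {φ : ℝ → ℝ} {a b : ℂ} (h : ‖a‖ ^ 2 - ‖b‖ ^ 2 = 1)
    (hφ : ∀ θ : ℝ, ex 1 (φ θ) = (a * ex 1 θ + b) / (conj b * ex 1 θ + conj a)) (n k : ℕ) :
    cf (fun θ => ex (-(n : ℤ)) (φ θ)) ((k + 1 : ℕ) : ℤ) = 0 := by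
  -- The pole of the Möbius transformation lies outside the closed disc, so `F` is holomorphic there
  -- and its contour integral vanishes by Cauchy's theorem.
  set F : ℂ → ℂ := fun z => z ^ k * ((a * z + b) / (conj b * z + conj a)) ^ n with hF
  have hd : ∀ z, ‖z‖ ≤ 1 → DifferentiableAt ℂ F z := fun z hz => by
    have := mobius_denom_ne_zero h hz
    fun_prop (disch := assumption)
  have h0 : (∮ z in C(0, 1), F z) = 0 :=
    Complex.circleIntegral_eq_zero_of_differentiable_on_off_countable zero_le_one
      Set.countable_empty
      (fun z hz => (hd z (by simpa using hz)).continuousAt.continuousWithinAt)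
      fun z hz => hd z (mem_ball_zero_iff.1 hz.1).le
  -- On the unit circle conjugation is inversion, so the integrand with negative powers is the
  -- conjugate of one with nonnegative powers. One power of `z` is absorbed by `dz = iz dθ`; this is
  -- why the index is `k + 1`.
  have h1 : ∀ θ : ℝ, ex (-((k + 1 : ℕ) : ℤ)) θ * ex (-(n : ℤ)) (φ θ) =
      conj (-Complex.I * (deriv (circleMap 0 1) θ • F (circleMap 0 1 θ))) := by
    intro θ
    rw [← conj_ex, ← conj_ex, ← map_mul]
    congr 1
    have e2 : ∀ θ, ex 1 θ = circleMap 0 1 θ := fun θ => by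
      rw [← Nat.cast_one, ex_eq_circleMap, pow_one]
    have e1 : ex n (φ θ) = ex 1 (φ θ) ^ n := by rw [ex_eq_circleMap, e2]
    rw [e1, hφ, e2, ex_eq_circleMap, deriv_circleMap, hF, smul_eq_mul, pow_succ]
    linear_combination ((circleMap 0 1 θ ^ k * circleMap 0 1 θ *
      ((a * circleMap 0 1 θ + b) / (conj b * circleMap 0 1 θ + conj a)) ^ n)) * Complex.I_mul_I
  rw [cf_eq]
  simp only [h1]
  rw [intervalIntegral.intervalIntegral_conj, intervalIntegral.integral_const_mul]
  change (2 * Real.pi : ℂ)⁻¹ * conj (-Complex.I * ∮ z in C(0, 1), F z) = 0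
  rw [h0]
  simp

/-- The antilinear part vanishes, so `S` is a unitary `V`, and the implementer can be taken with `ε
= 0`: it fixes the vacuum exactly. Intertwining then gives `u e(x) = e(Vx)`, and uniqueness
identifies the class of `u` with `p`. -/
theorem Implements.isSecondQuantized {s : ℝ} {γ : S1 ≃ₜ S1} {φ ψ : ℝ → ℝ}
    (h : LiftPair s γ φ ψ) (hγ : IsMobius γ) {p : PU F1} (hp : Implements p γ) :
    IsSecondQuantized p γ := by
  obtain ⟨a, b, hab, hμ⟩ := hγ
  have h1 : ∀ θ : ℝ, ex 1 (φ θ) = (a * ex 1 θ + b) / (conj b * ex 1 θ + conj a) := fun θ => by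
    rw [ex_eq_toCircle, ex_eq_toCircle, zpow_one, zpow_one, ← h.coe_eq, hμ]
  have h2 : ∀ n k : ℕ+, cf (fun θ => ex (-((n : ℕ) : ℤ)) (φ θ)) (k : ℕ) = 0 := fun n k => by
    have h3 := cf_ex_comp_of_mobius hab h1 n k.natPred
    rwa [k.natPred_add_one] at h3
  set σ := h.lift.sympEquiv h.lift_inv h.left_inv h.right_inv with hσ
  obtain ⟨u, hu, hu0⟩ := h.lift.exists_implementer_of_tsum_le h.lift_inv h.left_inv h.right_inv
    le_rfl (by norm_num) (by simp [h2])
  have hanti : ∀ x, antiPart σ.S' x = 0 := fun x => by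
    have h4 : ∀ n : ℕ+, antiPart σ.S' (unitVec n) = 0 := fun n => by
      have h5 := h.lift.enorm_antiPart_op_unitVec n
      simp only [h2] at h5
      have h6 : antiPart h.lift.op (unitVec n) = 0 := by simpa using h5
      exact h6
    have h6 := (antiPart σ.S').hasSum (hasSum_unitVec x)
    simp only [map_smulₛₗ, h4, smul_zero] at h6
    exact h6.unique hasSum_zero
  obtain ⟨V, hV⟩ := σ.exists_linearIsometryEquiv hanti
  have hV' : ∀ x, h.lift_inv.op x = V x := fun x => (hV x).symm
  refine ⟨V, fun f hf => ?_, u, ((h.implements_iff u).2 hu).unique hp, fun x => ?_⟩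
  · rw [← hV', h.op_cls hf.contDiff_one]
  · have hu0' : (u : F1 →L[ℂ] F1) (coherent 0) = coherent 0 := by
      rw [mul_zero, norm_le_zero_iff, sub_eq_zero] at hu0
      exact hu0
    rw [coherent_eq_displ x, coherent_eq_displ (V x), map_smul, V.norm_map]
    congr 1
    have h7 := congrArg (fun T : F1 →L[ℂ] F1 => T (coherent 0)) (hu (((Real.sqrt 2 : ℝ) : ℂ) • x))
    change (u : F1 →L[ℂ] F1) (weyl _ (coherent 0)) = weyl _ ((u : F1 →L[ℂ] F1) (coherent 0)) at h7
    rw [hu0', hV', map_smul] at h7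
    exact h7

/-! ### Continuity of the implementers -/

theorem enorm_le_of_sob_le {f : ℝ → ℂ} (hf : PerCont f) {N : ℝ≥0∞} (hN : N ≠ ⊤) (h : sob 1 f ≤ N)
    (θ : ℝ) : ‖f θ‖ ≤ Real.sqrt (wtSum 1 * N).toReal := by
  have h1 : ‖f θ‖ₑ ^ 2 ≤ wtSum 1 * N := (enorm_sq_le_sob (r := 1) (by norm_num) hf θ).trans (by gcongr)
  have h2 := ENNReal.toReal_mono (ENNReal.mul_ne_top (wtSum_ne_top (by norm_num)) hN) h1
  rw [ENNReal.toReal_pow, toReal_enorm] at h2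
  exact Real.le_sqrt_of_sq_le h2

namespace Lift

theorem abs_sub_le_of_sob {φ₀ φ₁ : ℝ → ℝ} (h₀ : Lift φ₀) (h₁ : Lift φ₁) {N : ℝ≥0∞} (hN : N ≠ ⊤)
    (h : sob 2 (fun θ => ((φ₁ θ - φ₀ θ : ℝ) : ℂ)) ≤ N) (θ : ℝ) :
    |φ₁ θ - φ₀ θ| ≤ Real.sqrt (wtSum 1 * N).toReal := by
  have h1 := enorm_le_of_sob_le (perCont_sub h₀ h₁) hN ((sob_mono (by norm_num) _).trans h) θ
  rwa [Complex.norm_real] at h1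

theorem abs_deriv_sub_le_of_sob {φ₀ φ₁ : ℝ → ℝ} (h₀ : Lift φ₀) (h₁ : Lift φ₁) {N : ℝ≥0∞}
    (hN : N ≠ ⊤) (h : sob 2 (fun θ => ((φ₁ θ - φ₀ θ : ℝ) : ℂ)) ≤ N) (θ : ℝ) :
    |deriv φ₁ θ - deriv φ₀ θ| ≤ Real.sqrt (wtSum 1 * N).toReal := by
  have h1 := enorm_le_of_sob_le (h₁.perCont_deriv.sub h₀.perCont_deriv) hN
    (le_trans (by rw [sob_two_sub h₀ h₁]; exact le_add_self) h) θ
  rwa [← Complex.ofReal_sub, Complex.norm_real] at h1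

/-- The action of diffeomorphisms on a fixed function of class `C²` is Lipschitz at the identity. -/
theorem exists_norm_op_sub_le (f : perC1) (hf : ContDiff ℝ 2 f.1) : ∃ C : ℝ, 0 ≤ C ∧
    ∀ {ρ : ℝ → ℝ} (h : Lift ρ) {δ : ℝ}, 0 ≤ δ → (∀ θ, |ρ θ - θ| ≤ δ) →
      (∀ θ, |deriv ρ θ - 1| ≤ δ) → ‖h.op (clR f) - clR f‖ ≤ C * δ := by
  set F : ℝ → ℂ := fun θ => ((f.1 θ : ℝ) : ℂ) with hF
  have hF2 : ContDiff ℝ 2 F := Complex.ofRealCLM.contDiff.comp hf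
  have hF1 : ContDiff ℝ 1 F := perC1.contDiff f
  have hd1 : ContDiff ℝ 1 (deriv F) := by
    have := (contDiff_succ_iff_deriv (n := 1) (f := F)).1 hF2
    exact this.2.2
  have hp1 := (perC1.perCont f).deriv hF1
  obtain ⟨C₁, hC₁, hb₁⟩ := hp1.bounded
  obtain ⟨C₂, hC₂, hb₂⟩ := (hp1.deriv hd1).bounded
  refine ⟨2 * C₁ + C₂, by positivity, fun {ρ} h {δ} hδ h0 h1 => ?_⟩
  have l1 : ∀ x y : ℝ, ‖F y - F x‖ ≤ C₁ * ‖y - x‖ := fun x y =>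
    convex_univ.norm_image_sub_le_of_norm_deriv_le (𝕜 := ℝ)
      (fun x _ => hF1.differentiable one_ne_zero x) (fun x _ => hb₁ x) trivial trivial
  have l2 : ∀ x y : ℝ, ‖deriv F y - deriv F x‖ ≤ C₂ * ‖y - x‖ := fun x y =>
    convex_univ.norm_image_sub_le_of_norm_deriv_le (𝕜 := ℝ)
      (fun x _ => hd1.differentiable one_ne_zero x) (fun x _ => hb₂ x) trivial trivial
  rw [h.op_clR, ← map_sub]
  set g : perC1 := h.compR f - f with hg
  have hgv : ∀ θ, ((g.1 θ : ℝ) : ℂ) = F (ρ θ) - F θ := fun θ => by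
    rw [hF, ← Complex.ofReal_sub]
    rfl
  have hgd : deriv (fun θ => ((g.1 θ : ℝ) : ℂ)) =
      fun θ => deriv F (ρ θ) * ((deriv ρ θ : ℝ) : ℂ) - deriv F θ := by
    simp only [hgv]
    funext θ
    exact ((h.hasDerivAt_comp hF1 θ).sub (hF1.differentiable one_ne_zero θ).hasDerivAt).deriv
  have hb0 : ∀ θ, ‖((g.1 θ : ℝ) : ℂ)‖ ≤ C₁ * δ := fun θ => by
    rw [hgv]
    refine (l1 _ _).trans ?_
    gcongr
    exact h0 θ
  have hb1 : ∀ θ, ‖deriv (fun θ => ((g.1 θ : ℝ) : ℂ)) θ‖ ≤ (C₁ + C₂) * δ := fun θ => by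
    rw [hgd]
    have e : deriv F (ρ θ) * ((deriv ρ θ : ℝ) : ℂ) - deriv F θ =
        deriv F (ρ θ) * ((deriv ρ θ - 1 : ℝ) : ℂ) + (deriv F (ρ θ) - deriv F θ) := by
      push_cast
      ring
    change ‖deriv F (ρ θ) * ((deriv ρ θ : ℝ) : ℂ) - deriv F θ‖ ≤ _
    rw [e, add_mul]
    refine (norm_add_le _ _).trans (add_le_add ?_ ((l2 _ _).trans ?_))
    · rw [norm_mul, Complex.norm_real]
      exact mul_le_mul (hb₁ _) (h1 θ) (norm_nonneg _) hC₁
    · gcongr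
      exact h0 θ
  -- The `H^{1/2}`-norm is dominated by the `H¹`-norm; the function contributes `C₁δ`, its
  -- derivative `(C₁ + C₂)δ`, and the sum of squares is at most the square of the sum.
  have hs : ‖clR g‖ₑ ^ 2 ≤ ENNReal.ofReal (((2 * C₁ + C₂) * δ) ^ 2) := by
    rw [clR_apply]
    refine enorm_clv_sq_le.trans ((sob_mono (by norm_num : (1 / 2 : ℝ) ≤ 1) _).trans ?_)
    rw [(perC1.perCont g).sob_one (perC1.contDiff g)]
    refine (add_le_add (sob_zero_le_of_bound (perC1.perCont g).cont hb0)
      (sob_zero_le_of_bound ((perC1.perCont g).deriv (perC1.contDiff g)).cont hb1)).trans ?_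
    rw [← ENNReal.ofReal_add (sq_nonneg _) (sq_nonneg _)]
    refine ENNReal.ofReal_le_ofReal ?_
    have : 0 ≤ (C₁ * δ) * ((C₁ + C₂) * δ) := by positivity
    linarith
  have hs' := ENNReal.toReal_mono ENNReal.ofReal_ne_top hs
  rw [ENNReal.toReal_pow, toReal_enorm, ENNReal.toReal_ofReal (sq_nonneg _)] at hs'
  exact (sq_le_sq₀ (norm_nonneg _) (by positivity)).1 hs'

/-- Continuity of the action on the one-particle space. -/
theorem tendsto_op_clR {ι : Type*} {l : Filter ι} {ρ : ι → ℝ → ℝ} (h : ∀ i, Lift (ρ i))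
    {δ : ι → ℝ} (hδ : Tendsto δ l (𝓝 0)) (hδ0 : ∀ i, 0 ≤ δ i)
    (h0 : ∀ᶠ i in l, ∀ θ, |ρ i θ - θ| ≤ δ i) (h1 : ∀ᶠ i in l, ∀ θ, |deriv (ρ i) θ - 1| ≤ δ i)
    (f : perC1) (hf : ContDiff ℝ 2 f.1) :
    Tendsto (fun i => (h i).op (clR f)) l (𝓝 (clR f)) := by
  obtain ⟨C, -, hC⟩ := exists_norm_op_sub_le f hf
  rw [tendsto_iff_norm_sub_tendsto_zero]
  refine squeeze_zero' (Eventually.of_forall fun _ => norm_nonneg _)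
    (h0.and h1 |>.mono fun i hi => hC (h i) (hδ0 i) hi.1 hi.2) ?_
  simpa using hδ.const_mul C

end Lift

/-- Operators which implement symplectic transformations tending to the identity and which almost
fix the vacuum tend strongly to the identity. -/
theorem tendsto_implementer {ι : Type*} {l : Filter ι} {v : ι → unitary (F1 →L[ℂ] F1)}
    {T : ι → H1 →L[ℝ] H1} (hv : ∀ᶠ i in l, ∀ x, (v i : F1 →L[ℂ] F1) * weyl x = weyl (T i x) * v i)
    (h0 : Tendsto (fun i => (v i : F1 →L[ℂ] F1) (coherent 0)) l (𝓝 (coherent 0)))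
    {D : Set H1} (hD : Dense D) (hT : ∀ x ∈ D, Tendsto (fun i => T i x) l (𝓝 x)) (ξ : F1) :
    Tendsto (fun i => (v i : F1 →L[ℂ] F1) ξ) l (𝓝 ξ) := by
  refine tendsto_apply_of_coherent (T := fun i => (v i : F1 →L[ℂ] F1)) (T₀ := 1) D hD
    (Eventually.of_forall fun i x => (Unitary.norm_map (v i) x).le) (fun x => le_rfl) ?_ ξ
  intro g hg
  set w : ι → H1 := fun i => ((Real.sqrt 2 : ℝ) : ℂ) • T i g with hw
  set w₀ : H1 := ((Real.sqrt 2 : ℝ) : ℂ) • g with hw₀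
  have hww : Tendsto w l (𝓝 w₀) := (hT g hg).const_smul _
  have h1 : Tendsto (fun i => weyl (w i) ((v i : F1 →L[ℂ] F1) (coherent 0))) l
      (𝓝 (weyl w₀ (coherent 0))) := by
    -- Here both the operator and the vector vary. The error in the vector passes through the
    -- isometry `W(w i)`, and the rest is strong continuity of `W`.
    have e : (fun i => weyl (w i) ((v i : F1 →L[ℂ] F1) (coherent 0))) = fun i =>
        weyl (w i) ((v i : F1 →L[ℂ] F1) (coherent 0) - coherent 0) + weyl (w i) (coherent 0) := by
      funext i
      rw [map_sub, sub_add_cancel]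
    rw [e, ← zero_add (weyl w₀ (coherent 0))]
    refine Tendsto.add ?_ (((continuous_weyl_apply (coherent 0)).tendsto w₀).comp hww)
    rw [tendsto_zero_iff_norm_tendsto_zero]
    simp only [norm_weyl]
    exact tendsto_iff_norm_sub_tendsto_zero.1 h0
  rw [coherent_eq_displ g, one_apply_eq_self]
  refine ((h1.const_smul (Complex.exp ((‖g‖ ^ 2 / 2 : ℝ) : ℂ))).congr' ?_)
  filter_upwards [hv] with i hi
  rw [map_smul]
  congr 1
  have h2 := congrArg (fun A : F1 →L[ℂ] F1 => A (coherent 0)) (hi w₀)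
  have h3 : T i w₀ = w i := by
    rw [hw, hw₀, Complex.coe_smul, map_smul]
    exact (Complex.coe_smul _ _).symm
  rw [h3] at h2
  exact h2.symm

/-- The classes of functions of class `C²` are dense. -/
theorem dense_clR_contDiff_two : Dense {x : H1 | ∃ f : perC1, ContDiff ℝ 2 f.1 ∧ clR f = x} := by
  refine dense_cls_smooth.mono ?_
  rintro _ ⟨f, hf, rfl⟩
  exact ⟨ofC1 f hf.contDiff_one, ContDiff.of_le hf (by norm_cast), clR_ofC1 _⟩

namespace Lift

theorem sob_one_deriv_le_of_sob {φ₀ φ₁ : ℝ → ℝ} (h₀ : Lift φ₀) (h₁ : Lift φ₁) :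
    sob 1 (fun θ => ((deriv φ₁ θ : ℝ) : ℂ)) ≤ 2 * (sob 2 (fun θ => ((φ₁ θ - φ₀ θ : ℝ) : ℂ)) +
      sob 1 fun θ => ((deriv φ₀ θ : ℝ) : ℂ)) := by
  have e : (fun θ => ((deriv φ₁ θ : ℝ) : ℂ)) = fun θ =>
      (((deriv φ₁ θ : ℝ) : ℂ) - ((deriv φ₀ θ : ℝ) : ℂ)) + ((deriv φ₀ θ : ℝ) : ℂ) := by
    funext θ
    rw [sub_add_cancel]
  conv_lhs => rw [e]
  refine (sob_add_le 1 (h₁.perCont_deriv.cont.sub h₀.perCont_deriv.cont)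
    h₀.perCont_deriv.cont).trans ?_
  gcongr
  rw [sob_two_sub h₀ h₁]
  exact le_add_self

theorem abs_comp_inv_sub_le {φ₀ φ₁ ψ₁ : ℝ → ℝ} (r₁ : ∀ θ, φ₁ (ψ₁ θ) = θ) {d : ℝ}
    (h : ∀ θ, |φ₁ θ - φ₀ θ| ≤ d) (θ : ℝ) : |φ₀ (ψ₁ θ) - θ| ≤ d := by
  have h1 := h (ψ₁ θ)
  rwa [r₁, abs_sub_comm] at h1

/-- `(φ₀ ∘ ψ₁)' - 1 = ((φ₀' - φ₁') ∘ ψ₁) ψ₁'` because `(φ₁' ∘ ψ₁) ψ₁' = 1`, and `ψ₁' ≤ 1/m`. -/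
theorem abs_deriv_comp_inv_sub_le {φ₀ φ₁ ψ₁ : ℝ → ℝ} (h₀ : Lift φ₀) (h₁ : Lift φ₁) (k₁ : Lift ψ₁)
    (r₁ : ∀ θ, φ₁ (ψ₁ θ) = θ) {m d : ℝ} (hm : 0 < m) (m₁ : ∀ θ, m ≤ deriv φ₁ θ)
    (h : ∀ θ, |deriv φ₁ θ - deriv φ₀ θ| ≤ d) (θ : ℝ) :
    |deriv (fun θ => φ₀ (ψ₁ θ)) θ - 1| ≤ d / m := by
  have e1 : HasDerivAt (fun θ => φ₀ (ψ₁ θ)) (deriv φ₀ (ψ₁ θ) * deriv ψ₁ θ) θ :=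
    (h₀.hasDerivAt (ψ₁ θ)).comp θ (k₁.hasDerivAt θ)
  have e2 : deriv φ₁ (ψ₁ θ) * deriv ψ₁ θ = 1 := by
    have e3 : HasDerivAt (fun θ => φ₁ (ψ₁ θ)) (deriv φ₁ (ψ₁ θ) * deriv ψ₁ θ) θ :=
      (h₁.hasDerivAt (ψ₁ θ)).comp θ (k₁.hasDerivAt θ)
    simp only [r₁] at e3
    exact e3.unique (hasDerivAt_id' θ)
  rw [e1.deriv, ← e2, ← sub_mul, abs_mul, abs_sub_comm, abs_of_pos (k₁.deriv_pos θ)]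
  have e4 : deriv ψ₁ θ ≤ 1 / m := by
    rw [le_div_iff₀ hm, ← e2, mul_comm]
    exact mul_le_mul_of_nonneg_right (m₁ _) (k₁.deriv_pos θ).le
  have hd : 0 ≤ d := (abs_nonneg _).trans (h θ)
  calc _ ≤ d * (1 / m) := mul_le_mul (h _) e4 (k₁.deriv_pos θ).le hd
    _ = d / m := by ring

/-- If the lifts `φ i` tend to `φ₀` in `H²`, the diffeomorphisms `φ₀ ∘ (φ i)⁻¹` are implemented by
unitary operators which tend strongly to the identity. -/
theorem exists_tendsto_implementer {ι : Type*} {l : Filter ι} {φ₀ ψ₀ : ℝ → ℝ} (h₀ : Lift φ₀)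
    (k₀ : Lift ψ₀) (l₀ : ∀ θ, ψ₀ (φ₀ θ) = θ) (r₀ : ∀ θ, φ₀ (ψ₀ θ) = θ)
    (hs : sob 2 (fun θ => ((φ₀ θ - θ : ℝ) : ℂ)) ≠ ⊤) {φ ψ : ι → ℝ → ℝ} (h : ∀ i, Lift (φ i))
    (k : ∀ i, Lift (ψ i)) (hl : ∀ i θ, ψ i (φ i θ) = θ) (hr : ∀ i θ, φ i (ψ i θ) = θ)
    (hN : Tendsto (fun i => sob 2 (fun θ => ((φ i θ - φ₀ θ : ℝ) : ℂ))) l (𝓝 0)) :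
    ∃ v : ι → unitary (F1 →L[ℂ] F1),
      (∀ᶠ i in l, ∀ x, (v i : F1 →L[ℂ] F1) * weyl x = weyl ((h₀.comp (k i)).op x) * v i) ∧
      ∀ ξ, Tendsto (fun i => (v i : F1 →L[ℂ] F1) ξ) l (𝓝 ξ) := by
  set N : ι → ℝ≥0∞ := fun i => sob 2 (fun θ => ((φ i θ - φ₀ θ : ℝ) : ℂ)) with hNdef
  set K₀ : ℝ≥0∞ := sob 1 fun θ => ((deriv φ₀ θ : ℝ) : ℂ) with hK₀
  have hK₀t : K₀ ≠ ⊤ := h₀.sob_deriv_ne_top (by norm_num; simpa using hs)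
  set K : ℝ≥0∞ := 2 * (1 + K₀) with hK
  have hKt : K ≠ ⊤ :=
    ENNReal.mul_ne_top (by norm_num) (ENNReal.add_ne_top.2 ⟨ENNReal.one_ne_top, hK₀t⟩)
  obtain ⟨m₀, hm₀, hmφ⟩ := h₀.exists_le_deriv
  obtain ⟨M₀, hM₀, hMφ⟩ := h₀.exists_deriv_le
  -- Once the derivatives differ by less than `m₀/2`, they keep the lower bound `m₀/2`. Likewise `K
  -- = 2(1 + K₀)` bounds the derivatives in `H¹` once the squared `H²`-distance is below `1`. The
  -- constant of the Hilbert-Schmidt estimate is thus uniform near `φ₀`.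
  set m := m₀ / 2 with hm
  set M := M₀ + m with hM
  have hmpos : 0 < m := half_pos hm₀
  set δ : ι → ℝ := fun i => Real.sqrt (wtSum 1 * N i).toReal with hδ
  have hsq : ∀ {c : ℝ≥0∞}, c ≠ ⊤ → Tendsto (fun i => Real.sqrt (c * N i).toReal) l (𝓝 0) := by
    intro c hc
    have h1 : Tendsto (fun i => (c * N i).toReal) l (𝓝 0) := by
      have h2 := ENNReal.Tendsto.const_mul hN (Or.inr hc)
      rw [mul_zero] at h2
      exact (ENNReal.tendsto_toReal ENNReal.zero_ne_top).comp h2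
    have h3 := (Real.continuous_sqrt.tendsto 0).comp h1
    rw [Real.sqrt_zero] at h3
    exact h3
  have hδ0 : Tendsto δ l (𝓝 0) := hsq (wtSum_ne_top (by norm_num))
  have hwc : hsConst m M K ≠ ⊤ := hsConst_ne_top hKt
  set ε : ι → ℝ := fun i => Real.sqrt (hsConst m M K * N i).toReal with hε
  have hε0 : Tendsto ε l (𝓝 0) := hsq hwc
  have hN1 : ∀ᶠ i in l, N i < 1 := (tendsto_order.1 hN).2 1 zero_lt_one
  have hδ1 : ∀ᶠ i in l, δ i < m := (tendsto_order.1 hδ0).2 m hmpos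
  have hε1 : ∀ᶠ i in l, ε i < 1 / 2 := (tendsto_order.1 hε0).2 _ (by norm_num)
  have d0 : ∀ i, N i < 1 → ∀ θ, |φ i θ - φ₀ θ| ≤ δ i := fun i hi =>
    abs_sub_le_of_sob h₀ (h i) hi.ne_top le_rfl
  have d1 : ∀ i, N i < 1 → ∀ θ, |deriv (φ i) θ - deriv φ₀ θ| ≤ δ i := fun i hi =>
    abs_deriv_sub_le_of_sob h₀ (h i) hi.ne_top le_rfl
  have hmi : ∀ i, N i < 1 → δ i < m → ∀ θ, m ≤ deriv (φ i) θ := fun i h1 h2 θ => by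
    have h3 := (abs_le.1 (d1 i h1 θ)).1
    have h4 := hmφ θ
    have h5 : m₀ = m + m := by rw [hm]; ring
    linarith
  have hMi : ∀ i, N i < 1 → δ i < m → ∀ θ, deriv (φ i) θ ≤ M := fun i h1 h2 θ => by
    have h3 := (abs_le.1 (d1 i h1 θ)).2
    have h4 := hMφ θ
    linarith
  have hex : ∀ i, ∃ v : unitary (F1 →L[ℂ] F1), N i < 1 → δ i < m → ε i < 1 / 2 →
      (∀ x, (v : F1 →L[ℂ] F1) * weyl x = weyl ((h₀.comp (k i)).op x) * v) ∧
      ‖(v : F1 →L[ℂ] F1) (coherent 0) - coherent 0‖ ≤ 4 * ε i := fun i => by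
    by_cases hi : N i < 1 ∧ δ i < m ∧ ε i < 1 / 2
    · obtain ⟨h1, h2, h3⟩ := hi
      obtain ⟨v, hv⟩ := exists_implementer_of_close h₀ (h i) k₀ (k i) l₀ r₀ (hl i) (hr i) hmpos
        (M := M) (by linarith) (fun θ => le_trans (by rw [hm]; linarith) (hmφ θ)) (hmi i h1 h2)
        (fun θ => (hMφ θ).trans (by linarith)) (hMi i h1 h2) hKt
        (le_trans (le_trans le_add_self (le_mul_of_one_le_left' one_le_two)) hK.ge)
        ((sob_one_deriv_le_of_sob h₀ (h i)).trans (by rw [hK]; gcongr)) h1.ne_top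
        (Real.sqrt_nonneg _) h3.le (by
          rw [Real.sq_sqrt ENNReal.toReal_nonneg,
            ENNReal.ofReal_toReal (ENNReal.mul_ne_top hwc h1.ne_top)])
      exact ⟨v, fun _ _ _ => hv⟩
    -- The value `1` for lifts far from `φ₀` is arbitrary; only eventual statements are made about
    -- `v`.
    · exact ⟨1, fun h1 h2 h3 => absurd ⟨h1, h2, h3⟩ hi⟩
  choose v hv using hex
  have hv1 : ∀ᶠ i in l, ∀ x, (v i : F1 →L[ℂ] F1) * weyl x = weyl ((h₀.comp (k i)).op x) * v i := by
    filter_upwards [hN1, hδ1, hε1] with i h1 h2 h3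
    exact (hv i h1 h2 h3).1
  refine ⟨v, hv1, tendsto_implementer hv1 ?_ dense_clR_contDiff_two ?_⟩
  · rw [tendsto_iff_norm_sub_tendsto_zero]
    refine squeeze_zero' (Eventually.of_forall fun _ => norm_nonneg _) ?_
      (by simpa using hε0.const_mul 4)
    filter_upwards [hN1, hδ1, hε1] with i h1 h2 h3
    exact (hv i h1 h2 h3).2
  · rintro _ ⟨f, hf, rfl⟩
    refine tendsto_op_clR (fun i => h₀.comp (k i)) (δ := fun i => δ i + δ i / m)
      (by simpa using hδ0.add (hδ0.div_const m))
      (fun i => add_nonneg (Real.sqrt_nonneg _) (div_nonneg (Real.sqrt_nonneg _) hmpos.le)) ?_ ?_ f hf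
    · filter_upwards [hN1] with i h1 θ
      exact (abs_comp_inv_sub_le (hr i) (d0 i h1) θ).trans
        (le_add_of_nonneg_right (div_nonneg (Real.sqrt_nonneg _) hmpos.le))
    · filter_upwards [hN1, hδ1] with i h1 h2 θ
      exact (abs_deriv_comp_inv_sub_le h₀ (h i) (k i) (hr i) hmpos (hmi i h1 h2) (d1 i h1) θ).trans
        (le_add_of_nonneg_left (Real.sqrt_nonneg _))

end Lift

/-! ### Topology of the projective unitary group and of `D^s(S¹)` -/

section Projective
variable {E : Type} [NormedAddCommGroup E] [InnerProductSpace ℂ E] [CompleteSpace E]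
  {ι : Type*} {l : Filter ι} {u : ι → unitary (E →L[ℂ] E)} {u₀ : unitary (E →L[ℂ] E)}

theorem PU.tendsto_mk (h : ∀ ξ, Tendsto (fun i => (u i : E →L[ℂ] E) ξ) l (𝓝 ((u₀ : E →L[ℂ] E) ξ))) :
    Tendsto (fun i => PU.mk (u i)) l (𝓝 (PU.mk u₀)) := by
  refine tendsto_nhds.2 fun W hW hmem => ?_
  obtain ⟨V, hV, hVW⟩ := isOpen_induced_iff.1 (isOpen_coinduced.1 hW)
  have h1 : ∀ u : unitary (E →L[ℂ] E), (fun ξ => (u : E →L[ℂ] E) ξ) ∈ V ↔ PU.mk u ∈ W := fun u =>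
    Set.ext_iff.1 hVW u
  exact ((tendsto_pi_nhds.2 h).eventually (hV.mem_nhds ((h1 u₀).2 hmem))).mono fun i hi =>
    (h1 _).1 hi

/-- For unitaries strong convergence passes to adjoints: with `η = u₀* ξ` one has `‖uᵢ* ξ - η‖ = ‖uᵢ
η - u₀ η‖`. Then `uᵢ A uᵢ*` converges strongly because the `uᵢ` are isometries. -/
theorem PU.tendsto_Ad_mk
    (h : ∀ ξ, Tendsto (fun i => (u i : E →L[ℂ] E) ξ) l (𝓝 ((u₀ : E →L[ℂ] E) ξ))) (A : E →L[ℂ] E)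
    (ξ : E) : Tendsto (fun i => PU.Ad (PU.mk (u i)) A ξ) l (𝓝 (PU.Ad (PU.mk u₀) A ξ)) := by
  have hnorm : ∀ (v : unitary (E →L[ℂ] E)) x, ‖(v : E →L[ℂ] E) x‖ = ‖x‖ := Unitary.norm_map
  have hus : ∀ (v : unitary (E →L[ℂ] E)) x, (v : E →L[ℂ] E) (star (v : E →L[ℂ] E) x) = x :=
    fun v x => congrArg (fun T : E →L[ℂ] E => T x) (Unitary.mul_star_self_of_mem v.2)
  set η := star (u₀ : E →L[ℂ] E) ξ with hη
  have h1 : ∀ i, ‖star (u i : E →L[ℂ] E) ξ - η‖ = ‖(u i : E →L[ℂ] E) η - (u₀ : E →L[ℂ] E) η‖ := by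
    intro i
    rw [← hnorm (u i), map_sub, hus, hη, hus, norm_sub_rev]
  have h2 : Tendsto (fun i => star (u i : E →L[ℂ] E) ξ) l (𝓝 η) := by
    rw [tendsto_iff_norm_sub_tendsto_zero]
    simp only [h1]
    exact tendsto_iff_norm_sub_tendsto_zero.1 (h η)
  have h3 : Tendsto (fun i => A (star (u i : E →L[ℂ] E) ξ) - A η) l (𝓝 0) := by
    rw [← sub_self (A η)]
    exact ((A.continuous.tendsto η).comp h2).sub_const _
  have h4 : Tendsto (fun i => (u i : E →L[ℂ] E) (A (star (u i : E →L[ℂ] E) ξ) - A η)) l (𝓝 0) := by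
    rw [tendsto_zero_iff_norm_tendsto_zero] at h3 ⊢
    simpa only [hnorm] using h3
  have h5 := h4.add (h (A η))
  rw [zero_add] at h5
  refine h5.congr fun i => ?_
  rw [map_sub, sub_add_cancel]
  rfl

end Projective

namespace SobolevLift
variable {s : ℝ}

/-- The weighted Fourier coefficients of a lift as a vector of `ℓ²`. -/
def seq (g : SobolevLift s) : lp (fun _ : ℤ => ℂ) 2 := ⟨sobolevSeq s g.lift, g.memlp⟩

theorem continuous_seq : Continuous (seq (s := s)) := continuous_induced_dom

theorem isLift_lift (g : SobolevLift s) : Lift g.lift := g.isLift.lift one_ne_zero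

theorem sob_sub (g₀ g : SobolevLift s) : sob s (fun θ => ((g.lift θ - g₀.lift θ : ℝ) : ℂ)) =
    ENNReal.ofReal (‖g.seq - g₀.seq‖ ^ 2) := by
  have h1 := hasSum_norm_sq (g.seq - g₀.seq)
  rw [← h1.tsum_eq, ENNReal.ofReal_tsum_of_nonneg (fun _ => by positivity) h1.summable, sob]
  refine tsum_congr fun k => ?_
  have e1 : (fun θ => ((g.lift θ - g₀.lift θ : ℝ) : ℂ)) = fun θ =>
      ((g.lift θ - θ : ℝ) : ℂ) - ((g₀.lift θ - θ : ℝ) : ℂ) := by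
    funext θ
    push_cast
    ring
  have h : ((1 + (k : ℝ) ^ 2) ^ (s / 2)) ^ 2 = (1 + (k : ℝ) ^ 2) ^ s := by
    rw [← Real.rpow_natCast, ← Real.rpow_mul (by positivity)]
    norm_num
  rw [e1, cf_sub g.isLift_lift.perCont_sub_id.cont g₀.isLift_lift.perCont_sub_id.cont,
    lp.coeFn_sub, Pi.sub_apply]
  change _ = ENNReal.ofReal (‖sobolevSeq s g.lift k - sobolevSeq s g₀.lift k‖ ^ 2)
  rw [sobolevSeq, sobolevSeq, coeff_eq_cf, coeff_eq_cf, ← mul_sub, norm_mul, Complex.norm_real,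
    Real.norm_of_nonneg (by positivity), mul_pow, h, ENNReal.ofReal_mul (by positivity), wt,
    ENNReal.ofReal_pow (norm_nonneg _), ofReal_norm]

theorem tendsto_sob_sub (g₀ : SobolevLift s) :
    Tendsto (fun g : SobolevLift s => sob s (fun θ => ((g.lift θ - g₀.lift θ : ℝ) : ℂ))) (𝓝 g₀)
      (𝓝 0) := by
  simp only [sob_sub]
  have h1 : Continuous fun g : SobolevLift s => ENNReal.ofReal (‖g.seq - g₀.seq‖ ^ 2) :=
    ENNReal.continuous_ofReal.comp ((continuous_seq.sub continuous_const).norm.pow 2)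
  simpa using h1.tendsto g₀

theorem exists_liftPair (hs : 2 < s) (g : SobolevLift s) : ∃ ψ, LiftPair s g.toHomeo g.lift ψ :=
  g.isLift_lift.exists_liftPair hs g.isLift.coe_eq ((memlp_sobolevSeq_iff _ _).1 g.memlp)

/-- Local strongly continuous lifts of the projective representation. -/
theorem exists_tendsto_unitary (hs : 2 < s) {U : SobolevDiffeo s → PU F1}
    (hU : ∀ γ, Implements (U γ) γ.1) (g₀ : SobolevLift s) :
    ∃ (u : SobolevLift s → unitary (F1 →L[ℂ] F1)) (u₀ : unitary (F1 →L[ℂ] F1)),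
      PU.mk u₀ = U g₀.proj ∧ (∀ᶠ g in 𝓝 g₀, PU.mk (u g) = U g.proj) ∧
      ∀ ξ, Tendsto (fun g => (u g : F1 →L[ℂ] F1) ξ) (𝓝 g₀) (𝓝 ((u₀ : F1 →L[ℂ] F1) ξ)) := by
  choose ψ hψ using exists_liftPair (s := s) hs
  obtain ⟨v, hv1, hv2⟩ := (hψ g₀).lift.exists_tendsto_implementer (hψ g₀).lift_inv (hψ g₀).left_inv
    (hψ g₀).right_inv (ne_top_of_le_ne_top (hψ g₀).sob_ne_top (sob_mono hs.le _))
    (fun g => (hψ g).lift) (fun g => (hψ g).lift_inv) (fun g => (hψ g).left_inv)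
    (fun g => (hψ g).right_inv)
    (tendsto_of_tendsto_of_tendsto_of_le_of_le tendsto_const_nhds g₀.tendsto_sob_sub
      (fun _ => zero_le) fun _ => sob_mono hs.le _)
  obtain ⟨u₀, hu₀⟩ := PU.mk_surjective (U g₀.proj)
  have hi := ((hψ g₀).implements_iff u₀).1 (by rw [hu₀]; exact hU g₀.proj)
  -- `v g` implements the diffeomorphism of `g` composed with the inverse of that of `g₀`;
  -- multiplication by `u₀` gives an implementer for `g`, so its class is `U g.proj` by uniqueness.
  refine ⟨fun g => v g * u₀, u₀, hu₀, ?_, fun ξ => hv2 _⟩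
  filter_upwards [hv1] with g hg
  refine Implements.unique (((hψ g).implements_iff _).2 fun x => ?_) (hU g.proj)
  have e : ((hψ g₀).lift.comp (hψ g).lift_inv).op ((hψ g₀).lift_inv.op x) = (hψ g).lift_inv.op x := by
    rw [Lift.op_comp]
    exact congrArg (fun T : H1 →L[ℝ] H1 => T x)
      (Lift.op_congr _ _ fun θ => by rw [(hψ g₀).left_inv])
  change (v g : F1 →L[ℂ] F1) * u₀ * weyl x = weyl ((hψ g).lift_inv.op x) * (v g * u₀)
  rw [mul_assoc, hi, ← mul_assoc, hg, e, mul_assoc]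

end SobolevLift

theorem continuous_of_implements {s : ℝ} (hs : 2 < s) {U : SobolevDiffeo s → PU F1}
    (hU : ∀ γ, Implements (U γ) γ.1) : Continuous U := by
  refine continuous_coinduced_dom.2 (continuous_iff_continuousAt.2 fun g₀ => ?_)
  obtain ⟨u, u₀, h0, h1, h2⟩ := g₀.exists_tendsto_unitary hs hU
  have h3 := PU.tendsto_mk h2
  rw [h0] at h3
  exact h3.congr' h1

theorem continuous_Ad_of_implements {s : ℝ} (hs : 2 < s) {U : SobolevDiffeo s → PU F1}
    (hU : ∀ γ, Implements (U γ) γ.1) (A : F1 →L[ℂ] F1) (ξ : F1) :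
    Continuous fun γ : SobolevDiffeo s => PU.Ad (U γ) A ξ := by
  refine continuous_coinduced_dom.2 (continuous_iff_continuousAt.2 fun g₀ => ?_)
  obtain ⟨u, u₀, h0, h1, h2⟩ := g₀.exists_tendsto_unitary hs hU
  have h3 := PU.tendsto_Ad_mk h2 A ξ
  rw [h0] at h3
  refine h3.congr' ?_
  filter_upwards [h1] with g hg
  rw [hg]
  rfl

/-! ### Smooth approximation with prescribed support -/

theorem cf_conj (f : ℝ → ℂ) (k : ℤ) : cf (fun θ => conj (f θ)) (-k) = conj (cf f k) := by
  have h := intervalIntegral.intervalIntegral_conj (μ := MeasureTheory.volume) (a := 0)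
    (b := 2 * Real.pi) (f := fun θ => ex (-k) θ * f θ)
  rw [cf_eq, cf_eq, map_mul, ← h]
  congr 1
  · simp [map_ofNat (starRingEnd ℂ) 2]
  · refine intervalIntegral.integral_congr fun θ _ => ?_
    simp only [map_mul, conj_ex]

theorem sob_conj (r : ℝ) (f : ℝ → ℂ) : sob r (fun θ => conj (f θ)) = sob r f := by
  rw [sob, sob, ← (Equiv.neg ℤ).tsum_eq]
  refine tsum_congr fun k => ?_
  rw [Equiv.neg_apply, cf_conj, wt, wt, Int.cast_neg, neg_sq, ← ofReal_norm, RCLike.norm_conj,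
    ofReal_norm]

theorem sob_re_le (r : ℝ) {f : ℝ → ℂ} (hf : Continuous f) :
    sob r (fun θ => (((f θ).re : ℝ) : ℂ)) ≤ sob r f := by
  have e : (fun θ => (((f θ).re : ℝ) : ℂ)) = fun θ =>
      (1 / 2 : ℂ) * f θ + (1 / 2 : ℂ) * conj (f θ) := by
    funext θ
    rw [Complex.re_eq_add_conj]
    ring
  rw [e]
  refine (sob_add_le r (f := fun θ => (1 / 2 : ℂ) * f θ) (g := fun θ => (1 / 2 : ℂ) * conj (f θ))
    (continuous_const.mul hf)
    (continuous_const.mul (Complex.continuous_conj.comp hf))).trans ?_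
  have hc : ‖(1 / 2 : ℂ)‖ₑ ^ 2 = ENNReal.ofReal (1 / 4) := by
    rw [← ofReal_norm, ← ENNReal.ofReal_pow (norm_nonneg _)]
    norm_num
  rw [sob_const_mul, sob_const_mul, sob_conj, hc, ← two_mul, ← mul_assoc, ← mul_assoc]
  have h4 : (2 : ℝ≥0∞) * 2 * ENNReal.ofReal (1 / 4) = 1 := by
    rw [show (2 : ℝ≥0∞) * 2 = ENNReal.ofReal 4 by norm_num, ← ENNReal.ofReal_mul (by norm_num)]
    norm_num
  rw [h4, one_mul]

theorem tendsto_sob_sub_partialSum {r : ℝ} {f : ℝ → ℂ} (hf : PerCont f) (h : sob r f ≠ ⊤) :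
    Tendsto (fun S : Finset ℤ => sob r (fun θ => f θ - comb ex (partialSum f S) θ)) atTop (𝓝 0) := by
  refine (ENNReal.tendsto_tsum_compl_atTop_zero h).congr fun S => ?_
  refine (tsum_subtype {k | k ∉ S} fun k => wt r k * ‖cf f k‖ₑ ^ 2).trans ?_
  refine tsum_congr fun k => ?_
  rw [cf_sub hf.cont (perCont_comb_ex _).cont, cf_comb_ex]
  by_cases hk : k ∈ S
  · simp [partialSum, hk]
  · simp [partialSum, hk]

/-- Smooth cutoff functions on the circle. -/
theorem exists_cutoff {K J : Set S1} (hK : IsClosed K) (hJ : IsOpen J) (hKJ : K ⊆ J) :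
    ∃ χ : S1 → ℝ, IsSmooth χ ∧ tsupport χ ⊆ J ∧ ∀ x ∈ K, χ x = 1 := by
  have : Fact (0 < 2 * Real.pi) := ⟨Real.two_pi_pos⟩
  obtain ⟨V, hV, hKV, hVJ⟩ := normal_exists_closure_subset hK hJ hKJ
  have hc : Continuous fun x : S1 => (AddCircle.toCircle x : ℂ) :=
    continuous_subtype_val.comp AddCircle.continuous_toCircle
  have hinj : Function.Injective fun x : S1 => (AddCircle.toCircle x : ℂ) :=
    Subtype.val_injective.comp (AddCircle.injective_toCircle Real.two_pi_pos.ne')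
  have hcl : ∀ {A : Set S1}, IsClosed A →
      IsClosed ((fun x : S1 => (AddCircle.toCircle x : ℂ)) '' A) :=
    fun hA => (hA.isCompact.image hc).isClosed
  -- A smooth Urysohn function is taken on the plane, for the images of the two closed sets under
  -- the embedding of the circle, and restricted. The intermediate open set `V` makes the closure of
  -- its support stay in `J`.
  obtain ⟨f, hf0, hf1, -⟩ := exists_contMDiffMap_zero_one_of_isClosed (n := ⊤)
    (modelWithCornersSelf ℝ ℂ) (hcl hV.isClosed_compl) (hcl hK)
    ((Set.disjoint_image_iff hinj).2 (Set.disjoint_left.2 fun x hx hx' => hx (hKV hx')))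
  refine ⟨fun x => f (AddCircle.toCircle x : ℂ), ?_, ?_, fun x hx => hf1 ⟨x, hx, rfl⟩⟩
  · have e : (fun θ : ℝ => f (AddCircle.toCircle (θ : S1) : ℂ)) = fun θ => f (ex 1 θ) := by
      funext θ
      rw [ex_eq_toCircle, zpow_one]
    rw [IsSmooth, e]
    exact (f.contMDiff.contDiff).comp (contDiff_ex 1)
  · refine (closure_mono fun x hx => ?_).trans hVJ
    by_contra hxV
    exact hx (hf0 ⟨x, hxV, rfl⟩)

theorem norm_clR_le (f : perC1) {N : ℝ≥0∞} (hN : N ≠ ⊤)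
    (h : sob 1 (fun θ => ((f.1 θ : ℝ) : ℂ)) ≤ N) : ‖clR f‖ ≤ Real.sqrt N.toReal := by
  have h1 : ‖clR f‖ₑ ^ 2 ≤ N :=
    (enorm_clv_sq_le (f := fun θ => ((f.1 θ : ℝ) : ℂ))).trans ((sob_mono (by norm_num) _).trans h)
  have h2 := ENNReal.toReal_mono hN h1
  rw [ENNReal.toReal_pow, toReal_enorm] at h2
  exact Real.le_sqrt_of_sq_le h2

/-- Classes of `C¹` functions supported in an open set are limits of classes of smooth functions
supported in this set. -/
theorem cls_mem_closure_of_tsupport_subset {g : S1 → ℝ} (hg : ContDiff ℝ 1 fun θ : ℝ => g θ)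
    {J : Set S1} (hJ : IsOpen J) (hgJ : tsupport g ⊆ J) :
    cls g ∈ closure {x : H1 | ∃ f : S1 → ℝ, IsSmooth f ∧ tsupport f ⊆ J ∧ cls f = x} := by
  obtain ⟨χ, hχ, hχJ, hχ1⟩ := exists_cutoff (isClosed_tsupport g) hJ hgJ
  have hχg : ∀ x, χ x * g x = g x := fun x => by
    by_cases hx : x ∈ tsupport g
    · rw [hχ1 x hx, one_mul]
    · rw [image_eq_zero_of_notMem_tsupport hx, mul_zero]
  set G : ℝ → ℂ := fun θ => (((ofC1 g hg).1 θ : ℝ) : ℂ) with hG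
  have hGp : PerCont G := perC1.perCont (ofC1 g hg)
  have hχp := perC1.perCont (ofC1 χ hχ.contDiff_one)
  -- The approximants are `χ` times the real parts of the Fourier partial sums of `g`. As `χ g = g`,
  -- the error is `χ` times a remainder that tends to zero in `H¹`, and multiplication by `χ` is
  -- bounded on `H¹`.
  let p : Finset ℤ → S1 → ℝ := fun S x => (∑ k ∈ S, cf G k * (AddCircle.toCircle x : ℂ) ^ k).re
  have hp : ∀ S (θ : ℝ), p S θ = (comb ex (partialSum G S) θ).re := fun S θ => by
    rw [comb_partialSum]
    simp only [p, ex_eq_toCircle]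
  have hps : ∀ S, IsSmooth (p S) := fun S => by
    rw [IsSmooth, funext (hp S)]
    exact Complex.reCLM.contDiff.comp (contDiff_comb_ex _)
  have hfs : ∀ S, IsSmooth fun x => χ x * p S x := fun S => ContDiff.mul hχ (hps S)
  set C : ℝ≥0∞ := algConst 1 * sob 1 (fun θ => (((ofC1 χ hχ.contDiff_one).1 θ : ℝ) : ℂ)) with hC
  have hCt : C ≠ ⊤ := ENNReal.mul_ne_top (algConst_ne_top (by norm_num)) (perC1.sob_one_ne_top _)
  set N : Finset ℤ → ℝ≥0∞ := fun S => sob 1 (fun θ => G θ - comb ex (partialSum G S) θ) with hN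
  have hN0 : Tendsto (fun S => C * N S) atTop (𝓝 0) := by
    have h1 := ENNReal.Tendsto.const_mul
      (tendsto_sob_sub_partialSum hGp (perC1.sob_one_ne_top (ofC1 g hg))) (Or.inr hCt)
    rwa [mul_zero] at h1
  have hN1 : ∀ᶠ S in atTop, C * N S < 1 := (tendsto_order.1 hN0).2 1 zero_lt_one
  have hlim : Tendsto (fun S => Real.sqrt (C * N S).toReal) atTop (𝓝 0) := by
    have h1 := (Real.continuous_sqrt.tendsto 0).comp
      ((ENNReal.tendsto_toReal ENNReal.zero_ne_top).comp hN0)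
    rw [Real.sqrt_zero] at h1
    exact h1
  refine mem_closure_of_tendsto (f := fun S => cls fun x => χ x * p S x) (b := atTop) ?_
    (Eventually.of_forall fun S => ⟨_, hfs S, ?_, rfl⟩)
  · rw [tendsto_iff_norm_sub_tendsto_zero]
    refine squeeze_zero' (Eventually.of_forall fun _ => norm_nonneg _) ?_ hlim
    filter_upwards [hN1] with S hS
    rw [norm_sub_rev, ← clR_ofC1 hg, ← clR_ofC1 (hfs S).contDiff_one, ← map_sub]
    refine norm_clR_le _ hS.ne_top ?_
    have e : (fun θ => (((ofC1 g hg - ofC1 (fun x => χ x * p S x) (hfs S).contDiff_one).1 θ : ℝ) : ℂ)) = fun θ =>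
        (((ofC1 χ hχ.contDiff_one).1 θ : ℝ) : ℂ) *
          (((G θ - comb ex (partialSum G S) θ).re : ℝ) : ℂ) := by
      funext θ
      rw [← Complex.ofReal_mul]
      congr 1
      change g θ - χ θ * p S θ = χ θ * (((g θ : ℝ) : ℂ) - comb ex (partialSum G S) θ).re
      rw [hp, Complex.sub_re, Complex.ofReal_re, mul_sub, hχg]
    have hF := hGp.sub (perCont_comb_ex (partialSum G S))
    rw [e]
    have hFr : PerCont fun θ => (((G θ - comb ex (partialSum G S) θ).re : ℝ) : ℂ) :=
      ⟨Complex.continuous_ofReal.comp (Complex.continuous_re.comp hF.cont), fun θ => by rw [hF.per]⟩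
    refine (sob_mul_le (r := 1) (by norm_num) hχp hFr (perC1.sob_one_ne_top _)).trans ?_
    rw [hC, mul_assoc]
    gcongr
    exact sob_re_le 1 hF.cont
  · exact (closure_mono (Function.support_mul_subset_left _ _)).trans hχJ

/-- For `T` in the commutant of the generators, the classes `x` with `T W(x)ξ = W(x) Tξ` form a
closed set containing the smooth ones. Needed since the image of a smooth generator under a Sobolev
diffeomorphism is only known to be of class `C¹`. -/
theorem weyl_mem_net {J : Set S1} (hJ : IsOpen J) {g : S1 → ℝ}
    (hg : ContDiff ℝ 1 fun θ : ℝ => g θ) (hgJ : tsupport g ⊆ J) : weyl (cls g) ∈ net J := by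
  intro T hT
  refine ContinuousLinearMap.ext fun ξ => ?_
  have h1 : cls g ∈ {x : H1 | T (weyl x ξ) = weyl x (T ξ)} := by
    refine closure_minimal ?_ ?_ (cls_mem_closure_of_tsupport_subset hg hJ hgJ)
    · rintro _ ⟨f, hf, hfJ, rfl⟩
      exact congrArg (fun A : F1 →L[ℂ] F1 => A ξ) (hT (weyl (cls f)) ⟨f, hf, hfJ, rfl⟩).symm
    · exact isClosed_eq (T.continuous.comp (continuous_weyl_apply ξ)) (continuous_weyl_apply _)
  exact h1

theorem implements_one : Implements 1 1 := by
  intro f hf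
  refine ⟨hasClass_of_contDiff hf.contDiff_one, hasClass_of_contDiff hf.contDiff_one, ?_⟩
  rw [map_one]
  rfl

/-! ### Covariance and locality of the net -/

section Net
variable {s : ℝ} {γ : S1 ≃ₜ S1} {φ ψ : ℝ → ℝ} {p : PU F1}

/-- Argued through commutants: the generators of `I` go into `net (γ '' I)`, so pulling back the
commutant of the generators for `γ '' I` lands in the commutant of those for `I`. -/
theorem Implements.image_net_subset (h : LiftPair s γ φ ψ) (hp : Implements p γ) {I : Set S1}
    (hI : IsOpen I) : PU.Ad p '' net I ⊆ net (γ '' I) := by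
  rintro _ ⟨x, hx, rfl⟩ T hT
  have h1 : (PU.Ad p).symm T ∈ Set.centralizer
      {T | ∃ f : S1 → ℝ, IsSmooth f ∧ tsupport f ⊆ I ∧ T = weyl (cls f)} := by
    rintro _ ⟨f, hf, hfI, rfl⟩
    have h2 : tsupport (f ∘ γ.symm) ⊆ γ '' I := fun y hy =>
      ⟨γ.symm y, hfI (tsupport_comp_subset_preimage f γ.symm.continuous hy), γ.apply_symm_apply y⟩
    have h3 := weyl_mem_net (γ.isOpenMap I hI) (h.contDiff_comp_symm hf.contDiff_one) h2 T hT
    rw [← (hp f hf).2.2] at h3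
    refine EquivLike.injective (PU.Ad p) ?_
    rw [map_mul, map_mul, StarAlgEquiv.apply_symm_apply]
    exact h3.symm
  have h4 := congrArg (PU.Ad p) (hx _ h1)
  rwa [map_mul, map_mul, StarAlgEquiv.apply_symm_apply] at h4

/-- Covariance of the `U(1)`-current net. -/
theorem Implements.image_net (hs : 2 < s) (h : LiftPair s γ φ ψ) (hp : Implements p γ) {I : Set S1}
    (hI : IsOpen I) : PU.Ad p '' net I = net (γ '' I) := by
  refine (hp.image_net_subset h hI).antisymm fun y hy => ?_
  -- The reverse inclusion is the same statement for `γ⁻¹`; the implementers of `γ` and `γ⁻¹` are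
  -- inverse to each other by uniqueness.
  obtain ⟨q, hq⟩ := h.symm.exists_implements hs
  have hpq : p * q = 1 := by
    refine (Implements.mul h h.symm hp hq).unique ?_
    rw [show γ * γ.symm = 1 from mul_inv_cancel γ]
    exact implements_one
  have h1 := hq.image_net_subset h.symm (γ.isOpenMap I hI) ⟨y, hy, rfl⟩
  rw [← Set.image_comp, show (γ.symm : S1 → S1) ∘ γ = id from funext γ.symm_apply_apply,
    Set.image_id] at h1
  refine ⟨PU.Ad q y, h1, ?_⟩
  change (PU.Ad p * PU.Ad q) y = y
  rw [← map_mul, hpq, map_one]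
  rfl

theorem comp_symm_eq_of_supp {I : Set S1} (hγ : supp γ ⊆ interior Iᶜ) {f : S1 → ℝ}
    (hf : tsupport f ⊆ I) : f ∘ γ.symm = f := by
  have h0 : ∀ y, γ y ≠ y → f y = 0 := fun y hy => image_eq_zero_of_notMem_tsupport fun hy' =>
    interior_subset (hγ (subset_closure hy)) (hf hy')
  funext y
  by_cases hy : γ.symm y = y
  · rw [Function.comp_apply, hy]
  · rw [Function.comp_apply, h0 y fun h => hy (γ.symm_apply_eq.2 h.symm), h0 (γ.symm y) fun h => hy ?_]
    rwa [γ.apply_symm_apply, eq_comm] at h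

/-- Diffeomorphisms supported in the interior of the complement of `I` act trivially. -/
theorem Implements.Ad_eq_self (hp : Implements p γ) {I : Set S1} (hγ : supp γ ⊆ interior Iᶜ)
    {x : F1 →L[ℂ] F1} (hx : x ∈ net I) : PU.Ad p x = x := by
  obtain ⟨u, rfl⟩ := PU.mk_surjective p
  rw [unitary_intertwine_iff]
  -- As `x` lies in the bicommutant, it is enough that `u` commutes with the generators of `I`; it
  -- does, because `γ` leaves functions supported in `I` unchanged.
  refine hx _ ?_
  rintro _ ⟨f, hf, hfI, rfl⟩
  have h1 := (unitary_intertwine_iff u _ _).1 (hp f hf).2.2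
  rw [comp_symm_eq_of_supp hγ hfI] at h1
  exact h1.symm

end Net

end

end U1Current

theorem theorem5p3 (s : ℝ) (hs : 2 < s) :
    -- `D^s(S¹)` is a group which contains `Diff(S¹)`
    (∀ γ ν : S1 ≃ₜ S1, IsSobolevDiffeo s γ → IsSobolevDiffeo s ν → IsSobolevDiffeo s (γ * ν)) ∧
    (∀ γ : S1 ≃ₜ S1, IsSobolevDiffeo s γ → IsSobolevDiffeo s γ⁻¹) ∧
    ∃ hdiff : ∀ γ : S1 ≃ₜ S1, IsSmoothDiffeo γ → IsSobolevDiffeo s γ,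
    ∃ U : SobolevDiffeo s → PU F1,
      -- `Ad U(γ) W([f]) = W([f ∘ γ⁻¹])`, and this determines `U(γ)` up to a phase
      (∀ γ : SobolevDiffeo s, Implements (U γ) γ.1) ∧
      (∀ (γ : SobolevDiffeo s) (p : PU F1), Implements p γ.1 → p = U γ) ∧
      -- `γ ↦ U(γ)` and `γ ↦ Ad U(γ)` are group homomorphisms
      (∀ γ ν κ : SobolevDiffeo s, κ.1 = γ.1 * ν.1 → U κ = U γ * U ν) ∧
      -- `γ ↦ Ad U(γ)` is pointwise strongly continuous
      (∀ (A : F1 →L[ℂ] F1) (ξ : F1), Continuous fun γ : SobolevDiffeo s => PU.Ad (U γ) A ξ) ∧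
      -- `U` is a continuous extension of the vacuum projective representation of `Diff(S¹)`
      Continuous U ∧
      (∀ U₀ : SmoothDiffeo → PU F1, IsVacuumRep U₀ ↔ ∀ γ, U₀ γ = U ⟨γ.1, hdiff γ.1 γ.2⟩) ∧
      -- covariance of the net
      (∀ (γ : SobolevDiffeo s) (I : Set S1), IsInterval I →
        PU.Ad (U γ) '' net I = net (γ.1 '' I)) ∧
      (∀ (γ : SobolevDiffeo s) (I : Set S1), IsInterval I → supp γ.1 ⊆ interior Iᶜ →
        ∀ x ∈ net I, PU.Ad (U γ) x = x) := by
  have hex : ∀ γ : SobolevDiffeo s, ∃ p, Implements p γ.1 := fun γ => by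
    obtain ⟨φ, ψ, h⟩ := γ.2.exists_liftPair hs
    exact h.exists_implements hs
  -- The choice involves no freedom, since the implementing class is unique. This also gives both
  -- directions of the statement on vacuum representations: such a representation implements
  -- `Diff(S¹)` and so agrees with `U`, while the restriction of `U` inherits the required
  -- properties.
  choose U hU using hex
  have hmul : ∀ γ ν κ : SobolevDiffeo s, κ.1 = γ.1 * ν.1 → U κ = U γ * U ν := fun γ ν κ e => by
    obtain ⟨φ, ψ, h⟩ := γ.2.exists_liftPair hs
    obtain ⟨χ, ρ, k⟩ := ν.2.exists_liftPair hs
    have h1 := Implements.mul h k (hU γ) (hU ν)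
    rw [← e] at h1
    exact (hU κ).unique h1
  refine ⟨fun γ ν h k => h.mul hs k, fun γ h => h.inv hs, fun γ h => h.isSobolevDiffeo s, U, hU,
    fun γ p hp => hp.unique (hU γ), hmul, continuous_Ad_of_implements hs hU,
    continuous_of_implements hs hU, fun U₀ => ⟨fun h γ => (h.implements γ).unique (hU ⟨γ.1, _⟩),
      fun h => ⟨fun γ ν κ e => ?_, fun γ hγ => ?_, fun γ => ?_⟩⟩, fun γ I hI => ?_,
    fun γ I _ hγ x hx => (hU γ).Ad_eq_self hγ hx⟩
  · rw [h κ, h γ, h ν]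
    exact hmul ⟨γ.1, γ.2.isSobolevDiffeo s⟩ ⟨ν.1, ν.2.isSobolevDiffeo s⟩
      ⟨κ.1, κ.2.isSobolevDiffeo s⟩ e
  · obtain ⟨φ, ψ, k⟩ := (γ.2.isSobolevDiffeo s).exists_liftPair hs
    rw [h γ]
    exact (hU ⟨γ.1, γ.2.isSobolevDiffeo s⟩).isSecondQuantized k hγ
  · rw [h γ]
    exact hU ⟨γ.1, γ.2.isSobolevDiffeo s⟩
  · obtain ⟨φ, ψ, h⟩ := γ.2.exists_liftPair hs
    exact (hU γ).image_net hs h hI.1
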